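/- **Setting.** Let $N$ be a finitely generated free abelian group, $M=\mathrm{Hom}(N,\mathbb Z)$, and let $\Sigma$ be the (finite) fan in $N_{\mathbb R}$ of a smooth complex toric variety, i.e. every cone $\sigma\in\Sigma$ is spanned by a part of a $\mathbb Z$-basis of $N$. For $\sigma\in\Sigma$ put $$\mathcal A_\sigma=\mathbb C[M\cap\sigma^\vee],\qquad M_\sigma=M/(M\cap\sigma^\perp),\qquad \mathcal B_\sigma=\mathbb C[M_\sigma^+],$$ where $M_\sigma^+$ is the image of $M\cap\sigma^\vee$ in $M_\sigma$; $\mathcal A_\sigma$ is $M$-graded and $\mathcal B_\sigma$ is $M_\sigma$-graded. With the restrictions $\mathcal A_\sigma\to\mathcal A_\tau$, $\mathcal B_\sigma\to\mathcal B_\tau$ for $\tau\subset\sigma$ these are sheaves of graded algebras $\mathcal A=\mathcal A_\Sigma$, $\mathcal B=\mathcal B_\Sigma$ on $\Sigma$ (the open sets of $\Sigma$ are the subfans), and there is a surjection $\delta:\mathcal A\to\mathcal B$. $\mathcal A\text{-mod}$ is the abelian category of sheaves of graded $\mathcal A$-modules with finitely generated stalks, and similarly for $\mathcal B\text{-mod}$.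 A cosheaf of $\mathcal A$-modules is a collection of graded $\mathcal A_\sigma$-modules $C_\sigma$ with compatible graded $\mathcal A_\sigma$-linear maps $C_\tau\to C_\sigma$ for $\tau\subset\sigma$; for $\mathcal B$, where $C_\tau$ is graded by $M_\tau$ and $C_\sigma$ by $M_\sigma$, these maps are given componentwise, $C_\tau^{m|_\tau}\to C_\sigma^{m}$ for $m\in M_\sigma$, compatibly with multiplication by the monomials of $\mathcal B_\sigma$. A graded $\mathcal B_\sigma$-module is torsion co-finite (tcf) if each of its elements is killed by a power of the maximal graded ideal $I_\sigma$ and its socle (the elements killed by $I_\sigma$) is finite dimensional; a graded $\mathcal A_\sigma$-module $C$ is tcf if the $\mathcal B_\sigma$-module $\mathcal B_\sigma\otimes_{\mathcal A_\sigma}C$ is tcf. $\text{co-}\mathcal A\text{-tcf}$ and $\text{co-}\mathcal B\text{-tcf}$ are the abelian categories of cosheaves with tcf stalks. $(-)^\vee$ is the graded dual; it takes sheaves to cosheaves, and $\mathcal A\text{-mod}$, $\mathcal B\text{-mod}$ to $\text{co-}\mathcal A\text{-tcf}$, $\text{co-}\mathcal B\text{-tcf}$. $\delta^*=\mathcal B\otimes_{\mathcal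 A}-$ is extension of scalars, for sheaves and for cosheaves; it is exact. $\mathcal A_{[\sigma]}$ and $\mathcal A_{\{\sigma\}}$ are the extensions by zero of $\mathcal A$ from the set $[\sigma]$ of faces of $\sigma$ and from the point $\sigma$; similarly $\mathcal B_{[\sigma]}$, $\mathcal B_{\{\sigma\}}$. Fix an orientation of each cone. A diagram $\{M_\sigma\}$ of cosheaves with maps $p_{\sigma\tau}:M_\sigma\to M_\tau$ for $\tau\subset\sigma$ has a cellular complex, with the terms $\bigoplus_{\dim\sigma=i}M_\sigma$ in degree $-i$ and with the differential $\sum\pm p_{\sigma\tau}$ over the facets $\tau$ of $\sigma$, the sign depending on whether the orientations of $\sigma$ and $\tau$ agree. **Theorem.** There exists an equivalence of triangulated categories $$\mathbf K_A: D^b(\mathcal A\text{-mod})\to D^b(\text{co-}\mathcal A\text{-tcf})$$ with the following properties. 1. On bounded complexes $\mathcal P^\bullet$ of projective objects of $\mathcal A\text{-mod}$, functorially in $\mathcal P^\bullet$, $\mathbf K_A(\mathcal P^\bullet)$ is isomorphic to the total complex of the cellular complexes of the diagrams $\sigma\mapsto \mathcal A_{[\sigma]}^\vee\otimes_{\mathcal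 A_\sigma}\mathcal P^i_\sigma$ (with the maps induced by the projections $\mathcal A_{[\sigma]}^\vee\to\mathcal A_{[\tau]}^\vee$ and the restrictions $\mathcal P^i_\sigma\to\mathcal P^i_\tau$); this is a complex in $\text{co-}\mathcal A\text{-tcf}$. 2. For each $\sigma\in\Sigma$, $$\mathbf K_A(\mathcal A_{\{\sigma\}})\simeq\mathcal A_{[\sigma]}^\vee[\dim\sigma],\qquad \mathbf K_A(\mathcal A_{[\sigma]})\simeq\mathcal A_{\{\sigma\}}^\vee[\dim\sigma].$$ Likewise there is an equivalence of triangulated categories $\mathbf K_B: D^b(\mathcal B\text{-mod})\to D^b(\text{co-}\mathcal B\text{-tcf})$ with the analogous properties, and $\mathbf K_A$, $\mathbf K_B$ can be chosen so that the diagram with $\delta^*:D^b(\mathcal A\text{-mod})\to D^b(\mathcal B\text{-mod})$ and $\delta^*:D^b(\text{co-}\mathcal A\text{-tcf})\to D^b(\text{co-}\mathcal B\text{-tcf})$ commutes: there is an isomorphism $\delta^*\circ\mathbf K_A\simeq\mathbf K_B\circ\delta^*$ of functors, compatible with the shifts. -/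

import Mathlib

noncomputable section

open CategoryTheory CategoryTheory.Limits
open scoped DirectSum Classical ZeroObject

namespace ToricKoszul

/-! ### Graded modules over semigroup algebras -/

section Graded

variable {G : Type} [AddCommGroup G]

/-- The group `G` preordered by a submonoid `S`: `m ≤ m'` iff `m' - m ∈ S`. -/
structure Wt (S : AddSubmonoid G) where
  deg : G

instance (S : AddSubmonoid G) : Preorder (Wt S) where
  le x y := y.deg - x.deg ∈ S
  le_refl x := by simp [S.zero_mem]
  le_trans x y z hxy hyz := by
    have := S.add_mem hyz hxy
    simpa using this

theorem Wt.le_def {S : AddSubmonoid G} {x y : Wt S} : x ≤ y ↔ y.deg - x.deg ∈ S := Iff.rfl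

theorem Wt.le_add {S : AddSubmonoid G} (m : G) (s : S) :
    (⟨m⟩ : Wt S) ≤ ⟨m + s⟩ := by
  simp [Wt.le_def]

/-- `G`-graded modules over the semigroup algebra `ℂ[S]`, for `S ⊆ G`: a family of vector spaces
`V m`, `m : G`, with the multiplications `V m ⟶ V m'` by the monomials `x ^ (m' - m)`,
`m' - m ∈ S`. Morphisms are the linear maps that preserve degrees and commute with the
monomials. -/
abbrev GrMod (S : AddSubmonoid G) := Wt S ⥤ ModuleCat.{0} ℂ

variable {S : AddSubmonoid G}

namespace GrMod

/-- The total space `⨁ m, V m` of a graded module. -/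
def Total (V : GrMod S) : Type := ⨁ m : G, V.obj ⟨m⟩

instance (V : GrMod S) : AddCommGroup V.Total := inferInstanceAs (AddCommGroup (⨁ m : G, V.obj ⟨m⟩))
instance (V : GrMod S) : Module ℂ V.Total := inferInstanceAs (Module ℂ (⨁ m : G, V.obj ⟨m⟩))

/-- The inclusion of a homogeneous component. -/
def incl (V : GrMod S) (m : G) : V.obj ⟨m⟩ →ₗ[ℂ] V.Total :=
  DirectSum.lof ℂ G (fun m => V.obj ⟨m⟩) m

/-- The projection to a homogeneous component. -/
def comp (V : GrMod S) (m : G) : V.Total →ₗ[ℂ] V.obj ⟨m⟩ :=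
  DirectSum.component ℂ G (fun m => V.obj ⟨m⟩) m

/-- Multiplication by a monomial, from one homogeneous component to another. -/
def mul (V : GrMod S) {m m' : G} (h : m' - m ∈ S) : V.obj ⟨m⟩ →ₗ[ℂ] V.obj ⟨m'⟩ :=
  (V.map (homOfLE (Wt.le_def.2 h) : (⟨m⟩ : Wt S) ⟶ ⟨m'⟩)).hom

theorem mul_mul (V : GrMod S) {m m' m'' : G} (h : m' - m ∈ S) (h' : m'' - m' ∈ S)
    (h'' : m'' - m ∈ S) (x : V.obj ⟨m⟩) : V.mul h' (V.mul h x) = V.mul h'' x := by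
  simp only [mul]
  rw [← LinearMap.comp_apply, ← ModuleCat.hom_comp, ← V.map_comp]
  rfl

theorem mul_self (V : GrMod S) {m : G} (h : m - m ∈ S) (x : V.obj ⟨m⟩) : V.mul h x = x := by
  simp only [mul]
  rw [show homOfLE _ = 𝟙 (⟨m⟩ : Wt S) from rfl, V.map_id]
  rfl

theorem mul_naturality {V W : GrMod S} (f : V ⟶ W) {m m' : G} (h : m' - m ∈ S)
    (x : V.obj ⟨m⟩) : (f.app ⟨m'⟩).hom (V.mul h x) = W.mul h ((f.app ⟨m⟩).hom x) := by
  simp only [mul]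
  rw [← LinearMap.comp_apply, ← ModuleCat.hom_comp, f.naturality]
  rfl

theorem incl_congr (V : GrMod S) {m m₁ m₂ : G} (e : m₁ = m₂) (h₁ : m₁ - m ∈ S)
    (h₂ : m₂ - m ∈ S) (x : V.obj ⟨m⟩) :
    V.incl m₁ (V.mul h₁ x) = V.incl m₂ (V.mul h₂ x) := by
  subst e; rfl

theorem comp_incl_self (V : GrMod S) (m : G) (x : V.obj ⟨m⟩) : V.comp m (V.incl m x) = x :=
  DirectSum.component.lof_self (R := ℂ) (ι := G) (M := fun m => V.obj ⟨m⟩) m x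

theorem comp_incl_ne (V : GrMod S) {m m' : G} (h : m ≠ m') (x : V.obj ⟨m⟩) :
    V.comp m' (V.incl m x) = 0 := by
  have := DirectSum.component.of (R := ℂ) (ι := G) (M := fun m => V.obj ⟨m⟩) m' m x
  rw [dif_neg h] at this
  exact this

theorem total_ext (V : GrMod S) {x y : V.Total} (h : ∀ m, V.comp m x = V.comp m y) : x = y :=
  DirectSum.ext_component ℂ h

theorem total_induction (V : GrMod S) {p : V.Total → Prop} (x : V.Total) (h0 : p 0)
    (h1 : ∀ m x, p (V.incl m x)) (h2 : ∀ x y, p x → p y → p (x + y)) : p x :=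
  DirectSum.induction_on (β := fun m => V.obj ⟨m⟩) (motive := p) x h0 h1 h2

theorem linearMap_ext (V : GrMod S) {M : Type*} [AddCommMonoid M] [Module ℂ M]
    {f g : V.Total →ₗ[ℂ] M} (h : ∀ m x, f (V.incl m x) = g (V.incl m x)) : f = g :=
  DirectSum.linearMap_ext ℂ fun m => LinearMap.ext (h m)

/-- Multiplication by the monomial `x ^ s` on the total space. -/
def mono (V : GrMod S) (s : S) : Module.End ℂ V.Total :=
  DirectSum.toModule ℂ G V.Total fun m =>
    V.incl (m + s) ∘ₗ V.mul (m := m) (m' := m + s) (Wt.le_def.1 (Wt.le_add m s))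

theorem mono_incl (V : GrMod S) (s : S) {m m' : G} (h : m' - m ∈ S) (e : m' = m + s)
    (x : V.obj ⟨m⟩) : V.mono s (V.incl m x) = V.incl m' (V.mul h x) := by
  subst e
  exact DirectSum.toModule_lof (ι := G) (M := fun m => V.obj ⟨m⟩) ℂ m x

/-- The action of the semigroup algebra `ℂ[S]` on the total space. -/
def action (V : GrMod S) : AddMonoidAlgebra ℂ S →ₐ[ℂ] Module.End ℂ V.Total :=
  AddMonoidAlgebra.lift ℂ _ _
    { toFun := fun s => V.mono s.toAdd
      map_one' := by
        refine V.linearMap_ext fun m x => ?_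
        rw [V.mono_incl (m' := m) _ (by simp [S.zero_mem]) (by simp), V.mul_self]
        rfl
      map_mul' := fun s t => by
        refine V.linearMap_ext fun m x => ?_
        have hs := s.toAdd.2
        have ht := t.toAdd.2
        have hm : ∀ (k : G) (u : S), k + u - k ∈ S := fun k u => by simp
        rw [Module.End.mul_apply, V.mono_incl t.toAdd (hm m _) rfl,
          V.mono_incl s.toAdd (hm _ _) rfl,
          V.mono_incl (m' := m + t.toAdd + s.toAdd) (s * t).toAdd
            (by simpa [add_assoc] using S.add_mem ht hs) (by
              rw [toAdd_mul]; push_cast; abel),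
          V.mul_mul] }

instance (V : GrMod S) : Module (AddMonoidAlgebra ℂ S) V.Total :=
  Module.compHom _ V.action.toRingHom

theorem smul_def (V : GrMod S) (a : AddMonoidAlgebra ℂ S) (x : V.Total) :
    a • x = V.action a x := rfl

instance (V : GrMod S) : IsScalarTower ℂ (AddMonoidAlgebra ℂ S) V.Total where
  smul_assoc c a x := by simp [smul_def]

theorem single_smul (V : GrMod S) (s : S) (c : ℂ) (x : V.Total) :
    (AddMonoidAlgebra.single s c : AddMonoidAlgebra ℂ S) • x = c • V.mono s x := by
  rw [smul_def, action, AddMonoidAlgebra.lift_single]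
  rfl

theorem single_smul_incl (V : GrMod S) (s : S) (c : ℂ) {m m' : G} (h : m' - m ∈ S)
    (e : m' = m + s) (x : V.obj ⟨m⟩) :
    (AddMonoidAlgebra.single s c : AddMonoidAlgebra ℂ S) • V.incl m x =
      c • V.incl m' (V.mul h x) := by
  rw [single_smul, V.mono_incl s h e]

/-- The `ℂ[S]`-linear map on total spaces induced by a morphism. -/
def totalMap {V W : GrMod S} (f : V ⟶ W) : V.Total →ₗ[AddMonoidAlgebra ℂ S] W.Total :=
  let F : V.Total →ₗ[ℂ] W.Total :=
    DirectSum.toModule ℂ G W.Total fun m => W.incl m ∘ₗ (f.app ⟨m⟩).hom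
  have hF : ∀ m x, F (V.incl m x) = W.incl m ((f.app ⟨m⟩).hom x) := fun m x =>
    DirectSum.toModule_lof (ι := G) (M := fun m => V.obj ⟨m⟩) ℂ m x
  { F with
    map_smul' := fun a x => by
      change F (a • x) = a • F x
      induction a using AddMonoidAlgebra.induction_linear with
      | zero => simp
      | add a b ha hb => rw [add_smul, add_smul, map_add, ha, hb]
      | single s c =>
        induction x using V.total_induction with
        | h0 => simp
        | h2 x y hx hy => rw [smul_add, map_add, map_add, smul_add, hx, hy]
        | h1 m x =>
          have hm : m + (s : G) - m ∈ S := by simp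
          rw [hF, V.single_smul_incl s c hm rfl, W.single_smul_incl s c hm rfl, map_smul, hF,
            mul_naturality] }

theorem totalMap_incl {V W : GrMod S} (f : V ⟶ W) (m : G) (x : V.obj ⟨m⟩) :
    totalMap f (V.incl m x) = W.incl m ((f.app ⟨m⟩).hom x) :=
  DirectSum.toModule_lof (ι := G) (M := fun m => V.obj ⟨m⟩) ℂ m x

theorem comp_totalMap {V W : GrMod S} (f : V ⟶ W) (m : G) (x : V.Total) :
    W.comp m (totalMap f x) = (f.app ⟨m⟩).hom (V.comp m x) := by
  induction x using V.total_induction with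
  | h0 => simp
  | h2 x y hx hy => simp only [map_add, hx, hy]
  | h1 k x =>
    rw [totalMap_incl]
    by_cases h : k = m
    · subst h; rw [comp_incl_self, comp_incl_self]
    · rw [comp_incl_ne _ h, comp_incl_ne _ h, map_zero]

theorem totalMap_injective {V W : GrMod S} (f : V ⟶ W) [Mono f] :
    Function.Injective (totalMap f) := by
  intro x y h
  refine V.total_ext fun m => ?_
  have hm : Function.Injective (f.app ⟨m⟩).hom := by
    have : Mono (f.app ⟨m⟩) := inferInstance
    exact (ModuleCat.mono_iff_injective _).1 this
  apply hm
  rw [← comp_totalMap, ← comp_totalMap, h]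

theorem totalMap_surjective {V W : GrMod S} (f : V ⟶ W) [Epi f] :
    Function.Surjective (totalMap f) := by
  intro y
  induction y using W.total_induction with
  | h0 => exact ⟨0, map_zero _⟩
  | h2 x y hx hy =>
    obtain ⟨a, rfl⟩ := hx
    obtain ⟨b, rfl⟩ := hy
    exact ⟨a + b, map_add _ _ _⟩
  | h1 m y =>
    have : Epi (f.app ⟨m⟩) := inferInstance
    obtain ⟨x, rfl⟩ := (ModuleCat.epi_iff_surjective _).1 this y
    exact ⟨V.incl m x, totalMap_incl _ _ _⟩

/-- A graded module is finitely generated if its total space is so over `ℂ[S]`. -/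
def IsFG (V : GrMod S) : Prop := Module.Finite (AddMonoidAlgebra ℂ S) V.Total

/-- The ideal of `ℂ[S]` spanned by the monomials `x ^ s`, `s ≠ 0`. When `0` is the only unit of
`S` it is the maximal graded ideal. -/
def augIdeal (S : AddSubmonoid G) : Ideal (AddMonoidAlgebra ℂ S) :=
  Ideal.span {a | ∃ s : S, s ≠ 0 ∧ a = AddMonoidAlgebra.single s 1}

/-- A graded module is torsion if each element is killed by a power of the maximal graded
ideal. -/
def IsTorsion (V : GrMod S) : Prop :=
  ∀ x : V.Total, ∃ k : ℕ, ∀ a ∈ augIdeal S ^ k, a • x = 0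

/-- The socle: the elements killed by the maximal graded ideal. -/
def socle (V : GrMod S) : Submodule ℂ V.Total where
  carrier := {x | ∀ a ∈ augIdeal S, a • x = 0}
  zero_mem' := fun a _ => smul_zero a
  add_mem' := fun hx hy a ha => by rw [smul_add, hx a ha, hy a ha, add_zero]
  smul_mem' := fun c x hx a ha => by
    have : a • c • x = c • a • x := by simp [smul_def]
    rw [this, hx a ha, smul_zero]

/-- Torsion co-finite modules: torsion modules with finite dimensional socle. -/
def IsTCF (V : GrMod S) : Prop := V.IsTorsion ∧ FiniteDimensional ℂ V.socle

theorem eq_of_comp (V : GrMod S) (x : V.Total) (h : ∀ m, V.comp m x = 0) : x = 0 :=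
  V.total_ext fun m => by rw [h, map_zero]

theorem exact_totalMap {V₁ V₂ V₃ : GrMod S} (f : V₁ ⟶ V₂) (g : V₂ ⟶ V₃)
    (h : ∀ m, Function.Exact (f.app ⟨m⟩).hom (g.app ⟨m⟩).hom) (x : V₂.Total)
    (hx : totalMap g x = 0) : ∃ y, totalMap f y = x := by
  have hc : ∀ m, ∃ y, (f.app ⟨m⟩).hom y = V₂.comp m x := fun m => by
    refine (h m _).1 ?_
    rw [← comp_totalMap, hx, map_zero]
  have key : ∀ m, ∃ y, totalMap f y = V₂.incl m (V₂.comp m x) := fun m => by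
    obtain ⟨y, hy⟩ := hc m
    exact ⟨V₁.incl m y, by rw [totalMap_incl, hy]⟩
  have hsum : ∃ (s : Finset G), x = ∑ m ∈ s, V₂.incl m (V₂.comp m x) :=
    ⟨_, (DirectSum.sum_support_of (β := fun m => V₂.obj ⟨m⟩) x).symm⟩
  obtain ⟨s, hs⟩ := hsum
  choose y hy using key
  exact ⟨∑ m ∈ s, y m, by rw [map_sum]; simp only [hy]; exact hs.symm⟩

theorem isNoetherianRing (hS : S.FG) : IsNoetherianRing (AddMonoidAlgebra ℂ S) := by
  have : AddMonoid.FG S := (AddMonoid.fg_iff_addSubmonoid_fg S).2 hS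
  exact Algebra.FiniteType.isNoetherianRing ℂ _

theorem IsFG.of_epi {V W : GrMod S} (f : V ⟶ W) [Epi f] (h : V.IsFG) : W.IsFG :=
  have : Module.Finite _ V.Total := h
  Module.Finite.of_surjective (totalMap f) (totalMap_surjective f)

theorem IsFG.of_mono (hS : S.FG) {V W : GrMod S} (f : V ⟶ W) [Mono f] (h : W.IsFG) : V.IsFG :=
  have := isNoetherianRing hS
  have : Module.Finite _ W.Total := h
  Module.Finite.of_injective (totalMap f) (totalMap_injective f)

theorem IsFG.of_iso {V W : GrMod S} (e : V ≅ W) (h : V.IsFG) : W.IsFG :=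
  h.of_epi e.hom

theorem IsFG.of_isZero {V : GrMod S} (h : ∀ m, Subsingleton (V.obj ⟨m⟩)) : V.IsFG := by
  have : Subsingleton V.Total := ⟨fun x y => V.total_ext fun m => Subsingleton.elim _ _⟩
  exact Module.Finite.of_finite

theorem IsFG.of_exact {V₁ V₂ V₃ : GrMod S} (f : V₁ ⟶ V₂) (g : V₂ ⟶ V₃)
    (h : ∀ m, Function.Exact (f.app ⟨m⟩).hom (g.app ⟨m⟩).hom) (h₁ : V₁.IsFG) [Epi g]
    (h₃ : V₃.IsFG) : V₂.IsFG := by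
  have : Module.Finite _ V₁.Total := h₁
  have : Module.Finite _ V₃.Total := h₃
  have : Module.Finite (AddMonoidAlgebra ℂ S) (LinearMap.range (totalMap f)) := inferInstance
  refine ⟨Submodule.fg_of_fg_map_of_fg_inf_ker (totalMap g) ?_ ?_⟩
  · rw [Submodule.map_top, LinearMap.range_eq_top.2 (totalMap_surjective g)]
    exact Module.Finite.fg_top
  · have e : (⊤ ⊓ LinearMap.ker (totalMap g)) = LinearMap.ker (totalMap g) := by simp
    rw [e]
    have hle : LinearMap.ker (totalMap g) ≤ LinearMap.range (totalMap f) := fun x hx => by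
      obtain ⟨y, hy⟩ := exact_totalMap f g h x hx
      exact ⟨y, hy⟩
    have hge : LinearMap.range (totalMap f) ≤ LinearMap.ker (totalMap g) := by
      rintro _ ⟨y, rfl⟩
      refine V₃.eq_of_comp _ fun m => ?_
      rw [comp_totalMap, comp_totalMap]
      exact (h m _).2 ⟨_, rfl⟩
    rw [le_antisymm hle hge]
    exact Module.Finite.iff_fg.1 this

/-- The span of the multiples of a family of homogeneous elements, in a given degree. -/
def genSpan (V : GrMod S) {ι : Type} (d : ι → G) (x : ∀ i, V.obj ⟨d i⟩) (m : G) :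
    Submodule ℂ (V.obj ⟨m⟩) :=
  Submodule.span ℂ {y | ∃ i, ∃ h : m - d i ∈ S, y = V.mul h (x i)}

theorem isFG_of_genSpan (V : GrMod S) {ι : Type} [Finite ι] (d : ι → G) (x : ∀ i, V.obj ⟨d i⟩)
    (h : ∀ m, V.genSpan d x m = ⊤) : V.IsFG := by
  refine ⟨(Submodule.fg_def.2 ⟨Set.range fun i => V.incl (d i) (x i), Set.finite_range _, ?_⟩)⟩
  rw [eq_top_iff]
  rintro y -
  induction y using V.total_induction with
  | h0 => exact zero_mem _
  | h2 y z hy hz => exact add_mem hy hz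
  | h1 m y =>
    have hy : y ∈ V.genSpan d x m := by rw [h]; trivial
    refine Submodule.span_induction (p := fun y _ => V.incl m y ∈ _) ?_ ?_ ?_ ?_ hy
    · rintro _ ⟨i, hi, rfl⟩
      have := V.single_smul_incl ⟨_, hi⟩ 1 hi (by simp) (x i)
      rw [one_smul] at this
      rw [← this]
      exact Submodule.smul_mem _ _ (Submodule.subset_span ⟨i, rfl⟩)
    · rw [map_zero]; exact zero_mem _
    · intro y z _ _ hy hz; rw [map_add]; exact add_mem hy hz
    · intro c y _ hy
      rw [map_smul, ← algebraMap_smul (AddMonoidAlgebra ℂ S)]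
      exact Submodule.smul_mem _ _ hy

theorem comp_mono (V : GrMod S) (s : S) {m m' : G} (h : m' - m ∈ S) (e : m' = m + s)
    (z : V.Total) : V.comp m' (V.mono s z) = V.mul h (V.comp m z) := by
  induction z using V.total_induction with
  | h0 => simp
  | h1 k z =>
    have hk : k + s - k ∈ S := by simp
    rw [V.mono_incl s hk rfl]
    by_cases e' : m = k
    · subst e'
      subst e
      rw [comp_incl_self, comp_incl_self]
    · rw [comp_incl_ne _ (fun h => e' h.symm), comp_incl_ne, map_zero]
      intro h
      exact e' (add_right_cancel (e.symm.trans h.symm))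
  | h2 y z hy hz => simp only [map_add, hy, hz]

theorem IsFG.exists_genSpan {V : GrMod S} (h : V.IsFG) :
    ∃ (ι : Type) (_ : Finite ι) (d : ι → G) (x : ∀ i, V.obj ⟨d i⟩), ∀ m, V.genSpan d x m = ⊤ := by
  obtain ⟨t, ht⟩ := (Module.finite_def.1 h)
  let D : Set G := ⋃ y ∈ t, {m | V.comp m y ≠ 0}
  have hD : D.Finite := by
    refine t.finite_toSet.biUnion fun y _ => ?_
    refine (DFinsupp.support (β := fun m : G => V.obj ⟨m⟩) y).finite_toSet.subset fun m hm => ?_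
    exact DFinsupp.mem_support_iff.2 hm
  refine ⟨t × D, ?_, fun i => i.2.1, fun i => V.comp i.2.1 i.1.1, fun m => ?_⟩
  · have := hD.to_subtype
    infer_instance
  set d : t × D → G := fun i => i.2.1
  set x : ∀ i : t × D, V.obj ⟨d i⟩ := fun i => V.comp i.2.1 i.1.1
  have hmul : ∀ (k k' : G) (hk : k' - k ∈ S) (z : V.obj ⟨k⟩), z ∈ V.genSpan d x k →
      V.mul hk z ∈ V.genSpan d x k' := by
    intro k k' hk z hz
    refine Submodule.span_induction (p := fun z _ => V.mul hk z ∈ V.genSpan d x k')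
      ?_ ?_ ?_ ?_ hz
    · rintro _ ⟨i, hi, rfl⟩
      have : k' - d i ∈ S := by simpa using S.add_mem hk hi
      rw [V.mul_mul _ _ this]
      exact Submodule.subset_span ⟨i, this, rfl⟩
    · rw [map_zero]; exact zero_mem _
    · intro y z _ _ hy hz; rw [map_add]; exact add_mem hy hz
    · intro c y _ hy; rw [map_smul]; exact Submodule.smul_mem _ _ hy
  have hmono : ∀ (s : S) (z : V.Total), (∀ m, V.comp m z ∈ V.genSpan d x m) →
      ∀ m, V.comp m (V.mono s z) ∈ V.genSpan d x m := by
    intro s z hz m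
    have hm : m - (m - s) ∈ S := by simp
    rw [V.comp_mono s hm (by simp)]
    exact hmul _ _ _ _ (hz _)
  let P : Submodule (AddMonoidAlgebra ℂ S) V.Total :=
    { carrier := {z | ∀ m, V.comp m z ∈ V.genSpan d x m}
      zero_mem' := fun m => by rw [map_zero]; exact zero_mem _
      add_mem' := fun hy hz m => by rw [map_add]; exact add_mem (hy m) (hz m)
      smul_mem' := fun a z hz => by
        induction a using AddMonoidAlgebra.induction_linear with
        | zero => intro m; rw [zero_smul, map_zero]; exact zero_mem _
        | add a b ha hb => intro m; rw [add_smul, map_add]; exact add_mem (ha m) (hb m)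
        | single s c =>
          intro m
          rw [single_smul, map_smul]
          exact Submodule.smul_mem _ _ (hmono s z hz m) }
  have hP : P = ⊤ := by
    rw [eq_top_iff, ← ht, Submodule.span_le]
    intro y hy m
    by_cases h0 : V.comp m y = 0
    · rw [h0]; exact zero_mem _
    · have hm : m ∈ D := Set.mem_biUnion hy h0
      refine Submodule.subset_span ⟨(⟨y, hy⟩, ⟨m, hm⟩), by simp [d, S.zero_mem], ?_⟩
      exact (V.mul_self _ _).symm
  rw [eq_top_iff]
  rintro z -
  have : V.incl m z ∈ P := by rw [hP]; trivial
  simpa [comp_incl_self] using this m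

/-! #### Graded duals, torsion co-finite modules -/

/-- The graded dual: `(V^∨)_m` is the dual of `V_{-m}`, and monomials act by transposition. -/
def dual (V : GrMod S) : GrMod S where
  obj x := ModuleCat.of ℂ (Module.Dual ℂ (V.obj ⟨-x.deg⟩))
  map {x y} f := ModuleCat.ofHom (LinearMap.dualMap (V.mul (m := -y.deg) (m' := -x.deg)
    (by have := Wt.le_def.1 (leOfHom f); simpa [sub_eq_add_neg, add_comm] using this)))
  map_id x := ModuleCat.hom_ext <| LinearMap.ext fun φ => LinearMap.ext fun v => by
    change φ (V.mul _ v) = φ v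
    rw [V.mul_self]
  map_comp {x y z} f g := ModuleCat.hom_ext <| LinearMap.ext fun φ => LinearMap.ext fun v => by
    change φ (V.mul _ v) = φ (V.mul _ (V.mul _ v))
    rw [V.mul_mul]

/-- Elements of the graded dual as functionals. -/
def dualFun (V : GrMod S) (m : G) : V.dual.obj ⟨m⟩ →ₗ[ℂ] Module.Dual ℂ (V.obj ⟨-m⟩) :=
  LinearMap.id (R := ℂ) (M := Module.Dual ℂ (V.obj ⟨-m⟩))

theorem dualFun_mul (V : GrMod S) {m m' : G} (h : m' - m ∈ S) (h' : -m - -m' ∈ S)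
    (φ : V.dual.obj ⟨m⟩) (v : V.obj ⟨-m'⟩) :
    V.dualFun m' (V.dual.mul h φ) v = V.dualFun m φ (V.mul h' v) := rfl

/-- The transpose of a morphism. -/
def dualMap {V W : GrMod S} (f : V ⟶ W) : W.dual ⟶ V.dual where
  app x := ModuleCat.ofHom (LinearMap.dualMap (f.app ⟨-x.deg⟩).hom)
  naturality {x y} g := ModuleCat.hom_ext <| LinearMap.ext fun φ => LinearMap.ext fun v => by
    change (W.dualFun x.deg φ) (W.mul _ ((f.app _).hom v)) =
      (W.dualFun x.deg φ) ((f.app _).hom (V.mul _ v))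
    rw [mul_naturality]

instance {V W : GrMod S} (f : V ⟶ W) [Epi f] : Mono (dualMap f) := by
  have : ∀ x, Mono ((dualMap f).app x) := fun x => by
    rw [ModuleCat.mono_iff_injective]
    have : Epi (f.app ⟨-x.deg⟩) := inferInstance
    exact LinearMap.dualMap_injective_of_surjective ((ModuleCat.epi_iff_surjective _).1 this)
  exact NatTrans.mono_of_mono_app _

theorem single_mem_augIdeal {s : S} (hs : s ≠ 0) :
    (AddMonoidAlgebra.single s 1 : AddMonoidAlgebra ℂ S) ∈ augIdeal S :=
  Ideal.subset_span ⟨s, hs, rfl⟩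

theorem mul_comp_of_mem_socle (V : GrMod S) {w : V.Total} (hw : w ∈ V.socle) {m m' : G}
    (h : m' - m ∈ S) (hne : m' ≠ m) : V.mul h (V.comp m w) = 0 := by
  have hs : (⟨m' - m, h⟩ : S) ≠ 0 := fun h0 => hne (by
    have := congrArg Subtype.val h0
    exact sub_eq_zero.1 this)
  have h1 := hw _ (single_mem_augIdeal hs)
  rw [single_smul, one_smul] at h1
  rw [← V.comp_mono ⟨m' - m, h⟩ h (by simp), h1, map_zero]

theorem incl_mem_socle (V : GrMod S) {m : G} {x : V.obj ⟨m⟩}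
    (hx : ∀ (m' : G) (h : m' - m ∈ S), m' ≠ m → V.mul h x = 0) : V.incl m x ∈ V.socle := by
  intro a ha
  refine Submodule.span_induction (p := fun a _ => a • V.incl m x = 0) ?_ ?_ ?_ ?_ ha
  · rintro _ ⟨s, hs, rfl⟩
    have hm : m + (s : G) - m ∈ S := by simp
    rw [V.single_smul_incl s 1 hm rfl, hx _ hm, map_zero, smul_zero]
    intro h
    exact hs (Subtype.ext (by simpa using h))
  · exact zero_smul _ _
  · intro a b _ _ ha hb; rw [add_smul, ha, hb, add_zero]
  · intro r a _ ha; rw [smul_eq_mul, mul_smul, ha, smul_zero]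

theorem incl_injective (V : GrMod S) (m : G) : Function.Injective (V.incl m) := fun x y h => by
  rw [← V.comp_incl_self m x, h, V.comp_incl_self]

/-- The homogeneous part of the socle. -/
def socleComp (V : GrMod S) (m : G) : Submodule ℂ (V.obj ⟨m⟩) := V.socle.comap (V.incl m)

theorem finiteDimensional_socle_of_dual {W : GrMod S} (h : W.dual.IsFG) :
    FiniteDimensional ℂ W.socle := by
  obtain ⟨ι, _, d, φ, hφ⟩ := h.exists_genSpan
  have := Fintype.ofFinite ι
  let ev : W.socle →ₗ[ℂ] (ι → ℂ) := LinearMap.pi fun i =>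
    (W.dualFun (d i) (φ i)) ∘ₗ W.comp (-d i) ∘ₗ W.socle.subtype
  refine FiniteDimensional.of_injective ev ?_
  rw [← LinearMap.ker_eq_bot, LinearMap.ker_eq_bot']
  rintro ⟨w, hw⟩ h0
  have h0 : ∀ i, W.dualFun (d i) (φ i) (W.comp (-d i) w) = 0 :=
    fun i => congrFun h0 i
  refine Subtype.ext (W.eq_of_comp _ fun m => ?_)
  obtain ⟨k, rfl⟩ := neg_surjective m
  change W.comp (-k) w = 0
  rw [← Module.forall_dual_apply_eq_zero_iff ℂ]
  suffices h : ∀ ψ : W.dual.obj ⟨k⟩, W.dualFun k ψ (W.comp (-k) w) = 0 from h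
  intro ψ
  have hψ : ψ ∈ W.dual.genSpan d φ k := by rw [hφ]; trivial
  refine Submodule.span_induction
    (p := fun ψ _ => W.dualFun k ψ (W.comp (-k) w) = 0)
    ?_ ?_ ?_ ?_ hψ
  · rintro _ ⟨i, hi, rfl⟩
    have hi' : -d i - -k ∈ S := by simpa [sub_eq_add_neg, add_comm] using hi
    rw [W.dualFun_mul hi hi']
    by_cases e : d i = k
    · subst e
      rw [W.mul_self, h0]
    · rw [W.mul_comp_of_mem_socle hw hi' (fun h => e (neg_injective h)), map_zero]
  · rw [map_zero, LinearMap.zero_apply]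
  · intro a b _ _ ha hb; rw [map_add, LinearMap.add_apply, ha, hb, add_zero]
  · intro c a _ ha; rw [map_smul, LinearMap.smul_apply, ha, smul_zero]

theorem IsTorsion.exists_socle {V : GrMod S} (hV : V.IsTorsion) {m : G} (x : V.obj ⟨m⟩)
    (hx : x ≠ 0) : ∃ (m' : G) (h : m' - m ∈ S), V.mul h x ≠ 0 ∧ V.mul h x ∈ V.socleComp m' := by
  obtain ⟨k, hk⟩ := hV (V.incl m x)
  induction k generalizing m with
  | zero =>
    exfalso
    have := hk 1 (by simp)
    rw [one_smul] at this
    exact hx (V.incl_injective m (this.trans (map_zero _).symm))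
  | succ k ih =>
    by_cases h : ∃ (m' : G) (h : m' - m ∈ S), m' ≠ m ∧ V.mul h x ≠ 0
    · obtain ⟨m', h, hne, h0⟩ := h
      obtain ⟨m'', h', h1, h2⟩ := ih (V.mul h x) h0 (fun a ha => by
        have hs : (⟨m' - m, h⟩ : S) ≠ 0 := fun h0 => hne (by
          have := congrArg Subtype.val h0
          exact sub_eq_zero.1 this)
        have := hk (a * AddMonoidAlgebra.single ⟨m' - m, h⟩ 1) (by
          rw [pow_succ]
          exact Ideal.mul_mem_mul ha (single_mem_augIdeal hs))
        rwa [mul_smul, V.single_smul_incl _ 1 h (by simp), one_smul] at this)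
      have hh : m'' - m ∈ S := by simpa using S.add_mem h' h
      rw [V.mul_mul h h' hh] at h1 h2
      exact ⟨m'', hh, h1, h2⟩
    · push Not at h
      have h0 : m - m ∈ S := by simp [S.zero_mem]
      refine ⟨m, h0, ?_, ?_⟩
      · rwa [V.mul_self]
      · rw [V.mul_self]
        exact V.incl_mem_socle h

theorem IsTCF.dual_isFG {V : GrMod S} (h : V.IsTCF) : V.dual.IsFG := by
  obtain ⟨htor, hfin⟩ := h
  have hfd : ∀ m, FiniteDimensional ℂ (V.socleComp m) := fun m => by
    let j : V.socleComp m →ₗ[ℂ] V.socle :=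
      (V.incl m ∘ₗ (V.socleComp m).subtype).codRestrict V.socle (fun x => x.2)
    refine FiniteDimensional.of_injective j fun x y hxy => Subtype.ext (V.incl_injective m ?_)
    exact congrArg Subtype.val hxy
  obtain ⟨t, ht⟩ := Module.finite_def.1 hfin
  let D : Set G := ⋃ y ∈ t, {m | V.comp m y.1 ≠ 0}
  have hD : D.Finite := by
    refine t.finite_toSet.biUnion fun y _ => ?_
    refine (DFinsupp.support (β := fun m : G => V.obj ⟨m⟩) y.1).finite_toSet.subset fun m hm => ?_
    exact DFinsupp.mem_support_iff.2 hm
  have hDsoc : ∀ m (x : V.obj ⟨m⟩), x ∈ V.socleComp m → x ≠ 0 → m ∈ D := by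
    intro m x hx hx0
    by_contra hm
    have hz : ∀ y : V.socle, V.comp m y.1 = 0 := by
      intro y
      have hy : y ∈ Submodule.span ℂ (t : Set V.socle) := by rw [ht]; trivial
      refine Submodule.span_induction (p := fun y _ => V.comp m y.1 = 0) ?_ ?_ ?_ ?_ hy
      · intro y hy
        by_contra h0
        exact hm (Set.mem_biUnion hy h0)
      · exact map_zero _
      · intro a b _ _ ha hb
        change V.comp m (a.1 + b.1) = 0
        rw [map_add, ha, hb, add_zero]
      · intro c a _ ha
        change V.comp m (c • a.1) = 0
        rw [map_smul, ha, smul_zero]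
    have := hz ⟨V.incl m x, hx⟩
    rw [V.comp_incl_self] at this
    exact hx0 this
  have hT : ∀ m, ∃ (T : Finset (Module.Dual ℂ (V.obj ⟨m⟩))), ∀ x ∈ V.socleComp m,
      (∀ φ ∈ T, φ x = 0) → x = 0 := by
    intro m
    obtain ⟨T, hT⟩ := Module.finite_def.1
      (inferInstance : Module.Finite ℂ (Module.Dual ℂ (V.socleComp m)))
    have hlift : ∀ φ : Module.Dual ℂ (V.socleComp m), ∃ ψ : Module.Dual ℂ (V.obj ⟨m⟩),
        ψ ∘ₗ (V.socleComp m).subtype = φ := fun φ => LinearMap.exists_extend φ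
    choose ext hext using hlift
    refine ⟨T.image ext, fun x hx h => ?_⟩
    have : (⟨x, hx⟩ : V.socleComp m) = 0 := by
      rw [← Module.forall_dual_apply_eq_zero_iff ℂ]
      intro φ
      have hφ : φ ∈ Submodule.span ℂ (T : Set (Module.Dual ℂ (V.socleComp m))) := by
        rw [hT]; trivial
      refine Submodule.span_induction (p := fun φ _ => φ ⟨x, hx⟩ = 0) ?_ ?_ ?_ ?_ hφ
      · intro φ hφ
        have := h (ext φ) (Finset.mem_image_of_mem _ hφ)
        rw [← hext φ]
        exact this
      · rfl
      · intro a b _ _ ha hb; rw [LinearMap.add_apply, ha, hb, add_zero]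
      · intro c a _ ha; rw [LinearMap.smul_apply, ha, smul_zero]
    exact congrArg Subtype.val this
  choose T hT using hT
  let E : Set G := {e | -e ∈ D}
  have hE : E.Finite := hD.preimage neg_injective.injOn
  have := hE.to_subtype
  let ι : Type := Σ e : E, T (-e.1)
  refine V.dual.isFG_of_genSpan (ι := ι) (fun i => i.1.1) (fun i => i.2.1) fun k => ?_
  rw [eq_top_iff]
  rintro ψ -
  let K := {i : ι // k - i.1.1 ∈ S}
  let Λ : K → Module.Dual ℂ (V.obj ⟨-k⟩) := fun i =>
    V.dualFun k (V.dual.mul (m := i.1.1.1) (m' := k) i.2 i.1.2.1)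
  have key : V.dualFun k ψ ∈ Submodule.span ℂ (Set.range Λ) := by
    refine mem_span_of_iInf_ker_le_ker ?_
    suffices hs : ∀ x, x ∈ (⨅ i, LinearMap.ker (Λ i)) → x = 0 by
      intro x hx
      rw [hs x hx]
      exact zero_mem _
    intro x hx
    by_contra hx0
    obtain ⟨m', h, h1, h2⟩ := htor.exists_socle x hx0
    obtain ⟨e, rfl⟩ := neg_surjective m'
    have he : e ∈ E := hDsoc _ _ h2 h1
    refine h1 (hT _ _ h2 fun φ hφ => ?_)
    have hke : k - e ∈ S := by simpa [sub_eq_add_neg, add_comm] using h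
    have := (Submodule.mem_iInf _).1 hx ⟨⟨⟨e, he⟩, ⟨φ, hφ⟩⟩, hke⟩
    exact this
  refine Submodule.span_mono ?_ key
  rintro _ ⟨i, rfl⟩
  exact ⟨i.1, i.2, rfl⟩

theorem IsTorsion.of_epi {V W : GrMod S} (f : V ⟶ W) [Epi f] (h : V.IsTorsion) :
    W.IsTorsion := by
  intro y
  obtain ⟨x, rfl⟩ := totalMap_surjective f y
  obtain ⟨k, hk⟩ := h x
  exact ⟨k, fun a ha => by rw [← map_smul, hk a ha, map_zero]⟩

theorem IsTCF.of_epi (hS : S.FG) {V W : GrMod S} (f : V ⟶ W) [Epi f] (h : V.IsTCF) :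
    W.IsTCF :=
  ⟨h.1.of_epi f, finiteDimensional_socle_of_dual (h.dual_isFG.of_mono hS (dualMap f))⟩

theorem totalMap_mem_socle {V W : GrMod S} (f : V ⟶ W) {x : V.Total} (hx : x ∈ V.socle) :
    totalMap f x ∈ W.socle := fun a ha => by rw [← map_smul, hx a ha, map_zero]

/-- The map induced on socles. -/
def socleMap {V W : GrMod S} (f : V ⟶ W) : V.socle →ₗ[ℂ] W.socle where
  toFun x := ⟨totalMap f x.1, totalMap_mem_socle f x.2⟩
  map_add' x y := Subtype.ext (map_add _ _ _)
  map_smul' c x := Subtype.ext (by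
    change totalMap f (c • x.1) = c • totalMap f x.1
    rw [← algebraMap_smul (AddMonoidAlgebra ℂ S) c x.1, map_smul, algebraMap_smul])

theorem IsTCF.of_mono {V W : GrMod S} (f : V ⟶ W) [Mono f] (h : W.IsTCF) : V.IsTCF := by
  refine ⟨fun x => ?_, ?_⟩
  · obtain ⟨k, hk⟩ := h.1 (totalMap f x)
    exact ⟨k, fun a ha => totalMap_injective f (by rw [map_smul, hk a ha, map_zero])⟩
  · have := h.2
    exact FiniteDimensional.of_injective (socleMap f) fun x y hxy =>
      Subtype.ext (totalMap_injective f (congrArg Subtype.val hxy))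

theorem IsTCF.of_isZero {V : GrMod S} (h : ∀ m, Subsingleton (V.obj ⟨m⟩)) : V.IsTCF := by
  have : Subsingleton V.Total := ⟨fun x y => V.total_ext fun m => Subsingleton.elim _ _⟩
  exact ⟨fun x => ⟨0, fun a _ => Subsingleton.elim _ _⟩, inferInstance⟩

theorem IsTCF.of_exact (hS : S.FG) {V₁ V₂ V₃ : GrMod S} (f : V₁ ⟶ V₂) (g : V₂ ⟶ V₃)
    (h : ∀ m, Function.Exact (f.app ⟨m⟩).hom (g.app ⟨m⟩).hom) [Mono f] (h₁ : V₁.IsTCF)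
    (h₃ : V₃.IsTCF) : V₂.IsTCF := by
  refine ⟨fun x => ?_, ?_⟩
  · obtain ⟨k, hk⟩ := h₃.1 (totalMap g x)
    have := isNoetherianRing hS
    obtain ⟨t, ht⟩ := (isNoetherianRing_iff_ideal_fg _).1 this (augIdeal S ^ k)
    have hy : ∀ a ∈ t, ∃ y, totalMap f y = a • x := fun a ha => by
      refine exact_totalMap f g h _ ?_
      rw [map_smul]
      exact hk a (ht ▸ Submodule.subset_span ha)
    choose! y hy using hy
    choose n hn using h₁.1
    refine ⟨(t.sup fun a => n (y a)) + k, fun b hb => ?_⟩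
    rw [pow_add] at hb
    refine Submodule.mul_induction_on hb (fun c hc a ha => ?_) fun a b ha hb => ?_
    · rw [mul_smul]
      rw [← ht] at ha
      refine Submodule.span_induction (p := fun a _ => c • a • x = 0) ?_ ?_ ?_ ?_ ha
      · intro a ha
        rw [← hy a ha, ← map_smul, hn (y a) c, map_zero]
        exact Ideal.pow_le_pow_right (Finset.le_sup (f := fun a => n (y a)) ha) hc
      · rw [zero_smul, smul_zero]
      · intro a b _ _ ha hb; rw [add_smul, smul_add, ha, hb, add_zero]
      · intro r a _ ha; rw [smul_eq_mul, mul_smul, smul_comm, ha, smul_zero]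
    · rw [add_smul, ha, hb, add_zero]
  · have := h₁.2
    have := h₃.2
    have hr : LinearMap.range (socleMap f) = LinearMap.ker (socleMap g) := by
      apply le_antisymm
      · rintro _ ⟨y, rfl⟩
        refine Subtype.ext (V₃.eq_of_comp _ fun m => ?_)
        change V₃.comp m (totalMap g (totalMap f y.1)) = 0
        rw [comp_totalMap, comp_totalMap]
        exact (h m _).2 ⟨_, rfl⟩
      · rintro ⟨x, hx⟩ hx0
        obtain ⟨y, rfl⟩ := exact_totalMap f g h x (congrArg Subtype.val hx0)
        refine ⟨⟨y, fun a ha => totalMap_injective f ?_⟩, rfl⟩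
        rw [map_smul, hx a ha, map_zero]
    have := isNoetherian_of_range_eq_ker (socleMap f) (socleMap g) hr
    infer_instance

/-- The graded dual of a finitely generated module is torsion co-finite, provided that the
nonzero elements of `S` have positive length for some additive function on `G`. -/
theorem IsFG.dual_isTCF (l : G →+ ℤ) (hl : ∀ s ∈ S, s ≠ 0 → 0 < l s) {V : GrMod S}
    (h : V.IsFG) : V.dual.IsTCF := by
  obtain ⟨ι, _, d, x, hx⟩ := h.exists_genSpan
  have := Fintype.ofFinite ι
  have hl0 : ∀ s ∈ S, 0 ≤ l s := fun s hs => by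
    by_cases e : s = 0
    · rw [e, map_zero]
    · exact (hl s hs e).le
  refine ⟨fun z => ?_, ?_⟩
  · -- `V` is bounded below for the length, so its dual is bounded above
    obtain ⟨B, hB⟩ : ∃ B : ℤ, ∀ m (v : V.dual.obj ⟨m⟩), v ≠ 0 → l m ≤ B := by
      obtain ⟨B, hB⟩ := (Set.finite_range fun i => -l (d i)).bddAbove
      refine ⟨B, fun m v hv => ?_⟩
      by_contra hlt
      apply hv
      have hbot : V.genSpan d x (-m) = ⊥ := by
        rw [genSpan, Submodule.span_eq_bot]
        rintro _ ⟨i, hi, rfl⟩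
        exfalso
        have h1 := hl0 _ hi
        have h2 := hB ⟨i, rfl⟩
        rw [map_sub, map_neg] at h1
        simp only at h2
        omega
      rw [hx] at hbot
      have : Subsingleton (V.obj ⟨-m⟩) := (Submodule.subsingleton_iff ℂ).1
        (subsingleton_of_bot_eq_top hbot.symm)
      change V.dualFun m v = 0
      exact LinearMap.ext fun w => by
        rw [Subsingleton.elim w 0, map_zero, map_zero]
    let F : ℤ → Submodule (AddMonoidAlgebra ℂ S) V.dual.Total := fun c =>
      { carrier := {z | ∀ m, V.dual.comp m z ≠ 0 → c ≤ l m}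
        zero_mem' := fun m h => absurd (map_zero _) h
        add_mem' := fun {a b} ha hb m h => by
          by_cases h0 : V.dual.comp m a = 0
          · exact hb m fun h1 => h (by rw [map_add, h0, h1, add_zero])
          · exact ha m h0
        smul_mem' := fun a z hz => by
          induction a using AddMonoidAlgebra.induction_linear with
          | zero => intro m hm; rw [zero_smul, map_zero] at hm; exact absurd rfl hm
          | add a b ha hb =>
            intro m hm
            by_cases h0 : V.dual.comp m (a • z) = 0
            · exact hb m fun h1 => hm (by rw [add_smul, map_add, h0, h1, add_zero])
            · exact ha m h0
          | single s c =>
            intro m hm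
            rw [single_smul, map_smul, V.dual.comp_mono s (m := m - s) (by simp) (by simp)] at hm
            have := hz (m - s) fun h0 => hm (by rw [h0, map_zero, smul_zero])
            rw [map_sub] at this
            have := hl0 _ s.2
            omega }
    have hF : ∀ c, ∀ a ∈ augIdeal S, ∀ z ∈ F c, a • z ∈ F (c + 1) := by
      intro c a ha z hz
      refine Submodule.span_induction (p := fun a _ => a • z ∈ F (c + 1)) ?_ ?_ ?_ ?_ ha
      · rintro _ ⟨s, hs, rfl⟩ m hm
        rw [single_smul, map_smul, V.dual.comp_mono s (m := m - s) (by simp) (by simp)] at hm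
        have h1 := hz (m - s) fun h0 => hm (by rw [h0, map_zero, smul_zero])
        rw [map_sub] at h1
        have := hl _ s.2 (fun h => hs (Subtype.ext h))
        omega
      · rw [zero_smul]; exact zero_mem _
      · intro a b _ _ ha hb; rw [add_smul]; exact add_mem ha hb
      · intro r a _ ha; rw [smul_eq_mul, mul_smul]; exact Submodule.smul_mem _ _ ha
    have hFk : ∀ (k : ℕ) (c : ℤ), ∀ a ∈ augIdeal S ^ k, ∀ z ∈ F c, a • z ∈ F (c + k) := by
      intro k
      induction k with
      | zero => intro c a _ z hz; simpa using Submodule.smul_mem _ a hz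
      | succ k ih =>
        intro c a ha z hz
        rw [pow_succ] at ha
        refine Submodule.mul_induction_on ha (fun a ha b hb => ?_) fun a b ha hb => ?_
        · rw [mul_smul]
          have := ih (c + 1) a ha _ (hF c b hb z hz)
          rwa [show c + 1 + (k : ℤ) = c + ((k + 1 : ℕ) : ℤ) by push_cast; ring] at this
        · rw [add_smul]; exact add_mem ha hb
    obtain ⟨c, hc⟩ : ∃ c : ℤ, z ∈ F c := by
      have hfin : {m | V.dual.comp m z ≠ 0}.Finite :=
        (DFinsupp.support (β := fun m : G => V.dual.obj ⟨m⟩) z).finite_toSet.subset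
          fun m hm => DFinsupp.mem_support_iff.2 hm
      obtain ⟨c, hc⟩ := (hfin.image l).bddBelow
      exact ⟨c, fun m hm => hc ⟨m, hm, rfl⟩⟩
    refine ⟨(B + 1 - c).toNat, fun a ha => V.dual.eq_of_comp _ fun m => ?_⟩
    by_contra hm
    have h1 := hFk _ c a ha z hc m hm
    have h2 := hB m _ hm
    have := Int.self_le_toNat (B + 1 - c)
    omega
  · have hdd : ∀ i, d i - -(-d i) ∈ S := fun i => by simp [S.zero_mem]
    have hdd' : ∀ i, -(-d i) - d i ∈ S := fun i => by simp [S.zero_mem]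
    let ev : V.dual.socle →ₗ[ℂ] (ι → ℂ) := LinearMap.pi fun i =>
      (Module.Dual.eval ℂ _ (V.mul (hdd' i) (x i))) ∘ₗ (V.dualFun (-d i)) ∘ₗ
        V.dual.comp (-d i) ∘ₗ V.dual.socle.subtype
    refine FiniteDimensional.of_injective ev ?_
    rw [← LinearMap.ker_eq_bot, LinearMap.ker_eq_bot']
    rintro ⟨w, hw⟩ h0
    have h0 : ∀ i, V.dualFun (-d i) (V.dual.comp (-d i) w) (V.mul (hdd' i) (x i)) = 0 :=
      fun i => congrFun h0 i
    refine Subtype.ext (V.dual.eq_of_comp _ fun m => ?_)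
    change V.dual.comp m w = 0
    change V.dualFun m (V.dual.comp m w) = 0
    refine LinearMap.ext fun v => ?_
    have hv : v ∈ V.genSpan d x (-m) := by rw [hx]; trivial
    refine Submodule.span_induction
      (p := fun v _ => V.dualFun m (V.dual.comp m w) v = 0) ?_ ?_ ?_ ?_ hv
    · rintro _ ⟨i, hi, rfl⟩
      have h1 : -m - -(-d i) ∈ S := by simpa using hi
      have h2 : -d i - m ∈ S := by simpa [sub_eq_add_neg, add_comm] using hi
      rw [← V.mul_mul (hdd' i) h1 hi, ← V.dualFun_mul h2 h1]
      by_cases e : -d i = m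
      · subst e
        rw [mul_self, h0]
      · rw [V.dual.mul_comp_of_mem_socle hw h2 e, map_zero, LinearMap.zero_apply]
    · rw [map_zero]
    · intro a b _ _ ha hb; rw [map_add, ha, hb, add_zero]
    · intro c a _ ha; rw [map_smul, ha, smul_zero]

end GrMod

end Graded

/-! ### Sheaves and cosheaves of graded modules on a finite poset of cones -/

/-- A sheaf of graded semigroup algebras on a poset of cones (with the topology in which the open
sets are the lower sets, so that a sheaf amounts to its stalks and the maps between them): the
stalk at `σ` is the semigroup algebra of the semigroup `mon σ`, graded by the group `wt σ`,
and for `τ ≤ σ` the structure map of algebras is the one induced by `res : wt σ →+ wt τ`. -/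
structure MonoidSheaf (I : Type) [PartialOrder I] where
  wt : I → Type
  [grp : ∀ σ, AddCommGroup (wt σ)]
  res : ∀ {σ τ : I}, τ ≤ σ → wt σ →+ wt τ
  res_refl : ∀ {σ : I} (h : σ ≤ σ) (m : wt σ), res h m = m
  res_res : ∀ {σ τ ξ : I} (h : τ ≤ σ) (h' : ξ ≤ τ) (h'' : ξ ≤ σ) (m : wt σ),
    res h' (res h m) = res h'' m
  mon : ∀ σ, AddSubmonoid (wt σ)
  res_mem : ∀ {σ τ : I} (h : τ ≤ σ) (m : wt σ), m ∈ mon σ → res h m ∈ mon τ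

attribute [instance] MonoidSheaf.grp

namespace MonoidSheaf

variable {I : Type} [PartialOrder I] (D : MonoidSheaf I)

/-- The stalk at `σ` of the sheaf of algebras. -/
abbrev Alg (σ : I) : Type := AddMonoidAlgebra ℂ (D.mon σ)

/-- Pairs (cone, weight), as indices of the homogeneous components of the stalks of a sheaf of
graded modules. There is an arrow from `(σ, m)` to `(τ, m')` iff `τ ≤ σ` and the weight `m'` is
obtained from the restriction of `m` by multiplying by a monomial of the algebra at `τ`. -/
structure ShIdx where
  cone : I
  deg : D.wt cone

instance : Preorder D.ShIdx where
  le x y := ∃ h : y.cone ≤ x.cone, y.deg - D.res h x.deg ∈ D.mon y.cone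
  le_refl x := ⟨le_rfl, by rw [D.res_refl, sub_self]; exact zero_mem _⟩
  le_trans x y z := by
    rintro ⟨h, hm⟩ ⟨h', hm'⟩
    refine ⟨h'.trans h, ?_⟩
    have := add_mem hm' (D.res_mem h' _ hm)
    rwa [map_sub, D.res_res h h' (h'.trans h), sub_add_sub_cancel] at this

theorem ShIdx.le_def {x y : D.ShIdx} :
    x ≤ y ↔ ∃ h : y.cone ≤ x.cone, y.deg - D.res h x.deg ∈ D.mon y.cone := Iff.rfl

/-- Pairs (cone, weight), as indices of the homogeneous components of the stalks of a cosheaf of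
graded modules. There is an arrow from `(τ, m')` to `(σ, m)` iff `τ ≤ σ` and the restriction of
the weight `m` is obtained from `m'` by multiplying by a monomial of the algebra at `τ`. -/
structure CoshIdx where
  cone : I
  deg : D.wt cone

instance : Preorder D.CoshIdx where
  le x y := ∃ h : x.cone ≤ y.cone, D.res h y.deg - x.deg ∈ D.mon x.cone
  le_refl x := ⟨le_rfl, by rw [D.res_refl, sub_self]; exact zero_mem _⟩
  le_trans x y z := by
    rintro ⟨h, hm⟩ ⟨h', hm'⟩
    refine ⟨h.trans h', ?_⟩
    have := add_mem (D.res_mem h _ hm') hm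
    rwa [map_sub, D.res_res h' h (h.trans h'), sub_add_sub_cancel] at this

theorem CoshIdx.le_def {x y : D.CoshIdx} :
    x ≤ y ↔ ∃ h : x.cone ≤ y.cone, D.res h y.deg - x.deg ∈ D.mon x.cone := Iff.rfl

/-- Sheaves of graded modules `F` over the sheaf of algebras. Explicitly `F` consists of the
homogeneous components `F (σ, m)` of the graded stalks `F_σ`, of the multiplications by monomials
`F (σ, m) ⟶ F (σ, m + s)`, `s ∈ mon σ`, and for `τ ≤ σ` of the restriction maps
`F (σ, m) ⟶ F (τ, m|τ)`, which commute with the multiplications. -/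
abbrev Sheaf := D.ShIdx ⥤ ModuleCat.{0} ℂ

/-- Cosheaves of graded modules `C` over the sheaf of algebras. Explicitly `C` consists of the
homogeneous components `C (σ, m)` of the graded stalks `C_σ`, of the multiplications by monomials
`C (σ, m) ⟶ C (σ, m + s)`, `s ∈ mon σ`, and for `τ ≤ σ` of the corestriction maps
`C (τ, m|τ) ⟶ C (σ, m)`, which commute with the multiplications by the monomials of `mon σ`.
-/
abbrev Cosheaf := D.CoshIdx ⥤ ModuleCat.{0} ℂ

/-- The weights at a fixed cone. -/
def shIncl (σ : I) : Wt (D.mon σ) ⥤ D.ShIdx :=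
  Monotone.functor (f := fun m => (⟨σ, m.deg⟩ : D.ShIdx)) fun x y h =>
    ⟨le_rfl, by rw [D.res_refl]; exact h⟩

/-- The weights at a fixed cone. -/
def coshIncl (σ : I) : Wt (D.mon σ) ⥤ D.CoshIdx :=
  Monotone.functor (f := fun m => (⟨σ, m.deg⟩ : D.CoshIdx)) fun x y h =>
    ⟨le_rfl, by rw [D.res_refl]; exact h⟩

/-- The stalk of a sheaf, as a graded module over the stalk of the sheaf of algebras. -/
def shStalk (σ : I) : D.Sheaf ⥤ GrMod (D.mon σ) :=
  (Functor.whiskeringLeft _ _ _).obj (D.shIncl σ)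

/-- The stalk of a cosheaf, as a graded module over the stalk of the sheaf of algebras. -/
def coshStalk (σ : I) : D.Cosheaf ⥤ GrMod (D.mon σ) :=
  (Functor.whiskeringLeft _ _ _).obj (D.coshIncl σ)

/-- Sheaves of modules with finitely generated stalks. -/
def fg : ObjectProperty D.Sheaf := fun F => ∀ σ, ((D.shStalk σ).obj F).IsFG

/-- Cosheaves of modules with torsion co-finite stalks. -/
def tcf : ObjectProperty D.Cosheaf := fun C => ∀ σ, ((D.coshStalk σ).obj C).IsTCF

/-- The semigroups of the stalks are finitely generated. -/
class IsFinGen : Prop where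
  fg : ∀ σ, (D.mon σ).FG

theorem exact_app {J : Type} [SmallCategory J] {T : ShortComplex (J ⥤ ModuleCat.{0} ℂ)}
    (hT : T.ShortExact) (j : J) : Function.Exact (T.f.app j).hom (T.g.app j).hom := by
  have := hT.map_of_exact ((evaluation J (ModuleCat.{0} ℂ)).obj j)
  exact (ShortComplex.ShortExact.moduleCat_exact_iff_function_exact _).1 this.exact

instance (σ : I) {X Y : D.Sheaf} (f : X ⟶ Y) [Mono f] : Mono ((D.shStalk σ).map f) :=
  have : ∀ x, Mono (((D.shStalk σ).map f).app x) := fun x =>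
    inferInstanceAs (Mono (f.app ((D.shIncl σ).obj x)))
  NatTrans.mono_of_mono_app _

instance (σ : I) {X Y : D.Sheaf} (f : X ⟶ Y) [Epi f] : Epi ((D.shStalk σ).map f) :=
  have : ∀ x, Epi (((D.shStalk σ).map f).app x) := fun x =>
    inferInstanceAs (Epi (f.app ((D.shIncl σ).obj x)))
  NatTrans.epi_of_epi_app _

instance (σ : I) {X Y : D.Cosheaf} (f : X ⟶ Y) [Mono f] : Mono ((D.coshStalk σ).map f) :=
  have : ∀ x, Mono (((D.coshStalk σ).map f).app x) := fun x =>
    inferInstanceAs (Mono (f.app ((D.coshIncl σ).obj x)))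
  NatTrans.mono_of_mono_app _

instance (σ : I) {X Y : D.Cosheaf} (f : X ⟶ Y) [Epi f] : Epi ((D.coshStalk σ).map f) :=
  have : ∀ x, Epi (((D.coshStalk σ).map f).app x) := fun x =>
    inferInstanceAs (Epi (f.app ((D.coshIncl σ).obj x)))
  NatTrans.epi_of_epi_app _

theorem subsingleton_of_isZero {J : Type} [SmallCategory J] {X : J ⥤ ModuleCat.{0} ℂ}
    (hX : IsZero X) (j : J) : Subsingleton (X.obj j) :=
  ModuleCat.subsingleton_of_isZero ((evaluation J (ModuleCat.{0} ℂ)).obj j |>.map_isZero hX)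

instance [D.IsFinGen] : D.fg.IsSerreClass where
  exists_zero := ⟨_, isZero_zero _, fun _ => GrMod.IsFG.of_isZero fun _ =>
    subsingleton_of_isZero (isZero_zero _) _⟩
  prop_of_mono f _ h σ := (h σ).of_mono (IsFinGen.fg σ) ((D.shStalk σ).map f)
  prop_of_epi f _ h σ := (h σ).of_epi ((D.shStalk σ).map f)
  prop_X₂_of_shortExact {T} hT h₁ h₃ σ :=
    have := hT.mono_f
    have := hT.epi_g
    GrMod.IsFG.of_exact ((D.shStalk σ).map T.f) ((D.shStalk σ).map T.g)
      (fun _ => exact_app hT _) (h₁ σ) (h₃ σ)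

instance [D.IsFinGen] : D.tcf.IsSerreClass where
  exists_zero := ⟨_, isZero_zero _, fun _ => GrMod.IsTCF.of_isZero fun _ =>
    subsingleton_of_isZero (isZero_zero _) _⟩
  prop_of_mono f _ h σ := (h σ).of_mono ((D.coshStalk σ).map f)
  prop_of_epi f _ h σ := (h σ).of_epi (IsFinGen.fg σ) ((D.coshStalk σ).map f)
  prop_X₂_of_shortExact {T} hT h₁ h₃ σ :=
    have := hT.mono_f
    have := hT.epi_g
    GrMod.IsTCF.of_exact (IsFinGen.fg σ) ((D.coshStalk σ).map T.f) ((D.coshStalk σ).map T.g)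
      (fun _ => exact_app hT _) (h₁ σ) (h₃ σ)

theorem isClosedUnderFiniteProducts {C : Type*} [Category* C] [Abelian C]
    (P : ObjectProperty C) [P.IsSerreClass] : P.IsClosedUnderFiniteProducts := by
  have : P.IsClosedUnderBinaryProducts := ⟨by
    rintro X ⟨p⟩
    let e : p.diag ≅ pair (p.diag.obj ⟨.left⟩) (p.diag.obj ⟨.right⟩) := diagramIsoPair _
    have hB : IsLimit (BinaryBiproduct.bicone (p.diag.obj ⟨.left⟩) (p.diag.obj ⟨.right⟩)).toCone :=
      BinaryBiproduct.isLimit _ _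
    exact P.prop_of_iso (IsLimit.conePointsIsoOfNatIso hB p.isLimit e.symm)
      (P.prop_biprod (p.prop_diag_obj _) (p.prop_diag_obj _))⟩
  exact .mk'

instance [D.IsFinGen] : D.fg.IsClosedUnderFiniteProducts := isClosedUnderFiniteProducts _

instance [D.IsFinGen] : D.tcf.IsClosedUnderFiniteProducts := isClosedUnderFiniteProducts _

/-- Finitely generated sheaves of modules form an abelian subcategory. -/
instance [D.IsFinGen] : Abelian D.fg.FullSubcategory := inferInstance

/-- Torsion co-finite cosheaves of modules form an abelian subcategory. -/
instance [D.IsFinGen] : Abelian D.tcf.FullSubcategory := inferInstance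

/-- The graded dual of a sheaf of modules, a cosheaf of modules:
`F^∨ (σ, m)` is the dual of `F (σ, -m)`. -/
def dual (F : D.Sheaf) : D.Cosheaf where
  obj x := ModuleCat.of ℂ (Module.Dual ℂ (F.obj ⟨x.cone, -x.deg⟩))
  map {x y} f := ModuleCat.ofHom (LinearMap.dualMap
    (F.map (homOfLE (by
      obtain ⟨h, hm⟩ := leOfHom f
      exact ⟨h, by simpa [sub_eq_add_neg, add_comm] using hm⟩) :
        (⟨y.cone, -y.deg⟩ : D.ShIdx) ⟶ ⟨x.cone, -x.deg⟩)).hom)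
  map_id x := ModuleCat.hom_ext <| LinearMap.ext fun φ => LinearMap.ext fun v => by
    change φ ((F.map (𝟙 _)).hom v) = φ v
    rw [F.map_id]
    rfl
  map_comp {x y z} f g := ModuleCat.hom_ext <| LinearMap.ext fun φ => LinearMap.ext fun v => by
    change φ ((F.map _).hom v) = φ ((F.map _).hom ((F.map _).hom v))
    rw [← LinearMap.comp_apply (F.map _).hom, ← ModuleCat.hom_comp, ← F.map_comp]
    rfl

/-- The nonzero elements of the semigroups have positive length for some additive function; in
particular `0` is the only unit, and the ideal spanned by the nontrivial monomials is the maximal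
graded ideal. -/
class HasLength : Prop where
  exists_length : ∀ σ, ∃ l : D.wt σ →+ ℤ, ∀ s ∈ D.mon σ, s ≠ 0 → 0 < l s

theorem dual_tcf [D.HasLength] {F : D.Sheaf} (hF : D.fg F) : D.tcf (D.dual F) := fun σ => by
  obtain ⟨l, hl⟩ := HasLength.exists_length (D := D) σ
  exact (hF σ).dual_isTCF l hl

/-- The sheaf of algebras, as a sheaf of modules over itself: the homogeneous component of weight
`m` of the stalk at `σ` has the monomial of weight `m` as its basis if `m ∈ mon σ`, and is zero
otherwise. -/
def structureSheaf : D.Sheaf where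
  obj x := ModuleCat.of ℂ (PLift (x.deg ∈ D.mon x.cone) →₀ ℂ)
  map {x y} f := ModuleCat.ofHom (Finsupp.lmapDomain ℂ ℂ fun h => ⟨by
    obtain ⟨h', hm⟩ := leOfHom f
    simpa using add_mem hm (D.res_mem h' _ h.down)⟩)
  map_id x := ModuleCat.hom_ext (LinearMap.ext fun φ => Finsupp.mapDomain_id)
  map_comp f g := ModuleCat.hom_ext <| LinearMap.ext fun φ => by
    change Finsupp.mapDomain _ φ = Finsupp.mapDomain _ (Finsupp.mapDomain _ φ)
    rw [← Finsupp.mapDomain_comp]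

/-- The extension by zero of the restriction of a sheaf to a locally closed (that is, convex)
subset of the poset of cones: its stalks are those of `F` at the cones in `Z`, and zero elsewhere.
-/
def extendByZero (F : D.Sheaf) (Z : Set I) [Z.OrdConnected] : D.Sheaf where
  obj x := ModuleCat.of ℂ (PLift (x.cone ∈ Z) → F.obj x)
  map {x y} f := ModuleCat.ofHom (LinearMap.pi fun _ =>
    if h : x.cone ∈ Z then (F.map f).hom ∘ₗ LinearMap.proj ⟨h⟩ else 0)
  map_id x := ModuleCat.hom_ext <| LinearMap.ext fun φ => funext fun h => by
    simp [h.down]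
  map_comp {x y z} f g := ModuleCat.hom_ext <| LinearMap.ext fun φ => funext fun h => by
    by_cases hx : x.cone ∈ Z
    · have hy : y.cone ∈ Z := Set.OrdConnected.out ‹_› h.down hx
        ⟨(leOfHom g).1, (leOfHom f).1⟩
      simp [hx, hy]
    · by_cases hy : y.cone ∈ Z <;> simp [hx, hy]

theorem extendByZero_fg {F : D.Sheaf} (hF : D.fg F) (Z : Set I) [Z.OrdConnected] :
    D.fg (D.extendByZero F Z) := fun σ => by
  let f : (D.shStalk σ).obj F ⟶ (D.shStalk σ).obj (D.extendByZero F Z) :=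
    { app := fun x => ModuleCat.ofHom (LinearMap.pi fun _ => LinearMap.id)
      naturality := fun x y g => ModuleCat.hom_ext <| LinearMap.ext fun v => funext fun h => by
        have h' : σ ∈ Z := h.down
        have : ((D.shIncl σ).obj x).cone ∈ Z := h'
        simp only [shStalk, extendByZero]
        simp [this]
        rfl }
  have : ∀ x, Epi (f.app x) := fun x => by
    rw [ModuleCat.epi_iff_surjective]
    intro φ
    by_cases h : σ ∈ Z
    · exact ⟨φ ⟨h⟩, funext fun _ => rfl⟩
    · exact ⟨0, funext fun h' => absurd h'.down h⟩
  have : Epi f := NatTrans.epi_of_epi_app _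
  exact (hF σ).of_epi f

theorem structureSheaf_fg : D.fg D.structureSheaf := fun σ => by
  refine GrMod.isFG_of_genSpan _ (ι := Unit) (fun _ => 0)
    (fun _ => (Finsupp.single ⟨zero_mem _⟩ 1 : PLift ((0 : D.wt σ) ∈ D.mon σ) →₀ ℂ)) fun m => ?_
  rw [eq_top_iff]
  rintro (φ : PLift (m ∈ D.mon σ) →₀ ℂ) -
  induction φ using Finsupp.induction_linear with
  | zero => exact zero_mem _
  | add f g hf hg => exact add_mem hf hg
  | single h c =>
    have : (Finsupp.single h c : PLift (m ∈ D.mon σ) →₀ ℂ) = c • Finsupp.single h 1 := by simp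
    rw [this]
    refine Submodule.smul_mem _ _ (Submodule.subset_span ⟨(), by simpa using h.down, ?_⟩)
    exact (Finsupp.mapDomain_single (α := PLift ((0 : D.wt σ) ∈ D.mon σ))
      (f := fun _ => h)).symm

/-- `𝒜_{[σ]}`, the extension by zero of the sheaf of algebras from the open subset of the faces
of `σ`, as a finitely generated sheaf of modules. -/
def openStar (σ : I) : D.fg.FullSubcategory :=
  ⟨D.extendByZero D.structureSheaf (Set.Iic σ), D.extendByZero_fg D.structureSheaf_fg _⟩

/-- `𝒜_{{σ}}`, the extension by zero of the sheaf of algebras from the point `σ`, as a finitely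
generated sheaf of modules. -/
def point (σ : I) : D.fg.FullSubcategory :=
  ⟨D.extendByZero D.structureSheaf {σ}, D.extendByZero_fg D.structureSheaf_fg _⟩

end MonoidSheaf

/-! ### The cellular complex and the Koszul functor -/

/-- The dimensions of the cones of a poset of cones, and the signs (incidence numbers) that arise
from a choice of orientations of the cones: `inc σ τ` is nonzero only if `τ` is a facet of `σ`, and
the square of the cellular differential vanishes. -/
structure CellData (I : Type) [PartialOrder I] [Fintype I] where
  dim : I → ℕ
  inc : I → I → ℤ
  le_of_inc : ∀ {σ τ}, inc σ τ ≠ 0 → τ ≤ σ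
  dim_of_inc : ∀ {σ τ}, inc σ τ ≠ 0 → dim σ = dim τ + 1
  inc_inc : ∀ σ ξ, ∑ τ, inc σ τ * inc τ ξ = 0

namespace CellData

variable {I : Type} [PartialOrder I] [Fintype I] (c : CellData I)
variable {C : Type*} [Category* C] [Preadditive C]

/-- The component of the cellular differential for a pair of cones. -/
def comp (P : Iᵒᵖ ⥤ C) (σ τ : I) : P.obj (.op σ) ⟶ P.obj (.op τ) :=
  if h : τ ≤ σ then c.inc σ τ • P.map (homOfLE h).op else 0

theorem comp_eq_zero (P : Iᵒᵖ ⥤ C) {σ τ : I} (h : c.inc σ τ = 0) : c.comp P σ τ = 0 := by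
  unfold comp
  split_ifs <;> simp [h]

theorem comp_comp (P : Iᵒᵖ ⥤ C) {σ ξ : I} (h : ξ ≤ σ) (τ : I) :
    c.comp P σ τ ≫ c.comp P τ ξ = (c.inc σ τ * c.inc τ ξ) • P.map (homOfLE h).op := by
  by_cases h₁ : c.inc σ τ = 0
  · simp [c.comp_eq_zero P h₁, h₁]
  by_cases h₂ : c.inc τ ξ = 0
  · simp [c.comp_eq_zero P h₂, h₂]
  have h₃ := c.le_of_inc h₁
  have h₄ := c.le_of_inc h₂
  rw [comp, comp, dif_pos h₃, dif_pos h₄, Preadditive.zsmul_comp, Preadditive.comp_zsmul,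
    smul_smul, ← P.map_comp]
  rfl

theorem comp_naturality {P Q : Iᵒᵖ ⥤ C} (f : P ⟶ Q) (σ τ : I) :
    c.comp P σ τ ≫ f.app (.op τ) = f.app (.op σ) ≫ c.comp Q σ τ := by
  unfold comp
  split_ifs <;> simp

variable [HasFiniteBiproducts C]

/-- The cones in cohomological degree `i`, that is, of dimension `-i`. -/
abbrev Cell (i : ℤ) : Type := {σ : I // -(c.dim σ : ℤ) = i}

/-- The cellular complex of a diagram `P` on the poset of cones, with the terms `P σ` in degree
`-dim σ`, and the differential given by the maps `P σ ⟶ P τ` for the facets `τ` of `σ`, with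
signs. -/
def cellular : (Iᵒᵖ ⥤ C) ⥤ CochainComplex C ℤ where
  obj P :=
    { X := fun i => ⨁ fun σ : c.Cell i => P.obj (.op σ.1)
      d := fun _ _ => biproduct.matrix fun σ τ => c.comp P σ.1 τ.1
      shape := fun i j hij => biproduct.hom_ext _ _ fun τ => biproduct.hom_ext' _ _ fun σ => by
        rw [biproduct.ι_matrix_assoc, biproduct.lift_π, zero_comp, comp_zero]
        refine c.comp_eq_zero P ?_
        by_contra h
        have := c.dim_of_inc h
        have h₁ := σ.2
        have h₂ := τ.2
        exact hij (by simp only [ComplexShape.up_Rel]; omega)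
      d_comp_d' := fun i j k hij hjk =>
        biproduct.hom_ext _ _ fun ξ => biproduct.hom_ext' _ _ fun σ => by
        simp only [zero_comp, comp_zero, Category.assoc, biproduct.matrix_π,
          biproduct.ι_matrix_assoc, biproduct.lift_desc]
        by_cases h : ξ.1 ≤ σ.1
        · simp only [c.comp_comp P h]
          rw [← Finset.sum_smul]
          have : ∑ τ : c.Cell j, c.inc σ.1 τ.1 * c.inc τ.1 ξ.1 = 0 := by
            rw [← c.inc_inc σ.1 ξ.1]
            refine Finset.sum_of_injOn Subtype.val (Subtype.val_injective.injOn) (by simp)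
              (fun τ _ hτ => ?_) (fun _ _ => rfl)
            by_cases h₁ : c.inc σ.1 τ = 0
            · simp [h₁]
            · refine absurd ?_ hτ
              have := c.dim_of_inc h₁
              have h₂ := σ.2
              simp only [ComplexShape.up_Rel] at hij
              exact ⟨⟨τ, by omega⟩, by simp⟩
          rw [this, zero_smul]
        · refine Finset.sum_eq_zero fun τ _ => ?_
          by_cases h₁ : c.inc σ.1 τ.1 = 0
          · simp [c.comp_eq_zero P h₁]
          by_cases h₂ : c.inc τ.1 ξ.1 = 0
          · simp [c.comp_eq_zero P h₂]
          exact absurd ((c.le_of_inc h₂).trans (c.le_of_inc h₁)) h }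
  map {P Q} f :=
    { f := fun i => biproduct.map fun σ => f.app (.op σ.1)
      comm' := fun i j _ => biproduct.hom_ext _ _ fun τ => biproduct.hom_ext' _ _ fun σ => by
        simp [c.comp_naturality f] }
  map_id P := by
    ext i : 1
    exact biproduct.hom_ext _ _ fun τ => by simp
  map_comp f g := by
    ext i : 1
    exact biproduct.hom_ext _ _ fun τ => by simp

instance : (c.cellular (C := C)).PreservesZeroMorphisms where
  map_zero P Q := by
    ext i : 1
    exact biproduct.hom_ext _ _ fun τ => by
      simp only [cellular, biproduct.map_π, zero_app, comp_zero]
      exact zero_comp.symm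

end CellData

namespace MonoidSheaf

variable {I : Type} [PartialOrder I] (D : MonoidSheaf I)

/-- For a cone `σ` and a weight `b`, the cosheaf `𝒜_{[σ]}^∨ (-b) ⊗ V`: its homogeneous component of
weight `n` at `τ` consists of the maps to `V` from the set of monomials of `𝒜_τ` of weight
`b|τ - n` (at most one) if `τ ≤ σ`, and is zero otherwise. -/
def cofreeObj (x : D.CoshIdx) (V : ModuleCat.{0} ℂ) : D.Cosheaf where
  obj q := ModuleCat.of ℂ ((q ⟶ x) → V)
  map f := ModuleCat.ofHom (LinearMap.funLeft ℂ V fun g => f ≫ g)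

/-- The functoriality of `𝒜_{[σ]}^∨ (-b) ⊗ V`: it is covariant in `V`, and for an arrow from `x'`
to `x` there is a map from the cosheaf of `x` to the one of `x'`, which is given by the
multiplications by monomials and by the projections from `𝒜_{[σ]}^∨` to `𝒜_{[τ]}^∨`. -/
def cofree : D.CoshIdxᵒᵖ ⥤ ModuleCat.{0} ℂ ⥤ D.Cosheaf where
  obj x :=
    { obj := fun V => D.cofreeObj x.unop V
      map := fun f => { app := fun q => ModuleCat.ofHom (f.hom.compLeft (q ⟶ x.unop)) } }
  map {x y} g :=
    { app := fun V =>
        { app := fun q => ModuleCat.ofHom (LinearMap.funLeft ℂ V fun h => h ≫ g.unop) } }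

/-- The maps of `𝒜_{[σ]}^∨ (-b) ⊗ V` for both variables. -/
def cofreeMap {x y : D.CoshIdx} (g : y ⟶ x) {V W : ModuleCat.{0} ℂ} (v : V ⟶ W) :
    (D.cofree.obj (.op x)).obj V ⟶ (D.cofree.obj (.op y)).obj W :=
  (D.cofree.map g.op).app V ≫ (D.cofree.obj (.op y)).map v

theorem cofreeMap_comp {x y z : D.CoshIdx} (g : y ⟶ x) (h : z ⟶ y) {V W U : ModuleCat.{0} ℂ}
    (v : V ⟶ W) (w : W ⟶ U) :
    D.cofreeMap g v ≫ D.cofreeMap h w = D.cofreeMap (h ≫ g) (v ≫ w) := by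
  simp [cofreeMap]

theorem cofreeMap_id (x : D.CoshIdx) (V : ModuleCat.{0} ℂ) :
    D.cofreeMap (𝟙 x) (𝟙 V) = 𝟙 _ := by
  simp [cofreeMap]

theorem cofreeMap_zero {x y : D.CoshIdx} (g : y ⟶ x) (V W : ModuleCat.{0} ℂ) :
    D.cofreeMap g (0 : V ⟶ W) = 0 := by
  ext q v
  rfl

/-- The functor `(b, b') ↦ 𝒜_{[σ]}^∨ (-b) ⊗ F (σ, b')`, where `b` and `b'` are weights at `σ`. -/
def kernelFunctor (F : D.Sheaf) (σ : I) : (Wt (D.mon σ))ᵒᵖ ⥤ Wt (D.mon σ) ⥤ D.Cosheaf :=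
  ((D.coshIncl σ).op ⋙ D.cofree) ⋙ (Functor.whiskeringLeft _ _ _).obj ((D.shStalk σ).obj F)

/-- The tensor product of graded modules `𝒜_{[σ]}^∨ ⊗ F_σ` over the algebra `𝒜_σ`, as the coend over
the weights `b` at `σ` of `𝒜_{[σ]}^∨ (-b) ⊗ F (σ, b)`, that is, as the quotient of their direct sum
by the relations `a x ⊗ v = a ⊗ x v` for the monomials `x` of `𝒜_σ`. -/
def kernelTensor (F : D.Sheaf) (σ : I) : D.Cosheaf := coend (D.kernelFunctor F σ)

/-- The inclusion of a direct summand. -/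
def kernelIncl (F : D.Sheaf) (σ : I) (b : D.wt σ) :
    (D.cofree.obj (.op ⟨σ, b⟩)).obj (F.obj ⟨σ, b⟩) ⟶ D.kernelTensor F σ :=
  coend.ι (D.kernelFunctor F σ) ⟨b⟩

theorem kernelIncl_condition (F : D.Sheaf) {σ : I} {a b : D.wt σ}
    (f : (⟨σ, a⟩ : D.CoshIdx) ⟶ ⟨σ, b⟩) (f' : (⟨σ, a⟩ : D.ShIdx) ⟶ ⟨σ, b⟩) :
    D.cofreeMap f (𝟙 _) ≫ D.kernelIncl F σ a = D.cofreeMap (𝟙 _) (F.map f') ≫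
      D.kernelIncl F σ b := by
  have hab : (⟨a⟩ : Wt (D.mon σ)) ≤ ⟨b⟩ := by
    obtain ⟨h, h'⟩ := leOfHom f'
    simpa [Wt.le_def, D.res_refl] using h'
  have := coend.condition (D.kernelFunctor F σ) (homOfLE hab)
  simp only [cofreeMap, op_id]
  rw [CategoryTheory.Functor.map_id, CategoryTheory.Functor.map_id, Category.comp_id, NatTrans.id_app, Category.id_comp]
  exact this

theorem kernelTensor_hom_ext {F : D.Sheaf} {σ : I} {X : D.Cosheaf} {f g : D.kernelTensor F σ ⟶ X}
    (h : ∀ b, D.kernelIncl F σ b ≫ f = D.kernelIncl F σ b ≫ g) : f = g :=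
  coend.hom_ext fun b => h b.deg

/-- The universal property of the tensor product. -/
def kernelDesc {F : D.Sheaf} {σ : I} {X : D.Cosheaf}
    (p : ∀ b, (D.cofree.obj (.op ⟨σ, b⟩)).obj (F.obj ⟨σ, b⟩) ⟶ X)
    (hp : ∀ (a b : D.wt σ) (f : (⟨σ, a⟩ : D.CoshIdx) ⟶ ⟨σ, b⟩)
      (f' : (⟨σ, a⟩ : D.ShIdx) ⟶ ⟨σ, b⟩),
      D.cofreeMap f (𝟙 _) ≫ p a = D.cofreeMap (𝟙 _) (F.map f') ≫ p b) :
    D.kernelTensor F σ ⟶ X :=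
  coend.desc (fun b => p b.deg) fun a b f => by
    have := hp a.deg b.deg ((D.coshIncl σ).map f) ((D.shIncl σ).map f)
    simp only [cofreeMap, op_id] at this
    rw [CategoryTheory.Functor.map_id, CategoryTheory.Functor.map_id, Category.comp_id, NatTrans.id_app, Category.id_comp] at this
    exact this

theorem kernelIncl_desc {F : D.Sheaf} {σ : I} {X : D.Cosheaf}
    (p : ∀ b, (D.cofree.obj (.op ⟨σ, b⟩)).obj (F.obj ⟨σ, b⟩) ⟶ X)
    (hp : ∀ (a b : D.wt σ) (f : (⟨σ, a⟩ : D.CoshIdx) ⟶ ⟨σ, b⟩)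
      (f' : (⟨σ, a⟩ : D.ShIdx) ⟶ ⟨σ, b⟩),
      D.cofreeMap f (𝟙 _) ≫ p a = D.cofreeMap (𝟙 _) (F.map f') ≫ p b) (b : D.wt σ) :
    D.kernelIncl F σ b ≫ D.kernelDesc p hp = p b :=
  coend.ι_desc _ _ _

/-- The arrow from `(τ, b|τ)` to `(σ, b)`. -/
def coshRes {σ τ : I} (h : τ ≤ σ) (b : D.wt σ) : (⟨τ, D.res h b⟩ : D.CoshIdx) ⟶ ⟨σ, b⟩ :=
  homOfLE ⟨h, by rw [sub_self]; exact zero_mem _⟩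

/-- The arrow from `(σ, b)` to `(τ, b|τ)`. -/
def shRes {σ τ : I} (h : τ ≤ σ) (b : D.wt σ) : (⟨σ, b⟩ : D.ShIdx) ⟶ ⟨τ, D.res h b⟩ :=
  homOfLE ⟨h, by rw [sub_self]; exact zero_mem _⟩

/-- The map `𝒜_{[σ]}^∨ ⊗ F_σ ⟶ 𝒜_{[τ]}^∨ ⊗ F'_τ` for `τ ≤ σ` and a morphism from `F` to `F'`, the
tensor product of the projection from `𝒜_{[σ]}^∨` to `𝒜_{[τ]}^∨` and of the restriction map. -/
def kernelMap {F F' : D.Sheaf} (α : F ⟶ F') {σ τ : I} (h : τ ≤ σ) :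
    D.kernelTensor F σ ⟶ D.kernelTensor F' τ :=
  D.kernelDesc (fun b => D.cofreeMap (D.coshRes h b) (F.map (D.shRes h b) ≫ α.app _) ≫
    D.kernelIncl F' τ (D.res h b)) fun a b f f' => by
    have hab : D.res h b - D.res h a ∈ D.mon τ := by
      obtain ⟨h₁, h₂⟩ := leOfHom f'
      rw [← map_sub]
      refine D.res_mem h _ ?_
      simpa [D.res_refl] using h₂
    let g : (⟨τ, D.res h a⟩ : D.CoshIdx) ⟶ ⟨τ, D.res h b⟩ :=
      homOfLE ⟨le_rfl, by rw [D.res_refl]; exact hab⟩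
    let g' : (⟨τ, D.res h a⟩ : D.ShIdx) ⟶ ⟨τ, D.res h b⟩ :=
      homOfLE ⟨le_rfl, by rw [D.res_refl]; exact hab⟩
    have h₁ : D.coshRes h a ≫ f = g ≫ D.coshRes h b := Subsingleton.elim _ _
    have h₂ : f' ≫ D.shRes h b = D.shRes h a ≫ g' := Subsingleton.elim _ _
    have h₃ := D.kernelIncl_condition F' g g'
    have e₁ : D.cofreeMap (D.coshRes h b) (F.map (D.shRes h a) ≫ α.app _) ≫
        D.cofreeMap g (𝟙 (F'.obj _)) =
        D.cofreeMap f (𝟙 (F.obj _)) ≫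
          D.cofreeMap (D.coshRes h a) (F.map (D.shRes h a) ≫ α.app _) := by
      rw [cofreeMap_comp, cofreeMap_comp, h₁, Category.id_comp, Category.comp_id]
    have e₂ : D.cofreeMap (D.coshRes h b) (F.map (D.shRes h a) ≫ α.app _) ≫
        D.cofreeMap (𝟙 _) (F'.map g') =
        D.cofreeMap (𝟙 _) (F.map f') ≫
          D.cofreeMap (D.coshRes h b) (F.map (D.shRes h b) ≫ α.app _) := by
      rw [cofreeMap_comp, cofreeMap_comp, Category.id_comp, Category.comp_id, ← F.map_comp_assoc,
        h₂, F.map_comp_assoc, Category.assoc, α.naturality]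
    rw [← Category.assoc, ← e₁, Category.assoc, h₃, ← Category.assoc, e₂, Category.assoc]

theorem kernelIncl_map {F F' : D.Sheaf} (α : F ⟶ F') {σ τ : I} (h : τ ≤ σ) (b : D.wt σ) :
    D.kernelIncl F σ b ≫ D.kernelMap α h =
      D.cofreeMap (D.coshRes h b) (F.map (D.shRes h b) ≫ α.app _) ≫
        D.kernelIncl F' τ (D.res h b) :=
  D.kernelIncl_desc _ _ _

theorem cofreeMap_kernelIncl (F : D.Sheaf) {x : D.CoshIdx} {V : ModuleCat.{0} ℂ} {τ : I}
    {b b' : D.wt τ} (e : b = b') (g : (⟨τ, b⟩ : D.CoshIdx) ⟶ x) (g' : (⟨τ, b'⟩ : D.CoshIdx) ⟶ x)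
    (v : V ⟶ F.obj ⟨τ, b⟩) (v' : V ⟶ F.obj ⟨τ, b'⟩)
    (hv : ∀ u : (⟨τ, b⟩ : D.ShIdx) ⟶ ⟨τ, b'⟩, v ≫ F.map u = v') :
    D.cofreeMap g v ≫ D.kernelIncl F τ b = D.cofreeMap g' v' ≫ D.kernelIncl F τ b' := by
  subst e
  have := hv (𝟙 _)
  rw [F.map_id, Category.comp_id] at this
  subst this
  rfl

theorem kernelMap_comp {F F' F'' : D.Sheaf} (α : F ⟶ F') (α' : F' ⟶ F'') {σ τ ξ : I} (h : τ ≤ σ)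
    (h' : ξ ≤ τ) (h'' : ξ ≤ σ) :
    D.kernelMap α h ≫ D.kernelMap α' h' = D.kernelMap (α ≫ α') h'' := by
  refine D.kernelTensor_hom_ext fun b => ?_
  rw [← Category.assoc, kernelIncl_map, Category.assoc, kernelIncl_map, kernelIncl_map,
    ← Category.assoc, cofreeMap_comp]
  refine D.cofreeMap_kernelIncl F'' (D.res_res h h' h'' b) _ _ _ _ fun u => ?_
  simp only [NatTrans.comp_app, Category.assoc, ← NatTrans.naturality, ← NatTrans.naturality_assoc]
  rw [← F.map_comp_assoc, ← F.map_comp_assoc]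
  rfl

theorem kernelMap_id (F : D.Sheaf) (σ : I) (h : σ ≤ σ) : D.kernelMap (𝟙 F) h = 𝟙 _ := by
  refine D.kernelTensor_hom_ext fun b => ?_
  rw [kernelIncl_map, Category.comp_id, ← Category.id_comp (D.kernelIncl F σ b),
    ← D.cofreeMap_id]
  refine D.cofreeMap_kernelIncl F (D.res_refl h b) _ _ _ _ fun u => ?_
  rw [NatTrans.id_app, Category.comp_id, ← F.map_comp, ← F.map_id]
  rfl

theorem kernelMap_zero (F F' : D.Sheaf) {σ τ : I} (h : τ ≤ σ) :
    D.kernelMap (0 : F ⟶ F') h = 0 := by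
  refine D.kernelTensor_hom_ext fun b => ?_
  rw [kernelIncl_map, comp_zero, zero_app, comp_zero, cofreeMap_zero, zero_comp]

/-- The diagram `σ ↦ 𝒜_{[σ]}^∨ ⊗ F_σ` of cosheaves of modules. -/
def kernelDiagram : D.Sheaf ⥤ Iᵒᵖ ⥤ D.Cosheaf where
  obj F :=
    { obj := fun σ => D.kernelTensor F σ.unop
      map := fun f => D.kernelMap (𝟙 F) (leOfHom f.unop)
      map_id := fun σ => D.kernelMap_id F σ.unop _
      map_comp := fun f g => ((D.kernelMap_comp (𝟙 F) (𝟙 F) (leOfHom f.unop) (leOfHom g.unop)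
        (leOfHom (f ≫ g).unop)).trans (by rw [Category.comp_id])).symm }
  map {F F'} α :=
    { app := fun σ => D.kernelMap α (le_refl σ.unop)
      naturality := fun σ τ f =>
        (D.kernelMap_comp (𝟙 F) α (leOfHom f.unop) (le_refl _) (leOfHom f.unop)).trans
          ((D.kernelMap_comp α (𝟙 F') (le_refl _) (leOfHom f.unop) (leOfHom f.unop)).trans
            (by rw [Category.comp_id, Category.id_comp])).symm }
  map_id F := by
    ext σ : 2
    exact D.kernelMap_id F σ.unop _
  map_comp f g := by
    ext σ : 2
    exact (D.kernelMap_comp _ _ _ _ _).symm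

instance : D.kernelDiagram.PreservesZeroMorphisms where
  map_zero F F' := by
    ext σ : 2
    exact D.kernelMap_zero _ _ _

instance : HasFiniteBiproducts D.Cosheaf := Abelian.hasFiniteBiproducts

/-- The cellular complex of the diagram `σ ↦ 𝒜_{[σ]}^∨ ⊗ F_σ`. -/
def koszul [Fintype I] (c : CellData I) : D.Sheaf ⥤ CochainComplex D.Cosheaf ℤ :=
  D.kernelDiagram ⋙ c.cellular

instance [Fintype I] (c : CellData I) : (D.koszul c).PreservesZeroMorphisms :=
  inferInstanceAs (D.kernelDiagram ⋙ c.cellular).PreservesZeroMorphisms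

/-- The total complex of the double complex which is obtained from a complex of sheaves of
modules by applying `koszul` to its terms. -/
def koszulTotal [Fintype I] (c : CellData I) :
    CochainComplex D.Sheaf ℤ ⥤ CochainComplex D.Cosheaf ℤ :=
  (D.koszul c).mapHomologicalComplex (.up ℤ) ⋙
    HomologicalComplex₂.totalFunctor D.Cosheaf (.up ℤ) (.up ℤ) (.up ℤ)

end MonoidSheaf

/-! ### Bounded derived categories -/

section Derived

universe w w' v v' u u'

variable (C : Type u) [Category.{v} C] [Abelian C] [HasDerivedCategory.{w} C]
  {E : Type u'} [Category.{v'} E] [Abelian E] [HasDerivedCategory.{w'} E]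

/-- The bounded derived category, as the full triangulated subcategory of the derived category
whose objects are the complexes with bounded cohomology. -/
abbrev Db : Type _ := (DerivedCategory.TStructure.t (C := C)).bounded.FullSubcategory

/-- The inclusion in the derived category. -/
abbrev Db.ι : Db C ⥤ DerivedCategory C := (DerivedCategory.TStructure.t (C := C)).bounded.ι

/-- An object of an abelian category, as a complex in degree `0`. -/
def Db.single : C ⥤ Db C :=
  (DerivedCategory.TStructure.t (C := C)).bounded.lift (DerivedCategory.singleFunctor C 0)
    fun X => ⟨⟨0, inferInstanceAs (((DerivedCategory.singleFunctor C 0).obj X).IsGE 0)⟩,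
      ⟨0, inferInstanceAs (((DerivedCategory.singleFunctor C 0).obj X).IsLE 0)⟩⟩

/-- Bounded complexes of projective objects. -/
def boundedProj : ObjectProperty (CochainComplex C ℤ) := fun P =>
  (∃ a, P.IsStrictlyGE a) ∧ (∃ b, P.IsStrictlyLE b) ∧ ∀ i, Projective (P.X i)

/-- A bounded complex of projective objects, as an object of the bounded derived category. -/
def Db.ofProj : (boundedProj C).FullSubcategory ⥤ Db C :=
  (DerivedCategory.TStructure.t (C := C)).bounded.lift
    ((boundedProj C).ι ⋙ DerivedCategory.Q) fun P => by
      obtain ⟨⟨a, _⟩, ⟨b, _⟩, _⟩ := P.property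
      exact ⟨⟨a, inferInstanceAs ((DerivedCategory.Q.obj P.obj).IsGE a)⟩,
        ⟨b, inferInstanceAs ((DerivedCategory.Q.obj P.obj).IsLE b)⟩⟩

variable {C}
variable (F : C ⥤ E) [F.Additive] [PreservesFiniteLimits F] [PreservesFiniteColimits F]

theorem bounded_mapDerivedCategory (X : Db C) :
    (DerivedCategory.TStructure.t (C := E)).bounded (F.mapDerivedCategory.obj X.obj) := by
  obtain ⟨X, ⟨a, ha⟩, ⟨b, hb⟩⟩ := X
  have : X.IsGE a := ha
  have : X.IsLE b := hb
  obtain ⟨K, _, _, ⟨e⟩⟩ := X.exists_iso_Q_obj_of_isGE_of_isLE a b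
  refine (DerivedCategory.TStructure.t (C := E)).bounded.prop_of_iso
    (F.mapDerivedCategory.mapIso e ≪≫ F.mapDerivedCategoryFactors.app K).symm ?_
  let L : CochainComplex E ℤ := (F.mapHomologicalComplex (.up ℤ)).obj K
  have : L.IsStrictlyGE a := inferInstance
  have : L.IsStrictlyLE b := inferInstance
  exact ⟨⟨a, inferInstanceAs ((DerivedCategory.Q.obj L).IsGE a)⟩,
    ⟨b, inferInstanceAs ((DerivedCategory.Q.obj L).IsLE b)⟩⟩

/-- The functor on bounded derived categories induced by an exact functor. -/
def mapDb : Db C ⥤ Db E :=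
  (DerivedCategory.TStructure.t (C := E)).bounded.lift (Db.ι C ⋙ F.mapDerivedCategory)
    (bounded_mapDerivedCategory F)

instance : (mapDb F).CommShift ℤ :=
  inferInstanceAs (((DerivedCategory.TStructure.t (C := E)).bounded.lift
    (Db.ι C ⋙ F.mapDerivedCategory) (bounded_mapDerivedCategory F)).CommShift ℤ)

theorem mapDb_isTriangulated : (mapDb F).IsTriangulated :=
  inferInstanceAs (((DerivedCategory.TStructure.t (C := E)).bounded.lift
    (Db.ι C ⋙ F.mapDerivedCategory) (bounded_mapDerivedCategory F)).IsTriangulated)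

end Derived

/-! ### Change of the sheaf of algebras -/

theorem isFG_pull_iff {G G' : Type} [AddCommGroup G] [AddCommGroup G'] {S : AddSubmonoid G}
    {S' : AddSubmonoid G'} (φ : G →+ G') (hφ : Function.Surjective φ)
    (hS : ∀ m, φ m ∈ S' ↔ m ∈ S) (V : GrMod S') (W : GrMod S)
    (hW : W = Monotone.functor (f := fun m : Wt S => (⟨φ m.deg⟩ : Wt S')) (fun x y h => by
      rw [Wt.le_def, ← map_sub, hS]; exact h) ⋙ V) : W.IsFG ↔ V.IsFG := by
  subst hW
  set W := Monotone.functor (f := fun m : Wt S => (⟨φ m.deg⟩ : Wt S')) (fun x y h => by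
      rw [Wt.le_def, ← map_sub, hS]; exact h) ⋙ V with hW
  have key : ∀ {ι : Type} (d : ι → G) (x : ∀ i, V.obj ⟨φ (d i)⟩) (m : G),
      GrMod.genSpan W d x m = V.genSpan (fun i => φ (d i)) x (φ m) := by
    intro ι d x m
    refine congrArg (Submodule.span ℂ) (Set.ext fun y => exists_congr fun i => ⟨?_, ?_⟩)
    · rintro ⟨h, e⟩
      exact ⟨by rw [← map_sub, hS]; exact h, e⟩
    · rintro ⟨h, e⟩
      exact ⟨by rw [← map_sub, hS] at h; exact h, e⟩
  constructor
  · intro h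
    obtain ⟨ι, _, d, x, hx⟩ := h.exists_genSpan
    refine GrMod.isFG_of_genSpan V (fun i => φ (d i)) x fun m => ?_
    obtain ⟨m, rfl⟩ := hφ m
    exact (key d x m).symm.trans (hx m)
  · intro h
    obtain ⟨ι, _, d, x, hx⟩ := h.exists_genSpan
    obtain ⟨d, rfl⟩ : ∃ d' : ι → G, d = fun i => φ (d' i) :=
      ⟨fun i => (hφ (d i)).choose, funext fun i => (hφ (d i)).choose_spec.symm⟩
    refine GrMod.isFG_of_genSpan W d x fun m => ?_
    exact (key d x m).trans (hx (φ m))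

namespace MonoidSheaf

variable {I : Type} [PartialOrder I]

theorem map_map_eq {J : Type} [Preorder J] (E : J ⥤ ModuleCat.{0} ℂ) {a b b' c : J}
    (f : a ⟶ b) (g : b ⟶ c) (f' : a ⟶ b') (g' : b' ⟶ c) (v : E.obj a) :
    (E.map g).hom ((E.map f).hom v) = (E.map g').hom ((E.map f').hom v) := by
  rw [← LinearMap.comp_apply, ← LinearMap.comp_apply, ← ModuleCat.hom_comp, ← ModuleCat.hom_comp,
    ← E.map_comp, ← E.map_comp]
  rfl

/-- The graded dual of an isomorphism. -/
def dualIso (D : MonoidSheaf I) {F F' : D.Sheaf} (e : F ≅ F') : D.dual F' ≅ D.dual F :=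
  NatIso.ofComponents (fun x => LinearEquiv.toModuleIso
    ((e.app (⟨x.cone, -x.deg⟩ : D.ShIdx)).toLinearEquiv.dualMap))
    fun {x y} f => ModuleCat.hom_ext <|
      LinearMap.ext fun (φ : Module.Dual ℂ (F'.obj ⟨x.cone, -x.deg⟩)) => LinearMap.ext fun v => by
      change φ ((F'.map _).hom ((e.hom.app _).hom v)) = φ ((e.hom.app _).hom ((F.map _).hom v))
      rw [← LinearMap.comp_apply (F'.map _).hom, ← LinearMap.comp_apply (e.hom.app _).hom,
        ← ModuleCat.hom_comp, ← ModuleCat.hom_comp, e.hom.naturality]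

/-- A surjective morphism of sheaves of graded semigroup algebras `A ⟶ B`, which is induced by
compatible surjections between the groups of weights, such that the semigroups of `A` are the
inverse images of the semigroups of `B`. -/
structure Quot (A B : MonoidSheaf I) where
  hom : ∀ σ, A.wt σ →+ B.wt σ
  surj : ∀ σ, Function.Surjective (hom σ)
  res_hom : ∀ {σ τ : I} (h : τ ≤ σ) (m : A.wt σ), B.res h (hom σ m) = hom τ (A.res h m)
  mem_iff : ∀ σ (m : A.wt σ), hom σ m ∈ B.mon σ ↔ m ∈ A.mon σ

namespace Quot

variable {A B : MonoidSheaf I} (δ : Quot A B)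

theorem sh_le_iff (x y : A.ShIdx) :
    (⟨x.cone, δ.hom _ x.deg⟩ : B.ShIdx) ≤ ⟨y.cone, δ.hom _ y.deg⟩ ↔ x ≤ y :=
  exists_congr fun h => by
    change δ.hom _ y.deg - B.res _ (δ.hom _ x.deg) ∈ _ ↔ _
    rw [δ.res_hom, ← map_sub, δ.mem_iff]

theorem cosh_le_iff (x y : A.CoshIdx) :
    (⟨x.cone, δ.hom _ x.deg⟩ : B.CoshIdx) ≤ ⟨y.cone, δ.hom _ y.deg⟩ ↔ x ≤ y :=
  exists_congr fun h => by
    change B.res _ (δ.hom _ y.deg) - δ.hom _ x.deg ∈ _ ↔ _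
    rw [δ.res_hom, ← map_sub, δ.mem_iff]

/-- The map on the indices of homogeneous components. -/
def toSh : A.ShIdx ⥤ B.ShIdx :=
  Monotone.functor (f := fun x => (⟨x.cone, δ.hom _ x.deg⟩ : B.ShIdx))
    fun x y h => (δ.sh_le_iff x y).2 h

/-- The map on the indices of homogeneous components. -/
def toCosh : A.CoshIdx ⥤ B.CoshIdx :=
  Monotone.functor (f := fun x => (⟨x.cone, δ.hom _ x.deg⟩ : B.CoshIdx))
    fun x y h => (δ.cosh_le_iff x y).2 h

instance : δ.toSh.IsEquivalence where
  faithful := ⟨fun _ => Subsingleton.elim _ _⟩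
  full := ⟨fun {x y} f => ⟨homOfLE ((δ.sh_le_iff x y).1 (leOfHom f)), Subsingleton.elim _ _⟩⟩
  essSurj := ⟨fun ⟨σ, m⟩ => by
    obtain ⟨m, rfl⟩ := δ.surj σ m
    exact ⟨⟨σ, m⟩, ⟨Iso.refl _⟩⟩⟩

instance : δ.toCosh.IsEquivalence where
  faithful := ⟨fun _ => Subsingleton.elim _ _⟩
  full := ⟨fun {x y} f => ⟨homOfLE ((δ.cosh_le_iff x y).1 (leOfHom f)), Subsingleton.elim _ _⟩⟩
  essSurj := ⟨fun ⟨σ, m⟩ => by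
    obtain ⟨m, rfl⟩ := δ.surj σ m
    exact ⟨⟨σ, m⟩, ⟨Iso.refl _⟩⟩⟩

/-- Restriction of scalars for sheaves of graded modules: the homogeneous component of weight `m`
of the restricted module is the component whose weight is the image of `m`. -/
def restrictSh : B.Sheaf ⥤ A.Sheaf := (Functor.whiskeringLeft _ _ _).obj δ.toSh

/-- Restriction of scalars for cosheaves of graded modules. -/
def restrictCosh : B.Cosheaf ⥤ A.Cosheaf := (Functor.whiskeringLeft _ _ _).obj δ.toCosh

instance : δ.restrictSh.IsEquivalence :=
  inferInstanceAs (δ.toSh.asEquivalence.congrLeft (E := ModuleCat.{0} ℂ)).inverse.IsEquivalence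

instance : δ.restrictCosh.IsEquivalence :=
  inferInstanceAs (δ.toCosh.asEquivalence.congrLeft (E := ModuleCat.{0} ℂ)).inverse.IsEquivalence

/-- Extension of scalars `δ^* = B ⊗_A -` for sheaves of graded modules, the left adjoint of the
restriction of scalars. -/
def extendSh : A.Sheaf ⥤ B.Sheaf := δ.restrictSh.leftAdjoint

/-- Extension of scalars `δ^* = B ⊗_A -` for cosheaves of graded modules, the left adjoint of the
restriction of scalars. -/
def extendCosh : A.Cosheaf ⥤ B.Cosheaf := δ.restrictCosh.leftAdjoint

def adjSh : δ.extendSh ⊣ δ.restrictSh := Adjunction.ofIsRightAdjoint _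

def adjCosh : δ.extendCosh ⊣ δ.restrictCosh := Adjunction.ofIsRightAdjoint _

instance : δ.extendSh.IsEquivalence := δ.adjSh.isEquivalence_left_of_isEquivalence_right

instance : δ.extendCosh.IsEquivalence := δ.adjCosh.isEquivalence_left_of_isEquivalence_right

theorem fg_restrictSh_iff (F : B.Sheaf) : A.fg (δ.restrictSh.obj F) ↔ B.fg F :=
  forall_congr' fun σ => isFG_pull_iff (δ.hom σ) (δ.surj σ) (δ.mem_iff σ) _ _ rfl

/-- The isomorphism of a sheaf with the restriction of its extension of scalars. -/
def unitIsoSh (F : A.Sheaf) : F ≅ δ.restrictSh.obj (δ.extendSh.obj F) :=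
  asIso (δ.adjSh.unit.app F)

instance [A.IsFinGen] : A.fg.IsClosedUnderIsomorphisms := inferInstance

theorem fg_extendSh_iff [A.IsFinGen] (F : A.Sheaf) : B.fg (δ.extendSh.obj F) ↔ A.fg F := by
  rw [← δ.fg_restrictSh_iff]
  exact (A.fg.prop_iff_of_iso (δ.unitIsoSh F)).symm

instance [B.IsFinGen] : (B.tcf.inverseImage δ.extendCosh).IsSerreClass := inferInstance

/-- Cosheaves of `A`-modules whose extensions of scalars to `B` are torsion co-finite. -/
def tcf : ObjectProperty A.Cosheaf := B.tcf.inverseImage δ.extendCosh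

instance [B.IsFinGen] : δ.tcf.IsSerreClass :=
  inferInstanceAs (B.tcf.inverseImage δ.extendCosh).IsSerreClass

instance [B.IsFinGen] : δ.tcf.IsClosedUnderFiniteProducts := isClosedUnderFiniteProducts _

/-- Torsion co-finite cosheaves of `A`-modules form an abelian subcategory. -/
instance [B.IsFinGen] : Abelian δ.tcf.FullSubcategory := inferInstance

theorem lift_isEquivalence {C E : Type*} [Category* C] [Category* E] (F : C ⥤ E)
    [F.IsEquivalence] (P : ObjectProperty C) (Q : ObjectProperty E)
    [P.IsClosedUnderIsomorphisms] (h : ∀ X, Q (F.obj X) ↔ P X)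
    [Q.IsClosedUnderIsomorphisms] :
    (Q.lift (P.ι ⋙ F) fun X => (h _).2 X.property).IsEquivalence where
  faithful := inferInstance
  full := inferInstance
  essSurj := ⟨fun Y => by
    have hY : Q (F.obj (F.objPreimage Y.obj)) :=
      Q.prop_of_iso (F.objObjPreimageIso Y.obj).symm Y.property
    exact ⟨⟨F.objPreimage Y.obj, (h _).1 hY⟩, ⟨Q.isoMk (F.objObjPreimageIso Y.obj)⟩⟩⟩

/-- Extension of scalars for finitely generated sheaves of modules. -/
def starSh [A.IsFinGen] : A.fg.FullSubcategory ⥤ B.fg.FullSubcategory :=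
  B.fg.lift (A.fg.ι ⋙ δ.extendSh) fun F => (δ.fg_extendSh_iff _).2 F.property

/-- Extension of scalars for torsion co-finite cosheaves of modules. -/
def starCosh : δ.tcf.FullSubcategory ⥤ B.tcf.FullSubcategory :=
  B.tcf.lift (δ.tcf.ι ⋙ δ.extendCosh) fun C => C.property

instance [A.IsFinGen] [B.IsFinGen] : δ.starSh.IsEquivalence :=
  lift_isEquivalence δ.extendSh A.fg B.fg δ.fg_extendSh_iff

instance [B.IsFinGen] : δ.starCosh.IsEquivalence :=
  lift_isEquivalence δ.extendCosh δ.tcf B.tcf fun _ => Iff.rfl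

instance [A.IsFinGen] [B.IsFinGen] : δ.starSh.Additive :=
  Functor.additive_of_preserves_binary_products _

instance [B.IsFinGen] : δ.starCosh.Additive :=
  Functor.additive_of_preserves_binary_products _

/-- The graded dual commutes with restriction of scalars. -/
def dualRestrictIso (E : B.Sheaf) :
    A.dual (δ.restrictSh.obj E) ≅ δ.restrictCosh.obj (B.dual E) :=
  NatIso.ofComponents (fun x =>
    (LinearEquiv.toModuleIso ((E.mapIso (eqToIso (by rw [map_neg]) :
      (⟨x.cone, -δ.hom _ x.deg⟩ : B.ShIdx) ≅ ⟨x.cone, δ.hom _ (-x.deg)⟩)).toLinearEquiv.dualMap)))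
    fun {x y} f => ModuleCat.hom_ext <|
      LinearMap.ext fun (φ : Module.Dual ℂ (E.obj ⟨x.cone, δ.hom _ (-x.deg)⟩)) =>
      LinearMap.ext fun v => by
      exact congrArg φ (map_map_eq E _ _ _ _ v)

theorem dual_tcf [A.IsFinGen] [B.IsFinGen] [B.HasLength] {F : A.Sheaf} (hF : A.fg F) :
    δ.tcf (A.dual F) := by
  let e₁ : A.dual (δ.restrictSh.obj (δ.extendSh.obj F)) ≅ A.dual F := A.dualIso (δ.unitIsoSh F)
  let e₂ : A.dual (δ.restrictSh.obj (δ.extendSh.obj F)) ≅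
      δ.restrictCosh.obj (B.dual (δ.extendSh.obj F)) := δ.dualRestrictIso _
  let e₃ : δ.extendCosh.obj (A.dual F) ≅ B.dual (δ.extendSh.obj F) :=
    δ.extendCosh.mapIso (e₁.symm ≪≫ e₂) ≪≫ asIso (δ.adjCosh.counit.app _)
  exact B.tcf.prop_of_iso e₃.symm (B.dual_tcf ((δ.fg_extendSh_iff F).2 hF))

end Quot

end MonoidSheaf

/-! ### The Koszul functor on derived categories -/

namespace MonoidSheaf

universe w w'

variable {I : Type} [PartialOrder I] [Fintype I]

/-- The functor `K` between the bounded derived categories is computed by the cellular complexes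
of the diagrams `σ ↦ 𝒜_{[σ]}^∨ ⊗ P_σ`: on bounded complexes of projective objects, it is given by
the total complexes of these cellular complexes. -/
def IsKoszul (D : MonoidSheaf I) [D.IsFinGen] (c : CellData I) (Q : ObjectProperty D.Cosheaf)
    [Q.IsSerreClass] [Q.IsClosedUnderFiniteProducts] [HasDerivedCategory.{w} D.fg.FullSubcategory]
    [HasDerivedCategory.{w'} Q.FullSubcategory]
    (K : Db D.fg.FullSubcategory ⥤ Db Q.FullSubcategory) : Prop :=
  ∃ T : (boundedProj D.fg.FullSubcategory).FullSubcategory ⥤ CochainComplex Q.FullSubcategory ℤ,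
    Nonempty (T ⋙ Q.ι.mapHomologicalComplex (.up ℤ) ≅
      (boundedProj D.fg.FullSubcategory).ι ⋙ D.fg.ι.mapHomologicalComplex (.up ℤ) ⋙
        D.koszulTotal c) ∧
    Nonempty (Db.ofProj D.fg.FullSubcategory ⋙ K ⋙ Db.ι Q.FullSubcategory ≅
      T ⋙ DerivedCategory.Q)

end MonoidSheaf

/-! ### Smooth fans -/

open scoped TensorProduct

/-- The convex cone in `N_ℝ` spanned by a set of lattice vectors. -/
def spanCone {N : Type} [AddCommGroup N] (S : Set N) : PointedCone ℝ (ℝ ⊗[ℤ] N) :=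
  PointedCone.hull ℝ ((fun v : N => (1 : ℝ) ⊗ₜ[ℤ] v) '' S)

/-- A smooth fan in the lattice `N`, that is, the fan of a smooth toric variety: a nonempty finite
collection of cones, each of which is spanned by a part of a basis of the lattice, with the faces
of the cones in the collection, and such that any two of the cones meet in a common face.
A cone is represented by the set of the primitive lattice vectors on its rays, which are the
elements of the basis that span it; the faces of the cone correspond to the subsets. -/
structure SmoothFan (N : Type) [AddCommGroup N] where
  cones : Finset (Finset N)
  nonempty : cones.Nonempty
  smooth : ∀ S ∈ cones, ∃ (ι : Type) (b : Module.Basis ι ℤ N), (S : Set N) ⊆ Set.range b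
  faces : ∀ S ∈ cones, ∀ T ⊆ S, T ∈ cones
  inter : ∀ S ∈ cones, ∀ T ∈ cones,
    spanCone (S : Set N) ⊓ spanCone (T : Set N) = spanCone ((S : Set N) ∩ (T : Set N))

namespace SmoothFan

variable {N : Type} [AddCommGroup N] (Δ : SmoothFan N)

/-- The cones of the fan, ordered by inclusion. -/
abbrev Cone : Type := {S : Finset N // S ∈ Δ.cones}

/-- The dimension of a cone. -/
def dim (σ : Δ.Cone) : ℕ := σ.1.card

variable {Δ}

/-- The subgroup `M ∩ σ^⊥` of the group of characters `M`. -/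
def perp (σ : Δ.Cone) : AddSubgroup (N →ₗ[ℤ] ℤ) where
  carrier := {m | ∀ v ∈ σ.1, m v = 0}
  zero_mem' := by simp
  add_mem' := fun ha hb v hv => by simp [ha v hv, hb v hv]
  neg_mem' := fun ha v hv => by simp [ha v hv]

/-- The semigroup `M ∩ σ^∨` of the characters that are nonnegative on `σ`. -/
def dualCone (σ : Δ.Cone) : AddSubmonoid (N →ₗ[ℤ] ℤ) where
  carrier := {m | ∀ v ∈ σ.1, 0 ≤ m v}
  zero_mem' := by simp
  add_mem' := fun ha hb v hv => by simpa using add_nonneg (ha v hv) (hb v hv)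

theorem perp_le {σ τ : Δ.Cone} (h : τ ≤ σ) : perp σ ≤ perp τ := fun _ hm v hv => hm v (h hv)

/-- The semigroup of the characters of the torus of the affine toric variety of `σ` that are
regular at its fixed point, in the group `M_σ = M / (M ∩ σ^⊥)` of all the characters: the image of
`M ∩ σ^∨`. -/
def posChar (σ : Δ.Cone) : AddSubmonoid ((N →ₗ[ℤ] ℤ) ⧸ perp σ) :=
  (dualCone σ).map (QuotientAddGroup.mk' (perp σ))

theorem mk_mem_posChar (σ : Δ.Cone) (m : N →ₗ[ℤ] ℤ) :
    QuotientAddGroup.mk' (perp σ) m ∈ posChar σ ↔ m ∈ dualCone σ := by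
  refine ⟨?_, fun h => ⟨m, h, rfl⟩⟩
  rintro ⟨m', hm', e⟩ v hv
  have h : -m' + m ∈ perp σ := QuotientAddGroup.eq.1 e
  have h1 : (-m' + m) v = 0 := h v hv
  have h2 : 0 ≤ m' v := hm' v hv
  simp only [LinearMap.add_apply, LinearMap.neg_apply] at h1
  omega

variable (Δ)

/-- The sheaf of algebras `𝒜` on the fan: its stalk at `σ` is the `M`-graded algebra
`ℂ[M ∩ σ^∨]` of functions on the affine chart of the toric variety. -/
def A : MonoidSheaf Δ.Cone where
  wt _ := N →ₗ[ℤ] ℤ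
  res _ := AddMonoidHom.id _
  res_refl _ _ := rfl
  res_res _ _ _ _ := rfl
  mon σ := dualCone σ
  res_mem h _ hm v hv := hm v (h hv)

/-- The sheaf of algebras `ℬ` on the fan: its stalk at `σ` is the `M_σ`-graded algebra `ℂ[M_σ^+]`,
where `M_σ = M / (M ∩ σ^⊥)` and `M_σ^+` is the image of `M ∩ σ^∨` in `M_σ`. -/
def B : MonoidSheaf Δ.Cone where
  wt σ := (N →ₗ[ℤ] ℤ) ⧸ perp σ
  res {σ τ} h := QuotientAddGroup.map (perp σ) (perp τ) (AddMonoidHom.id _) (perp_le h)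
  res_refl {σ} _ m := by
    obtain ⟨m, rfl⟩ := QuotientAddGroup.mk'_surjective (perp σ) m
    rfl
  res_res {σ _ _} _ _ _ m := by
    obtain ⟨m, rfl⟩ := QuotientAddGroup.mk'_surjective (perp σ) m
    rfl
  mon σ := posChar σ
  res_mem {σ τ} h m hm := by
    obtain ⟨m, hm, rfl⟩ := hm
    exact ⟨m, fun v hv => hm v (h hv), rfl⟩

/-- The surjection of sheaves of algebras from `𝒜` to `ℬ`. -/
def δ : Δ.A.Quot Δ.B where
  hom σ := QuotientAddGroup.mk' (perp σ)
  surj σ := QuotientAddGroup.mk'_surjective (perp σ)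
  res_hom _ _ := rfl
  mem_iff := mk_mem_posChar

theorem dualCone_fg [Module.Finite ℤ N] (σ : Δ.Cone) : (dualCone σ).FG := by
  obtain ⟨ι, b, hb⟩ := Δ.smooth σ.1 σ.2
  have : Finite ι := Module.Finite.finite_basis b
  have := Fintype.ofFinite ι
  let s : Set (N →ₗ[ℤ] ℤ) := Set.range b.coord ∪
    {m | ∃ i, b i ∉ σ.1 ∧ m = -b.coord i}
  have hs : s.Finite := (Set.finite_range _).union
    ((Set.finite_range fun i => -b.coord i).subset fun m ⟨i, _, e⟩ => ⟨i, e.symm⟩)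
  refine AddSubmonoid.fg_iff _ |>.2 ⟨s, le_antisymm ?_ ?_, hs⟩
  · rw [AddSubmonoid.closure_le]
    rintro m (⟨i, rfl⟩ | ⟨i, hi, rfl⟩) v hv
    · obtain ⟨j, rfl⟩ := hb hv
      by_cases h : j = i <;> simp [h]
    · obtain ⟨j, rfl⟩ := hb hv
      have h : j ≠ i := fun h => hi (h ▸ hv)
      simp [h]
  · intro m hm
    have e : m = ∑ i, m (b i) • b.coord i := b.ext fun j => by
      simp
    rw [e]
    refine sum_mem fun i _ => ?_
    by_cases hi : b i ∈ σ.1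
    · obtain ⟨n, hn⟩ := Int.eq_ofNat_of_zero_le (hm _ hi)
      rw [hn, natCast_zsmul]
      exact AddSubmonoid.nsmul_mem (AddSubmonoid.closure s) (AddSubmonoid.subset_closure (Or.inl ⟨i, rfl⟩)) n
    · obtain ⟨n, hn | hn⟩ := (m (b i)).eq_nat_or_neg
      · rw [hn, natCast_zsmul]
        exact AddSubmonoid.nsmul_mem (AddSubmonoid.closure s) (AddSubmonoid.subset_closure (Or.inl ⟨i, rfl⟩)) n
      · rw [hn, neg_zsmul, natCast_zsmul, ← smul_neg]
        exact AddSubmonoid.nsmul_mem (AddSubmonoid.closure s) (AddSubmonoid.subset_closure (Or.inr ⟨i, hi, rfl⟩)) n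

instance [Module.Finite ℤ N] : Δ.A.IsFinGen := ⟨Δ.dualCone_fg⟩

instance [Module.Finite ℤ N] : Δ.B.IsFinGen := ⟨fun σ => (Δ.dualCone_fg σ).map _⟩

instance : Δ.B.HasLength where
  exists_length σ := by
    let l : (N →ₗ[ℤ] ℤ) →+ ℤ :=
      { toFun := fun m => ∑ v ∈ σ.1, m v
        map_zero' := by simp
        map_add' := fun m m' => by simp [Finset.sum_add_distrib] }
    refine ⟨QuotientAddGroup.lift (perp σ) l fun m hm => Finset.sum_eq_zero hm, ?_⟩
    rintro _ ⟨m, hm, rfl⟩ h0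
    change 0 < ∑ v ∈ σ.1, m v
    by_contra h
    have hz : ∑ v ∈ σ.1, m v = 0 := le_antisymm (not_lt.1 h) (Finset.sum_nonneg hm)
    exact h0 ((QuotientAddGroup.eq_zero_iff m).2 ((Finset.sum_eq_zero_iff_of_nonneg hm).1 hz))

/-- Orientations of the cones of the fan. They are given by signs, with respect to the orientations
for which the spanning vectors form a positive basis when they are listed according to a fixed
well-ordering of `N`. -/
abbrev Orientation : Type := Δ.Cone → ℤˣ

/-- The sign for a facet `T` of `S` with the orientations given by the well-ordering: it is
`(-1) ^ k` where `k` is the number of the elements of `T` that precede the element of `S \ T`. -/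
def sign (S T : Finset N) : ℤ :=
  ∏ w ∈ S \ T, (-1) ^ (T.filter fun v => WellOrderingRel v w).card

variable {Δ}

theorem sign_insert {S : Finset N} {a : N} (ha : a ∉ S) :
    sign (insert a S) S = (-1) ^ (S.filter fun v => WellOrderingRel v a).card := by
  have : insert a S \ S = {a} := by
    ext x
    simp only [Finset.mem_sdiff, Finset.mem_insert, Finset.mem_singleton]
    constructor
    · tauto
    · rintro rfl; tauto
  rw [sign, this, Finset.prod_singleton]

theorem sign_mul_sign {S : Finset N} {a b : N} (ha : a ∉ S) (hb : b ∉ S) (hab : a ≠ b) :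
    sign (insert a (insert b S)) (insert b S) * sign (insert b S) S +
      sign (insert b (insert a S)) (insert a S) * sign (insert a S) S = 0 := by
  rw [sign_insert ha, sign_insert hb, sign_insert (by simp [ha, hab]),
    sign_insert (by simp [hb, hab.symm]), Finset.filter_insert, Finset.filter_insert]
  rcases trichotomous_of (WellOrderingRel (α := N)) a b with h | h | h
  · rw [if_neg (asymm h), if_pos h, Finset.card_insert_of_notMem (by simp [ha])]
    ring
  · exact absurd h hab
  · rw [if_pos h, if_neg (asymm h), Finset.card_insert_of_notMem (by simp [hb])]
    ring

variable (Δ)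

/-- The dimensions and the incidence numbers of oriented cones: the incidence number of a cone and
of a facet is `1` or `-1` depending on whether their orientations agree or not. -/
def cellData (ε : Δ.Orientation) : CellData Δ.Cone where
  dim := Δ.dim
  inc σ τ := if τ ≤ σ ∧ Δ.dim σ = Δ.dim τ + 1 then ε σ * ε τ * sign σ.1 τ.1 else 0
  le_of_inc h := by
    by_contra h'
    exact h (if_neg fun h'' => h' h''.1)
  dim_of_inc h := by
    by_contra h'
    exact h (if_neg fun h'' => h' h''.2)
  inc_inc σ ξ := by
    by_cases h : ξ ≤ σ ∧ Δ.dim σ = Δ.dim ξ + 2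
    swap
    · refine Finset.sum_eq_zero fun τ _ => ?_
      by_cases h₁ : τ ≤ σ ∧ Δ.dim σ = Δ.dim τ + 1
      · by_cases h₂ : ξ ≤ τ ∧ Δ.dim τ = Δ.dim ξ + 1
        · exact absurd ⟨h₂.1.trans h₁.1, by omega⟩ h
        · rw [if_neg h₂, mul_zero]
      · rw [if_neg h₁, zero_mul]
    obtain ⟨hξ, hd⟩ := h
    have hc : (σ.1 \ ξ.1).card = 2 := by
      have := Finset.card_sdiff_add_card_eq_card hξ
      have hd' : σ.1.card = ξ.1.card + 2 := hd
      omega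
    obtain ⟨a, b, hab, e⟩ := Finset.card_eq_two.1 hc
    have ha : a ∈ σ.1 \ ξ.1 := by rw [e]; simp
    have hb : b ∈ σ.1 \ ξ.1 := by rw [e]; simp
    rw [Finset.mem_sdiff] at ha hb
    have eσ : σ.1 = insert a (insert b ξ.1) := by
      rw [← Finset.sdiff_union_of_subset hξ, e, Finset.insert_union, Finset.singleton_union]
    have ea : insert a ξ.1 ⊆ σ.1 := by rw [eσ]; exact Finset.insert_subset_insert _ (by simp)
    have eb : insert b ξ.1 ⊆ σ.1 := by rw [eσ]; simp
    let τa : Δ.Cone := ⟨insert a ξ.1, Δ.faces _ σ.2 _ ea⟩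
    let τb : Δ.Cone := ⟨insert b ξ.1, Δ.faces _ σ.2 _ eb⟩
    have da : Δ.dim τa = Δ.dim ξ + 1 := Finset.card_insert_of_notMem ha.2
    have db : Δ.dim τb = Δ.dim ξ + 1 := Finset.card_insert_of_notMem hb.2
    have hne : τa ≠ τb := fun h => by
      have : a ∈ τb.1 := by rw [← h]; simp [τa]
      simp [τb, hab, ha.2] at this
    rw [Finset.sum_eq_add τa τb hne]
    · rw [if_pos ⟨ea, by omega⟩, if_pos ⟨Finset.subset_insert _ _, da⟩, if_pos ⟨eb, by omega⟩,
        if_pos ⟨Finset.subset_insert _ _, db⟩]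
      have key := sign_mul_sign ha.2 hb.2 hab
      rw [← eσ, Finset.insert_comm, ← eσ] at key
      have ua : (ε τa : ℤ) * ε τa = 1 := by
        rw [← Units.val_mul, Int.units_mul_self, Units.val_one]
      have ub : (ε τb : ℤ) * ε τb = 1 := by
        rw [← Units.val_mul, Int.units_mul_self, Units.val_one]
      change ε σ * ε τa * sign σ.1 (insert a ξ.1) * (ε τa * ε ξ * sign (insert a ξ.1) ξ.1) +
        ε σ * ε τb * sign σ.1 (insert b ξ.1) * (ε τb * ε ξ * sign (insert b ξ.1) ξ.1) = 0
      linear_combination (ε σ : ℤ) * ε ξ * key +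
        (ε σ : ℤ) * ε ξ * sign σ.1 (insert a ξ.1) * sign (insert a ξ.1) ξ.1 * ua +
        (ε σ : ℤ) * ε ξ * sign σ.1 (insert b ξ.1) * sign (insert b ξ.1) ξ.1 * ub
    · rintro τ - ⟨h₁, h₂⟩
      by_cases h₃ : ξ ≤ τ ∧ Δ.dim τ = Δ.dim ξ + 1
      swap
      · rw [if_neg h₃, mul_zero]
      by_cases h₄ : τ ≤ σ
      swap
      · rw [if_neg fun h => h₄ h.1, zero_mul]
      exfalso
      have hc : (τ.1 \ ξ.1).card = 1 := by
        have := Finset.card_sdiff_add_card_eq_card h₃.1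
        have hd' : τ.1.card = ξ.1.card + 1 := h₃.2
        omega
      obtain ⟨x, hx⟩ := Finset.card_eq_one.1 hc
      have eτ : τ.1 = insert x ξ.1 := by
        rw [← Finset.sdiff_union_of_subset h₃.1, hx]
        rfl
      have hxσ : x ∈ σ.1 \ ξ.1 := by
        have : x ∈ τ.1 \ ξ.1 := by rw [hx]; simp
        rw [Finset.mem_sdiff] at this ⊢
        exact ⟨h₄ this.1, this.2⟩
      rw [e, Finset.mem_insert, Finset.mem_singleton] at hxσ
      rcases hxσ with rfl | rfl
      · exact h₁ (Subtype.ext eτ)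
      · exact h₂ (Subtype.ext eτ)
    · simp
    · simp

variable [Module.Finite ℤ N]

/-- The category `𝒜-mod` of the sheaves of graded `𝒜`-modules with finitely generated stalks. -/
abbrev AMod : Type 1 := Δ.A.fg.FullSubcategory

/-- The category `ℬ-mod` of the sheaves of graded `ℬ`-modules with finitely generated stalks. -/
abbrev BMod : Type 1 := Δ.B.fg.FullSubcategory

/-- The category `co-𝒜-tcf` of the cosheaves of graded `𝒜`-modules with torsion co-finite stalks,
that is, of those whose extension of scalars to `ℬ` has torsion co-finite stalks. -/
abbrev CoATcf : Type 1 := Δ.δ.tcf.FullSubcategory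

/-- The category `co-ℬ-tcf` of the cosheaves of graded `ℬ`-modules with torsion co-finite stalks. -/
abbrev CoBTcf : Type 1 := Δ.B.tcf.FullSubcategory

/-- `𝒜_{[σ]}`, as an object of `𝒜-mod`. -/
def openA (σ : Δ.Cone) : Δ.AMod := Δ.A.openStar σ

/-- `𝒜_{{σ}}`, as an object of `𝒜-mod`. -/
def pointA (σ : Δ.Cone) : Δ.AMod := Δ.A.point σ

/-- `ℬ_{[σ]}`, as an object of `ℬ-mod`. -/
def openB (σ : Δ.Cone) : Δ.BMod := Δ.B.openStar σ

/-- `ℬ_{{σ}}`, as an object of `ℬ-mod`. -/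
def pointB (σ : Δ.Cone) : Δ.BMod := Δ.B.point σ

/-- The graded dual of an object of `𝒜-mod`, as an object of `co-𝒜-tcf`. -/
def dualA (F : Δ.AMod) : Δ.CoATcf := ⟨Δ.A.dual F.obj, Δ.δ.dual_tcf F.property⟩

/-- The graded dual of an object of `ℬ-mod`, as an object of `co-ℬ-tcf`. -/
def dualB (F : Δ.BMod) : Δ.CoBTcf := ⟨Δ.B.dual F.obj, Δ.B.dual_tcf F.property⟩

end SmoothFan

end ToricKoszul

end

open CategoryTheory ToricKoszul

universe w₁ w₂ w₃ w₄

/-! Reduction to `ℬ`. The semigroup `M ∩ σ^∨` is the full preimage of `M_σ^+`, so weights of `M`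
that differ by an element of `M ∩ σ^⊥` are joined by an invertible monomial of `𝒜_σ`. The preorders
that index the homogeneous components for `𝒜` and for `ℬ` are therefore equivalent, and `δ^*` is an
equivalence for sheaves and for cosheaves. `K_A` is `K_B` conjugated by these equivalences
(`exists_transport`), so the square commutes by construction. The cellular description passes to `𝒜`
because tensor products with the kernels, cellular complexes and total complexes commute with
restriction of scalars (`koszulTotalIso`, `isKoszul_of_iso`).

Generators. A sheaf of `ℬ`-modules is a functor on a preorder of pairs (cone, weight). By smoothness
a weight of `M_σ` is an arbitrary tuple of integers indexed by the rays of `σ`. The linearized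
representable functors `free x` are the shifts of the `ℬ_{[σ]}`, and they are projective.
Inclusion-exclusion over faces produces the point sheaves from them (`shInd_of_free`), and
multiplication by variables produces the quotients of point sheaves by prime monomial ideals
(`shInd_of_point`). Every nonzero sheaf contains such a quotient (`exists_mono_ind`, the analogue of
an associated prime). Noetherian induction (`closedUnder_eq_top`) then shows that the free sheaves
generate `D^b(ℬ-mod)`. Graded duality, which is reflexive because the components are finite
dimensional, shows in the same way that the duals of point sheaves generate `D^b(co-ℬ-tcf)`.

The functor. As the free sheaves generate, every object of `D^b(ℬ-mod)` is represented by a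
K-projective complex, unique up to homotopy. The total complex of the cellular complexes preserves
homotopies and degreewise split triangles, hence gives a triangulated functor `K_B`
(`exists_derived`), described on bounded complexes of projectives as required.

The computation. The cellular complex of `free x` has the cofree, hence injective, cosheaves
`ℬ_{[τ]}^∨` (shifted), `τ ≤ x.cone`, as its summands. Its component at an index `q` involves only
the cones between `q.cone` and `x.cone`, which form a Boolean lattice, with constant coefficients.
It is contractible unless the two cones coincide (`exists_contraction`). So this complex is an
injective resolution of the dual of a point sheaf, placed in degree `-dim` (`pointResolution`).

The equivalence. Morphisms from `free x` to shifts of `free x'` are scalars or zero, and only in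
degree `0`. The same holds for morphisms from the dual point of `x` to the resolution attached to
`x'`, since only the summand at `x.cone` receives any. `K_B` matches the scalars
(`point_hom_bijective`), so it is fully faithful by dévissage. Its image contains the duals of point
sheaves, so it is an equivalence. The value on a point sheaf is found backwards: the preimage of a
shifted cofree cosheaf is tested against all shifts of free sheaves, which puts it in the heart and
identifies it with the point sheaf (`nonempty_koszul_shInd`). -/

noncomputable section

open CategoryTheory CategoryTheory.Limits
open scoped DirectSum Classical ZeroObject

set_option linter.unusedSectionVars false

namespace ToricKoszul

/-! ### Triangulated functors that are fully faithful on generators -/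

section Devissage

open Pretriangulated

variable {T S : Type*} [Category* T] [Category* S] [Preadditive T] [Preadditive S]
  [HasZeroObject T] [HasZeroObject S] [HasShift T ℤ] [HasShift S ℤ]
  [∀ n : ℤ, (shiftFunctor T n).Additive] [∀ n : ℤ, (shiftFunctor S n).Additive]
  [Pretriangulated T] [Pretriangulated S]

/-- A class of objects generates a triangulated category if every strictly full triangulated
subcategory that contains it is the whole category. -/
def Generates (G : ObjectProperty T) : Prop :=
  ∀ W : ObjectProperty T, W.IsTriangulated → W.IsClosedUnderIsomorphisms → G ≤ W → ∀ X, W X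

variable (F : T ⥤ S) [F.CommShift ℤ] [F.IsTriangulated]

/-- `F` is bijective on the morphisms from `X` to `Y`. -/
def HomBij (X Y : T) : Prop := Function.Bijective (F.map : (X ⟶ Y) → (F.obj X ⟶ F.obj Y))

variable {F}

theorem HomBij.of_iso {X X' Y Y' : T} (h : HomBij F X Y) (e : X ≅ X') (e' : Y ≅ Y') :
    HomBij F X' Y' := by
  have : (F.map : (X' ⟶ Y') → _) =
      (Iso.homCongr (F.mapIso e) (F.mapIso e')) ∘ F.map ∘ (Iso.homCongr e e').symm := by
    funext f
    simp [Iso.homCongr]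
  unfold HomBij
  rw [this]
  exact (Equiv.bijective _).comp (h.comp (Equiv.bijective _))

theorem HomBij.eq_zero {X Y : T} (h : HomBij F X Y) {f : X ⟶ Y} (hf : F.map f = 0) : f = 0 :=
  h.1 (hf.trans (F.map_zero _ _).symm)

/-- Five lemma for the long exact sequences of `Hom(X, -)` and `Hom(F X, -)` at the objects
`D₃[-1]`, `D₁`, `D₂`, `D₃`, `D₁[1]`. The first of these is the first vertex of the inverse rotation.
-/
theorem homBij_of_distinguished_right {X : T} {D : Triangle T} (hD : D ∈ distTriang T)
    (h₀ : HomBij F X D.invRotate.obj₁) (h₁ : HomBij F X D.obj₁) (h₃ : HomBij F X D.obj₃)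
    (h₄ : HomBij F X (D.obj₁⟦(1 : ℤ)⟧)) : HomBij F X D.obj₂ := by
  have hD' := F.map_distinguished _ hD
  have hI := inv_rot_of_distTriang _ hD
  have hI' := F.map_distinguished _ hI
  constructor
  · refine (injective_iff_map_eq_zero (F.mapAddHom (X := X) (Y := D.obj₂))).2 ?_
    intro f hf
    change F.map f = 0 at hf
    have h : f ≫ D.mor₂ = 0 := h₃.eq_zero (by rw [F.map_comp, hf, zero_comp])
    obtain ⟨g, rfl⟩ := D.coyoneda_exact₂ hD f h
    obtain ⟨k, hk⟩ := Triangle.coyoneda_exact₂ _ hI' (F.map g) (by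
      change F.map g ≫ F.map D.mor₁ = 0
      rw [← F.map_comp, hf])
    obtain ⟨k, rfl⟩ := h₀.2 k
    let i : D.invRotate.obj₁ ⟶ D.obj₁ := D.invRotate.mor₁
    have hi : i ≫ D.mor₁ = 0 := comp_distTriang_mor_zero₁₂ _ hI
    have : g = k ≫ i := h₁.1 (hk.trans (F.map_comp _ _).symm)
    rw [this, Category.assoc, hi, comp_zero]
  · intro φ
    obtain ⟨b, hb⟩ := h₃.2 (φ ≫ F.map D.mor₂)
    have h : b ≫ D.mor₃ = 0 := h₄.eq_zero (by
      rw [F.map_comp, hb, Category.assoc, ← F.map_comp, comp_distTriang_mor_zero₂₃ _ hD,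
        F.map_zero, comp_zero])
    obtain ⟨a, rfl⟩ := D.coyoneda_exact₃ hD b h
    obtain ⟨c, hc⟩ := Triangle.coyoneda_exact₂ _ hD' (φ - F.map a) (by
      change (φ - F.map a) ≫ F.map D.mor₂ = 0
      rw [Preadditive.sub_comp, ← hb, F.map_comp, sub_self])
    obtain ⟨c, rfl⟩ := h₁.2 c
    refine ⟨a + c ≫ D.mor₁, ?_⟩
    rw [F.map_add, F.map_comp]
    exact (congrArg (F.map a + ·) hc).symm.trans (by abel)

/-- The contravariant five lemma, with the same four neighbours of `D₂` read in the opposite order.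
-/
theorem homBij_of_distinguished_left {Y : T} {D : Triangle T} (hD : D ∈ distTriang T)
    (h₀ : HomBij F D.invRotate.obj₁ Y) (h₁ : HomBij F D.obj₁ Y) (h₃ : HomBij F D.obj₃ Y)
    (h₄ : HomBij F (D.obj₁⟦(1 : ℤ)⟧) Y) : HomBij F D.obj₂ Y := by
  have hD' := F.map_distinguished _ hD
  have hR := rot_of_distTriang _ hD
  have hR' := F.map_distinguished _ hR
  have hI := inv_rot_of_distTriang _ hD
  constructor
  · refine (injective_iff_map_eq_zero (F.mapAddHom (X := D.obj₂) (Y := Y))).2 ?_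
    intro f hf
    change F.map f = 0 at hf
    have h : D.mor₁ ≫ f = 0 := h₁.eq_zero (by rw [F.map_comp, hf, comp_zero])
    obtain ⟨g, rfl⟩ := D.yoneda_exact₂ hD f h
    obtain ⟨k, hk⟩ := Triangle.yoneda_exact₂ _ hR' (F.map g) (by
      change F.map D.mor₂ ≫ F.map g = 0
      rw [← F.map_comp, hf])
    obtain ⟨k, rfl⟩ := h₄.2 k
    have : g = D.mor₃ ≫ k := h₃.1 (hk.trans (F.map_comp _ _).symm)
    rw [this, ← Category.assoc, comp_distTriang_mor_zero₂₃ _ hD, zero_comp]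
  · intro φ
    obtain ⟨b, hb⟩ := h₁.2 (F.map D.mor₁ ≫ φ)
    let i : D.invRotate.obj₁ ⟶ D.obj₁ := D.invRotate.mor₁
    have hi : i ≫ D.mor₁ = 0 := comp_distTriang_mor_zero₁₂ _ hI
    have h : i ≫ b = 0 := h₀.eq_zero (by
      rw [F.map_comp, hb, ← Category.assoc, ← F.map_comp, hi, F.map_zero, zero_comp])
    obtain ⟨(a : D.obj₂ ⟶ Y), (rfl : b = D.mor₁ ≫ a)⟩ := Triangle.yoneda_exact₂ _ hI b h
    obtain ⟨c, hc⟩ := Triangle.yoneda_exact₂ _ hD' (φ - F.map a) (by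
      change F.map D.mor₁ ≫ (φ - F.map a) = 0
      rw [Preadditive.comp_sub, ← hb, ← F.map_comp, sub_self])
    obtain ⟨c, rfl⟩ := h₃.2 c
    refine ⟨a + D.mor₂ ≫ c, ?_⟩
    rw [F.map_add, F.map_comp]
    exact (congrArg (F.map a + ·) hc).symm.trans (by abel)

/-- The shift of a morphism set in both variables. -/
theorem HomBij.shift {X Y : T} (h : HomBij F X Y) (n : ℤ) : HomBij F (X⟦n⟧) (Y⟦n⟧) := by
  have key : ∀ f : X ⟶ Y, F.map (f⟦n⟧') =
      (F.commShiftIso n).hom.app X ≫ (F.map f)⟦n⟧' ≫ (F.commShiftIso n).inv.app Y := fun f => by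
    have := (F.commShiftIso n).hom.naturality f
    simp only [Functor.comp_map] at this
    rw [← Category.assoc, ← this]
    simp
  constructor
  · intro f g hfg
    obtain ⟨f, rfl⟩ := (shiftFunctor T n).map_surjective f
    obtain ⟨g, rfl⟩ := (shiftFunctor T n).map_surjective g
    rw [key, key] at hfg
    have := (cancel_epi _).1 hfg
    have := (cancel_mono _).1 this
    rw [h.1 ((shiftFunctor S n).map_injective this)]
  · intro φ
    obtain ⟨ψ, hψ⟩ := (shiftFunctor S n).map_surjective
      ((F.commShiftIso n).inv.app X ≫ φ ≫ (F.commShiftIso n).hom.app Y)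
    obtain ⟨f, rfl⟩ := h.2 ψ
    refine ⟨f⟦n⟧', ?_⟩
    rw [key, hψ]
    simp

/-- A triangulated functor is fully faithful if it is so on the shifts of generators. -/
theorem homBij_of_generates {G : ObjectProperty T} (hG : Generates G)
    (h : ∀ X Y, G X → G Y → ∀ n : ℤ, HomBij F X (Y⟦n⟧)) (X Y : T) : HomBij F X Y := by
  -- Dévissage one variable at a time: here the source is a generator and the target varies.
  -- Quantifying over all shifts `n` makes the class of targets stable under shift and supplies the
  -- outer terms of the five lemma.
  have step : ∀ X, G X → ∀ Y, ∀ n : ℤ, HomBij F X (Y⟦n⟧) := by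
    intro X hX
    let W : ObjectProperty T := fun Y => ∀ n : ℤ, HomBij F X (Y⟦n⟧)
    have hiso : W.IsClosedUnderIsomorphisms := ⟨fun e hY n =>
      (hY n).of_iso (Iso.refl _) ((shiftFunctor T n).mapIso e)⟩
    have hz : W.ContainsZero := ⟨0, isZero_zero T, fun n => by
      have h0 : IsZero ((0 : T)⟦n⟧) := (shiftFunctor T n).map_isZero (isZero_zero T)
      exact ⟨fun _ _ _ => h0.eq_of_tgt _ _, fun _ => ⟨0, (F.map_isZero h0).eq_of_tgt _ _⟩⟩⟩
    have hs : W.IsStableUnderShift ℤ := ⟨fun a => ⟨fun Y hY n =>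
      (hY (a + n)).of_iso (Iso.refl _) ((shiftFunctorAdd T a n).app Y)⟩⟩
    have h2 : W.IsTriangulatedClosed₂ := .mk' fun D hD h₁ h₃ n => by
      have hDn := Triangle.shift_distinguished D hD n
      exact homBij_of_distinguished_right hDn
        ((h₃ (n + -1)).of_iso (Iso.refl _) ((shiftFunctorAdd T n (-1)).app D.obj₃)) (h₁ n) (h₃ n)
        ((h₁ (n + 1)).of_iso (Iso.refl _) ((shiftFunctorAdd T n 1).app D.obj₁))
    exact hG W { } hiso fun Y hY => h X Y hX hY
  -- Second dévissage, in the source. The target is now arbitrary, so a shift of the source can be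
  -- moved to the target.
  let W : ObjectProperty T := fun X => ∀ Y, HomBij F X Y
  have hiso : W.IsClosedUnderIsomorphisms := ⟨fun e hX Y => (hX Y).of_iso e (Iso.refl _)⟩
  have hz : W.ContainsZero := ⟨0, isZero_zero T, fun Y => 
    ⟨fun _ _ _ => (isZero_zero T).eq_of_src _ _,
      fun _ => ⟨0, (F.map_isZero (isZero_zero T)).eq_of_src _ _⟩⟩⟩
  have hs : W.IsStableUnderShift ℤ := ⟨fun a => ⟨fun X hX Y =>
    ((hX (Y⟦-a⟧)).shift a).of_iso (Iso.refl _) ((shiftFunctorCompIsoId T (-a) a (by lia)).app Y)⟩⟩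
  have h2 : W.IsTriangulatedClosed₂ := .mk' fun D hD h₁ h₃ Y =>
    homBij_of_distinguished_left hD (W.le_shift (-1 : ℤ) _ h₃ Y) (h₁ Y) (h₃ Y)
      (W.le_shift (1 : ℤ) _ h₁ Y)
  exact hG W { } hiso (fun X hX Y => (step X hX Y 0).of_iso (Iso.refl _)
    ((shiftFunctorZero T ℤ).app Y)) X Y

/-- Once `F` is fully faithful its essential image is a triangulated subcategory, hence everything
as soon as it contains generators of the target. -/
theorem isEquivalence_of_generates {G : ObjectProperty T} (hG : Generates G)
    (h : ∀ X Y, G X → G Y → ∀ n : ℤ, HomBij F X (Y⟦n⟧)) {G' : ObjectProperty S}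
    (hG' : Generates G') (h' : G' ≤ F.essImage) : F.IsEquivalence := by
  have hb := homBij_of_generates hG h
  have : F.Full := ⟨fun f => (hb _ _).2 f⟩
  have : F.Faithful := ⟨fun h => (hb _ _).1 h⟩
  have : F.EssSurj := ⟨fun Y => hG' F.essImage inferInstance inferInstance h' Y⟩
  exact { }

end Devissage

/-! ### Generation of the bounded derived category -/

section Bounded

open Pretriangulated DerivedCategory.TStructure

universe w v u

variable {C : Type u} [Category.{v} C] [Abelian C] [HasDerivedCategory.{w} C]

/-- A class of objects of an abelian category generates its bounded derived category if it
contains all objects up to short exact sequences. -/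
theorem Db.prop_of_single (W : ObjectProperty (Db C)) [W.IsTriangulated]
    [W.IsClosedUnderIsomorphisms] (h : ∀ X, W ((Db.single C).obj X)) (X : Db C) : W X := by
  have hn : ∀ (n : ℤ) (X : Db C), X.obj.IsGE n → X.obj.IsLE n → W X := by
    intro n X _ _
    obtain ⟨Y, ⟨e⟩⟩ := X.obj.exists_iso_singleFunctor_obj_of_isGE_of_isLE n
    let e' : X ≅ ((Db.single C).obj Y)⟦-n⟧ := (t (C := C)).bounded.isoMk (e ≪≫
      (((DerivedCategory.singleFunctors C).shiftIso (-n) n 0 (by lia)).symm.app Y) ≪≫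
        ((Db.ι C).commShiftIso (-n)).symm.app ((Db.single C).obj Y))
    exact W.prop_of_iso e'.symm (W.le_shift _ _ (h Y))
  -- Induction on the cohomological amplitude: truncating at `n + k` splits off the top cohomology
  -- object, to which the case of amplitude `0` applies.
  have key : ∀ (k : ℕ) (n : ℤ) (X : Db C), X.obj.IsGE n → X.obj.IsLE (n + k) → W X := by
    intro k
    induction k with
    | zero => intro n X h₁ h₂; exact hn n X h₁ (by simpa using h₂)
    | succ k ih =>
      intro n X h₁ h₂
      have hA : (t (C := C)).bounded (((t (C := C)).truncLE (n + k)).obj X.obj) :=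
        ⟨⟨n, inferInstance⟩, ⟨n + k, inferInstance⟩⟩
      let A : Db C := ⟨_, hA⟩
      let f : A ⟶ X := ObjectProperty.homMk (((t (C := C)).truncLEι (n + k)).app X.obj)
      obtain ⟨Z, g, h, hD⟩ := distinguished_cocone_triangle f
      have hD' := (Db.ι C).map_distinguished _ hD
      -- The cone is taken inside the bounded category. Uniqueness of the third vertex identifies it
      -- afterwards with the truncation from above.
      let e := isoTriangleOfIso₁₂ _ _ hD' ((t (C := C)).triangleLEGE_distinguished (n + k)
        (n + k + 1) rfl X.obj) (Iso.refl _) (Iso.refl _)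
        ((Category.comp_id _).trans (Category.id_comp _).symm)
      let e₃ : Z.obj ≅ ((t (C := C)).truncGE (n + k + 1)).obj X.obj := Triangle.π₃.mapIso e
      have : (t (C := C)).IsLE X.obj (n + k + 1) := by
        have : n + (k + 1 : ℕ) = n + k + 1 := by push_cast; ring
        rwa [this] at h₂
      have hZ : W Z := hn (n + k + 1) Z ((t (C := C)).isGE_of_iso e₃.symm _)
        ((t (C := C)).isLE_of_iso e₃.symm _)
      exact W.ext_of_isTriangulatedClosed₂ _ hD (ih n A inferInstance inferInstance) hZ
  obtain ⟨⟨a, ha⟩, ⟨b, hb⟩⟩ := X.property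
  refine key (b - a).toNat a X ha ?_
  have : b ≤ a + (b - a).toNat := by lia
  exact (t (C := C)).isLE_of_le X.obj _ _ this

end Bounded

/-! ### The total complex of an additive functor with values in complexes -/

section Totalization

universe v v' u u'

variable {C : Type u} [Category.{v} C] [Abelian C] {E : Type u'} [Category.{v'} E] [Abelian E]
  [HasCoproducts.{0} E]

/-- The evaluation of additive functors, as a bifunctor. -/
def evalAdditive (C : Type u) [Category.{v} C] [Abelian C] (E : Type u') [Category.{v'} E]
    [Abelian E] : C ⥤ (C ⥤+ E) ⥤ E :=
  evaluation C E ⋙ (Functor.whiskeringLeft _ _ _).obj (AdditiveFunctor.forget C E)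

instance : (evalAdditive C E).Additive where
  map_add := by
    intros
    ext F
    exact F.obj.map_add

instance (X : C) : ((evalAdditive C E).obj X).Additive where
  map_add := rfl

instance {I₁ I₂ : Type} {c₁ : ComplexShape I₁} {c₂ : ComplexShape I₂} {J : Type}
    (c : ComplexShape J) [TotalComplexShape c₁ c₂ c] (K : HomologicalComplex₂ E c₁ c₂) :
    K.HasTotal c := fun _ => inferInstance

variable (k : C ⥤ CochainComplex E ℤ) [k.Additive]

/-- The components of an additive functor with values in complexes. -/
def evalComplex : CochainComplex (C ⥤+ E) ℤ where
  X j := AdditiveFunctor.of (k ⋙ HomologicalComplex.eval E (.up ℤ) j)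
  d i j := ObjectProperty.homMk
    { app := fun X => (k.obj X).d i j
      naturality := fun X Y f => (k.map f).comm i j }
  shape i j h := by
    ext X
    exact (k.obj X).shape i j h
  d_comp_d' i j l _ _ := by
    ext X
    exact (k.obj X).d_comp_d i j l

/-- The total complex of the bicomplex obtained by applying `k` to the terms of a complex. -/
def totalization : CochainComplex C ℤ ⥤ CochainComplex E ℤ :=
  (evalAdditive C E).map₂CochainComplex.flip.obj (evalComplex k)

instance : (totalization k).CommShift ℤ :=
  inferInstanceAs (((evalAdditive C E).map₂CochainComplex.flip.obj (evalComplex k)).CommShift ℤ)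

/-- Both bicomplexes have the terms `(k.obj (X.X p)).X q` and the same differentials, so identities
serve as components. The bifunctor form of the total complex is the one that carries the
compatibility with shifts. -/
def totalizationIso : totalization k ≅ k.mapHomologicalComplex (.up ℤ) ⋙
    HomologicalComplex₂.totalFunctor E (.up ℤ) (.up ℤ) (.up ℤ) :=
  NatIso.ofComponents (fun X => Iso.refl _) (fun {X Y} f => by
    refine (Category.comp_id _).trans (Eq.trans ?_ (Category.id_comp _).symm)
    refine congrArg (fun φ => HomologicalComplex₂.total.map φ _) ?_
    ext p q
    exact Category.comp_id ((k.map (f.f p)).f q))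

variable {k}

/-- The inclusions of the summands of the total complex. -/
def totalizationι (k : C ⥤ CochainComplex E ℤ) [k.Additive] (K : CochainComplex C ℤ) (p q n : ℤ)
    (h : p + q = n) : (k.obj (K.X p)).X q ⟶ ((totalization k).obj K).X n :=
  CochainComplex.ιMapBifunctor K (evalComplex k) (evalAdditive C E) p q n h

theorem totalization_hom_ext {K : CochainComplex C ℤ} {n : ℤ} {X : E}
    {f g : ((totalization k).obj K).X n ⟶ X}
    (h : ∀ p q h, totalizationι k K p q n h ≫ f = totalizationι k K p q n h ≫ g) : f = g :=
  HomologicalComplex.mapBifunctor.hom_ext (K₁ := K) (K₂ := evalComplex k) (F := evalAdditive C E) h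

/-- The map on the terms of the total complexes which is induced by maps of the terms. -/
def totalizationMap (k : C ⥤ CochainComplex E ℤ) [k.Additive] {K L : CochainComplex C ℤ}
    (f : ∀ p, K.X p ⟶ L.X p) (n : ℤ) :
    ((totalization k).obj K).X n ⟶ ((totalization k).obj L).X n :=
  HomologicalComplex₂.totalDesc _ fun p q h => (k.map (f p)).f q ≫ totalizationι k L p q n h

theorem totalizationι_map {K L : CochainComplex C ℤ}
    (f : ∀ p, K.X p ⟶ L.X p) (p q n : ℤ) (h : p + q = n) :
    totalizationι k K p q n h ≫ totalizationMap k f n =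
      (k.map (f p)).f q ≫ totalizationι k L p q n h :=
  HomologicalComplex₂.ι_totalDesc _ _ _ _ _

theorem totalizationι_map_assoc {K L : CochainComplex C ℤ}
    (f : ∀ p, K.X p ⟶ L.X p) (p q n : ℤ) (h : p + q = n) {Z : E}
    (g : ((totalization k).obj L).X n ⟶ Z) :
    totalizationι k K p q n h ≫ totalizationMap k f n ≫ g =
      (k.map (f p)).f q ≫ totalizationι k L p q n h ≫ g := by
  rw [← Category.assoc, totalizationι_map, Category.assoc]

theorem totalization_map_f {K L : CochainComplex C ℤ} (f : K ⟶ L) (n : ℤ) :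
    ((totalization k).map f).f n = totalizationMap k f.f n :=
  totalization_hom_ext fun p q h => by
    rw [totalizationι_map]
    refine (HomologicalComplex.ι_mapBifunctorMap _ _ _ _ p q n h).trans ?_
    exact congrArg _ (Category.id_comp _)

theorem totalizationMap_comp {K L M : CochainComplex C ℤ} (f : ∀ p, K.X p ⟶ L.X p)
    (g : ∀ p, L.X p ⟶ M.X p) (n : ℤ) :
    totalizationMap k f n ≫ totalizationMap k g n = totalizationMap k (fun p => f p ≫ g p) n :=
  totalization_hom_ext fun p q h => by
    rw [totalizationι_map_assoc, totalizationι_map, totalizationι_map, k.map_comp,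
      HomologicalComplex.comp_f, Category.assoc]

theorem totalizationMap_add {K L : CochainComplex C ℤ} (f g : ∀ p, K.X p ⟶ L.X p) (n : ℤ) :
    totalizationMap k f n + totalizationMap k g n = totalizationMap k (fun p => f p + g p) n :=
  totalization_hom_ext fun p q h => by
    rw [Preadditive.comp_add, totalizationι_map, totalizationι_map, totalizationι_map, k.map_add,
      HomologicalComplex.add_f_apply, Preadditive.add_comp]

theorem totalizationMap_id (K : CochainComplex C ℤ) (n : ℤ) :
    totalizationMap k (fun p => 𝟙 (K.X p)) n = 𝟙 _ :=
  totalization_hom_ext fun p q h => by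
    rw [totalizationι_map, k.map_id, HomologicalComplex.id_f, Category.id_comp, Category.comp_id]

/-- The sign convention of the total differential: the differential of `K` enters without sign, that
of `k` with the sign `(-1)^p`. -/
theorem totalizationι_d (K : CochainComplex C ℤ) (p q n n' : ℤ) (h : p + q = n) (h' : n + 1 = n') :
    totalizationι k K p q n h ≫ ((totalization k).obj K).d n n' =
      (k.map (K.d p (p + 1))).f q ≫ totalizationι k K (p + 1) q n' (by lia) +
        p.negOnePow • (k.obj (K.X p)).d q (q + 1) ≫ totalizationι k K p (q + 1) n' (by lia) := by
  subst h'
  refine (Preadditive.comp_add (C := E) _ _ _ (totalizationι k K p q n h) _ _).trans ?_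
  refine congrArg₂ (fun a b => a + b) ?_ ?_
  · refine (HomologicalComplex.mapBifunctor.ι_D₁ K (evalComplex k) (evalAdditive C E) _ _ _ p q
      h).trans ?_
    refine (HomologicalComplex.mapBifunctor.d₁_eq K (evalComplex k) (evalAdditive C E) _
      (show (ComplexShape.up ℤ).Rel p (p + 1) from rfl) q (n + 1) (show p + 1 + q = n + 1 by lia)).trans ?_
    exact one_smul _ _
  · refine (HomologicalComplex.mapBifunctor.ι_D₂ K (evalComplex k) (evalAdditive C E) _ _ _ p q
      h).trans ?_
    exact (HomologicalComplex.mapBifunctor.d₂_eq K (evalComplex k) (evalAdditive C E) _ p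
      (show (ComplexShape.up ℤ).Rel q (q + 1) from rfl) (n + 1) (show p + (q + 1) = n + 1 by lia))

instance : (totalization k).Additive where
  map_add {K L f g} := by
    ext n : 1
    rw [HomologicalComplex.add_f_apply, totalization_map_f, totalization_map_f,
      totalization_map_f, totalizationMap_add]
    rfl

/-- Total complexes preserve homotopies. -/
def totalizationHomotopy {K L : CochainComplex C ℤ} {f g : K ⟶ L} (h : Homotopy f g) :
    Homotopy ((totalization k).map f) ((totalization k).map g) :=
  HomologicalComplex.mapBifunctorMapHomotopy₁ h (𝟙 (evalComplex k)) (evalAdditive C E) _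

variable (S : ShortComplex (CochainComplex C ℤ))
  (σ : ∀ n, (S.map (HomologicalComplex.eval C _ n)).Splitting)

/-- The sections of a degreewise splitting. -/
def degreewiseSection (p : ℤ) : S.X₃.X p ⟶ S.X₂.X p := (σ p).s

/-- The retractions of a degreewise splitting. -/
def degreewiseRetraction (p : ℤ) : S.X₂.X p ⟶ S.X₁.X p := (σ p).r

/-- Total complexes preserve degreewise splittings. -/
def totalizationSplitting (n : ℤ) :
    ((S.map (totalization k)).map (HomologicalComplex.eval E _ n)).Splitting where
  r := totalizationMap k (degreewiseRetraction S σ) n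
  s := totalizationMap k (degreewiseSection S σ) n
  f_r := by
    have h : ((totalization k).map S.f).f n ≫ totalizationMap k (degreewiseRetraction S σ) n =
        𝟙 _ := by
      rw [totalization_map_f, totalizationMap_comp, ← totalizationMap_id]
      congr 1
      funext p
      exact (σ p).f_r
    exact h
  s_g := by
    have h : totalizationMap k (degreewiseSection S σ) n ≫ ((totalization k).map S.g).f n =
        𝟙 _ := by
      rw [totalization_map_f, totalizationMap_comp, ← totalizationMap_id]
      congr 1
      funext p
      exact (σ p).s_g
    exact h
  id := by
    have h : totalizationMap k (degreewiseRetraction S σ) n ≫ ((totalization k).map S.f).f n +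
        ((totalization k).map S.g).f n ≫ totalizationMap k (degreewiseSection S σ) n = 𝟙 _ := by
      rw [totalization_map_f, totalizationMap_comp, totalization_map_f, totalizationMap_comp,
        totalizationMap_add, ← totalizationMap_id]
      congr 1
      funext p
      exact (σ p).id
    exact h

theorem homOfDegreewiseSplit_f' (n : ℤ) :
    (CochainComplex.homOfDegreewiseSplit S σ).f n =
      degreewiseSection S σ n ≫ S.X₂.d n (n + 1) ≫ degreewiseRetraction S σ (n + 1) := by
  rw [CochainComplex.homOfDegreewiseSplit_f]
  exact CochainComplex.HomComplex.Cochain.mk_v (F := S.X₃) (G := S.X₁) (n := 1)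
    (fun p q _ => degreewiseSection S σ p ≫ S.X₂.d p q ≫ degreewiseRetraction S σ q) n (n + 1) rfl

theorem degreewiseSection_retraction (p : ℤ) :
    degreewiseSection S σ p ≫ degreewiseRetraction S σ p = 0 := (σ p).s_r

/-- The connecting morphism of a degreewise split sequence is section, differential, retraction. In
the total complex the differential of `k` commutes with the sections and contributes nothing,
because section followed by retraction is zero. Only the differential of the middle complex
survives, and that is the image of the original connecting morphism. -/
theorem totalization_homOfDegreewiseSplit :
    (totalization k).map (CochainComplex.homOfDegreewiseSplit S σ) ≫
        ((totalization k).commShiftIso (1 : ℤ)).hom.app S.X₁ =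
      CochainComplex.homOfDegreewiseSplit (S.map (totalization k)) (totalizationSplitting S σ) := by
  ext n : 1
  refine totalization_hom_ext fun p q h => ?_
  -- Shifting the first variable introduces no sign: the comparison is the inclusion of the summand
  -- reindexed by `p + 1`.
  have e₂ : totalizationι k (S.X₁⟦(1 : ℤ)⟧) p q n h ≫
      (((totalization k).commShiftIso (1 : ℤ)).hom.app S.X₁).f n =
      totalizationι k S.X₁ (p + 1) q (n + 1) (by lia) := by
    refine (CochainComplex.ι_mapBifunctorShift₁Iso_hom_f S.X₁ (evalComplex k) (evalAdditive C E) 1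
      p q n h (p + 1) (n + 1) rfl rfl).trans ?_
    refine congrArg₂ (fun a b => a ≫ b) ?_ (Category.comp_id _) |>.trans (Category.id_comp _)
    exact congrArg (fun a => NatTrans.app a _) ((evalAdditive C E).map_id _)
  rw [HomologicalComplex.comp_f, totalization_map_f, totalizationι_map_assoc, e₂,
    homOfDegreewiseSplit_f', homOfDegreewiseSplit_f']
  have e₃ : totalizationι k S.X₃ p q n h ≫ totalizationMap k (degreewiseSection S σ) n ≫
      ((totalization k).obj S.X₂).d n (n + 1) ≫
        totalizationMap k (degreewiseRetraction S σ) (n + 1) =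
      (k.map (degreewiseSection S σ p ≫ S.X₂.d p (p + 1) ≫
        degreewiseRetraction S σ (p + 1))).f q ≫
        totalizationι k S.X₁ (p + 1) q (n + 1) (by lia) := by
    have h0 := congrArg (fun a => (k.map a).f q) (degreewiseSection_retraction S σ p)
    simp only [k.map_comp, HomologicalComplex.comp_f, k.map_zero, HomologicalComplex.zero_f] at h0
    rw [totalizationι_map_assoc]
    rw [← Category.assoc (totalizationι k S.X₂ p q n h), totalizationι_d _ p q n (n + 1) h rfl,
      Preadditive.add_comp, Category.assoc, totalizationι_map, Linear.units_smul_comp,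
      Category.assoc, totalizationι_map, Preadditive.comp_add, Linear.comp_units_smul,
      ← HomologicalComplex.Hom.comm_assoc, reassoc_of% h0, zero_comp, smul_zero, add_zero]
    simp only [k.map_comp, HomologicalComplex.comp_f, Category.assoc]
  exact e₃.symm

/-- The total complex of a degreewise split triangle. -/
def totalizationTriangleIso : (totalization k).mapTriangle.obj
      (CochainComplex.triangleOfDegreewiseSplit S σ) ≅
    CochainComplex.triangleOfDegreewiseSplit (S.map (totalization k))
      (totalizationSplitting S σ) :=
  Pretriangulated.Triangle.isoMk _ _ (Iso.refl _) (Iso.refl _) (Iso.refl _)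
    ((Category.comp_id _).trans (Category.id_comp _).symm)
    ((Category.comp_id _).trans (Category.id_comp _).symm)
    (by
      have h := totalization_homOfDegreewiseSplit (k := k) S σ
      refine (congrArg _ ((shiftFunctor (CochainComplex E ℤ) (1 : ℤ)).map_id _)).trans ?_
      exact (Category.comp_id _).trans (h.trans (Category.id_comp _).symm))

variable (k)

/-- The total complex, as a functor between homotopy categories. -/
def totalizationH : HomotopyCategory C (.up ℤ) ⥤ HomotopyCategory E (.up ℤ) :=
  CategoryTheory.Quotient.lift _ (totalization k ⋙ HomotopyCategory.quotient E (.up ℤ))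
    fun _ _ _ _ ⟨h⟩ => HomotopyCategory.eq_of_homotopy _ _ (totalizationHomotopy h)

instance : (totalizationH k).CommShift ℤ := Quotient.liftCommShift _ _ _ _

def totalizationHFactors : HomotopyCategory.quotient C (.up ℤ) ⋙ totalizationH k ≅
    totalization k ⋙ HomotopyCategory.quotient E (.up ℤ) :=
  CategoryTheory.Quotient.lift.isLift _ _ _

instance : NatTrans.CommShift (totalizationHFactors k).hom ℤ :=
  Quotient.liftCommShift_compatibility _ _ _ _

/-- Distinguished triangles of the homotopy category are, up to isomorphism, those of degreewise
split short exact sequences, and total complexes preserve these together with their connecting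
morphisms. -/
instance : (totalizationH k).IsTriangulated where
  map_distinguished T hT := by
    rw [HomotopyCategory.distinguished_iff_iso_trianglehOfDegreewiseSplit] at hT
    obtain ⟨S, σ, ⟨e⟩⟩ := hT
    refine Pretriangulated.isomorphic_distinguished _
      ((HomotopyCategory.distinguished_iff_iso_trianglehOfDegreewiseSplit _).2
        ⟨S.map (totalization k), totalizationSplitting S σ, ⟨Iso.refl _⟩⟩) _
      ((totalizationH k).mapTriangle.mapIso e ≪≫ ?_)
    exact (Functor.mapTriangleCompIso _ _).symm.app _ ≪≫
      (Functor.mapTriangleIso (totalizationHFactors k)).app _ ≪≫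
      (Functor.mapTriangleCompIso _ _).app _ ≪≫
      (HomotopyCategory.quotient E (.up ℤ)).mapTriangle.mapIso (totalizationTriangleIso S σ)

end Totalization

/-! ### Complexes with terms in a full subcategory -/

section Lift

universe v v' u u'

variable {D : Type u} [Category.{v} D] {E : Type u'} [Category.{v'} E] [Preadditive E]
  (Q : ObjectProperty E)

/-- A functor to complexes whose terms lie in a full subcategory. -/
def liftComplex (G : D ⥤ CochainComplex E ℤ) (hG : ∀ K n, Q ((G.obj K).X n)) :
    D ⥤ CochainComplex Q.FullSubcategory ℤ where
  obj K :=
    { X := fun n => ⟨(G.obj K).X n, hG K n⟩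
      d := fun i j => ObjectProperty.homMk ((G.obj K).d i j)
      shape := fun i j h => by
        ext
        exact (G.obj K).shape i j h
      d_comp_d' := fun i j l _ _ => by
        ext
        exact (G.obj K).d_comp_d i j l }
  map f :=
    { f := fun n => ObjectProperty.homMk ((G.map f).f n)
      comm' := fun i j _ => by
        ext
        exact (G.map f).comm i j }
  map_id K := by
    ext n
    exact congrArg (fun a => HomologicalComplex.Hom.f a n) (G.map_id K)
  map_comp f g := by
    ext n
    exact congrArg (fun a => HomologicalComplex.Hom.f a n) (G.map_comp f g)

def liftComplexIso (G : D ⥤ CochainComplex E ℤ) (hG : ∀ K n, Q ((G.obj K).X n)) :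
    liftComplex Q G hG ⋙ Q.ι.mapHomologicalComplex (.up ℤ) ≅ G :=
  NatIso.ofComponents (fun K => HomologicalComplex.Hom.isoOfComponents (fun n => Iso.refl _)
    fun i j _ => (Category.id_comp _).trans (Category.comp_id _).symm) fun f => by
      ext n
      exact (Category.comp_id _).trans (Category.id_comp _).symm

end Lift

section LiftTotalization

universe v v' u u'

variable {C : Type u} [Category.{v} C] [Abelian C] {E : Type u'} [Category.{v'} E] [Abelian E]
  [HasCoproducts.{0} E] (k : C ⥤ CochainComplex E ℤ) [k.Additive] (Q : ObjectProperty E)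
  [Q.IsSerreClass] [Q.IsClosedUnderFiniteProducts]

/-- A Serre class contains the coproducts of families of its objects almost all of which vanish. -/
theorem prop_sigma_of_finite {ι : Type} (f : ι → E) (hf : ∀ i, Q (f i)) (s : Finset ι)
    (hs : ∀ i ∉ s, IsZero (f i)) : Q (∐ f) := by
  have := Abelian.hasFiniteBiproducts (C := E)
  let p : (⨁ fun i : s => f i.1) ⟶ ∐ f := biproduct.desc fun i => Sigma.ι f i.1
  have : Epi p := ⟨fun g h e => by
    refine Sigma.hom_ext _ _ fun i => ?_
    by_cases hi : i ∈ s
    · have := congrArg (fun a => biproduct.ι (fun i : s => f i) ⟨i, hi⟩ ≫ a) e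
      simpa [p] using this
    · exact (hs i hi).eq_of_src _ _⟩
  refine Q.prop_of_epi p ?_
  have : Q.IsClosedUnderFiniteProducts := inferInstance
  exact Q.prop_of_iso (biproduct.isoProduct fun i : s => f i).symm
    (Q.prop_product (f := fun i : s => f i.1) fun i => hf i.1)

variable {k} in
-- The term of degree `n` is a coproduct over `p + q = n`, and only `a ≤ q ≤ b` contributes, so it
-- is a finite sum of objects of `Q`. No boundedness of `K` is required.
theorem totalization_prop (hk : ∀ X n, Q ((k.obj X).X n)) (a b : ℤ)
    (ha : ∀ X n, n < a → IsZero ((k.obj X).X n)) (hb : ∀ X n, b < n → IsZero ((k.obj X).X n))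
    (K : CochainComplex C ℤ) (n : ℤ) : Q (((totalization k).obj K).X n) := by
  refine prop_sigma_of_finite Q _ (fun i => hk _ _) ((Finset.Icc a b).image fun j =>
    ⟨(n - j, j), show n - j + j = n by lia⟩) fun i hi => ?_
  obtain ⟨⟨p, q⟩, h⟩ := i
  by_cases hq : q < a
  · exact ha _ _ hq
  by_cases hq' : b < q
  · exact hb _ _ hq'
  refine absurd (Finset.mem_image.2 ⟨q, Finset.mem_Icc.2 ⟨by lia, by lia⟩, ?_⟩) hi
  have h : p + q = n := h
  exact Subtype.ext (Prod.ext (by simp only; lia) rfl)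

variable (hk : ∀ K n, Q (((totalization k).obj K).X n))

/-- The total complex, with terms in a Serre class. -/
def totalizationQ : CochainComplex C ℤ ⥤ CochainComplex Q.FullSubcategory ℤ :=
  liftComplex Q (totalization k) hk

/-- The total complex, with terms in a Serre class, on homotopy categories. -/
def totalizationQH : HomotopyCategory C (.up ℤ) ⥤ HomotopyCategory Q.FullSubcategory (.up ℤ) :=
  CategoryTheory.Quotient.lift _ (totalizationQ k Q hk ⋙ HomotopyCategory.quotient _ (.up ℤ))
    -- Equality up to homotopy may be tested after including `Q` in `E`, where the homotopy is
    -- available.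
    fun K L f g h => (Q.ι.mapHomotopyCategory (.up ℤ)).map_injective (by
      let e := Functor.isoWhiskerRight (liftComplexIso Q (totalization k) hk)
        (HomotopyCategory.quotient E (.up ℤ))
      have key : ∀ φ : K ⟶ L, (Q.ι.mapHomotopyCategory (.up ℤ)).map
          ((totalizationQ k Q hk ⋙ HomotopyCategory.quotient _ (.up ℤ)).map φ) =
          e.hom.app K ≫ (HomotopyCategory.quotient E (.up ℤ)).map ((totalization k).map φ) ≫
            e.inv.app L := fun φ => (NatIso.naturality_2 e φ).symm
      rw [key, key, HomotopyCategory.eq_of_homotopy _ _ (totalizationHomotopy h.some)])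

def totalizationQHFactors : HomotopyCategory.quotient C (.up ℤ) ⋙ totalizationQH k Q hk ≅
    totalizationQ k Q hk ⋙ HomotopyCategory.quotient _ (.up ℤ) :=
  CategoryTheory.Quotient.lift.isLift _ _ _

/-- The inclusion of homotopy categories is fully faithful and triangulated, so through this
isomorphism the lifted functor inherits its shift structure and exactness from `totalizationH`. -/
def totalizationQHComp : totalizationQH k Q hk ⋙ Q.ι.mapHomotopyCategory (.up ℤ) ≅
    totalizationH k :=
  Quotient.natIsoLift _
    (Functor.isoWhiskerRight (liftComplexIso Q (totalization k) hk)
        (HomotopyCategory.quotient E (.up ℤ)))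

instance : (totalizationQH k Q hk).CommShift ℤ :=
  Functor.CommShift.ofComp (totalizationQHComp k Q hk) ℤ

instance : NatTrans.CommShift (totalizationQHComp k Q hk).hom ℤ :=
  Functor.CommShift.ofComp_compatibility (totalizationQHComp k Q hk) ℤ

instance : (totalizationQH k Q hk).IsTriangulated :=
  (Functor.isTriangulated_iff_comp_right (totalizationQHComp k Q hk)).2 inferInstance

end LiftTotalization

/-! ### Quasi-inverses of triangulated equivalences -/

section Inverse

variable {T S : Type*} [Category* T] [Category* S] [Preadditive T] [Preadditive S]
  [HasZeroObject T] [HasZeroObject S] [HasShift T ℤ] [HasShift S ℤ]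
  [∀ n : ℤ, (shiftFunctor T n).Additive] [∀ n : ℤ, (shiftFunctor S n).Additive]
  [Pretriangulated T] [Pretriangulated S] (F : T ⥤ S) [h : F.CommShift ℤ] [F.IsEquivalence]

instance asEquivalenceCommShift : F.asEquivalence.functor.CommShift ℤ := h

/-- The quasi-inverse of an equivalence commutes with shifts. -/
instance invCommShift : F.asEquivalence.inverse.CommShift ℤ := F.asEquivalence.commShiftInverse ℤ

instance : F.asEquivalence.CommShift ℤ := F.asEquivalence.commShift_of_functor ℤ

instance [h' : F.IsTriangulated] : F.asEquivalence.inverse.IsTriangulated :=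
  (Equivalence.IsTriangulated.mk' F.asEquivalence h').rightAdjoint_isTriangulated

end Inverse

/-! ### Bounded K-projective complexes -/

section BoundedKProjective

open DerivedCategory.TStructure

universe w v u

variable (C : Type u) [Category.{v} C] [Abelian C] [HasDerivedCategory.{w} C]

/-- The K-projective complexes with bounded cohomology, up to homotopy. -/
def boundedKProjective : ObjectProperty (HomotopyCategory C (.up ℤ)) :=
  (HomotopyCategory.subcategoryAcyclic C).leftOrthogonal ⊓
    (t (C := C)).bounded.inverseImage DerivedCategory.Qh

instance : (boundedKProjective C).IsTriangulated := by
  unfold boundedKProjective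
  infer_instance

theorem boundedKProjective_bounded (X : (boundedKProjective C).FullSubcategory) :
    (t (C := C)).bounded (((boundedKProjective C).ι ⋙ DerivedCategory.Qh).obj X) := X.property.2

/-- The localization functor on bounded K-projective complexes. -/
def boundedKProjectiveQ : (boundedKProjective C).FullSubcategory ⥤ Db C :=
  (t (C := C)).bounded.lift ((boundedKProjective C).ι ⋙ DerivedCategory.Qh)
    (boundedKProjective_bounded C)

instance : (boundedKProjectiveQ C).CommShift ℤ :=
  inferInstanceAs (((t (C := C)).bounded.lift ((boundedKProjective C).ι ⋙ DerivedCategory.Qh)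
    (boundedKProjective_bounded C)).CommShift ℤ)

instance : (boundedKProjectiveQ C).IsTriangulated :=
  inferInstanceAs (((t (C := C)).bounded.lift ((boundedKProjective C).ι ⋙ DerivedCategory.Qh)
    (boundedKProjective_bounded C)).IsTriangulated)

/-- A source left orthogonal to the acyclic complexes has the same morphisms before and after
localization at quasi-isomorphisms. -/
theorem boundedKProjectiveQ_map_bijective (X Y : (boundedKProjective C).FullSubcategory) :
    Function.Bijective ((boundedKProjectiveQ C).map : (X ⟶ Y) → _) := by
  have h := (X.property.1).map_bijective_of_isTriangulated DerivedCategory.Qh Y.obj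
  constructor
  · intro f g hfg
    exact ObjectProperty.hom_ext _ (h.1 (congrArg (fun a => a.hom) hfg))
  · intro g
    obtain ⟨f, hf⟩ := h.2 g.hom
    exact ⟨ObjectProperty.homMk f, ObjectProperty.hom_ext _ hf⟩

instance : (boundedKProjectiveQ C).Full := ⟨fun {X Y} => (boundedKProjectiveQ_map_bijective C X Y).2⟩

instance : (boundedKProjectiveQ C).Faithful :=
  ⟨fun {X Y} => (boundedKProjectiveQ_map_bijective C X Y).1⟩

variable {C}

theorem boundedKProjective_of_boundedProj (P : (boundedProj C).FullSubcategory) :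
    boundedKProjective C ((HomotopyCategory.quotient C (.up ℤ)).obj P.obj) := by
  obtain ⟨⟨a, _⟩, ⟨b, _⟩, _⟩ := P.property
  have := CochainComplex.isKProjective_of_projective P.obj b
  refine ⟨CochainComplex.IsKProjective.leftOrthogonal P.obj, ?_⟩
  exact (t (C := C)).bounded.prop_of_iso
    ((DerivedCategory.quotientCompQhIso C).symm.app P.obj) ((Db.ofProj C).obj P).property

variable (C) in
/-- Bounded complexes of projective objects, up to homotopy. -/
def boundedProjQuotient : (boundedProj C).FullSubcategory ⥤ (boundedKProjective C).FullSubcategory :=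
  (boundedKProjective C).lift ((boundedProj C).ι ⋙ HomotopyCategory.quotient C (.up ℤ))
    boundedKProjective_of_boundedProj

variable (C) in
def boundedProjQuotientIso : boundedProjQuotient C ⋙ boundedKProjectiveQ C ≅ Db.ofProj C :=
  ((t (C := C)).bounded.fullyFaithfulι.whiskeringRight _).preimageIso
    (Functor.isoWhiskerLeft (boundedProj C).ι (DerivedCategory.quotientCompQhIso C))

/-- A projective object, as a complex in degree `0`. -/
def projSingle (P : C) [Projective P] : (boundedProj C).FullSubcategory :=
  ⟨(CochainComplex.singleFunctor C 0).obj P, ⟨0, inferInstance⟩, ⟨0, inferInstance⟩, fun i => by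
    by_cases h : i = 0
    · subst h
      exact Projective.of_iso (HomologicalComplex.singleObjXSelf (.up ℤ) 0 P).symm inferInstance
    · have h0 : IsZero (((CochainComplex.singleFunctor C 0).obj P).X i) :=
        HomologicalComplex.isZero_single_obj_X (.up ℤ) 0 P i h
      exact ⟨fun f _ _ => ⟨0, h0.eq_of_src _ _⟩⟩⟩

def projSingleIso (P : C) [Projective P] :
    (Db.ofProj C).obj (projSingle P) ≅ (Db.single C).obj P :=
  (t (C := C)).bounded.isoMk ((DerivedCategory.singleFunctorIsoCompQ C 0).symm.app P)

/-- The projective objects, as objects of the bounded derived category. -/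
def IsProjSingle (X : Db C) : Prop := ∃ (P : C) (_ : Projective P), Nonempty (X ≅ (Db.single C).obj P)

/-- The functor is fully faithful, so its essential image is triangulated. It contains the
projective objects in degree `0`, and these contain a generating class. Every object thus has a
K-projective representative without any construction of projective resolutions. -/
theorem boundedKProjectiveQ_isEquivalence {G : ObjectProperty (Db C)} (hG : Generates G)
    (h : ∀ X, G X → IsProjSingle X) : (boundedKProjectiveQ C).IsEquivalence where
  essSurj := ⟨hG (boundedKProjectiveQ C).essImage inferInstance inferInstance fun X hX => by
    obtain ⟨P, _, ⟨e⟩⟩ := h X hX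
    exact ⟨(boundedProjQuotient C).obj (projSingle P),
      ⟨(boundedProjQuotientIso C).app _ ≪≫ projSingleIso P ≪≫ e.symm⟩⟩⟩

end BoundedKProjective

/-! ### The derived functor of the total complex -/

section Derived

open DerivedCategory.TStructure

universe w w' v v' u u'

variable {C : Type u} [Category.{v} C] [Abelian C] {E : Type u'} [Category.{v'} E] [Abelian E]
  [HasCoproducts.{0} E] (k : C ⥤ CochainComplex E ℤ) [k.Additive] (Q : ObjectProperty E)
  [Q.IsSerreClass] [Q.IsClosedUnderFiniteProducts]
  (hk : ∀ K n, Q (((totalization k).obj K).X n))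
  [HasDerivedCategory.{w} C] [HasDerivedCategory.{w'} Q.FullSubcategory]

variable {k Q} in
theorem totalization_isZero {K : CochainComplex C ℤ} {n : ℤ}
    (h : ∀ p q, p + q = n → IsZero ((k.obj (K.X p)).X q)) :
    IsZero (((totalization k).obj K).X n) :=
  (IsZero.iff_id_eq_zero _).2 (totalization_hom_ext fun p q hpq => (h p q hpq).eq_of_src _ _)

variable {Q} in
theorem isZero_of_ι (X : Q.FullSubcategory) (h : IsZero X.obj) : IsZero X :=
  (IsZero.iff_id_eq_zero _).2 (ObjectProperty.hom_ext _ (h.eq_of_src _ _))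

/-- The total complex, on bounded K-projective complexes. -/
def totalizationD : (boundedKProjective C).FullSubcategory ⥤ DerivedCategory Q.FullSubcategory :=
  (boundedKProjective C).ι ⋙ totalizationQH k Q hk ⋙ DerivedCategory.Qh

instance : (totalizationD k Q hk).CommShift ℤ :=
  inferInstanceAs (((boundedKProjective C).ι ⋙ totalizationQH k Q hk ⋙
    DerivedCategory.Qh).CommShift ℤ)

instance : (totalizationD k Q hk).IsTriangulated :=
  inferInstanceAs (((boundedKProjective C).ι ⋙ totalizationQH k Q hk ⋙
    DerivedCategory.Qh).IsTriangulated)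

def totalizationDIso : boundedProjQuotient C ⋙ totalizationD k Q hk ≅
    (boundedProj C).ι ⋙ totalizationQ k Q hk ⋙ DerivedCategory.Q :=
  Functor.isoWhiskerLeft (boundedProj C).ι
    (Functor.isoWhiskerRight (totalizationQHFactors k Q hk) DerivedCategory.Qh ≪≫
      Functor.isoWhiskerLeft (totalizationQ k Q hk) (DerivedCategory.quotientCompQhIso _))

/-- The total left derived functor of the total complex, provided that the projective objects
generate the bounded derived category. -/
theorem exists_derived {G : ObjectProperty (Db C)} (hG : Generates G)
    (hP : ∀ X, G X → IsProjSingle X)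
    (a b : ℤ) (ha : ∀ X n, n < a → IsZero ((k.obj X).X n))
    (hb : ∀ X n, b < n → IsZero ((k.obj X).X n)) :
    ∃ (K : Db C ⥤ Db Q.FullSubcategory) (_ : K.CommShift ℤ), K.IsTriangulated ∧
      Nonempty (Db.ofProj C ⋙ K ⋙ Db.ι Q.FullSubcategory ≅
        (boundedProj C).ι ⋙ totalizationQ k Q hk ⋙ DerivedCategory.Q) := by
  have := boundedKProjectiveQ_isEquivalence hG hP
  let e := (boundedKProjectiveQ C).asEquivalence
  -- The usual left derived functor: replace an object by a K-projective complex, then take the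
  -- total complex.
  let K' := (boundedKProjectiveQ C).asEquivalence.inverse ⋙ totalizationD k Q hk
  let i : Db.ofProj C ⋙ K' ≅ (boundedProj C).ι ⋙ totalizationQ k Q hk ⋙ DerivedCategory.Q :=
    Functor.isoWhiskerRight (boundedProjQuotientIso C).symm K' ≪≫
      Functor.isoWhiskerLeft (boundedProjQuotient C)
        (Functor.isoWhiskerRight e.unitIso.symm (totalizationD k Q hk)) ≪≫
      totalizationDIso k Q hk
  -- Objects whose image has bounded cohomology form a triangulated subcategory, so generators
  -- suffice. For a projective object in degree `0` the total complex lives in the degrees from `a`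
  -- to `b`.
  have hK' : ∀ X, (t (C := Q.FullSubcategory)).bounded (K'.obj X) :=
    hG ((t (C := Q.FullSubcategory)).bounded.inverseImage K') inferInstance inferInstance
      fun X hX => by
        obtain ⟨P, _, ⟨j⟩⟩ := hP X hX
        refine (t (C := Q.FullSubcategory)).bounded.prop_of_iso
          ((i.app (projSingle P)).symm ≪≫ K'.mapIso (projSingleIso P ≪≫ j.symm)) ?_
        have hz : ∀ n, (n < a ∨ b < n) →
            IsZero (((totalizationQ k Q hk).obj (projSingle P).obj).X n) := fun n hn =>
          isZero_of_ι _ (totalization_isZero (fun p q h => by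
            by_cases h0 : p = 0
            · rcases hn with hn | hn
              · exact ha _ _ (by lia)
              · exact hb _ _ (by lia)
            · have h1 : IsZero ((projSingle P).obj.X p) :=
                HomologicalComplex.isZero_single_obj_X (.up ℤ) 0 P p h0
              have h2 : IsZero (k.obj ((projSingle P).obj.X p)) := k.map_isZero h1
              exact (HomologicalComplex.eval E (.up ℤ) q).map_isZero h2))
        let L := (totalizationQ k Q hk).obj (projSingle P).obj
        have : L.IsStrictlyGE a := (CochainComplex.isStrictlyGE_iff _ _).2 fun n hn => hz n (.inl hn)
        have : L.IsStrictlyLE b := (CochainComplex.isStrictlyLE_iff _ _).2 fun n hn => hz n (.inr hn)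
        exact ⟨⟨a, inferInstanceAs ((DerivedCategory.Q.obj L).IsGE a)⟩,
          ⟨b, inferInstanceAs ((DerivedCategory.Q.obj L).IsLE b)⟩⟩
  exact ⟨(t (C := Q.FullSubcategory)).bounded.lift K' hK', inferInstance, inferInstance, ⟨i⟩⟩

end Derived

/-! ### The total complex for a complex in degree zero -/

section Single

universe v v' u u'

variable {C : Type u} [Category.{v} C] [Abelian C] {E : Type u'} [Category.{v'} E] [Abelian E]
  [HasCoproducts.{0} E] (k : C ⥤ CochainComplex E ℤ) [k.Additive]

def singleXIsoOfEq (F : C) (p : ℤ) (hp : p = 0) :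
    ((CochainComplex.singleFunctor C 0).obj F).X p ≅ F :=
  HomologicalComplex.singleObjXIsoOfEq (.up ℤ) 0 F p hp

def singleXIso (F : C) : ((CochainComplex.singleFunctor C 0).obj F).X 0 ≅ F :=
  singleXIsoOfEq F 0 rfl

/-- The inclusion of the terms of `k` in the total complex of a complex in degree `0`. -/
def totalizationSingleι (F : C) (n : ℤ) :
    (k.obj F).X n ⟶ ((totalization k).obj ((CochainComplex.singleFunctor C 0).obj F)).X n :=
  (k.map (singleXIso F).inv).f n ≫
    totalizationι k ((CochainComplex.singleFunctor C 0).obj F) 0 n n (zero_add n)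

/-- The projection of the total complex of a complex in degree `0`. -/
def totalizationSingleπ (F : C) (n : ℤ) :
    ((totalization k).obj ((CochainComplex.singleFunctor C 0).obj F)).X n ⟶ (k.obj F).X n :=
  HomologicalComplex₂.totalDesc _ fun p q h => if hp : p = 0 then
      (k.map (singleXIsoOfEq F p hp).hom).f q ≫
        eqToHom (by
          have h : p + q = n := h
          rw [show q = n by lia])
    else 0

theorem totalizationSingleι_π (F : C) (n : ℤ) :
    totalizationSingleι k F n ≫ totalizationSingleπ k F n = 𝟙 _ := by
  have h := HomologicalComplex₂.ι_totalDesc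
    (K := (((evalAdditive C E).mapBifunctorHomologicalComplex (.up ℤ) (.up ℤ)).obj
      ((CochainComplex.singleFunctor C 0).obj F)).obj (evalComplex k)) (c₁₂ := .up ℤ) (i₁₂ := n)
    (A := (k.obj F).X n) (fun p q h => if hp : p = 0 then
      (k.map (singleXIsoOfEq F p hp).hom).f q ≫
        eqToHom (by
          have h : p + q = n := h
          rw [show q = n by lia])
    else 0) 0 n (zero_add n)
  rw [dif_pos rfl] at h
  have h' : totalizationι k ((CochainComplex.singleFunctor C 0).obj F) 0 n n (zero_add n) ≫
      totalizationSingleπ k F n = (k.map (singleXIso F).hom).f n :=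
    h.trans (Category.comp_id _)
  rw [totalizationSingleι, Category.assoc, h', ← HomologicalComplex.comp_f, ← k.map_comp,
    Iso.inv_hom_id, k.map_id, HomologicalComplex.id_f]

/-- Only the summand with `p = 0` of the total complex is nonzero, the others being images of zero
objects. -/
theorem totalizationSingle_epi (F : C) (n : ℤ) {X : E}
    {f g : ((totalization k).obj ((CochainComplex.singleFunctor C 0).obj F)).X n ⟶ X}
    (h : totalizationSingleι k F n ≫ f = totalizationSingleι k F n ≫ g) : f = g := by
  refine totalization_hom_ext fun p q hpq => ?_
  by_cases hp : p = 0
  · subst hp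
    obtain rfl : q = n := by lia
    have e : totalizationι k ((CochainComplex.singleFunctor C 0).obj F) 0 q q hpq =
        (k.map (singleXIso F).hom).f q ≫
          totalizationSingleι k F q := by
      rw [totalizationSingleι, ← Category.assoc, ← HomologicalComplex.comp_f, ← k.map_comp,
        Iso.hom_inv_id, k.map_id, HomologicalComplex.id_f]
      exact (Category.id_comp _).symm
    rw [e, Category.assoc, Category.assoc, h]
  · have h1 : IsZero (((CochainComplex.singleFunctor C 0).obj F).X p) :=
      HomologicalComplex.isZero_single_obj_X (.up ℤ) 0 F p hp
    exact ((HomologicalComplex.eval E (.up ℤ) q).map_isZero (k.map_isZero h1)).eq_of_src _ _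

theorem totalizationSingleπ_ι (F : C) (n : ℤ) :
    totalizationSingleπ k F n ≫ totalizationSingleι k F n = 𝟙 _ :=
  totalizationSingle_epi k F n (by
    rw [← Category.assoc, totalizationSingleι_π, Category.id_comp, Category.comp_id])

/-- The total complex for a complex in degree `0`. -/
def totalizationSingle : k ≅ CochainComplex.singleFunctor C 0 ⋙ totalization k :=
  NatIso.ofComponents (fun F => HomologicalComplex.Hom.isoOfComponents
    (fun n => ⟨totalizationSingleι k F n, totalizationSingleπ k F n, totalizationSingleι_π k F n,
      totalizationSingleπ_ι k F n⟩)
    (fun i j hij => by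
      obtain rfl : i + 1 = j := hij
      change totalizationSingleι k F i ≫ ((totalization k).obj _).d i (i + 1) = _ ≫
        totalizationSingleι k F (i + 1)
      have h0 : ((CochainComplex.singleFunctor C 0).obj F).d 0 (0 + 1) = 0 :=
        HomologicalComplex.single_obj_d _ _ _ _ _
      rw [totalizationSingleι, totalizationSingleι, Category.assoc,
        totalizationι_d _ 0 i i (i + 1) _ rfl, h0, k.map_zero, HomologicalComplex.zero_f,
        zero_comp, zero_add, Int.negOnePow_zero, one_smul, ← Category.assoc,
        HomologicalComplex.Hom.comm, Category.assoc]))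
    fun {F F'} f => by
      ext n
      change (k.map f).f n ≫ totalizationSingleι k F' n = totalizationSingleι k F n ≫
        ((totalization k).map ((CochainComplex.singleFunctor C 0).map f)).f n
      have h0 : ((CochainComplex.singleFunctor C 0).map f).f 0 =
          (singleXIso F).hom ≫ f ≫
            (singleXIso F').inv :=
        HomologicalComplex.single_map_f_self _ _ _
      rw [totalizationSingleι, totalizationSingleι, Category.assoc, totalization_map_f,
        totalizationι_map, h0, ← Category.assoc, ← Category.assoc, ← HomologicalComplex.comp_f,
        ← HomologicalComplex.comp_f, ← k.map_comp, ← k.map_comp]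
      simp only [Iso.inv_hom_id_assoc]

variable (Q : ObjectProperty E)

variable {k} in
def liftComplexMapIso {D : Type*} [Category* D] {G G' : D ⥤ CochainComplex E ℤ} (e : G ≅ G')
    (hG : ∀ K n, Q ((G.obj K).X n)) (hG' : ∀ K n, Q ((G'.obj K).X n)) :
    liftComplex Q G hG ≅ liftComplex Q G' hG' :=
  NatIso.ofComponents (fun K =>
    { hom := { f := fun n => ObjectProperty.homMk ((e.hom.app K).f n)
               comm' := fun i j _ => by
                ext
                exact (e.hom.app K).comm i j }
      inv := { f := fun n => ObjectProperty.homMk ((e.inv.app K).f n)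
               comm' := fun i j _ => by
                ext
                exact (e.inv.app K).comm i j }
      hom_inv_id := by
        ext n
        exact congrArg (fun a => HomologicalComplex.Hom.f a n) (e.hom_inv_id_app K)
      inv_hom_id := by
        ext n
        exact congrArg (fun a => HomologicalComplex.Hom.f a n) (e.inv_hom_id_app K) })
    fun {K L} f => by
      ext n
      exact congrArg (fun a => HomologicalComplex.Hom.f a n) (e.hom.naturality f)

variable [Q.IsSerreClass] [Q.IsClosedUnderFiniteProducts]
  (hk : ∀ K n, Q (((totalization k).obj K).X n)) (hk' : ∀ X n, Q ((k.obj X).X n))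

def totalizationQSingle : liftComplex Q k hk' ≅
    CochainComplex.singleFunctor C 0 ⋙ totalizationQ k Q hk :=
  liftComplexMapIso Q (totalizationSingle k) hk' (fun _ _ => hk _ _)

end Single

/-! ### Morphisms in the derived category to complexes of injective objects -/

section KInjective

universe w v u

variable {C : Type u} [Category.{v} C] [Abelian C]

/-- A morphism to a term of a complex that is the only one with nonzero morphisms from the given
object, as a morphism from the complex in a single degree. -/
def fromSingle {Z : C} {L : CochainComplex C ℤ} (j : ℤ) (h : ∀ i, i ≠ j → ∀ f : Z ⟶ L.X i, f = 0)
    (φ : Z ⟶ L.X j) : (CochainComplex.singleFunctor C j).obj Z ⟶ L :=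
  HomologicalComplex.mkHomFromSingle φ fun i hi => h i (by
    have : j + 1 = i := hi
    lia) _

def singleXSelf (j : ℤ) (Z : C) : ((CochainComplex.singleFunctor C j).obj Z).X j ≅ Z :=
  HomologicalComplex.singleObjXSelf (.up ℤ) j Z

theorem fromSingle_f {Z : C} {L : CochainComplex C ℤ} (j : ℤ)
    (h : ∀ i, i ≠ j → ∀ f : Z ⟶ L.X i, f = 0) (φ : Z ⟶ L.X j) :
    (singleXSelf j Z).inv ≫ (fromSingle j h φ).f j = φ := by
  have := HomologicalComplex.mkHomFromSingle_f (c := .up ℤ) φ fun i hi => h i (by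
    have : j + 1 = i := hi
    lia) _
  exact (congrArg (fun a => (singleXSelf j Z).inv ≫ a) this).trans
    ((singleXSelf j Z).inv_hom_id_assoc φ)

theorem single_hom_ext {Z : C} {L : CochainComplex C ℤ} {j : ℤ}
    {f g : (CochainComplex.singleFunctor C j).obj Z ⟶ L}
    (h : (singleXSelf j Z).inv ≫ f.f j = (singleXSelf j Z).inv ≫ g.f j) : f = g :=
  HomologicalComplex.from_single_hom_ext ((cancel_epi (singleXSelf j Z).inv).1 h)

/-- A homotopy out of a complex in degree `j` is a single map to the term of degree `j - 1`, and
such maps vanish by hypothesis. Homotopy classes of morphisms are then the morphisms themselves. -/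
theorem single_homotopy_eq {Z : C} {L : CochainComplex C ℤ} {j : ℤ}
    (h : ∀ i, i ≠ j → ∀ f : Z ⟶ L.X i, f = 0)
    (f g : (CochainComplex.singleFunctor C j).obj Z ⟶ L) (H : Homotopy f g) : f = g := by
  refine single_hom_ext (congrArg _ ?_)
  have h1 : H.hom j (j - 1) = 0 := by
    have := h (j - 1) (by lia) ((singleXSelf j Z).inv ≫ H.hom j (j - 1))
    rw [← cancel_epi (singleXSelf j Z).inv, this, comp_zero]
  have h2 : H.hom (j + 1) j = 0 :=
    (HomologicalComplex.isZero_single_obj_X (.up ℤ) j Z (j + 1) (by lia)).eq_of_src _ _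
  rw [H.comm j, dNext_eq H.hom (show (ComplexShape.up ℤ).Rel j (j + 1) from rfl),
    prevD_eq H.hom (show (ComplexShape.up ℤ).Rel (j - 1) j by simp), h1, h2]
  simp

variable [HasDerivedCategory.{w} C]

/-- Morphisms to a K-injective complex in the derived category are homotopy classes of chain maps.
-/
theorem Q_map_surjective (K L : CochainComplex C ℤ) [L.IsKInjective] :
    Function.Surjective (DerivedCategory.Q.map : (K ⟶ L) → _) := by
  intro g
  obtain ⟨f, hf⟩ := (CochainComplex.IsKInjective.Qh_map_bijective ((HomotopyCategory.quotient C (.up ℤ)).obj K) L).2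
    ((DerivedCategory.quotientCompQhIso C).hom.app K ≫ g ≫
      (DerivedCategory.quotientCompQhIso C).inv.app L)
  obtain ⟨f, rfl⟩ := (HomotopyCategory.quotient C (.up ℤ)).map_surjective f
  refine ⟨f, ?_⟩
  have := NatIso.naturality_1 (DerivedCategory.quotientCompQhIso C) f
  rw [← this]
  refine (congrArg (fun a => (DerivedCategory.quotientCompQhIso C).inv.app K ≫ a ≫
    (DerivedCategory.quotientCompQhIso C).hom.app L) hf).trans ?_
  simp

theorem Q_map_bijective (K L : CochainComplex C ℤ) [L.IsKInjective]
    (h : ∀ f g : K ⟶ L, Homotopy f g → f = g) :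
    Function.Bijective (DerivedCategory.Q.map : (K ⟶ L) → _) := by
  refine ⟨fun f g e => ?_, Q_map_surjective K L⟩
  refine h f g (HomotopyCategory.homotopyOfEq _ _
    ((CochainComplex.IsKInjective.Qh_map_bijective ((HomotopyCategory.quotient C (.up ℤ)).obj K) L).1 ?_))
  have h1 := NatIso.naturality_2 (DerivedCategory.quotientCompQhIso C) f
  have h2 := NatIso.naturality_2 (DerivedCategory.quotientCompQhIso C) g
  exact h1.symm.trans ((congrArg (fun a => (DerivedCategory.quotientCompQhIso C).hom.app K ≫ a ≫
    (DerivedCategory.quotientCompQhIso C).inv.app L) e).trans h2)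

/-- The morphisms from an object in a single degree to a K-injective complex with only one term
to which there are nonzero morphisms. -/
theorem single_Q_bijective {Z : C} {L : CochainComplex C ℤ} [L.IsKInjective] {j : ℤ}
    (h : ∀ i, i ≠ j → ∀ f : Z ⟶ L.X i, f = 0) :
    Function.Bijective (fun φ => DerivedCategory.Q.map (fromSingle j h φ)) := by
  have h1 : Function.Bijective (fromSingle j h) := by
    refine ⟨fun a b e => ?_, fun f => ⟨(singleXSelf j Z).inv ≫ f.f j,
      single_hom_ext (fromSingle_f _ _ _)⟩⟩
    rw [← fromSingle_f j h a, e, fromSingle_f]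
  exact (Q_map_bijective _ L (single_homotopy_eq h)).comp h1

/-- A morphism from an object in degree `j` is represented by a chain map, which is determined by
its component in degree `j`. Here only that term of `L` matters. -/
theorem single_Q_eq_zero {Z : C} {L : CochainComplex C ℤ} [L.IsKInjective] {j : ℤ}
    (h : ∀ f : Z ⟶ L.X j, f = 0)
    (g : DerivedCategory.Q.obj ((CochainComplex.singleFunctor C j).obj Z) ⟶
      DerivedCategory.Q.obj L) : g = 0 := by
  obtain ⟨f, rfl⟩ := Q_map_surjective _ L g
  have : f = 0 := single_hom_ext ((h _).trans ((h _)).symm)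
  rw [this, Functor.map_zero]

end KInjective

/-! ### A criterion for an equivalence -/

section Criterion

open DerivedCategory.TStructure

universe w w' v v' u u'

variable {C : Type u} [Category.{v} C] [Abelian C] [HasDerivedCategory.{w} C]

def projSingleMap {P P' : C} [Projective P] [Projective P'] (α : P ⟶ P') :
    projSingle P ⟶ projSingle P' :=
  ObjectProperty.homMk ((CochainComplex.singleFunctor C 0).map α)

theorem projSingleIso_naturality {P P' : C} [Projective P] [Projective P'] (α : P ⟶ P') :
    (Db.ofProj C).map (projSingleMap α) ≫ (projSingleIso P').hom =
      (projSingleIso P).hom ≫ (Db.single C).map α :=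
  ObjectProperty.hom_ext _ ((DerivedCategory.singleFunctorIsoCompQ C 0).symm.hom.naturality α)

/-- The complex of `P` in degree `0` is K-projective, so the morphism lifts to a chain map, and the
target is zero in degree `0`. -/
theorem projective_single_eq_zero {P X : C} [Projective P] {n : ℤ} (hn : n ≠ 0)
    (f : (Db.single C).obj P ⟶ ((Db.single C).obj X)⟦n⟧) : f = 0 := by
  let e : ((Db.single C).obj X)⟦n⟧.obj ≅
      DerivedCategory.Q.obj ((CochainComplex.singleFunctor C (-n)).obj X) :=
    ((Db.ι C).commShiftIso n).app ((Db.single C).obj X) ≪≫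
      ((DerivedCategory.singleFunctors C).shiftIso n (-n) 0 (by lia)).app X ≪≫
      (DerivedCategory.singleFunctorIsoCompQ C (-n)).app X
  let K := (CochainComplex.singleFunctor C 0).obj P
  let e' : ((Db.single C).obj P).obj ≅ DerivedCategory.Q.obj K :=
    (DerivedCategory.singleFunctorIsoCompQ C 0).app P
  let L := (CochainComplex.singleFunctor C (-n)).obj X
  have := (projSingle P).property.2.2
  have : (projSingle P).obj.IsStrictlyLE 0 := inferInstanceAs (((CochainComplex.singleFunctor C 0).obj P).IsStrictlyLE 0)
  have : K.IsKProjective :=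
    CochainComplex.isKProjective_of_projective (projSingle P).obj 0
  obtain ⟨g, hg⟩ := (CochainComplex.IsKProjective.Qh_map_bijective K ((HomotopyCategory.quotient C (.up ℤ)).obj L)).2
    ((DerivedCategory.quotientCompQhIso C).hom.app K ≫ (e'.inv ≫ f.hom ≫ e.hom) ≫
      (DerivedCategory.quotientCompQhIso C).inv.app L)
  obtain ⟨g, rfl⟩ := (HomotopyCategory.quotient C (.up ℤ)).map_surjective g
  have hg0 : g = 0 := single_hom_ext
    ((HomologicalComplex.isZero_single_obj_X (.up ℤ) (-n) X 0 (by lia)).eq_of_tgt _ _)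
  rw [hg0, Functor.map_zero, Functor.map_zero] at hg
  have h1 : e'.inv ≫ f.hom ≫ e.hom = 0 := by
    rw [← cancel_epi ((DerivedCategory.quotientCompQhIso C).hom.app K),
      ← cancel_mono ((DerivedCategory.quotientCompQhIso C).inv.app L), Category.assoc, ← hg]
    simp
  have h2 : f.hom = 0 := by
    rw [← cancel_epi e'.inv, ← cancel_mono e.hom, Category.assoc, h1]
    simp
  exact ObjectProperty.hom_ext _ h2

variable {E : Type u'} [Category.{v'} E] [Abelian E]
  [HasCoproducts.{0} E] (k : C ⥤ CochainComplex E ℤ) [k.Additive] (Q : ObjectProperty E)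
  [Q.IsSerreClass] [Q.IsClosedUnderFiniteProducts] [HasDerivedCategory.{w'} Q.FullSubcategory]
  (hk : ∀ K n, Q (((totalization k).obj K).X n)) (hk' : ∀ X n, Q ((k.obj X).X n))
  {K : Db C ⥤ Db Q.FullSubcategory}
  (i : Db.ofProj C ⋙ K ⋙ Db.ι Q.FullSubcategory ≅
    (boundedProj C).ι ⋙ totalizationQ k Q hk ⋙ DerivedCategory.Q)

variable {k Q hk} in
/-- The value on a projective object of a functor that is computed by total complexes. -/
def projSingleDerived (P : C) [Projective P] : (K.obj ((Db.single C).obj P)).obj ≅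
    DerivedCategory.Q.obj ((liftComplex Q k hk').obj P) :=
  (Db.ι Q.FullSubcategory).mapIso (K.mapIso (projSingleIso P).symm) ≪≫ i.app (projSingle P) ≪≫
    DerivedCategory.Q.mapIso ((totalizationQSingle k Q hk hk').symm.app P)

variable {k Q hk} in
-- Makes the effect of `K` on morphisms of projective objects explicit: up to the chosen
-- identifications it is the chain map `k α`.
theorem projSingleDerived_naturality {P P' : C} [Projective P] [Projective P'] (α : P ⟶ P') :
    (K.map ((Db.single C).map α)).hom ≫ (projSingleDerived hk' i P').hom =
      (projSingleDerived hk' i P).hom ≫ DerivedCategory.Q.map ((liftComplex Q k hk').map α) := by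
  have h1 : (Db.single C).map α ≫ (projSingleIso P').inv =
      (projSingleIso P).inv ≫ (Db.ofProj C).map (projSingleMap α) := by
    rw [Iso.comp_inv_eq, Category.assoc, projSingleIso_naturality, Iso.inv_hom_id_assoc]
  have h2 : (K.map ((Db.single C).map α)).hom ≫ (K.map (projSingleIso P').inv).hom =
      (K.map (projSingleIso P).inv).hom ≫ (K.map ((Db.ofProj C).map (projSingleMap α))).hom := by
    have := congrArg (fun a => (K.map a).hom) h1
    simpa using this
  have h3 : (K.map ((Db.ofProj C).map (projSingleMap α))).hom ≫ i.hom.app (projSingle P') =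
      i.hom.app (projSingle P) ≫ DerivedCategory.Q.map ((totalizationQ k Q hk).map
        ((CochainComplex.singleFunctor C 0).map α)) := i.hom.naturality (projSingleMap α)
  have h4 : DerivedCategory.Q.map ((totalizationQ k Q hk).map
        ((CochainComplex.singleFunctor C 0).map α)) ≫
      DerivedCategory.Q.map ((totalizationQSingle k Q hk hk').inv.app P') =
      DerivedCategory.Q.map ((totalizationQSingle k Q hk hk').inv.app P) ≫
        DerivedCategory.Q.map ((liftComplex Q k hk').map α) := by
    have := (totalizationQSingle k Q hk hk').inv.naturality α
    refine (DerivedCategory.Q.map_comp _ _).symm.trans ?_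
    exact (congrArg _ this).trans (DerivedCategory.Q.map_comp _ _)
  change _ ≫ (K.map (projSingleIso P').inv).hom ≫ i.hom.app (projSingle P') ≫
    DerivedCategory.Q.map ((totalizationQSingle k Q hk hk').inv.app P') =
    ((K.map (projSingleIso P).inv).hom ≫ i.hom.app (projSingle P) ≫
    DerivedCategory.Q.map ((totalizationQSingle k Q hk hk').inv.app P)) ≫ _
  refine (Category.assoc _ _ _).symm.trans ((congrArg (fun a => a ≫ _) h2).trans ?_)
  rw [Category.assoc, Category.assoc, Category.assoc]
  refine congrArg _ ((Category.assoc _ _ _).symm.trans ((congrArg (fun a => a ≫ _) h3).trans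
    ((Category.assoc _ _ _).trans (congrArg _ h4))))

variable [K.CommShift ℤ] [K.IsTriangulated]

variable {k Q hk} in
/-- If `k P` is a resolution of an object `Z`, up to a shift, and if only one term of `k P'`, which
consists of injective objects, receives nonzero morphisms from `Z`, then the bijectivity of the
functor on the morphisms from `P` to `P'` in all degrees reduces to the one of a map to the
morphisms from `Z` to this term. -/
theorem homBij_of_resolution (i : Db.ofProj C ⋙ K ⋙ Db.ι Q.FullSubcategory ≅
      (boundedProj C).ι ⋙ totalizationQ k Q hk ⋙ DerivedCategory.Q) {P P' : C} [Projective P] [Projective P'] {Z : Q.FullSubcategory}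
    {j : ℤ} (w : (CochainComplex.singleFunctor _ j).obj Z ⟶ (liftComplex Q k hk').obj P)
    [QuasiIso w] [((liftComplex Q k hk').obj P').IsKInjective]
    (h : ∀ i, i ≠ j → ∀ f : Z ⟶ ((liftComplex Q k hk').obj P').X i, f = 0)
    (hb : Function.Bijective fun α : P ⟶ P' =>
      (singleXSelf j Z).inv ≫ w.f j ≫ ((liftComplex Q k hk').map α).f j) (n : ℤ) :
    HomBij K ((Db.single C).obj P) (((Db.single C).obj P')⟦n⟧) := by
  let L := (liftComplex Q k hk').obj P
  let L' := (liftComplex Q k hk').obj P'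
  have hw : IsIso (DerivedCategory.Q.map w) := (DerivedCategory.isIso_Q_map_iff_quasiIso _ w).2 ‹_›
  by_cases hn : n = 0
  · subst hn
    refine HomBij.of_iso (Y := (Db.single C).obj P') ?_ (Iso.refl _)
      ((shiftFunctorZero (Db C) ℤ).symm.app _)
    have h1 : Function.Bijective ((Db.single C).map : (P ⟶ P') → _) := by
      constructor
      · intro a b e
        exact (DerivedCategory.singleFunctor C 0).map_injective (congrArg (fun a => a.hom) e)
      · intro g
        obtain ⟨a, ha⟩ := (DerivedCategory.singleFunctor C 0).map_surjective g.hom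
        exact ⟨a, ObjectProperty.hom_ext _ ha⟩
    -- Replaces the source by `Z` along the resolution `w`, and the target by `k P'`. All the maps
    -- involved are isomorphisms in the derived category.
    let r : (K.obj ((Db.single C).obj P) ⟶ K.obj ((Db.single C).obj P')) →
        (DerivedCategory.Q.obj ((CochainComplex.singleFunctor _ j).obj Z) ⟶
          DerivedCategory.Q.obj L') :=
      fun g => DerivedCategory.Q.map w ≫ (projSingleDerived hk' i P).inv ≫ g.hom ≫
        (projSingleDerived hk' i P').hom
    have hr : Function.Bijective r := by
      constructor
      · intro a b e
        refine ObjectProperty.hom_ext _ ?_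
        have e : DerivedCategory.Q.map w ≫ (projSingleDerived hk' i P).inv ≫ a.hom ≫
          (projSingleDerived hk' i P').hom = DerivedCategory.Q.map w ≫
          (projSingleDerived hk' i P).inv ≫ b.hom ≫ (projSingleDerived hk' i P').hom := e
        rwa [cancel_epi, cancel_epi, cancel_mono] at e
      · intro g
        refine ⟨ObjectProperty.homMk ((projSingleDerived hk' i P).hom ≫
          inv (DerivedCategory.Q.map w) ≫ g ≫ (projSingleDerived hk' i P').inv), ?_⟩
        change DerivedCategory.Q.map w ≫ (projSingleDerived hk' i P).inv ≫
          ((projSingleDerived hk' i P).hom ≫ inv (DerivedCategory.Q.map w) ≫ g ≫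
            (projSingleDerived hk' i P').inv) ≫ (projSingleDerived hk' i P').hom = g
        simp
    have key : r ∘ K.map ∘ (Db.single C).map = (fun φ => DerivedCategory.Q.map
        (fromSingle j h φ)) ∘ fun α : P ⟶ P' =>
          (singleXSelf j Z).inv ≫ w.f j ≫ ((liftComplex Q k hk').map α).f j := by
      funext α
      change DerivedCategory.Q.map w ≫ (projSingleDerived hk' i P).inv ≫
        (K.map ((Db.single C).map α)).hom ≫ (projSingleDerived hk' i P').hom = _
      rw [projSingleDerived_naturality, Iso.inv_hom_id_assoc]
      refine (DerivedCategory.Q.map_comp _ _).symm.trans (congrArg _ ?_)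
      refine single_hom_ext ?_
      exact (fromSingle_f _ _ _).symm
    have h2 : Function.Bijective (r ∘ K.map ∘ (Db.single C).map : (P ⟶ P') → _) := by
      rw [key]
      exact (single_Q_bijective h).comp hb
    exact (Function.Bijective.of_comp_iff _ h1).1 ((Function.Bijective.of_comp_iff' hr _).1 h2)
  -- For `n ≠ 0` both sides vanish. On the side of `K`, a morphism from `Z` in degree `j` meets the
  -- term of degree `j + n ≠ j` of `k P'`, which receives none.
  · have h0 : ∀ g : K.obj ((Db.single C).obj P) ⟶ K.obj (((Db.single C).obj P')⟦n⟧), g = 0 := by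
      intro g
      let e : (K.obj (((Db.single C).obj P')⟦n⟧)).obj ≅ DerivedCategory.Q.obj (L'⟦n⟧) :=
        (Db.ι _).mapIso ((K.commShiftIso n).app _) ≪≫ ((Db.ι _).commShiftIso n).app _ ≪≫
          (shiftFunctor _ n).mapIso (projSingleDerived hk' i P') ≪≫
          (DerivedCategory.Q.commShiftIso n).symm.app L'
      have h1 : DerivedCategory.Q.map w ≫ (projSingleDerived hk' i P).inv ≫ g.hom ≫ e.hom = 0 :=
        single_Q_eq_zero (L := L'⟦n⟧) (h (j + n) (by lia)) _
      have h2 : g.hom = 0 := by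
        rw [← cancel_mono e.hom, ← cancel_epi (projSingleDerived hk' i P).inv,
          ← cancel_epi (DerivedCategory.Q.map w), h1]
        simp
      exact ObjectProperty.hom_ext _ h2
    exact ⟨fun f g _ => (projective_single_eq_zero hn f).trans
      (projective_single_eq_zero hn g).symm, fun g => ⟨0, (h0 _).trans (h0 _).symm⟩⟩

variable {k Q hk} in
/-- The value on a projective object `P` if `k P` is a resolution of an object `Z` up to a shift. -/
def derivedSingleIso {P : C} [Projective P] {Z : Q.FullSubcategory}
    {j d : ℤ} (hd : j + d = 0)
    (w : (CochainComplex.singleFunctor _ j).obj Z ⟶ (liftComplex Q k hk').obj P)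
    [hw : QuasiIso w] : K.obj ((Db.single C).obj P) ≅ ((Db.single _).obj Z)⟦d⟧ :=
  have : IsIso (DerivedCategory.Q.map w) := (DerivedCategory.isIso_Q_map_iff_quasiIso _ w).2 hw
  (t (C := Q.FullSubcategory)).bounded.isoMk
    (projSingleDerived hk' i P ≪≫ (asIso (DerivedCategory.Q.map w)).symm ≪≫
      ((DerivedCategory.singleFunctorIsoCompQ _ j).symm.app Z) ≪≫
      ((DerivedCategory.singleFunctors _).shiftIso d j 0 (by lia)).symm.app Z ≪≫
      ((Db.ι _).commShiftIso d).symm.app ((Db.single _).obj Z))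

end Criterion

/-! ### Functors on a preorder given by the indicator of a convex subset -/

section Indicator

variable {J : Type} [Preorder J]

theorem map_map_apply (F : J ⥤ ModuleCat.{0} ℂ) {x y z : J} (f : x ⟶ y) (g : y ⟶ z) (h : x ⟶ z)
    (a : F.obj x) : (F.map g).hom ((F.map f).hom a) = (F.map h).hom a := by
  rw [← LinearMap.comp_apply, ← ModuleCat.hom_comp, ← F.map_comp]
  rfl

theorem map_self_apply (F : J ⥤ ModuleCat.{0} ℂ) {x : J} (f : x ⟶ x) (a : F.obj x) :
    (F.map f).hom a = a := by
  rw [show f = 𝟙 x from rfl, F.map_id]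
  rfl

/-- Evaluation functors are exact and jointly detect zero objects, so exactness is tested on
homology at each index. -/
theorem shortExact_of_pointwise (T : ShortComplex (J ⥤ ModuleCat.{0} ℂ))
    (h₁ : ∀ x, Function.Injective (T.f.app x).hom)
    (h₂ : ∀ x, Function.Exact (T.f.app x).hom (T.g.app x).hom)
    (h₃ : ∀ x, Function.Surjective (T.g.app x).hom) : T.ShortExact where
  mono_f := by
    have : ∀ x, Mono (T.f.app x) := fun x => (ModuleCat.mono_iff_injective _).2 (h₁ x)
    exact NatTrans.mono_of_mono_app _
  epi_g := by
    have : ∀ x, Epi (T.g.app x) := fun x => (ModuleCat.epi_iff_surjective _).2 (h₃ x)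
    exact NatTrans.epi_of_epi_app _
  exact := by
    rw [ShortComplex.exact_iff_isZero_homology, Functor.isZero_iff]
    intro x
    refine IsZero.of_iso ?_ (T.mapHomologyIso ((evaluation J (ModuleCat.{0} ℂ)).obj x)).symm
    rw [← ShortComplex.exact_iff_isZero_homology]
    exact (ShortComplex.ShortExact.moduleCat_exact_iff_function_exact
      (T.map ((evaluation J (ModuleCat.{0} ℂ)).obj x))).2 (h₂ x)

variable (Z Z' : Set J) [Z.OrdConnected] [Z'.OrdConnected]

/-- The functor which is the field on the convex subset `Z`, with identity transition maps, and
zero elsewhere. -/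
def ind : J ⥤ ModuleCat.{0} ℂ where
  obj x := ModuleCat.of ℂ (PLift (x ∈ Z) → ℂ)
  map {x y} f := ModuleCat.ofHom (LinearMap.pi fun _ =>
    if h : x ∈ Z then LinearMap.proj ⟨h⟩ else 0)
  map_id x := ModuleCat.hom_ext <| LinearMap.ext fun φ => funext fun h => by
    simp [h.down]
  map_comp {x y z} f g := ModuleCat.hom_ext <| LinearMap.ext fun φ => funext fun h => by
    by_cases hx : x ∈ Z
    · have hy : y ∈ Z := Set.OrdConnected.out ‹_› hx h.down ⟨leOfHom f, leOfHom g⟩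
      simp [hx, hy]
    · by_cases hy : y ∈ Z <;> simp [hx, hy]

/-- The constant section `c` of the indicator functor. -/
def indVal (x : J) (c : ℂ) : (ind Z).obj x := fun _ => c

/-- The scalar for an element of the indicator functor. -/
def indCoe {x : J} (hx : x ∈ Z) : (ind Z).obj x →ₗ[ℂ] ℂ :=
  LinearMap.proj (R := ℂ) (φ := fun _ : PLift (x ∈ Z) => ℂ) ⟨hx⟩

variable {Z Z'}

theorem indCoe_indVal {x : J} (hx : x ∈ Z) (c : ℂ) : indCoe Z hx (indVal Z x c) = c := rfl

theorem indVal_indCoe {x : J} (hx : x ∈ Z) (φ : (ind Z).obj x) :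
    indVal Z x (indCoe Z hx φ) = φ := rfl

theorem ind_eq {x : J} {φ ψ : (ind Z).obj x} (h : ∀ hx, indCoe Z hx φ = indCoe Z hx ψ) : φ = ψ :=
  funext fun hx => h hx.down

theorem ind_eq_of_notMem {x : J} (h : x ∉ Z) (φ ψ : (ind Z).obj x) : φ = ψ :=
  ind_eq fun hx => absurd hx h

theorem smul_indVal (x : J) (c d : ℂ) : c • indVal Z x d = indVal Z x (c * d) := rfl

theorem ind_map {x y : J} (f : x ⟶ y) (hx : x ∈ Z) (c : ℂ) :
    ((ind Z).map f).hom (indVal Z x c) = indVal Z y c := funext fun h => by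
  simp [ind, indVal, hx]
  rfl

theorem ind_map_of_notMem {x y : J} (f : x ⟶ y) (hx : x ∉ Z) (φ : (ind Z).obj x) :
    ((ind Z).map f).hom φ = 0 := by
  rw [ind_eq_of_notMem hx φ 0, map_zero]

variable {F G : J ⥤ ModuleCat.{0} ℂ}

/-- A morphism from an indicator functor, given by compatible elements. -/
def fromInd (Z : Set J) [Z.OrdConnected] (F : J ⥤ ModuleCat.{0} ℂ) (v : ∀ x, F.obj x)
    (h : ∀ (x y : J) (f : x ⟶ y), x ∈ Z → (F.map f).hom (v x) = if y ∈ Z then v y else 0) :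
    ind Z ⟶ F where
  app x := ModuleCat.ofHom (if hx : x ∈ Z then (indCoe Z hx).smulRight (v x) else 0)
  naturality x y f := ModuleCat.hom_ext <| LinearMap.ext fun φ => by
    change (if hy : y ∈ Z then (indCoe Z hy).smulRight (v y) else 0) (((ind Z).map f).hom φ) =
      (F.map f).hom ((if hx : x ∈ Z then (indCoe Z hx).smulRight (v x) else 0) φ)
    by_cases hx : x ∈ Z
    · obtain ⟨c, rfl⟩ : ∃ c, φ = indVal Z x c := ⟨_, (indVal_indCoe hx φ).symm⟩
      rw [dif_pos hx, ind_map f hx]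
      change _ = (F.map f).hom (c • v x)
      rw [map_smul, h x y f hx]
      by_cases hy : y ∈ Z
      · rw [dif_pos hy, if_pos hy]
        rfl
      · rw [dif_neg hy, if_neg hy, smul_zero]
        rfl
    · rw [ind_map_of_notMem f hx, dif_neg hx, LinearMap.zero_apply, map_zero, map_zero]

theorem fromInd_indVal {v : ∀ x, F.obj x}
    {h : ∀ (x y : J) (f : x ⟶ y), x ∈ Z → (F.map f).hom (v x) = if y ∈ Z then v y else 0}
    {x : J} (hx : x ∈ Z) (c : ℂ) : ((fromInd Z F v h).app x).hom (indVal Z x c) = c • v x := by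
  change (if hx : x ∈ Z then (indCoe Z hx).smulRight (v x) else 0) (indVal Z x c) = _
  rw [dif_pos hx]
  rfl

theorem ind_hom_ext {f g : ind Z ⟶ F}
    (h : ∀ x, x ∈ Z → (f.app x).hom (indVal Z x 1) = (g.app x).hom (indVal Z x 1)) : f = g := by
  ext x φ
  by_cases hx : x ∈ Z
  · have e : φ = indCoe Z hx φ • indVal Z x 1 := by
      rw [smul_indVal, mul_one, indVal_indCoe]
    rw [e, map_smul, map_smul, h x hx]
  · rw [ind_eq_of_notMem hx φ 0, map_zero, map_zero]

theorem ind_hom_injective {f : ind Z ⟶ F}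
    (h : ∀ x, x ∈ Z → (f.app x).hom (indVal Z x 1) ≠ 0) (x : J) :
    Function.Injective (f.app x).hom := by
  refine (injective_iff_map_eq_zero _).2 fun φ hφ => ind_eq fun hx => ?_
  have e : φ = indCoe Z hx φ • indVal Z x 1 := by
    rw [smul_indVal, mul_one, indVal_indCoe]
  rw [e, map_smul, smul_eq_zero] at hφ
  rw [map_zero]
  exact hφ.resolve_right (h x hx)

theorem mono_of_injective {f : F ⟶ G} (h : ∀ x, Function.Injective (f.app x).hom) : Mono f := by
  have : ∀ x, Mono (f.app x) := fun x => (ModuleCat.mono_iff_injective _).2 (h x)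
  exact NatTrans.mono_of_mono_app _

/-- The morphism between indicator functors which is the identity on the intersection. -/
def indMap (Z Z' : Set J) [Z.OrdConnected] [Z'.OrdConnected]
    (h : ∀ x y, x ≤ y → x ∈ Z → y ∈ Z' → (x ∈ Z' ↔ y ∈ Z)) : ind Z ⟶ ind Z' :=
  fromInd Z (ind Z') (fun x => indVal Z' x 1) fun x y f hx => by
    by_cases hy' : y ∈ Z'
    · have := h x y (leOfHom f) hx hy'
      by_cases hx' : x ∈ Z'
      · rw [ind_map f hx', if_pos (this.1 hx')]
      · rw [ind_map_of_notMem f hx', if_neg fun hy => hx' (this.2 hy)]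
    · exact ind_eq_of_notMem hy' _ _

theorem indMap_indVal {h : ∀ x y, x ≤ y → x ∈ Z → y ∈ Z' → (x ∈ Z' ↔ y ∈ Z)} {x : J} (hx : x ∈ Z)
    (c : ℂ) : ((indMap Z Z' h).app x).hom (indVal Z x c) = indVal Z' x c := by
  refine (fromInd_indVal hx c).trans ?_
  rw [smul_indVal, mul_one]

/-- An upward closed part of `Z` is stable under the transition maps and gives a subfunctor. The
quotient is supported on the complement. All the exact sequences of indicator sheaves come from such
decompositions. -/
theorem ind_shortExact {A B : Set J} [A.OrdConnected] [B.OrdConnected] (hZ : A ∪ B = Z)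
    (hd : Disjoint A B) (hA : ∀ x y, x ≤ y → x ∈ A → y ∈ Z → y ∈ A) :
    ∃ (f : ind A ⟶ ind Z) (g : ind Z ⟶ ind B) (w : f ≫ g = 0),
      (ShortComplex.mk f g w).ShortExact := by
  have hAZ : ∀ x, x ∈ A → x ∈ Z := fun x hx => hZ ▸ Or.inl hx
  have hBZ : ∀ x, x ∈ B → x ∈ Z := fun x hx => hZ ▸ Or.inr hx
  have hAB : ∀ x, x ∈ A → x ∉ B := fun x hx hx' => Set.disjoint_left.1 hd hx hx'
  have hZ' : ∀ x, x ∈ Z → x ∈ A ∨ x ∈ B := fun x hx => by rwa [← hZ] at hx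
  let f := indMap A Z fun x y h hx hy => ⟨fun _ => hA x y h hx hy, fun _ => hAZ x hx⟩
  let g := indMap Z B fun x y h hx hy => ⟨fun _ => hBZ y hy, fun _ => (hZ' x hx).resolve_left
    fun h' => hAB y (hA x y h h' (hBZ y hy)) hy⟩
  have hf : ∀ x, x ∈ A → ∀ c, (f.app x).hom (indVal A x c) = indVal Z x c :=
    fun x hx c => indMap_indVal hx c
  have hg : ∀ x, x ∈ Z → ∀ c, (g.app x).hom (indVal Z x c) = indVal B x c :=
    fun x hx c => indMap_indVal hx c
  have w : f ≫ g = 0 := ind_hom_ext fun x hx => by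
    change (g.app x).hom ((f.app x).hom _) = 0
    rw [hf x hx, hg x (hAZ x hx)]
    exact ind_eq_of_notMem (hAB x hx) _ _
  refine ⟨f, g, w, shortExact_of_pointwise _ (ind_hom_injective fun x hx h => ?_) (fun x φ => ?_)
    fun x φ => ?_⟩
  · change (f.app x).hom _ = 0 at h
    rw [hf x hx] at h
    exact one_ne_zero (congrArg (indCoe Z (hAZ x hx)) h)
  · change (g.app x).hom φ = 0 ↔ φ ∈ Set.range (f.app x).hom
    constructor
    · intro h
      by_cases hx : x ∈ A
      · exact ⟨indVal A x (indCoe Z (hAZ x hx) φ), (hf x hx _).trans (indVal_indCoe _ _)⟩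
      · refine ⟨0, (map_zero _).trans (ind_eq fun hxZ => ?_)⟩
        have hB := (hZ' x hxZ).resolve_left hx
        rw [← indVal_indCoe hxZ φ, hg x hxZ] at h
        rw [map_zero]
        exact (congrArg (indCoe B hB) h).symm
    · rintro ⟨φ, rfl⟩
      exact congrArg (fun a => (a.app x).hom φ) w
  · by_cases hx : x ∈ B
    · exact ⟨indVal Z x (indCoe B hx φ), (hg x (hBZ x hx) _).trans (indVal_indCoe _ _)⟩
    · exact ⟨0, ind_eq_of_notMem hx _ _⟩

/-- The functor represented by an element, linearized. -/
abbrev free (y : J) : J ⥤ ModuleCat.{0} ℂ := ind (Set.Ici y)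

/-- The Yoneda lemma: the morphism from a free functor given by an element. -/
def fromFree {y : J} (a : F.obj y) : free y ⟶ F :=
  fromInd (Set.Ici y) F (fun x => if h : y ≤ x then (F.map (homOfLE h)).hom a else 0)
    fun x z f hx => by
      have hx : y ≤ x := hx
      have hz : y ≤ z := hx.trans (leOfHom f)
      rw [dif_pos hx, if_pos (show z ∈ Set.Ici y from hz), dif_pos hz]
      exact map_map_apply F _ _ _ a

theorem fromFree_apply {y x : J} (a : F.obj y) (f : y ⟶ x) (c : ℂ) :
    ((fromFree a).app x).hom (indVal (Set.Ici y) x c) = c • (F.map f).hom a := by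
  refine (fromInd_indVal (show x ∈ Set.Ici y from leOfHom f) c).trans ?_
  rw [dif_pos (leOfHom f)]
  rfl

theorem fromFree_self {y : J} (a : F.obj y) :
    ((fromFree a).app y).hom (indVal (Set.Ici y) y 1) = a := by
  rw [fromFree_apply a (𝟙 y), one_smul, map_self_apply]

theorem free_hom_ext {y : J} {f g : free y ⟶ F}
    (h : (f.app y).hom (indVal (Set.Ici y) y 1) = (g.app y).hom (indVal (Set.Ici y) y 1)) :
    f = g := by
  refine ind_hom_ext fun x hx => ?_
  have e : ∀ f : free y ⟶ F, (f.app x).hom (indVal (Set.Ici y) x 1) =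
      (F.map (homOfLE (show y ≤ x from hx))).hom
        ((f.app y).hom (indVal (Set.Ici y) y 1)) := fun f => by
    rw [← ind_map (Z := Set.Ici y) (homOfLE (show y ≤ x from hx)) (le_refl y), ← LinearMap.comp_apply,
      ← LinearMap.comp_apply, ← ModuleCat.hom_comp, ← ModuleCat.hom_comp, f.naturality]
  rw [e, e, h]

theorem fromFree_comp {y : J} (a : F.obj y) (g : F ⟶ G) :
    fromFree a ≫ g = fromFree ((g.app y).hom a) := free_hom_ext (by
  change (g.app y).hom (((fromFree a).app y).hom _) = _
  rw [fromFree_self, fromFree_self])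

/-- By Yoneda a morphism from `free y` is an element at `y`, and epimorphisms are surjective there.
-/
instance free_projective (y : J) : Projective (free y) where
  factors {E X} f e _ := by
    have : Epi (e.app y) := inferInstance
    obtain ⟨a, ha⟩ := (ModuleCat.epi_iff_surjective _).1 this ((f.app y).hom (indVal _ y 1))
    exact ⟨fromFree a, free_hom_ext (by
      rw [fromFree_comp, fromFree_self, ha])⟩

end Indicator

/-! ### Coordinates of the weights of the sheaf of algebras `ℬ` -/

namespace SmoothFan

variable {N : Type} [AddCommGroup N] {Δ : SmoothFan N}

/-- The value of a weight in `M_σ = M / (M ∩ σ^⊥)` on a ray of `σ`. -/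
def coord {σ : Δ.Cone} (m : Δ.B.wt σ) (v : N) : ℤ :=
  (Quotient.out (s := QuotientAddGroup.leftRel (perp σ)) m : N →ₗ[ℤ] ℤ) v

/-- The value of a character on a lattice vector. -/
def charVal {σ : Δ.Cone} (m : Δ.A.wt σ) (v : N) : ℤ :=
  let m' : N →ₗ[ℤ] ℤ := m
  m' v

/-- Two representatives of a weight differ by an element of `σ^⊥`, which vanishes on the rays of
`σ`. The value on such a ray is therefore independent of the representative chosen by `coord`. -/
theorem coord_mk {σ : Δ.Cone} (m : Δ.A.wt σ) {v : N} (hv : v ∈ σ.1) :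
    coord (Δ.δ.hom σ m) v = charVal m v := by
  let m' : N →ₗ[ℤ] ℤ := m
  have h : -m' + Quotient.out (s := QuotientAddGroup.leftRel (perp σ)) (Δ.δ.hom σ m') ∈ perp σ :=
    QuotientAddGroup.eq.1 (Quotient.out_eq (s := QuotientAddGroup.leftRel (perp σ))
      (Δ.δ.hom σ m')).symm
  have h1 : (-m' + Quotient.out (s := QuotientAddGroup.leftRel (perp σ)) (Δ.δ.hom σ m')) v = 0 :=
    h v hv
  rw [LinearMap.add_apply, LinearMap.neg_apply] at h1
  have h2 : coord (Δ.δ.hom σ m) v =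
    (Quotient.out (s := QuotientAddGroup.leftRel (perp σ)) (Δ.δ.hom σ m') : N →ₗ[ℤ] ℤ) v := rfl
  have h3 : charVal m v = m' v := rfl
  lia

theorem coord_res {σ τ : Δ.Cone} (h : τ ≤ σ) (m : Δ.B.wt σ) {v : N} (hv : v ∈ τ.1) :
    coord (Δ.B.res h m) v = coord m v := by
  obtain ⟨m, rfl⟩ := Δ.δ.surj σ m
  rw [Δ.δ.res_hom, coord_mk _ hv, coord_mk _ (h hv)]
  rfl

theorem coord_add {σ : Δ.Cone} (m m' : Δ.B.wt σ) {v : N} (hv : v ∈ σ.1) :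
    coord (m + m') v = coord m v + coord m' v := by
  obtain ⟨m, rfl⟩ := Δ.δ.surj σ m
  obtain ⟨m', rfl⟩ := Δ.δ.surj σ m'
  rw [← map_add, coord_mk _ hv, coord_mk _ hv, coord_mk _ hv]
  rfl

theorem coord_neg {σ : Δ.Cone} (m : Δ.B.wt σ) {v : N} (hv : v ∈ σ.1) :
    coord (-m) v = -coord m v := by
  obtain ⟨m, rfl⟩ := Δ.δ.surj σ m
  rw [← map_neg, coord_mk _ hv, coord_mk _ hv]
  rfl

theorem mem_mon_iff {σ : Δ.Cone} (m : Δ.B.wt σ) : m ∈ Δ.B.mon σ ↔ ∀ v ∈ σ.1, 0 ≤ coord m v := by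
  obtain ⟨m, rfl⟩ := Δ.δ.surj σ m
  rw [Δ.δ.mem_iff]
  change (∀ v ∈ σ.1, 0 ≤ charVal m v) ↔ _
  exact forall₂_congr fun v hv => by rw [coord_mk _ hv]

theorem coord_ext {σ : Δ.Cone} {m m' : Δ.B.wt σ} (h : ∀ v ∈ σ.1, coord m v = coord m' v) :
    m = m' := by
  have h1 : ∀ v ∈ σ.1, coord (m - m') v = 0 := fun v hv => by
    rw [sub_eq_add_neg, coord_add _ _ hv, coord_neg _ hv, h v hv, add_neg_cancel]
  rw [← sub_eq_zero]
  generalize m - m' = k at h1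
  obtain ⟨k, rfl⟩ := Δ.δ.surj σ k
  refine (QuotientAddGroup.eq_zero_iff (N := perp σ) (k : N →ₗ[ℤ] ℤ)).2 fun v hv => ?_
  have := h1 v hv
  rwa [coord_mk _ hv] at this

variable (Δ) in
-- Smoothness enters here: the rays are part of a basis of the lattice, so a character may be
-- prescribed freely on them. With `coord_ext`, weights at `σ` are exactly integer tuples indexed by
-- the rays.
theorem exists_coord (σ : Δ.Cone) (f : N → ℤ) : ∃ m : Δ.B.wt σ, ∀ v ∈ σ.1, coord m v = f v := by
  obtain ⟨ι, b, hb⟩ := Δ.smooth σ.1 σ.2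
  let m : N →ₗ[ℤ] ℤ := b.constr ℤ fun i => f (b i)
  refine ⟨Δ.δ.hom σ m, fun v hv => ?_⟩
  refine (coord_mk _ hv).trans ?_
  obtain ⟨i, rfl⟩ := hb hv
  exact b.constr_basis ℤ _ i

/-- The order in coordinates: going up means passing to a face and increasing the remaining
coordinates. Coordinates outside the smaller cone are forgotten. -/
theorem sh_le_iff {x y : Δ.B.ShIdx} :
    x ≤ y ↔ y.cone ≤ x.cone ∧ ∀ v ∈ y.cone.1, coord x.deg v ≤ coord y.deg v := by
  have key : ∀ h : y.cone ≤ x.cone, y.deg - Δ.B.res h x.deg ∈ Δ.B.mon y.cone ↔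
      ∀ v ∈ y.cone.1, coord x.deg v ≤ coord y.deg v := fun h => by
    rw [mem_mon_iff]
    refine forall₂_congr fun v hv => ?_
    rw [sub_eq_add_neg, coord_add _ _ hv, coord_neg _ hv, coord_res _ _ hv]
    lia
  exact ⟨fun ⟨h, h'⟩ => ⟨h, (key h).1 h'⟩, fun ⟨h, h'⟩ => ⟨h, (key h).2 h'⟩⟩

theorem cosh_le_iff {x y : Δ.B.CoshIdx} :
    x ≤ y ↔ x.cone ≤ y.cone ∧ ∀ v ∈ x.cone.1, coord x.deg v ≤ coord y.deg v := by
  have key : ∀ h : x.cone ≤ y.cone, Δ.B.res h y.deg - x.deg ∈ Δ.B.mon x.cone ↔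
      ∀ v ∈ x.cone.1, coord x.deg v ≤ coord y.deg v := fun h => by
    rw [mem_mon_iff]
    refine forall₂_congr fun v hv => ?_
    rw [sub_eq_add_neg, coord_add _ _ hv, coord_neg _ hv, coord_res _ _ hv]
    lia
  exact ⟨fun ⟨h, h'⟩ => ⟨h, (key h).1 h'⟩, fun ⟨h, h'⟩ => ⟨h, (key h).2 h'⟩⟩

/-- The index with the next weight in the direction of `t`. -/
def next (x : Δ.B.ShIdx) (t : N) : Δ.B.ShIdx :=
  ⟨x.cone, (Δ.exists_coord x.cone fun v => coord x.deg v + if v = t then 1 else 0).choose⟩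

theorem coord_next (x : Δ.B.ShIdx) (t : N) {v : N} (hv : v ∈ x.cone.1) :
    coord (next x t).deg v = coord x.deg v + if v = t then 1 else 0 :=
  (Δ.exists_coord x.cone fun v => coord x.deg v + if v = t then 1 else 0).choose_spec v hv

theorem le_next (x : Δ.B.ShIdx) (t : N) : x ≤ next x t :=
  sh_le_iff.2 ⟨le_refl x.cone, fun v hv => by rw [coord_next x t hv]; split_ifs <;> lia⟩

theorem next_le {x y : Δ.B.ShIdx} {t : N} (h : x ≤ y)
    (ht : t ∈ y.cone.1 → coord x.deg t < coord y.deg t) : next x t ≤ y := by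
  rw [sh_le_iff] at h ⊢
  refine ⟨h.1, fun v hv => ?_⟩
  rw [coord_next x t (h.1 hv)]
  have := h.2 v hv
  split_ifs with e
  · subst e
    have := ht hv
    lia
  · lia

/-- The face of a cone opposite to a ray. -/
def face (x : Δ.B.ShIdx) (t : N) : Δ.B.ShIdx :=
  ⟨⟨x.cone.1.erase t, Δ.faces _ x.cone.2 _ (Finset.erase_subset _ _)⟩,
    Δ.B.res (Finset.erase_subset _ _) x.deg⟩

theorem coord_face (x : Δ.B.ShIdx) (t : N) {v : N} (hv : v ∈ (face x t).cone.1) :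
    coord (face x t).deg v = coord x.deg v := coord_res _ _ hv

theorem le_face (x : Δ.B.ShIdx) (t : N) : x ≤ face x t :=
  sh_le_iff.2 ⟨Finset.erase_subset _ _, fun _ hv => (coord_face x t hv).ge⟩

theorem face_le {x y : Δ.B.ShIdx} {t : N} (h : x ≤ y) (ht : t ∉ y.cone.1) : face x t ≤ y := by
  rw [sh_le_iff] at h ⊢
  have hc : y.cone ≤ (face x t).cone := fun v hv =>
    Finset.mem_erase.2 ⟨fun e => ht (e ▸ hv), h.1 hv⟩
  exact ⟨hc, fun v hv => (coord_face x t (hc hv)).trans_le (h.2 v hv)⟩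

/-! ### Some sheaves of modules -/

/-- The indices above `x` of the cones that contain `U`, with the same weight on `T` as `x`. -/
def shSet (x : Δ.B.ShIdx) (U T : Finset N) : Set Δ.B.ShIdx :=
  {y | x ≤ y ∧ U ⊆ y.cone.1 ∧ T ⊆ y.cone.1 ∧ ∀ v ∈ T, coord y.deg v = coord x.deg v}

instance (x : Δ.B.ShIdx) (U T : Finset N) : (shSet x U T).OrdConnected where
  out' a ha c hc b hb := by
    have h1 := sh_le_iff.1 hb.1
    have h2 := sh_le_iff.1 hb.2
    have h3 := sh_le_iff.1 ha.1
    refine ⟨ha.1.trans hb.1, hc.2.1.trans h2.1, hc.2.2.1.trans h2.1, fun v hv => ?_⟩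
    have e1 := h2.2 v (hc.2.2.1 hv)
    have e2 := h1.2 v (h2.1 (hc.2.2.1 hv))
    have e3 := hc.2.2.2 v hv
    have e4 := ha.2.2.2 v hv
    lia

/-- The stalk at a face `τ` of `x.cone` is generated by the restriction of the generator, and the
other stalks are zero. -/
theorem free_fg (x : Δ.B.ShIdx) : Δ.B.fg (free x) := fun τ => by
  by_cases h : τ ≤ x.cone
  · have hx : x ≤ (⟨τ, Δ.B.res h x.deg⟩ : Δ.B.ShIdx) :=
      sh_le_iff.2 ⟨h, fun v hv => (coord_res h _ hv).ge⟩
    refine GrMod.isFG_of_genSpan _ (ι := Unit) (fun _ => Δ.B.res h x.deg)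
      (fun _ => indVal (Set.Ici x) ⟨τ, Δ.B.res h x.deg⟩ 1) fun m => ?_
    rw [eq_top_iff]
    rintro φ -
    by_cases hm : x ≤ (⟨τ, m⟩ : Δ.B.ShIdx)
    · have e : φ = indCoe (Set.Ici x) (x := ⟨τ, m⟩) hm φ • indVal (Set.Ici x) ⟨τ, m⟩ 1 := by
        rw [smul_indVal, mul_one]
        rfl
      rw [e]
      refine Submodule.smul_mem _ _ (Submodule.subset_span ⟨(), ?_, ?_⟩)
      · rw [mem_mon_iff]
        intro v hv
        rw [sub_eq_add_neg, coord_add _ _ hv, coord_neg _ hv, coord_res _ _ hv]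
        have := (sh_le_iff.1 hm).2 v hv
        simp only at this
        lia
      · exact (ind_map (Z := Set.Ici x) (x := ⟨τ, Δ.B.res h x.deg⟩) (y := ⟨τ, m⟩)
          (homOfLE (sh_le_iff.2 ⟨le_rfl, fun v hv =>
            (coord_res h _ hv).trans_le ((sh_le_iff.1 hm).2 v hv)⟩)) hx 1).symm
    · have e : φ = 0 := ind_eq_of_notMem (Z := Set.Ici x) (x := ⟨τ, m⟩) hm _ _
      rw [e]
      exact zero_mem _
  · refine GrMod.IsFG.of_isZero fun m => ⟨fun φ ψ => ?_⟩
    exact ind_eq_of_notMem (Z := Set.Ici x) (x := ⟨τ, m⟩) (fun hx => h (sh_le_iff.1 hx).1) _ _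

/-- The sheaf is a quotient of `free x`: among the indices above `x`, losing a ray of `U` or `T`, or
raising a coordinate in `T`, cannot be undone, so the complement is upward closed. -/
theorem ind_shSet_fg [Module.Finite ℤ N] (x : Δ.B.ShIdx) (U T : Finset N) :
    Δ.B.fg (ind (shSet x U T)) := by
  let f : free x ⟶ ind (shSet x U T) := indMap (Set.Ici x) (shSet x U T)
    fun y z h hy hz => ⟨fun _ => hz.1, fun _ => ⟨hy, hz.2.1.trans (sh_le_iff.1 h).1,
      hz.2.2.1.trans (sh_le_iff.1 h).1, fun v hv => by
        have e1 := (sh_le_iff.1 h).2 v (hz.2.2.1 hv)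
        have e2 := (sh_le_iff.1 (show x ≤ y from hy)).2 v ((sh_le_iff.1 h).1 (hz.2.2.1 hv))
        have e3 := hz.2.2.2 v hv
        lia⟩⟩
  have : ∀ y, Epi (f.app y) := fun y => by
    rw [ModuleCat.epi_iff_surjective]
    intro φ
    by_cases hy : y ∈ shSet x U T
    · exact ⟨indVal (Set.Ici x) y (indCoe _ hy φ), indMap_indVal (show y ∈ Set.Ici x from hy.1) _⟩
    · exact ⟨0, ind_eq_of_notMem hy _ _⟩
  have : Epi f := NatTrans.epi_of_epi_app _
  exact Δ.B.fg.prop_of_epi f (free_fg x)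

variable [Module.Finite ℤ N]

/-- The indicator sheaf of `shSet x U T`. -/
def shInd (x : Δ.B.ShIdx) (U T : Finset N) : Δ.BMod := ⟨ind (shSet x U T), ind_shSet_fg x U T⟩

/-- The free sheaf with a generator of index `x`. -/
def shFree (x : Δ.B.ShIdx) : Δ.BMod := ⟨free x, free_fg x⟩

/-- Closure under extensions and cokernels of monomorphisms. -/
structure ClosedUnder {C : Type*} [Category* C] [Abelian C] (W : ObjectProperty C) : Prop where
  iso : W.IsClosedUnderIsomorphisms
  ext : ∀ {S : ShortComplex C}, S.ShortExact → W S.X₁ → W S.X₃ → W S.X₂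
  coker : ∀ {S : ShortComplex C}, S.ShortExact → W S.X₁ → W S.X₂ → W S.X₃

theorem exists_shortExact {A B Z : Set Δ.B.ShIdx} [A.OrdConnected] [B.OrdConnected]
    [Z.OrdConnected] (hfA : Δ.B.fg (ind A)) (hfB : Δ.B.fg (ind B)) (hfZ : Δ.B.fg (ind Z))
    (hZ : A ∪ B = Z) (hd : Disjoint A B) (hA : ∀ x y, x ≤ y → x ∈ A → y ∈ Z → y ∈ A) :
    ∃ S : ShortComplex Δ.BMod, S.ShortExact ∧ S.X₁ = ⟨ind A, hfA⟩ ∧ S.X₂ = ⟨ind Z, hfZ⟩ ∧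
      S.X₃ = ⟨ind B, hfB⟩ := by
  obtain ⟨f, g, w, h⟩ := ind_shortExact hZ hd hA
  exact ⟨ShortComplex.mk (X₁ := ⟨ind A, hfA⟩) (X₂ := ⟨ind Z, hfZ⟩) (X₃ := ⟨ind B, hfB⟩)
    (ObjectProperty.homMk f) (ObjectProperty.homMk g) (ObjectProperty.hom_ext _ w),
    CategoryTheory.ShortExact.reflects_shortExact_of_faithful Δ.B.fg.ι h, rfl, rfl, rfl⟩

variable {W : ObjectProperty Δ.BMod}

/-- Induction on `U`. Within `shSet x U ∅` the cones that omit `t` are those below the facet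
opposite to `t`, and they form the subsheaf attached to `face x t`. The quotient requires `t` as
well. For `U = x.cone` the result is a shifted point sheaf. -/
theorem shInd_of_free (hW : ClosedUnder W) (h : ∀ x, W (shFree x)) (U : Finset N) :
    ∀ x : Δ.B.ShIdx, U ⊆ x.cone.1 → W (shInd x U ∅) := by
  have := hW.iso
  induction U using Finset.induction_on with
  | empty =>
    intro x _
    have e : shSet x ∅ ∅ = Set.Ici x := Set.ext fun y => ⟨fun hy => hy.1, fun hy =>
      ⟨hy, by simp, by simp, by simp⟩⟩
    have : ∀ (Z : Set Δ.B.ShIdx) [Z.OrdConnected] (hZ : Δ.B.fg (ind Z)), Z = Set.Ici x →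
        W ⟨ind Z, hZ⟩ := by
      rintro Z _ hZ rfl
      exact h x
    exact this _ _ e
  | insert t U ht ih =>
    intro x hx
    obtain ⟨S, hS, e1, e2, e3⟩ := exists_shortExact (ind_shSet_fg (face x t) U ∅)
      (ind_shSet_fg x (insert t U) ∅) (ind_shSet_fg x U ∅) (Set.ext fun y => by
        constructor
        · rintro (hy | hy)
          · exact ⟨(le_face x t).trans hy.1, hy.2.1, by simp, by simp⟩
          · exact ⟨hy.1, (Finset.subset_insert _ _).trans hy.2.1, by simp, by simp⟩
        · rintro ⟨hy, hU, -⟩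
          by_cases hty : t ∈ y.cone.1
          · exact .inr ⟨hy, Finset.insert_subset hty hU, by simp, by simp⟩
          · exact .inl ⟨face_le hy hty, hU, by simp, by simp⟩)
      (Set.disjoint_left.2 fun y hy hy' => by
        have := (sh_le_iff.1 hy.1).1 (hy'.2.1 (Finset.mem_insert_self t U))
        simp [face] at this)
      (fun y z h hy hz => ⟨hy.1.trans h, hz.2.1, by simp, by simp⟩)
    have h3 := hW.coker hS
      (e1 ▸ ih (face x t) fun v hv => Finset.mem_erase.2
        ⟨fun e => ht (e ▸ hv), hx (Finset.mem_insert_of_mem hv)⟩)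
      (e2 ▸ ih x ((Finset.subset_insert _ _).trans hx))
    rwa [e3] at h3

/-- Induction on `T`. The monomial dual to the ray `t` acts injectively on the sheaf for `T`. Its
image is the same sheaf generated at `next x t`, and its cokernel is the sheaf for `insert t T`. -/
theorem shInd_of_point (hW : ClosedUnder W) (h : ∀ x : Δ.B.ShIdx, W (shInd x x.cone.1 ∅))
    (T : Finset N) : ∀ x : Δ.B.ShIdx, T ⊆ x.cone.1 → W (shInd x x.cone.1 T) := by
  have := hW.iso
  induction T using Finset.induction_on with
  | empty => exact fun x _ => h x
  | insert t T ht ih =>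
    intro x hx
    have htx : t ∈ x.cone.1 := hx (Finset.mem_insert_self _ _)
    have hTx : T ⊆ x.cone.1 := (Finset.subset_insert _ _).trans hx
    have hT : ∀ v ∈ T, coord (next x t).deg v = coord x.deg v := fun v hv => by
      rw [coord_next x t (hTx hv), if_neg fun e : v = t => ht (e ▸ hv), add_zero]
    obtain ⟨S, hS, e1, e2, e3⟩ := exists_shortExact (ind_shSet_fg (next x t) x.cone.1 T)
      (ind_shSet_fg x x.cone.1 (insert t T)) (ind_shSet_fg x x.cone.1 T) (Set.ext fun y => by
        constructor
        · rintro (hy | hy)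
          · exact ⟨(le_next x t).trans hy.1, hy.2.1, hy.2.2.1, fun v hv => by
              rw [hy.2.2.2 v hv, hT v hv]⟩
          · exact ⟨hy.1, hy.2.1, (Finset.subset_insert _ _).trans hy.2.2.1, fun v hv =>
              hy.2.2.2 v (Finset.mem_insert_of_mem hv)⟩
        · rintro ⟨hy, hU, hTy, hv⟩
          have hty := hU htx
          by_cases hlt : coord x.deg t < coord y.deg t
          · exact .inl ⟨next_le hy fun _ => hlt, hU, hTy, fun v hv' => by rw [hv v hv', hT v hv']⟩
          · refine .inr ⟨hy, hU, Finset.insert_subset hty hTy, fun v hv' => ?_⟩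
            rw [Finset.mem_insert] at hv'
            rcases hv' with rfl | hv'
            · exact le_antisymm (not_lt.1 hlt) ((sh_le_iff.1 hy).2 v hty)
            · exact hv v hv')
      (Set.disjoint_left.2 fun y hy hy' => by
        have h1 := (sh_le_iff.1 hy.1).2 t (hy'.2.2.1 (Finset.mem_insert_self _ _))
        have h2 := hy'.2.2.2 t (Finset.mem_insert_self _ _)
        rw [coord_next x t htx, if_pos rfl] at h1
        lia)
      (fun y z h hy hz => ⟨hy.1.trans h, hz.2.1, hz.2.2.1, fun v hv => by
        rw [hz.2.2.2 v hv, hT v hv]⟩)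
    have h3 := hW.coker hS (e1 ▸ ih (next x t) hTx) (e2 ▸ ih x hTx)
    rwa [e3] at h3

end SmoothFan

namespace SmoothFan

variable {N : Type} [AddCommGroup N] {Δ : SmoothFan N}

/-! ### Subsheaves of nonzero sheaves -/

section Prime

variable {F : Δ.B.Sheaf}

/-- The rays whose monomials kill an element of a stalk. -/
def killed {x : Δ.B.ShIdx} (a : F.obj x) : Finset N :=
  x.cone.1.filter fun t => (F.map (homOfLE (le_next x t))).hom a = 0

theorem mem_killed {x : Δ.B.ShIdx} {a : F.obj x} {t : N} :
    t ∈ killed a ↔ t ∈ x.cone.1 ∧ (F.map (homOfLE (le_next x t))).hom a = 0 := Finset.mem_filter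

theorem map_eq_zero_of_killed {x y : Δ.B.ShIdx} {a : F.obj x} {t : N} (ht : t ∈ killed a)
    (h : x ≤ y) (hlt : t ∈ y.cone.1 → coord x.deg t < coord y.deg t) :
    (F.map (homOfLE h)).hom a = 0 := by
  rw [← map_map_apply F (homOfLE (le_next x t)) (homOfLE (next_le h hlt)), (mem_killed.1 ht).2,
    map_zero]

/-- Monomials commute, so a variable that kills an element kills its multiples. -/
theorem killed_subset_next {x : Δ.B.ShIdx} (a : F.obj x) (s : N) {z : Δ.B.ShIdx}
    (e : next x s = z) (h : x ≤ z) : killed a ⊆ killed ((F.map (homOfLE h)).hom a) := by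
  subst e
  intro t ht
  have htx : t ∈ x.cone.1 := (mem_killed.1 ht).1
  refine mem_killed.2 ⟨htx, ?_⟩
  rw [map_map_apply F _ _ (homOfLE ((le_next x s).trans (le_next _ t)))]
  refine map_eq_zero_of_killed ht _ fun _ => ?_
  rw [coord_next (next x s) t htx, coord_next x s htx, if_pos rfl]
  split_ifs <;> lia

theorem mem_killed_of_next {x : Δ.B.ShIdx} {a : F.obj x} {s : N} (hs : s ∈ x.cone.1)
    {z : Δ.B.ShIdx} (e : next x s = z) (h : x ≤ z) (ha : (F.map (homOfLE h)).hom a = 0) :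
    s ∈ killed a := by
  subst e
  exact mem_killed.2 ⟨hs, ha⟩

/-- Induction on the degree of the monomial. Multiplication by a variable that does not kill `a`
gives a nonzero element killed by at least the same variables, hence by exactly these, by
maximality. So no monomial in the remaining variables kills `a`, and its annihilator is a prime
monomial ideal. -/
theorem map_ne_zero_of_maximal {σ : Δ.Cone} {k : ℕ}
    (hk : ∀ (m : Δ.B.wt σ) (a : F.obj ⟨σ, m⟩), a ≠ 0 → (killed a).card ≤ k) (n : ℕ) :
    ∀ (m m' : Δ.B.wt σ) (h : (⟨σ, m⟩ : Δ.B.ShIdx) ≤ ⟨σ, m'⟩) (a : F.obj ⟨σ, m⟩), a ≠ 0 →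
      (killed a).card = k → (∀ t ∈ killed a, coord m' t = coord m t) →
      ∑ t ∈ σ.1, (coord m' t - coord m t) = n → (F.map (homOfLE h)).hom a ≠ 0 := by
  induction n with
  | zero =>
    intro m m' h a ha _ _ hs
    have h1 := (Finset.sum_eq_zero_iff_of_nonneg fun t ht => by
      have := (sh_le_iff.1 h).2 t ht
      simp only at this
      lia).1 hs
    obtain rfl : m' = m := coord_ext fun t ht => by
      have := h1 t ht
      lia
    rwa [map_self_apply]
  | succ n ih =>
    intro m m' h a ha hc ht hs
    obtain ⟨s, hs1, hs2⟩ : ∃ s ∈ σ.1, coord m s < coord m' s := by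
      by_contra! hcon
      have : ∑ t ∈ σ.1, (coord m' t - coord m t) ≤ 0 := Finset.sum_nonpos fun t ht => by
        have := hcon t ht
        lia
      lia
    have hs3 : s ∉ killed a := fun hsk => by
      have := ht s hsk
      lia
    obtain ⟨k', e⟩ : ∃ k' : Δ.B.wt σ, next ⟨σ, m⟩ s = ⟨σ, k'⟩ := ⟨_, rfl⟩
    have hle1 : (⟨σ, m⟩ : Δ.B.ShIdx) ≤ ⟨σ, k'⟩ := e ▸ le_next _ s
    have hle : (⟨σ, k'⟩ : Δ.B.ShIdx) ≤ ⟨σ, m'⟩ := e ▸ next_le h fun _ => hs2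
    have hcn : ∀ v ∈ σ.1, coord k' v = coord m v + if v = s then 1 else 0 := fun v hv => by
      have h1 := coord_next ⟨σ, m⟩ s hv
      rwa [e] at h1
    have ha' : (F.map (homOfLE hle1)).hom a ≠ 0 := fun h0 =>
      hs3 (mem_killed_of_next hs1 e hle1 h0)
    have hk' : killed a = killed ((F.map (homOfLE hle1)).hom a) :=
      Finset.eq_of_subset_of_card_le (killed_subset_next a s e hle1) (by rw [hc]; exact hk _ _ ha')
    have := ih k' m' hle _ ha' (by rw [← hk', hc]) (fun t ht' => by
        rw [← hk'] at ht'
        rw [ht t ht', hcn t (mem_killed.1 ht').1, if_neg, add_zero]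
        rintro rfl
        exact hs3 ht') (by
        have e : ∀ t ∈ σ.1, coord m' t - coord k' t =
            (coord m' t - coord m t) - if t = s then 1 else 0 := fun t ht => by
          rw [hcn t ht]; ring
        rw [Finset.sum_congr rfl e, Finset.sum_sub_distrib, hs, Finset.sum_ite_eq' σ.1 s,
          if_pos hs1]
        push_cast; ring)
    rwa [map_map_apply F _ _ (homOfLE h)] at this

/-- The analogue of an associated prime. Choose a minimal cone with nonzero stalk, so that
restrictions to its proper faces vanish, and in this stalk a nonzero homogeneous element killed by
the greatest number of variables. It generates a subsheaf that is a shifted point sheaf modulo these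
variables. -/
theorem exists_mono_ind (h : ∃ x, Nontrivial (F.obj x)) :
    ∃ (x : Δ.B.ShIdx) (T : Finset N) (_ : T ⊆ x.cone.1) (f : ind (shSet x x.cone.1 T) ⟶ F),
      Mono f := by
  let S : Set Δ.Cone := {σ | ∃ m, Nontrivial (F.obj ⟨σ, m⟩)}
  have hS : S.Nonempty := let ⟨x, hx⟩ := h; ⟨x.cone, x.deg, hx⟩
  obtain ⟨σ, hσ⟩ := S.toFinite.exists_minimal hS
  have hzero : ∀ (y : Δ.B.ShIdx), y.cone < σ → ∀ a : F.obj y, a = 0 := fun y hy a => by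
    by_contra ha
    exact hy.not_ge (hσ.2 ⟨y.deg, ⟨a, 0, ha⟩⟩ hy.le)
  let K : Set ℕ := {k | ∃ (m : Δ.B.wt σ) (a : F.obj ⟨σ, m⟩), a ≠ 0 ∧ (killed a).card = k}
  have hK : K.Nonempty := by
    obtain ⟨m, hm⟩ := hσ.1
    obtain ⟨a, ha⟩ := exists_ne (0 : F.obj ⟨σ, m⟩)
    exact ⟨_, m, a, ha, rfl⟩
  have hKb : BddAbove K := ⟨σ.1.card, by
    rintro _ ⟨m, a, _, rfl⟩
    exact Finset.card_le_card (Finset.filter_subset _ _)⟩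
  obtain ⟨m, a, ha, hc⟩ := Nat.sSup_mem hK hKb
  have hmax : ∀ (m' : Δ.B.wt σ) (a' : F.obj ⟨σ, m'⟩), a' ≠ 0 → (killed a').card ≤ sSup K :=
    fun m' a' ha' => le_csSup hKb ⟨m', a', ha', rfl⟩
  let x : Δ.B.ShIdx := ⟨σ, m⟩
  let Z := shSet x σ.1 (killed a)
  have hT : killed a ⊆ σ.1 := Finset.filter_subset _ _
  -- Outside `Z` either the cone is a proper face of `σ`, where `F` vanishes by minimality, or a
  -- coordinate along a killing variable has increased.
  have hout : ∀ (y : Δ.B.ShIdx) (h : x ≤ y), y ∉ Z → (F.map (homOfLE h)).hom a = 0 := by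
    intro y h hy
    by_cases hσy : y.cone = σ
    · have : ∃ t ∈ killed a, coord y.deg t ≠ coord m t := by
        by_contra! hcon
        exact hy ⟨h, by rw [hσy], by rw [hσy]; exact hT, hcon⟩
      obtain ⟨t, ht, hne⟩ := this
      exact map_eq_zero_of_killed ht h fun hty =>
        lt_of_le_of_ne ((sh_le_iff.1 h).2 t hty) fun e => hne e.symm
    · exact hzero y (lt_of_le_of_ne (sh_le_iff.1 h).1 hσy) _
  have hin : ∀ (y : Δ.B.ShIdx) (h : x ≤ y), y ∈ Z → (F.map (homOfLE h)).hom a ≠ 0 := by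
    rintro ⟨τ, m'⟩ h hy
    obtain rfl : τ = σ := le_antisymm (sh_le_iff.1 h).1 hy.2.1
    have hnn : 0 ≤ ∑ t ∈ τ.1, (coord m' t - coord m t) := Finset.sum_nonneg fun t ht => by
      have := (sh_le_iff.1 h).2 t ht
      simp only [x] at this
      lia
    exact map_ne_zero_of_maximal hmax (∑ t ∈ τ.1, (coord m' t - coord m t)).toNat m m' h a ha hc
      hy.2.2.2 (Int.toNat_of_nonneg hnn).symm
  let f : ind Z ⟶ F := fromInd Z F
    (fun y => if h : x ≤ y then (F.map (homOfLE h)).hom a else 0) fun y z g hy => by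
      have hz := hy.1.trans (leOfHom g)
      rw [dif_pos hy.1, dif_pos hz, map_map_apply F _ _ (homOfLE hz)]
      split_ifs with hzZ
      · rfl
      · exact hout z hz hzZ
  refine ⟨x, killed a, hT, f, mono_of_injective (ind_hom_injective fun y hy => ?_)⟩
  rw [fromInd_indVal hy, one_smul, dif_pos hy.1]
  exact hin y hy.1 hy

end Prime

/-! ### All sheaves are obtained by extensions -/

section Noetherian

variable [Module.Finite ℤ N]

/-- The submodules of the stalks that correspond to a subsheaf. -/
def stalkRange {F G : Δ.B.Sheaf} (i : G ⟶ F) (σ : Δ.Cone) :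
    Submodule (Δ.B.Alg σ) ((Δ.B.shStalk σ).obj F).Total :=
  LinearMap.range (GrMod.totalMap ((Δ.B.shStalk σ).map i))

theorem stalkRange_le {F G G' : Δ.B.Sheaf} (i : G ⟶ F) (i' : G' ⟶ F) (j : G ⟶ G')
    (h : j ≫ i' = i) : stalkRange i ≤ stalkRange i' := by
  subst h
  rintro σ _ ⟨x, rfl⟩
  refine ⟨GrMod.totalMap ((Δ.B.shStalk σ).map j) x, GrMod.total_ext _ fun m => ?_⟩
  rw [GrMod.comp_totalMap, GrMod.comp_totalMap, GrMod.comp_totalMap]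
  rfl

/-- Recovers inclusions between homogeneous components from inclusions between total stalks, where
the noetherian property is available. -/
theorem exists_of_stalkRange_le {F G G' : Δ.B.Sheaf} (i : G ⟶ F) (i' : G' ⟶ F)
    (h : stalkRange i' ≤ stalkRange i) (x : Δ.B.ShIdx) (a : G'.obj x) :
    ∃ b, (i.app x).hom b = (i'.app x).hom a := by
  obtain ⟨σ, m⟩ := x
  obtain ⟨b, hb⟩ := h σ ⟨GrMod.incl ((Δ.B.shStalk σ).obj G') m a, rfl⟩
  refine ⟨GrMod.comp ((Δ.B.shStalk σ).obj G) m b, ?_⟩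
  have h1 := congrArg (GrMod.comp ((Δ.B.shStalk σ).obj F) m) hb
  rw [GrMod.comp_totalMap, GrMod.comp_totalMap] at h1
  exact h1.trans (congrArg (((Δ.B.shStalk σ).map i').app ⟨m⟩).hom
    (GrMod.comp_incl_self ((Δ.B.shStalk σ).obj G') m a))

/-- Noetherian induction. Among the subobjects of `F` that belong to `W` take one with maximal
stalks. If the quotient were nonzero it would contain a shifted point sheaf modulo variables, and
the preimage of that sheaf in `F` would be a larger subobject in `W`. -/
theorem closedUnder_eq_top {W : ObjectProperty Δ.BMod} (hW : ClosedUnder W)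
    (h : ∀ x : Δ.B.ShIdx, W (shInd x x.cone.1 ∅)) (F : Δ.BMod) : W F := by
  have := hW.iso
  have hnoeth : ∀ σ, IsNoetherian (Δ.B.Alg σ) ((Δ.B.shStalk σ).obj F.obj).Total := fun σ => by
    have := GrMod.isNoetherianRing (MonoidSheaf.IsFinGen.fg (D := Δ.B) σ)
    have : Module.Finite (Δ.B.Alg σ) ((Δ.B.shStalk σ).obj F.obj).Total := F.property σ
    exact isNoetherian_of_isNoetherianRing_of_finite _ _
  have hwf : WellFounded fun R R' : ∀ σ, Submodule (Δ.B.Alg σ) ((Δ.B.shStalk σ).obj F.obj).Total =>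
      R > R' :=
    wellFounded_lt (α := ∀ σ, (Submodule (Δ.B.Alg σ) ((Δ.B.shStalk σ).obj F.obj).Total)ᵒᵈ)
  -- The zero object is the cokernel of an identity, and the fan has at least one cone, so `W`
  -- contains an object to start from.
  have h0 : W 0 := by
    obtain ⟨σ, hσ⟩ := Δ.nonempty
    let x : Δ.B.ShIdx := ⟨⟨σ, hσ⟩, 0⟩
    let S := ShortComplex.mk (𝟙 (shInd x x.cone.1 ∅)) (0 : shInd x x.cone.1 ∅ ⟶ (0 : Δ.BMod)) comp_zero
    have hS : S.ShortExact := (ShortComplex.Splitting.ofIsIsoOfIsZero S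
      (inferInstanceAs (IsIso (𝟙 _))) (isZero_zero _)).shortExact
    exact hW.coker hS (h x) (h x)
  let S : Set (∀ σ, Submodule (Δ.B.Alg σ) ((Δ.B.shStalk σ).obj F.obj).Total) :=
    {R | ∃ (G : Δ.BMod) (i : G ⟶ F) (_ : Mono i), W G ∧ R = stalkRange i.hom}
  have hS : S.Nonempty := ⟨_, 0, 0, inferInstance, h0, rfl⟩
  obtain ⟨R, ⟨G, i, hi, hG, rfl⟩, hmax⟩ := hwf.has_min S hS
  by_cases hz : IsZero (cokernel i)
  · have : Epi i := Preadditive.epi_of_isZero_cokernel i hz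
    have : IsIso i := isIso_of_mono_of_epi i
    exact W.prop_of_iso (asIso i) hG
  exfalso
  obtain ⟨x, T, hT, f, hf⟩ := exists_mono_ind (F := (cokernel i).obj) (by
    by_contra hcon
    have hzero : IsZero (cokernel i).obj → IsZero (cokernel i) := fun h =>
      (IsZero.iff_id_eq_zero _).2 (ObjectProperty.hom_ext _ (h.eq_of_src _ _))
    refine hz (hzero ((Functor.isZero_iff _).2 fun x => ?_))
    have : Subsingleton ((cokernel i).obj.obj x) :=
      not_nontrivial_iff_subsingleton.1 fun hx => hcon ⟨x, hx⟩
    exact ModuleCat.isZero_of_subsingleton _)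
  let j : shInd x x.cone.1 T ⟶ cokernel i := ObjectProperty.homMk f
  have hj : Mono j := (Δ.B.fg.ι).mono_of_mono_map hf
  let p := cokernel.π i
  let k : G ⟶ pullback p j := pullback.lift i 0 (by simp [p])
  have w : k ≫ pullback.snd p j = 0 := pullback.lift_snd _ _ _
  have hk : k ≫ pullback.fst p j = i := pullback.lift_fst _ _ _
  have hse : (ShortComplex.mk k (pullback.snd p j) w).ShortExact := by
    have : Mono k := mono_of_mono_fac hk
    refine ShortComplex.ShortExact.mk' (ShortComplex.exact_of_f_is_kernel _
      (KernelFork.IsLimit.ofι' k w fun {A} g hg => ?_)) this inferInstance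
    have hg' : (g ≫ pullback.fst p j) ≫ cokernel.π i = 0 := by
      rw [Category.assoc, pullback.condition, reassoc_of% hg, zero_comp]
    refine ⟨(Abelian.monoIsKernelOfCokernel _ (cokernelIsCokernel i)).lift
      (KernelFork.ofι _ hg'), ?_⟩
    refine pullback.hom_ext ?_ ?_
    · rw [Category.assoc, hk]
      exact (Abelian.monoIsKernelOfCokernel _ (cokernelIsCokernel i)).fac
        (KernelFork.ofι _ hg') WalkingParallelPair.zero
    · rw [Category.assoc, w, comp_zero, hg]
  have hG' : W (pullback p j) := hW.ext hse hG (shInd_of_point hW h T x hT)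
  refine hmax _ ⟨pullback p j, pullback.fst p j, inferInstance, hG', rfl⟩ ?_
  refine lt_of_le_not_ge (stalkRange_le i.hom (pullback.fst p j).hom k.hom
    (congrArg (fun a => a.hom) hk)) fun hle => ?_
  -- If the enlargement had the same stalks as `G`, it would map to zero in the quotient. Then `j`
  -- would vanish, against its injectivity at the index `x`.
  have hpz : pullback.fst p j ≫ p = 0 := by
    refine ObjectProperty.hom_ext _ ?_
    ext y a
    obtain ⟨b, hb⟩ := exists_of_stalkRange_le i.hom (pullback.fst p j).hom hle y a
    have h1 : i.hom ≫ p.hom = 0 := congrArg (fun a => a.hom) (cokernel.condition i)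
    change (p.hom.app y).hom (((pullback.fst p j).hom.app y).hom a) = 0
    rw [← hb]
    exact congrArg (fun q => (q.app y).hom b) h1
  have hjz : j = 0 := by
    rw [← cancel_epi (pullback.snd p j), ← pullback.condition, hpz, comp_zero]
  have hxmem : x ∈ shSet x x.cone.1 T := ⟨le_rfl, le_rfl, hT, fun _ _ => rfl⟩
  have h1 : f = 0 := congrArg (fun a => a.hom) hjz
  have h2 : Function.Injective (f.app x).hom :=
    (ModuleCat.mono_iff_injective _).1 inferInstance
  have h3 : indVal (shSet x x.cone.1 T) x 1 = 0 := h2 (by rw [h1]; rfl)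
  exact one_ne_zero (congrArg (indCoe _ hxmem) h3)

end Noetherian

end SmoothFan

/-! ### Generators of bounded derived categories -/

section Generators

open SmoothFan Pretriangulated DerivedCategory.TStructure

universe w v u

variable {C : Type u} [Category.{v} C] [Abelian C] [HasDerivedCategory.{w} C]

theorem Db.exists_triangle {S : ShortComplex C} (hS : S.ShortExact) :
    ∃ (Z : Db C) (g : (Db.single C).obj S.X₂ ⟶ Z) (h : Z ⟶ ((Db.single C).obj S.X₁)⟦(1 : ℤ)⟧),
      Triangle.mk ((Db.single C).map S.f) g h ∈ distTriang (Db C) ∧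
        Nonempty (Z ≅ (Db.single C).obj S.X₃) := by
  obtain ⟨Z, g, h, hD⟩ := distinguished_cocone_triangle ((Db.single C).map S.f)
  have hD' := (Db.ι C).map_distinguished _ hD
  let e := isoTriangleOfIso₁₂ _ _ hD' hS.singleTriangle_distinguished (Iso.refl _) (Iso.refl _)
    ((Category.comp_id _).trans (Category.id_comp _).symm)
  let e₃ : Z.obj ≅ ((Db.single C).obj S.X₃).obj := Triangle.π₃.mapIso e
  exact ⟨Z, g, h, hD, ⟨(t (C := C)).bounded.isoMk e₃⟩⟩

theorem closedUnder_single (W : ObjectProperty (Db C)) [W.IsTriangulated]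
    [W.IsClosedUnderIsomorphisms] : ClosedUnder (W.inverseImage (Db.single C)) where
  iso := inferInstance
  ext hS h₁ h₃ := by
    obtain ⟨Z, g, h, hD, ⟨e⟩⟩ := Db.exists_triangle hS
    exact W.ext_of_isTriangulatedClosed₂ _ hD h₁ (W.prop_of_iso e.symm h₃)
  coker hS h₁ h₂ := by
    obtain ⟨Z, g, h, hD, ⟨e⟩⟩ := Db.exists_triangle hS
    exact W.prop_of_iso e (W.ext_of_isTriangulatedClosed₃ _ hD h₁ h₂)

/-- The objects of the bounded derived category that are given by a class of objects of the abelian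
category. -/
def singles (G : ObjectProperty C) : ObjectProperty (Db C) :=
  fun X => ∃ P, G P ∧ Nonempty (X ≅ (Db.single C).obj P)

theorem single_of_shortExact (W : ObjectProperty (Db C)) [W.IsTriangulated]
    [W.IsClosedUnderIsomorphisms] {S : ShortComplex C} (hS : S.ShortExact)
    (h₂ : W ((Db.single C).obj S.X₂)) (h₃ : W ((Db.single C).obj S.X₃)) :
    W ((Db.single C).obj S.X₁) := by
  obtain ⟨Z, g, h, hD, ⟨e⟩⟩ := Db.exists_triangle hS
  exact W.ext_of_isTriangulatedClosed₁ _ hD h₂ (W.prop_of_iso e.symm h₃)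

/-- A triangulated subcategory meets the abelian category in a class with the two-out-of-three
property for short exact sequences. Closure under kernels of epimorphisms is offered as well,
because the dual side needs it. -/
theorem generates_singles {G : ObjectProperty C}
    (h : ∀ W : ObjectProperty C, ClosedUnder W →
      (∀ {S : ShortComplex C}, S.ShortExact → W S.X₂ → W S.X₃ → W S.X₁) → G ≤ W → ∀ X, W X) :
    Generates (singles G) := by
  intro W _ _ hG X
  exact Db.prop_of_single W (h _ (closedUnder_single W) (single_of_shortExact W) fun P hP =>
    hG _ ⟨P, hP, ⟨Iso.refl _⟩⟩) X

end Generators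

/-! ### Duality -/

theorem isIso_of_bijective {J : Type} [Preorder J] {F G : J ⥤ ModuleCat.{0} ℂ} (f : F ⟶ G)
    (h : ∀ x, Function.Bijective (f.app x).hom) : IsIso f := by
  have : ∀ x, IsIso (f.app x) := fun x => (ConcreteCategory.isIso_iff_bijective _).2 (h x)
  exact NatIso.isIso_of_isIso_app f

/-- The functional on the indicator functor given by the basis. -/
def indFun {J : Type} [Preorder J] (Z : Set J) [Z.OrdConnected] (x : J) :
    Module.Dual ℂ ((ind Z).obj x) :=
  if h : x ∈ Z then indCoe Z h else 0

theorem indFun_indVal {J : Type} [Preorder J] {Z : Set J} [Z.OrdConnected] {x : J} (hx : x ∈ Z)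
    (c : ℂ) : indFun Z x (indVal Z x c) = c := by
  rw [indFun, dif_pos hx, indCoe_indVal]

theorem nat_apply {J : Type} [Preorder J] {F G : J ⥤ ModuleCat.{0} ℂ} (f : F ⟶ G) {x y : J}
    (g : x ⟶ y) (v : F.obj x) :
    (f.app y).hom ((F.map g).hom v) = (G.map g).hom ((f.app x).hom v) := by
  rw [← LinearMap.comp_apply, ← LinearMap.comp_apply, ← ModuleCat.hom_comp, ← ModuleCat.hom_comp,
    f.naturality]

instance preservesHomology_ι {C : Type*} [Category* C] [Abelian C] (Q : ObjectProperty C)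
    [Q.IsSerreClass] [Q.IsClosedUnderFiniteProducts] : Q.ι.PreservesHomology where
  preservesKernels _ _ f := Q.preservesKernels_ι f
  preservesCokernels _ _ f := Q.preservesCokernels_ι f

namespace MonoidSheaf

variable {I : Type} [PartialOrder I] (D : MonoidSheaf I)

theorem neg_le {q q' : D.CoshIdx} (h : q ≤ q') :
    (⟨q'.cone, -q'.deg⟩ : D.ShIdx) ≤ ⟨q.cone, -q.deg⟩ := by
  obtain ⟨h, hm⟩ := h
  exact ⟨h, by simpa [sub_eq_add_neg, add_comm] using hm⟩

variable {D} in
/-- The opposite of a set of indices. -/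
def negSet (Z : Set D.ShIdx) : Set D.CoshIdx := {q | (⟨q.cone, -q.deg⟩ : D.ShIdx) ∈ Z}

instance (Z : Set D.ShIdx) [Z.OrdConnected] : (negSet Z).OrdConnected where
  out' _ hx _ hy _ hz := Set.OrdConnected.out (s := Z) ‹_› hy hx ⟨D.neg_le hz.2, D.neg_le hz.1⟩

theorem dual_map_apply (F : D.Sheaf) {q q' : D.CoshIdx} (f : q ⟶ q')
    (φ : Module.Dual ℂ (F.obj ⟨q.cone, -q.deg⟩)) :
    ((D.dual F).map f).hom φ = φ ∘ₗ (F.map (homOfLE (D.neg_le (leOfHom f)))).hom := rfl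

/-- The graded dual of an indicator sheaf. -/
def indDual (Z : Set D.ShIdx) [Z.OrdConnected] : ind (negSet Z) ⟶ D.dual (ind Z) :=
  fromInd (negSet Z) (D.dual (ind Z)) (fun q => indFun Z ⟨q.cone, -q.deg⟩) fun q q' f hq => by
    have key := D.dual_map_apply (ind Z) f (indFun Z ⟨q.cone, -q.deg⟩)
    by_cases hq' : (⟨q'.cone, -q'.deg⟩ : D.ShIdx) ∈ Z
    · refine key.trans (Eq.trans ?_ (if_pos (show q' ∈ negSet Z from hq')).symm)
      refine LinearMap.ext fun φ => ?_
      change indFun Z _ (((ind Z).map _).hom φ) = indFun Z _ φ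
      rw [← indVal_indCoe hq' φ, ind_map _ hq', indFun_indVal hq']
      exact indFun_indVal (Z := Z) (x := ⟨q.cone, -q.deg⟩) hq _
    · refine key.trans (Eq.trans ?_ (if_neg (show q' ∉ negSet Z from hq')).symm)
      refine LinearMap.ext fun φ => ?_
      change indFun Z _ (((ind Z).map _).hom φ) = 0
      rw [ind_map_of_notMem _ hq', map_zero]

def dualIndIso (Z : Set D.ShIdx) [Z.OrdConnected] : ind (negSet Z) ≅ D.dual (ind Z) :=
  have : IsIso (D.indDual Z) := isIso_of_bijective _ fun q => by
    refine ⟨ind_hom_injective (fun q hq h => ?_) q, fun φ => ?_⟩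
    · have h1 : (1 : ℂ) • indFun Z ⟨q.cone, -q.deg⟩ = 0 :=
        (fromInd_indVal (F := D.dual (ind Z)) hq 1).symm.trans h
      rw [one_smul] at h1
      have h2 := LinearMap.congr_fun h1 (indVal Z ⟨q.cone, -q.deg⟩ 1)
      rw [indFun_indVal (Z := Z) (x := ⟨q.cone, -q.deg⟩) hq] at h2
      exact one_ne_zero h2
    · let φ' : Module.Dual ℂ ((ind Z).obj ⟨q.cone, -q.deg⟩) := φ
      refine ⟨indVal _ q (φ' (indVal Z ⟨q.cone, -q.deg⟩ 1)), ?_⟩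
      by_cases hq : q ∈ negSet Z
      · refine (fromInd_indVal (F := D.dual (ind Z)) hq _).trans ?_
        change φ' (indVal Z ⟨q.cone, -q.deg⟩ 1) • indFun Z ⟨q.cone, -q.deg⟩ = φ'
        refine LinearMap.ext fun v => ?_
        obtain ⟨c, rfl⟩ : ∃ c, v = indVal Z ⟨q.cone, -q.deg⟩ c := ⟨_, (indVal_indCoe hq v).symm⟩
        have hv : indVal Z ⟨q.cone, -q.deg⟩ c = c • indVal Z ⟨q.cone, -q.deg⟩ 1 := by
          rw [smul_indVal, mul_one]
        rw [LinearMap.smul_apply,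
          indFun_indVal (Z := Z) (x := ⟨q.cone, -q.deg⟩) hq, hv, map_smul, smul_eq_mul, smul_eq_mul,
          mul_comm]
      · rw [ind_eq_of_notMem hq (indVal _ q _) 0, map_zero]
        change (0 : Module.Dual ℂ ((ind Z).obj ⟨q.cone, -q.deg⟩)) = φ'
        refine LinearMap.ext fun v => ?_
        rw [ind_eq_of_notMem (Z := Z) (x := ⟨q.cone, -q.deg⟩) hq v 0, map_zero, map_zero]
  asIso (D.indDual Z)

/-- The transpose of a morphism of sheaves of modules. -/
def dualMap {F F' : D.Sheaf} (f : F ⟶ F') : D.dual F' ⟶ D.dual F where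
  app q := ModuleCat.ofHom (LinearMap.dualMap (f.app ⟨q.cone, -q.deg⟩).hom)
  naturality {q q'} g := ModuleCat.hom_ext <|
    LinearMap.ext fun (φ : Module.Dual ℂ (F'.obj ⟨q.cone, -q.deg⟩)) => LinearMap.ext fun v => by
    change φ ((F'.map _).hom ((f.app _).hom v)) = φ ((f.app _).hom ((F.map _).hom v))
    rw [nat_apply]

/-- Exactness is checked on each homogeneous component, where the graded dual is the dual of a
vector space. -/
theorem dual_shortExact {S : ShortComplex D.Sheaf} (hS : S.ShortExact) :
    ∃ w : D.dualMap S.g ≫ D.dualMap S.f = 0,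
      (ShortComplex.mk (D.dualMap S.g) (D.dualMap S.f) w).ShortExact := by
  have h1 : ∀ x, Function.Exact (S.f.app x).hom (S.g.app x).hom := fun x => exact_app hS x
  have hf := hS.mono_f
  have hg := hS.epi_g
  have h2 : ∀ x, Function.Injective (S.f.app x).hom := fun x =>
    (ModuleCat.mono_iff_injective _).1 inferInstance
  have h3 : ∀ x, Function.Surjective (S.g.app x).hom := fun x =>
    (ModuleCat.epi_iff_surjective _).1 inferInstance
  have h4 : ∀ x, Function.Exact (S.g.app x).hom.dualMap (S.f.app x).hom.dualMap := fun x => by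
    rw [LinearMap.exact_iff, LinearMap.ker_dualMap_eq_dualAnnihilator_range,
      LinearMap.range_dualMap_eq_dualAnnihilator_ker, (LinearMap.exact_iff.1 (h1 x))]
  have w : D.dualMap S.g ≫ D.dualMap S.f = 0 := by
    ext q φ
    exact (h4 _ _).2 ⟨φ, rfl⟩
  exact ⟨w, shortExact_of_pointwise _
    (fun x => LinearMap.dualMap_injective_of_surjective (h3 _)) (fun x => h4 _)
    fun x => LinearMap.dualMap_surjective_of_injective (h2 _)⟩

/-- The graded dual of a cosheaf of modules. -/
def codual (E : D.Cosheaf) : D.Sheaf where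
  obj x := ModuleCat.of ℂ (Module.Dual ℂ (E.obj ⟨x.cone, -x.deg⟩))
  map {x y} f := ModuleCat.ofHom (LinearMap.dualMap
    (E.map (homOfLE (by
      obtain ⟨h, hm⟩ := leOfHom f
      exact ⟨h, by simpa [sub_eq_add_neg, add_comm] using hm⟩) :
        (⟨y.cone, -y.deg⟩ : D.CoshIdx) ⟶ ⟨x.cone, -x.deg⟩)).hom)
  map_id x := ModuleCat.hom_ext <| LinearMap.ext fun φ => LinearMap.ext fun v => by
    change φ ((E.map (𝟙 _)).hom v) = φ v
    rw [E.map_id]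
    rfl
  map_comp {x y z} f g := ModuleCat.hom_ext <| LinearMap.ext fun φ => LinearMap.ext fun v => by
    change φ ((E.map _).hom v) = φ ((E.map _).hom ((E.map _).hom v))
    rw [← LinearMap.comp_apply (E.map _).hom, ← ModuleCat.hom_comp, ← E.map_comp]
    rfl

variable {D}

theorem codual_fg {E : D.Cosheaf} (hE : D.tcf E) : D.fg (D.codual E) := fun σ =>
  (hE σ).dual_isFG

theorem _root_.ToricKoszul.GrMod.IsFG.finite {G : Type} [AddCommGroup G] {S : AddSubmonoid G}
    {V : GrMod S} (h : V.IsFG) (m : G) : Module.Finite ℂ (V.obj ⟨m⟩) := by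
  obtain ⟨ι, _, d, x, hx⟩ := h.exists_genSpan
  refine ⟨Submodule.fg_def.2 ⟨_, ?_, hx m⟩⟩
  refine (Set.finite_range fun i : ι => if h : m - d i ∈ S then V.mul h (x i) else 0).subset ?_
  rintro _ ⟨i, hi, rfl⟩
  exact ⟨i, dif_pos hi⟩

/-- The dual of a torsion co-finite stalk is finitely generated, so its homogeneous components are
finite dimensional, and a vector space with finite dimensional dual is finite dimensional. -/
theorem tcf_finite {E : D.Cosheaf} (hE : D.tcf E) (q : D.CoshIdx) : Module.Finite ℂ (E.obj q) := by
  obtain ⟨σ, m⟩ := q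
  obtain ⟨m, rfl⟩ := neg_surjective m
  rw [← Module.finite_dual_iff]
  exact (codual_fg hE σ).finite m

theorem le_neg_neg (q : D.CoshIdx) : q ≤ ⟨q.cone, - -q.deg⟩ := by
  rw [neg_neg]

theorem neg_neg_le (q : D.CoshIdx) : (⟨q.cone, - -q.deg⟩ : D.CoshIdx) ≤ q := by
  rw [neg_neg]

/-- The evaluation map to the double dual. -/
def evalDual (E : D.Cosheaf) : E ⟶ D.dual (D.codual E) where
  app q := ModuleCat.ofHom (Module.Dual.eval ℂ (E.obj ⟨q.cone, - -q.deg⟩) ∘ₗ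
    (E.map (homOfLE (le_neg_neg q))).hom)
  naturality {q q'} f := ModuleCat.hom_ext <| LinearMap.ext fun v =>
    LinearMap.ext fun (φ : Module.Dual ℂ (E.obj ⟨q'.cone, - -q'.deg⟩)) => by
    exact congrArg φ (map_map_eq E _ _ _ _ v)

theorem isIso_evalDual {E : D.Cosheaf} (hE : D.tcf E) : IsIso (evalDual E) :=
  isIso_of_bijective _ fun q => by
    have := tcf_finite hE ⟨q.cone, - -q.deg⟩
    have h1 : Function.Bijective (Module.Dual.eval ℂ (E.obj ⟨q.cone, - -q.deg⟩)) :=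
      (Module.evalEquiv ℂ (E.obj ⟨q.cone, - -q.deg⟩)).bijective
    refine h1.comp (Function.bijective_iff_has_inverse.2
      ⟨(E.map (homOfLE (neg_neg_le q))).hom, fun v => ?_, fun v => ?_⟩)
    · exact (map_map_apply E _ _ (𝟙 q) v).trans (map_self_apply E _ v)
    · exact (map_map_apply E _ _ (𝟙 _) v).trans (map_self_apply E _ v)

end MonoidSheaf

namespace SmoothFan

variable {N : Type} [AddCommGroup N] {Δ : SmoothFan N} [Module.Finite ℤ N]

theorem dualB_shortExact {S : ShortComplex Δ.BMod} (hS : S.ShortExact) :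
    ∃ S' : ShortComplex Δ.CoBTcf, S'.ShortExact ∧ S'.X₁ = Δ.dualB S.X₃ ∧ S'.X₂ = Δ.dualB S.X₂ ∧
      S'.X₃ = Δ.dualB S.X₁ := by
  have := hS.mono_f
  have := hS.epi_g
  have : Mono (Δ.B.fg.ι.map S.f) := inferInstance
  have : Epi (Δ.B.fg.ι.map S.g) := inferInstance
  obtain ⟨w, h⟩ := Δ.B.dual_shortExact (hS.map Δ.B.fg.ι)
  exact ⟨ShortComplex.mk (X₁ := Δ.dualB S.X₃) (X₂ := Δ.dualB S.X₂) (X₃ := Δ.dualB S.X₁)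
    (ObjectProperty.homMk (Δ.B.dualMap S.g.hom)) (ObjectProperty.homMk (Δ.B.dualMap S.f.hom))
    (ObjectProperty.hom_ext _ w),
    CategoryTheory.ShortExact.reflects_shortExact_of_faithful Δ.B.tcf.ι h, rfl, rfl, rfl⟩

def dualBIso {F F' : Δ.BMod} (e : F ≅ F') : Δ.dualB F ≅ Δ.dualB F' :=
  Δ.B.tcf.isoMk (Δ.B.dualIso (Δ.B.fg.ι.mapIso e.symm))

/-- Torsion co-finite cosheaves are reflexive, so `E` is the dual of its own graded dual. Generation
statements thus pass from sheaves to cosheaves. -/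
theorem exists_dualB (E : Δ.CoBTcf) : ∃ F : Δ.BMod, Nonempty (E ≅ Δ.dualB F) :=
  have : IsIso (MonoidSheaf.evalDual E.obj) := MonoidSheaf.isIso_evalDual E.property
  ⟨⟨Δ.B.codual E.obj, MonoidSheaf.codual_fg E.property⟩,
    ⟨Δ.B.tcf.isoMk (@asIso _ _ _ _ (MonoidSheaf.evalDual E.obj) this)⟩⟩

variable (Δ) in
/-- The free sheaves on one generator. -/
def IsShFree : ObjectProperty Δ.BMod := fun F => ∃ x, Nonempty (F ≅ shFree x)

variable (Δ) in
/-- The duals of the structure sheaves of closed points, with a shift of the weights. -/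
def IsDualPoint : ObjectProperty Δ.CoBTcf :=
  fun F => ∃ x : Δ.B.ShIdx, Nonempty (F ≅ Δ.dualB (shInd x x.cone.1 ∅))

theorem shFree_closedUnder (W : ObjectProperty Δ.BMod) (hW : ClosedUnder W) (h : IsShFree Δ ≤ W)
    (F : Δ.BMod) : W F :=
  closedUnder_eq_top hW (fun x => shInd_of_free hW (fun x => h _ ⟨x, ⟨Iso.refl _⟩⟩) _ x le_rfl) F

/-- The dual of a class of objects closed under 2-out-of-3. -/
theorem dualPoint_closedUnder {W : ObjectProperty Δ.CoBTcf} (hi : W.IsClosedUnderIsomorphisms)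
    (h12 : ∀ {S : ShortComplex Δ.CoBTcf}, S.ShortExact → W S.X₁ → W S.X₃ → W S.X₂)
    (h23 : ∀ {S : ShortComplex Δ.CoBTcf}, S.ShortExact → W S.X₂ → W S.X₃ → W S.X₁)
    (h : IsDualPoint Δ ≤ W) (E : Δ.CoBTcf) : W E := by
  obtain ⟨F, ⟨e⟩⟩ := exists_dualB E
  refine W.prop_of_iso e.symm ?_
  refine closedUnder_eq_top (W := fun F => W (Δ.dualB F)) ⟨⟨fun e h => W.prop_of_iso (dualBIso e) h⟩,
    fun hS h₁ h₃ => ?_, fun hS h₁ h₂ => ?_⟩ (fun x => h _ ⟨x, ⟨Iso.refl _⟩⟩) F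
  · obtain ⟨S', hS', e1, e2, e3⟩ := dualB_shortExact hS
    exact e2 ▸ h12 hS' (e1 ▸ h₃) (e3 ▸ h₁)
  · obtain ⟨S', hS', e1, e2, e3⟩ := dualB_shortExact hS
    exact e1 ▸ h23 hS' (e2 ▸ h₂) (e3 ▸ h₁)

theorem generates_shFree [HasDerivedCategory Δ.BMod] : Generates (singles (IsShFree Δ)) :=
  generates_singles fun W hW _ h => shFree_closedUnder W hW h

theorem generates_dualPoint [HasDerivedCategory Δ.CoBTcf] : Generates (singles (IsDualPoint Δ)) :=
  generates_singles fun _ hW hW' h => dualPoint_closedUnder hW.iso hW.ext hW' h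

end SmoothFan

/-! ### Cofree functors on a preorder -/

section Cofree

variable {J : Type} [Preorder J] {F G : J ⥤ ModuleCat.{0} ℂ}

/-- The morphism to a cofree functor given by a functional. -/
def toCofree {y : J} (ψ : Module.Dual ℂ (F.obj y)) : F ⟶ ind (Set.Iic y) where
  app x := ModuleCat.ofHom (LinearMap.pi fun h : PLift (x ∈ Set.Iic y) =>
    ψ ∘ₗ (F.map (homOfLE h.down)).hom)
  naturality x z f := ModuleCat.hom_ext <| LinearMap.ext fun v => funext fun h => by
    have hx : x ∈ Set.Iic y := (leOfHom f).trans h.down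
    let φ : (ind (Set.Iic y)).obj x := fun h => ψ ((F.map (homOfLE h.down)).hom v)
    change ψ ((F.map (homOfLE h.down)).hom ((F.map f).hom v)) =
      indCoe (Set.Iic y) h.down (((ind (Set.Iic y)).map f).hom φ)
    rw [← indVal_indCoe hx φ, ind_map f hx, indCoe_indVal, map_map_apply F f _ (homOfLE hx)]
    rfl

theorem toCofree_apply {y x : J} (ψ : Module.Dual ℂ (F.obj y)) (h : x ≤ y) (v : F.obj x) :
    ((toCofree ψ).app x).hom v = indVal (Set.Iic y) x (ψ ((F.map (homOfLE h)).hom v)) := rfl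

theorem toCofree_hom_ext {y : J} {f g : F ⟶ ind (Set.Iic y)}
    (h : (f.app y).hom = (g.app y).hom) : f = g := by
  ext x v
  refine ind_eq fun hx => ?_
  have e : ∀ f : F ⟶ ind (Set.Iic y), indCoe (Set.Iic y) hx ((f.app x).hom v) =
      indCoe (Set.Iic y) (le_refl y) ((f.app y).hom ((F.map (homOfLE hx)).hom v)) := fun f => by
    rw [nat_apply]
    generalize (f.app x).hom v = φ
    rw [← indVal_indCoe hx φ, ind_map _ hx]
    rfl
  rw [e, e, h]

/-- Morphisms to the cofree functor are functionals on the component at `y`, and these extend along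
injections of vector spaces. -/
instance cofree_injective (y : J) : Injective (ind (Set.Iic y)) where
  factors {A B} g f hf := by
    have h1 : Function.Injective (f.app y).hom := (ModuleCat.mono_iff_injective _).1 inferInstance
    obtain ⟨l, hl⟩ := (f.app y).hom.exists_leftInverse_of_injective (LinearMap.ker_eq_bot.2 h1)
    let ψ : Module.Dual ℂ (B.obj y) := indCoe (Set.Iic y) (le_refl y) ∘ₗ (g.app y).hom ∘ₗ l
    refine ⟨toCofree ψ, toCofree_hom_ext (LinearMap.ext fun v => ?_)⟩
    change ((toCofree ψ).app y).hom ((f.app y).hom v) = _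
    rw [toCofree_apply ψ (le_refl y), map_self_apply]
    exact congrArg (g.app y).hom (LinearMap.congr_fun hl v)

end Cofree

/-! ### The tensor products with the dualizing kernels -/

namespace MonoidSheaf

variable {I : Type} [PartialOrder I] (D : MonoidSheaf I)

/-- The constant elements of `cofree`. -/
def cofreeConst (y : D.CoshIdx) (V : ModuleCat.{0} ℂ) (q : D.CoshIdx) :
    V →ₗ[ℂ] ((D.cofree.obj (.op y)).obj V).obj q :=
  LinearMap.pi (R := ℂ) (φ := fun _ : q ⟶ y => V) fun _ => LinearMap.id

theorem exists_cofreeConst {y : D.CoshIdx} {V : ModuleCat.{0} ℂ} {q : D.CoshIdx}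
    (φ : ((D.cofree.obj (.op y)).obj V).obj q) : ∃ w, φ = D.cofreeConst y V q w := by
  by_cases h : q ≤ y
  · exact ⟨(φ : (q ⟶ y) → V) (homOfLE h), rfl⟩
  · exact ⟨0, funext fun g => absurd (leOfHom g) h⟩

theorem cofreeConst_eq_zero {y : D.CoshIdx} {V : ModuleCat.{0} ℂ} {q : D.CoshIdx} (h : ¬ q ≤ y)
    (w : V) : D.cofreeConst y V q w = 0 := funext fun g => absurd (leOfHom g) h

variable (F : D.Sheaf) (τ : I)

/-- The decomposable elements of the tensor product. -/
def kerElt (b : D.wt τ) (q : D.CoshIdx) : F.obj ⟨τ, b⟩ →ₗ[ℂ] (D.kernelTensor F τ).obj q :=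
  ((D.kernelIncl F τ b).app q).hom ∘ₗ D.cofreeConst ⟨τ, b⟩ (F.obj ⟨τ, b⟩) q

variable {D F τ}

theorem kerElt_eq_zero {b : D.wt τ} {q : D.CoshIdx} (h : ¬ q ≤ ⟨τ, b⟩) (w : F.obj ⟨τ, b⟩) :
    D.kerElt F τ b q w = 0 :=
  (congrArg ((D.kernelIncl F τ b).app q).hom (D.cofreeConst_eq_zero h w)).trans (map_zero _)

theorem kerElt_map {b : D.wt τ} {q q' : D.CoshIdx} (f : q ⟶ q') (w : F.obj ⟨τ, b⟩) :
    ((D.kernelTensor F τ).map f).hom (D.kerElt F τ b q w) = D.kerElt F τ b q' w :=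
  (nat_apply (D.kernelIncl F τ b) f (D.cofreeConst ⟨τ, b⟩ (F.obj ⟨τ, b⟩) q w)).symm

/-- The relation `x a ⊗ w = a ⊗ x w` of the tensor product over `𝒜_τ`, for a monomial `x`, in terms
of decomposable elements. -/
theorem kerElt_mul {a b : D.wt τ} (f : (⟨τ, a⟩ : D.ShIdx) ⟶ ⟨τ, b⟩) (q : D.CoshIdx)
    (w : F.obj ⟨τ, a⟩) :
    D.kerElt F τ a q w = D.kerElt F τ b q ((F.map f).hom w) := by
  have hab : b - a ∈ D.mon τ := by
    obtain ⟨h, h'⟩ := leOfHom f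
    simpa [D.res_refl] using h'
  have := D.kernelIncl_condition F
    (homOfLE ⟨le_rfl, by rw [D.res_refl]; exact hab⟩ : (⟨τ, a⟩ : D.CoshIdx) ⟶ ⟨τ, b⟩) f
  exact congrArg (fun k => (k.app q).hom (D.cofreeConst ⟨τ, b⟩ (F.obj ⟨τ, a⟩) q w)) this

theorem ker_hom_ext {X : D.Cosheaf} {f g : D.kernelTensor F τ ⟶ X}
    (h : ∀ b q w, (f.app q).hom (D.kerElt F τ b q w) = (g.app q).hom (D.kerElt F τ b q w)) :
    f = g :=
  D.kernelTensor_hom_ext fun b => by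
    ext q φ
    obtain ⟨w, rfl⟩ := D.exists_cofreeConst φ
    exact h b q w

theorem kernelMap_kerElt {F' : D.Sheaf} (α : F ⟶ F') {τ' : I} (h : τ' ≤ τ) (b : D.wt τ)
    (q : D.CoshIdx) (w : F.obj ⟨τ, b⟩) :
    ((D.kernelMap α h).app q).hom (D.kerElt F τ b q w) =
      D.kerElt F' τ' (D.res h b) q ((α.app _).hom ((F.map (D.shRes h b)).hom w)) :=
  congrArg (fun k => (k.app q).hom (D.cofreeConst ⟨τ, b⟩ (F.obj ⟨τ, b⟩) q w))
    (D.kernelIncl_map α h b)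

/-- The morphism to the tensor product given by a homogeneous element of the stalk. -/
def kerConst (b : D.wt τ) (w : F.obj ⟨τ, b⟩) :
    ind (Set.Iic (⟨τ, b⟩ : D.CoshIdx)) ⟶ D.kernelTensor F τ :=
  fromInd _ _ (fun q => D.kerElt F τ b q w) fun q q' f _ => by
    rw [kerElt_map]
    split_ifs with h
    · rfl
    · exact kerElt_eq_zero h w

theorem kerConst_indVal {b : D.wt τ} {w : F.obj ⟨τ, b⟩} {q : D.CoshIdx} (h : q ≤ ⟨τ, b⟩) (c : ℂ) :
    ((kerConst b w).app q).hom (indVal (Set.Iic (⟨τ, b⟩ : D.CoshIdx)) q c) =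
      c • D.kerElt F τ b q w := fromInd_indVal (show q ∈ Set.Iic (⟨τ, b⟩ : D.CoshIdx) from h) c

/-- Negation of weights reverses the order, so a cofree cosheaf is the graded dual of a free sheaf.
-/
theorem iic_tcf [D.HasLength] (hfree : ∀ x : D.ShIdx, D.fg (free x)) [D.IsFinGen]
    (y : D.CoshIdx) : D.tcf (ind (Set.Iic y)) := by
  have e : Set.Iic y = negSet (Set.Ici (⟨y.cone, -y.deg⟩ : D.ShIdx)) := by
    ext q
    refine ⟨fun h => D.neg_le h, fun h => ?_⟩
    obtain ⟨h, h'⟩ := show (⟨y.cone, -y.deg⟩ : D.ShIdx) ≤ ⟨q.cone, -q.deg⟩ from h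
    exact ⟨h, by simpa [sub_eq_add_neg, add_comm] using h'⟩
  have : ∀ (Z : Set D.CoshIdx) [Z.OrdConnected],
      Z = negSet (Set.Ici (⟨y.cone, -y.deg⟩ : D.ShIdx)) → D.tcf (ind Z) := by
    rintro Z _ rfl
    exact D.tcf.prop_of_iso (D.dualIndIso _).symm (D.dual_tcf (hfree _))
  exact this _ e

/-- Finitely many generators of the stalk at `τ` present the tensor product as a quotient of a
finite sum of cofree cosheaves, and torsion co-finite cosheaves are closed under quotients. -/
theorem kernelTensor_tcf [D.HasLength] (hfree : ∀ x : D.ShIdx, D.fg (free x)) [D.IsFinGen]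
    (hF : D.fg F) (τ : I) : D.tcf (D.kernelTensor F τ) := by
  obtain ⟨ι, _, d, x, hx⟩ : ∃ (ι : Type) (_ : Finite ι) (d : ι → D.wt τ)
      (x : ∀ i, F.obj ⟨τ, d i⟩), ∀ m, ((D.shStalk τ).obj F).genSpan d x m = ⊤ :=
    (hF τ).exists_genSpan
  have := Fintype.ofFinite ι
  let p : (⨁ fun i => ind (Set.Iic (⟨τ, d i⟩ : D.CoshIdx))) ⟶ D.kernelTensor F τ :=
    biproduct.desc fun i => kerConst (d i) (x i)
  have : Epi p := ⟨fun {X} f g hfg => by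
    have hi : ∀ i, kerConst (d i) (x i) ≫ f = kerConst (d i) (x i) ≫ g := fun i => by
      have := congrArg (fun k => biproduct.ι _ i ≫ k) hfg
      simpa only [p, biproduct.ι_desc_assoc] using this
    refine ker_hom_ext fun b q w => ?_
    by_cases hq : q ≤ ⟨τ, b⟩
    swap
    · rw [kerElt_eq_zero hq, map_zero, map_zero]
    have hw : w ∈ ((D.shStalk τ).obj F).genSpan d x b := by rw [hx]; trivial
    refine Submodule.span_induction (p := fun w _ => (f.app q).hom (D.kerElt F τ b q w) =
      (g.app q).hom (D.kerElt F τ b q w)) ?_ ?_ ?_ ?_ hw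
    · rintro _ ⟨i, h, rfl⟩
      let l : (⟨τ, d i⟩ : D.ShIdx) ⟶ ⟨τ, b⟩ := (D.shIncl τ).map (homOfLE (Wt.le_def.2 h))
      -- The monomial multiplying the generator moves across the tensor sign, so the element comes
      -- from the `i`-th summand.
      have h5 := (kerElt_mul l q (x i)).symm
      change (f.app q).hom (D.kerElt F τ b q ((F.map l).hom (x i))) =
        (g.app q).hom (D.kerElt F τ b q ((F.map l).hom (x i)))
      rw [h5]
      by_cases hqi : q ≤ ⟨τ, d i⟩
      · have h6 := congrArg (fun k => (k.app q).hom
          (indVal (Set.Iic (⟨τ, d i⟩ : D.CoshIdx)) q 1)) (hi i)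
        have h7 := kerConst_indVal (w := x i) hqi 1
        rw [one_smul] at h7
        rw [← h7]
        exact h6
      · rw [kerElt_eq_zero hqi, map_zero, map_zero]
    · exact (congrArg _ (map_zero _)).trans ((map_zero _).trans ((congrArg _ (map_zero _)).trans
        (map_zero _)).symm)
    · intro u v _ _ hu hv
      rw [map_add, map_add, map_add, hu, hv]
    · intro c u _ hu
      rw [map_smul, map_smul, map_smul, hu]⟩
  refine D.tcf.prop_of_epi p ?_
  exact D.tcf.prop_of_iso (biproduct.isoProduct _).symm (D.tcf.prop_product fun i => iic_tcf hfree _)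

end MonoidSheaf

/-! ### Morphisms between free functors -/

section Free

variable {J : Type} [Preorder J]

/-- The scalar that describes a morphism between free functors. -/
def coef {x x' : J} (α : free x ⟶ free x') : ℂ :=
  indFun (Set.Ici x') x ((α.app x).hom (indVal (Set.Ici x) x 1))

theorem free_app_indVal {x x' : J} (hx : x' ≤ x) (α : free x ⟶ free x') {z : J} (hz : x ≤ z) :
    (α.app z).hom (indVal (Set.Ici x) z 1) = indVal (Set.Ici x') z (coef α) := by
  have h1 := nat_apply α (homOfLE hz) (indVal (Set.Ici x) x 1)
  rw [ind_map (Z := Set.Ici x) _ (show x ∈ Set.Ici x from le_refl x)] at h1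
  refine h1.trans ?_
  have h2 : (α.app x).hom (indVal (Set.Ici x) x 1) = indVal (Set.Ici x') x (coef α) := by
    rw [coef, indFun, dif_pos (show x ∈ Set.Ici x' from hx), indVal_indCoe]
  rw [h2, ind_map (Z := Set.Ici x') _ (show x ∈ Set.Ici x' from hx)]

/-- By Yoneda a morphism is an element of `free x'` at `x`, and this component is one-dimensional
when `x' ≤ x`. -/
theorem coef_bijective {x x' : J} (hx : x' ≤ x) :
    Function.Bijective (coef : (free x ⟶ free x') → ℂ) := by
  constructor
  · intro α β h
    refine free_hom_ext ?_
    rw [free_app_indVal hx α le_rfl, free_app_indVal hx β le_rfl, h]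
  · intro c
    refine ⟨fromFree (indVal (Set.Ici x') x c), ?_⟩
    rw [coef, fromFree_self, indFun_indVal (show x ∈ Set.Ici x' from hx)]

theorem free_hom_eq_zero {x x' : J} (hx : ¬ x' ≤ x) (α : free x ⟶ free x') : α = 0 :=
  free_hom_ext (ind_eq_of_notMem (Z := Set.Ici x') hx _ _)

end Free

/-! ### Tensor products of the kernels with free sheaves -/

namespace MonoidSheaf

variable {I : Type} [PartialOrder I] {D : MonoidSheaf I} {x : D.ShIdx} {τ : I}

/-- The restriction of an index to a face, as an index for cosheaves. -/
def resCosh (x : D.ShIdx) (h : τ ≤ x.cone) : D.CoshIdx := ⟨τ, D.res h x.deg⟩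

/-- The generator of the tensor product with a free sheaf. -/
def kerGen (x : D.ShIdx) (h : τ ≤ x.cone) (q : D.CoshIdx) : (D.kernelTensor (free x) τ).obj q :=
  D.kerElt (free x) τ (D.res h x.deg) q (indVal (Set.Ici x) ⟨τ, D.res h x.deg⟩ 1)

theorem le_res (h : τ ≤ x.cone) : x ≤ ⟨τ, D.res h x.deg⟩ := leOfHom (D.shRes h x.deg)

theorem kerGen_map (h : τ ≤ x.cone) {q q' : D.CoshIdx} (f : q ⟶ q') :
    ((D.kernelTensor (free x) τ).map f).hom (kerGen x h q) = kerGen x h q' := kerElt_map f _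

theorem kerGen_eq_zero (h : τ ≤ x.cone) {q : D.CoshIdx} (hq : ¬ q ≤ resCosh x h) :
    kerGen x h q = 0 := kerElt_eq_zero hq _

theorem resCosh_le (h : τ ≤ x.cone) {b : D.wt τ} (hb : x ≤ ⟨τ, b⟩) : resCosh x h ≤ ⟨τ, b⟩ := by
  obtain ⟨_, h'⟩ := hb
  have h1 : D.res (le_refl τ) b - D.res h x.deg ∈ D.mon τ := by rw [D.res_refl]; exact h'
  exact ⟨le_rfl, h1⟩

/-- Homogeneous elements of the stalk of `free x` at `τ` are multiples of the restricted generator,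
and the monomial factor is absorbed by the other side of the tensor product. -/
theorem exists_kerGen (h : τ ≤ x.cone) (b : D.wt τ) (w : (free x).obj ⟨τ, b⟩) :
    ∃ c : ℂ, ∀ q, D.kerElt (free x) τ b q w = c • kerGen x h q := by
  by_cases hb : x ≤ ⟨τ, b⟩
  · refine ⟨indCoe (Set.Ici x) (x := ⟨τ, b⟩) hb w, fun q => ?_⟩
    have hle : (⟨τ, D.res h x.deg⟩ : D.ShIdx) ≤ ⟨τ, b⟩ := by
      obtain ⟨_, h'⟩ := hb
      exact ⟨le_rfl, by rw [D.res_refl]; exact h'⟩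
    have h1 : w = ((free x).map (homOfLE hle)).hom (indVal (Set.Ici x) ⟨τ, D.res h x.deg⟩
        (indCoe (Set.Ici x) (x := ⟨τ, b⟩) hb w)) := by
      rw [ind_map (Z := Set.Ici x) _ (show _ ∈ Set.Ici x from le_res h)]
      rfl
    conv_lhs => rw [h1]
    rw [← kerElt_mul, kerGen, ← map_smul, smul_indVal, mul_one]
  · refine ⟨0, fun q => ?_⟩
    rw [ind_eq_of_notMem (Z := Set.Ici x) hb w 0, map_zero, zero_smul]

/-- The functional on `cofree` that defines `kerDesc`. -/
def kerFun (h : τ ≤ x.cone) (b : D.wt τ) : Module.Dual ℂ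
    (((D.cofree.obj (.op ⟨τ, b⟩)).obj ((free x).obj ⟨τ, b⟩)).obj (resCosh x h)) :=
  if hb : resCosh x h ≤ ⟨τ, b⟩ then indFun (Set.Ici x) ⟨τ, b⟩ ∘ₗ
    LinearMap.proj (R := ℂ) (φ := fun _ : resCosh x h ⟶ ⟨τ, b⟩ => (free x).obj ⟨τ, b⟩) (homOfLE hb)
  else 0

theorem kerFun_const (h : τ ≤ x.cone) (b : D.wt τ) (w : (free x).obj ⟨τ, b⟩) :
    kerFun h b (D.cofreeConst ⟨τ, b⟩ _ (resCosh x h) w) = indFun (Set.Ici x) ⟨τ, b⟩ w := by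
  unfold kerFun
  split_ifs with hb
  · rfl
  · rw [indFun, dif_neg fun hx : (⟨τ, b⟩ : D.ShIdx) ∈ Set.Ici x => hb (resCosh_le h hx)]
    rfl

theorem kerFun_condition (h : τ ≤ x.cone) (a b : D.wt τ) (f : (⟨τ, a⟩ : D.CoshIdx) ⟶ ⟨τ, b⟩)
    (f' : (⟨τ, a⟩ : D.ShIdx) ⟶ ⟨τ, b⟩) :
    D.cofreeMap f (𝟙 ((free x).obj ⟨τ, a⟩)) ≫ toCofree (kerFun h a) =
      D.cofreeMap (𝟙 (⟨τ, b⟩ : D.CoshIdx)) ((free x).map f') ≫ toCofree (kerFun h b) :=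
  toCofree_hom_ext <|
    LinearMap.ext fun φ => by
    obtain ⟨w, rfl⟩ := D.exists_cofreeConst φ
    change ((toCofree (kerFun h a)).app _).hom (D.cofreeConst _ _ (resCosh x h) w) =
      ((toCofree (kerFun h b)).app _).hom
        (D.cofreeConst _ _ (resCosh x h) (((free x).map f').hom w))
    rw [toCofree_apply _ (le_refl _), toCofree_apply _ (le_refl _), map_self_apply, map_self_apply,
      kerFun_const, kerFun_const]
    by_cases ha : x ≤ ⟨τ, a⟩
    · rw [← indVal_indCoe (Z := Set.Ici x) (x := ⟨τ, a⟩) ha w,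
        ind_map (Z := Set.Ici x) _ (show _ ∈ Set.Ici x from ha),
        indFun_indVal (show (⟨τ, a⟩ : D.ShIdx) ∈ Set.Ici x from ha),
        indFun_indVal (show (⟨τ, b⟩ : D.ShIdx) ∈ Set.Ici x from ha.trans (leOfHom f'))]
    · rw [ind_eq_of_notMem (Z := Set.Ici x) ha w 0, map_zero, map_zero, map_zero]

/-- The tensor product with a free sheaf is cofree. -/
def kerDesc (h : τ ≤ x.cone) : D.kernelTensor (free x) τ ⟶ ind (Set.Iic (resCosh x h)) :=
  D.kernelDesc (fun b => toCofree (kerFun h b)) (kerFun_condition h)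

theorem kerDesc_kerGen (h : τ ≤ x.cone) {q : D.CoshIdx} (hq : q ≤ resCosh x h) :
    ((kerDesc h).app q).hom (kerGen x h q) = indVal _ q 1 := by
  have h1 := congrArg (fun k => (k.app q).hom (D.cofreeConst ⟨τ, D.res h x.deg⟩ _ q
    (indVal (Set.Ici x) ⟨τ, D.res h x.deg⟩ 1)))
    (D.kernelIncl_desc (fun b => toCofree (kerFun (x := x) h b)) (kerFun_condition h)
      (D.res h x.deg))
  refine h1.trans ((toCofree_apply _ hq _).trans (congrArg _ ?_))
  exact (kerFun_const h _ _).trans (indFun_indVal (show _ ∈ Set.Ici x from le_res h) 1)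

/-- The stalk of `free x` at `τ` is free of rank one over the algebra, so tensoring with it only
shifts the weights of the kernel. The inverse is tensoring with the generator. -/
theorem isIso_kerDesc (h : τ ≤ x.cone) : IsIso (kerDesc h) := by
  let g : ind (Set.Iic (resCosh x h)) ⟶ D.kernelTensor (free x) τ :=
    kerConst (D.res h x.deg) (indVal (Set.Ici x) ⟨τ, D.res h x.deg⟩ 1)
  have hg : ∀ q, q ≤ resCosh x h → (g.app q).hom (indVal _ q 1) = kerGen x h q := fun q hq =>
    (kerConst_indVal (w := indVal (Set.Ici x) ⟨τ, D.res h x.deg⟩ 1) hq 1).trans (one_smul _ _)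
  refine ⟨g, ker_hom_ext fun b q w => ?_, ind_hom_ext fun q hq => ?_⟩
  · obtain ⟨c, hc⟩ := exists_kerGen h b w
    rw [hc, map_smul, map_smul]
    by_cases hq : q ≤ resCosh x h
    · change c • (g.app q).hom (((kerDesc h).app q).hom (kerGen x h q)) = c • kerGen x h q
      rw [kerDesc_kerGen h hq, hg q hq]
    · rw [kerGen_eq_zero h hq, map_zero, map_zero]
  · change ((kerDesc h).app q).hom ((g.app q).hom (indVal _ q 1)) = indVal _ q 1
    rw [hg q hq, kerDesc_kerGen h hq]

theorem kerGen_ne_zero (h : τ ≤ x.cone) {q : D.CoshIdx} (hq : q ≤ resCosh x h) :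
    kerGen x h q ≠ 0 := fun h0 => by
  have h1 := kerDesc_kerGen h hq
  rw [h0, map_zero] at h1
  exact one_ne_zero (congrArg (indCoe (Set.Iic (resCosh x h)) (x := q) hq) h1).symm

theorem exists_smul_kerGen (h : τ ≤ x.cone) {q : D.CoshIdx}
    (a : (D.kernelTensor (free x) τ).obj q) : ∃ c : ℂ, a = c • kerGen x h q := by
  have := isIso_kerDesc (x := x) h
  have hinj : Function.Injective ((kerDesc (x := x) h).app q).hom :=
    ((ConcreteCategory.isIso_iff_bijective ((kerDesc (x := x) h).app q)).1 inferInstance).1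
  by_cases hq : q ≤ resCosh x h
  · refine ⟨indCoe _ (show q ∈ Set.Iic (resCosh x h) from hq) (((kerDesc h).app q).hom a), hinj ?_⟩
    rw [map_smul, kerDesc_kerGen h hq, smul_indVal, mul_one, indVal_indCoe]
  · refine ⟨0, hinj (ind_eq_of_notMem (Z := Set.Iic (resCosh x h)) hq _ _)⟩

theorem kernelTensor_free_isZero (h : ¬ τ ≤ x.cone) : IsZero (D.kernelTensor (free x) τ) :=
  (IsZero.iff_id_eq_zero _).2 (ker_hom_ext fun b q w => by
    rw [ind_eq_of_notMem (Z := Set.Ici x) (x := ⟨τ, b⟩) (fun hx => h hx.1) w 0, map_zero, map_zero,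
      map_zero])

/-- On components that are at most one-dimensional, all structure maps become scalars in the bases
`kerGen`: restriction to faces has coefficient `1`, a morphism of free sheaves its own coefficient.
-/
theorem kernelMap_kerGen {x' : D.ShIdx} (hx : x' ≤ x) (α : free x ⟶ free x') (h : τ ≤ x.cone)
    {τ' : I} (h' : τ' ≤ τ) (h'' : τ' ≤ x'.cone) (q : D.CoshIdx) :
    ((D.kernelMap α h').app q).hom (kerGen x h q) = coef α • kerGen x' h'' q := by
  have hle : (⟨τ', D.res h'' x'.deg⟩ : D.ShIdx) ≤ ⟨τ', D.res h' (D.res h x.deg)⟩ := by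
    obtain ⟨h₁, h₂⟩ := hx
    refine ⟨le_rfl, ?_⟩
    have := D.res_mem (h'.trans h) _ h₂
    rw [map_sub, D.res_res h₁ (h'.trans h) h''] at this
    rwa [D.res_refl, D.res_res h h' (h'.trans h)]
  have hz : x ≤ (⟨τ', D.res h' (D.res h x.deg)⟩ : D.ShIdx) :=
    (le_res h).trans (leOfHom (D.shRes h' (D.res h x.deg)))
  refine (kernelMap_kerElt α h' _ q _).trans ?_
  rw [ind_map (Z := Set.Ici x) _ (show _ ∈ Set.Ici x from le_res h),
    free_app_indVal hx α hz, kerGen, ← map_smul, kerElt_mul (homOfLE hle), smul_indVal,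
    ind_map (Z := Set.Ici x') _ (show _ ∈ Set.Ici x' from le_res h''), mul_one]

theorem kernelTensor_free_injective (x : D.ShIdx) (τ : I) :
    Injective (D.kernelTensor (free x) τ) := by
  by_cases h : τ ≤ x.cone
  · have := isIso_kerDesc (x := x) h
    exact Injective.of_iso (asIso (kerDesc (x := x) h)).symm inferInstance
  · exact ⟨fun f _ _ => ⟨0, (kernelTensor_free_isZero h).eq_of_tgt _ _⟩⟩

end MonoidSheaf

/-! ### Calculus in cellular complexes -/

namespace CellData

variable {I : Type} [PartialOrder I] [Fintype I] (c : CellData I)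
variable {C : Type*} [Category* C] [Preadditive C] [HasFiniteBiproducts C]

/-- The inclusion of a summand in a term of a cellular complex. -/
def cellι (P : Iᵒᵖ ⥤ C) {i : ℤ} (σ : c.Cell i) : P.obj (.op σ.1) ⟶ (c.cellular.obj P).X i :=
  biproduct.ι (fun σ : c.Cell i => P.obj (.op σ.1)) σ

/-- The projection to a summand of a term of a cellular complex. -/
def cellπ (P : Iᵒᵖ ⥤ C) {i : ℤ} (σ : c.Cell i) : (c.cellular.obj P).X i ⟶ P.obj (.op σ.1) :=
  biproduct.π (fun σ : c.Cell i => P.obj (.op σ.1)) σ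

variable {c}

theorem cellπ_hom_ext {P : Iᵒᵖ ⥤ C} {i : ℤ} {X : C} {f g : X ⟶ (c.cellular.obj P).X i}
    (h : ∀ σ, f ≫ c.cellπ P σ = g ≫ c.cellπ P σ) : f = g := biproduct.hom_ext _ _ h

theorem cellι_hom_ext {P : Iᵒᵖ ⥤ C} {i : ℤ} {X : C} {f g : (c.cellular.obj P).X i ⟶ X}
    (h : ∀ σ, c.cellι P σ ≫ f = c.cellι P σ ≫ g) : f = g := biproduct.hom_ext' _ _ h

theorem cellι_π_self (P : Iᵒᵖ ⥤ C) {i : ℤ} (σ : c.Cell i) : c.cellι P σ ≫ c.cellπ P σ = 𝟙 _ :=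
  biproduct.ι_π_self _ _

theorem cellι_π_ne (P : Iᵒᵖ ⥤ C) {i : ℤ} {σ σ' : c.Cell i} (h : σ ≠ σ') :
    c.cellι P σ ≫ c.cellπ P σ' = 0 := biproduct.ι_π_ne _ h

theorem sum_cellπ_ι (P : Iᵒᵖ ⥤ C) (i : ℤ) : ∑ σ : c.Cell i, c.cellπ P σ ≫ c.cellι P σ = 𝟙 _ :=
  biproduct.total

theorem cellular_map_π {P Q : Iᵒᵖ ⥤ C} (f : P ⟶ Q) {i : ℤ} (σ : c.Cell i) :
    (c.cellular.map f).f i ≫ c.cellπ Q σ = c.cellπ P σ ≫ f.app (.op σ.1) :=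
  biproduct.map_π (fun σ : c.Cell i => f.app (.op σ.1)) σ

theorem cellι_map {P Q : Iᵒᵖ ⥤ C} (f : P ⟶ Q) {i : ℤ} (σ : c.Cell i) :
    c.cellι P σ ≫ (c.cellular.map f).f i = f.app (.op σ.1) ≫ c.cellι Q σ :=
  biproduct.ι_map (fun σ : c.Cell i => f.app (.op σ.1)) σ

theorem cellι_d_π (P : Iᵒᵖ ⥤ C) {i j : ℤ} (σ : c.Cell i) (τ : c.Cell j) :
    c.cellι P σ ≫ (c.cellular.obj P).d i j ≫ c.cellπ P τ = c.comp P σ.1 τ.1 :=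
  (biproduct.ι_matrix_assoc ..).trans (biproduct.lift_π ..)

theorem cellular_d_π (P : Iᵒᵖ ⥤ C) {i j : ℤ} (τ : c.Cell j) :
    (c.cellular.obj P).d i j ≫ c.cellπ P τ = ∑ σ : c.Cell i, c.cellπ P σ ≫ c.comp P σ.1 τ.1 := by
  rw [← Category.id_comp ((c.cellular.obj P).d i j ≫ c.cellπ P τ), ← sum_cellπ_ι,
    Preadditive.sum_comp]
  exact Finset.sum_congr rfl fun σ _ => by rw [Category.assoc, cellι_d_π]

instance : (c.cellular (C := C)).Additive where
  map_add {P Q f g} := by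
    ext i : 1
    refine cellπ_hom_ext fun τ => ?_
    rw [cellular_map_π, HomologicalComplex.add_f_apply, Preadditive.add_comp, cellular_map_π,
      cellular_map_π, NatTrans.app_add, Preadditive.comp_add]

variable (c)

/-- A map of degree `-1` between the terms of a cellular complex. -/
def cellularHomotopyHom {P : Iᵒᵖ ⥤ C} (g : ∀ σ τ : I, P.obj (.op σ) ⟶ P.obj (.op τ)) (i j : ℤ) :
    (c.cellular.obj P).X i ⟶ (c.cellular.obj P).X j :=
  biproduct.matrix fun (σ : c.Cell i) (τ : c.Cell j) => g σ.1 τ.1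

variable {c} in
theorem cellι_homotopyHom_π {P : Iᵒᵖ ⥤ C} (g : ∀ σ τ : I, P.obj (.op σ) ⟶ P.obj (.op τ))
    {i j : ℤ} (σ : c.Cell i) (τ : c.Cell j) :
    c.cellι P σ ≫ c.cellularHomotopyHom g i j ≫ c.cellπ P τ = g σ.1 τ.1 :=
  (biproduct.ι_matrix_assoc ..).trans (biproduct.lift_π ..)

variable {c} in
theorem cellι_comp_π {P : Iᵒᵖ ⥤ C} {i j k : ℤ} (f : (c.cellular.obj P).X i ⟶ (c.cellular.obj P).X j)
    (g : (c.cellular.obj P).X j ⟶ (c.cellular.obj P).X k) (σ : c.Cell i) (ξ : c.Cell k) :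
    c.cellι P σ ≫ (f ≫ g) ≫ c.cellπ P ξ =
      ∑ τ : c.Cell j, (c.cellι P σ ≫ f ≫ c.cellπ P τ) ≫ c.cellι P τ ≫ g ≫ c.cellπ P ξ := by
  conv_lhs => rw [← Category.comp_id f, ← sum_cellπ_ι]
  simp only [Preadditive.comp_sum, Preadditive.sum_comp, Category.assoc]

/-- A sum over the cells of one dimension. -/
theorem sum_cell {M : Type*} [AddCommMonoid M] (f : I → M) (i : ℤ)
    (hf : ∀ σ, -(c.dim σ : ℤ) ≠ i → f σ = 0) : ∑ σ : c.Cell i, f σ.1 = ∑ σ, f σ :=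
  Finset.sum_of_injOn Subtype.val (Subtype.val_injective.injOn) (by simp)
    (fun σ _ hσ => hf σ fun h => hσ ⟨⟨σ, h⟩, by simp⟩) (fun _ _ => rfl)

/-- A contraction of a cellular complex. -/
def cellularContraction {P : Iᵒᵖ ⥤ C} (g : ∀ σ τ : I, P.obj (.op σ) ⟶ P.obj (.op τ))
    (hg : ∀ σ τ, c.dim τ ≠ c.dim σ + 1 → g σ τ = 0)
    (h1 : ∀ σ, ∑ τ, c.comp P σ τ ≫ g τ σ + ∑ τ, g σ τ ≫ c.comp P τ σ = 𝟙 _)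
    (h0 : ∀ σ σ', σ ≠ σ' → ∑ τ, c.comp P σ τ ≫ g τ σ' + ∑ τ, g σ τ ≫ c.comp P τ σ' = 0) :
    Homotopy (𝟙 (c.cellular.obj P)) 0 where
  hom i j := c.cellularHomotopyHom g i j
  zero i j hij := cellπ_hom_ext fun τ => cellι_hom_ext fun σ => by
    rw [cellι_homotopyHom_π, zero_comp, comp_zero]
    refine hg _ _ fun h => hij ?_
    have h₁ := σ.2
    have h₂ := τ.2
    simp only [ComplexShape.up_Rel]
    omega
  comm i := by
    rw [dNext_eq _ (show (ComplexShape.up ℤ).Rel i (i + 1) from rfl),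
      prevD_eq _ (show (ComplexShape.up ℤ).Rel (i - 1) i from sub_add_cancel i 1),
      HomologicalComplex.zero_f, add_zero, HomologicalComplex.id_f]
    refine cellπ_hom_ext fun σ' => cellι_hom_ext fun σ => ?_
    have e1 : c.cellι P σ ≫ ((c.cellular.obj P).d i (i + 1) ≫
        c.cellularHomotopyHom g (i + 1) i) ≫ c.cellπ P σ' = ∑ τ, c.comp P σ.1 τ ≫ g τ σ'.1 := by
      rw [← c.sum_cell (fun τ => c.comp P σ.1 τ ≫ g τ σ'.1) (i + 1) fun τ hτ => ?_]
      · simp only [cellι_comp_π, cellι_d_π, cellι_homotopyHom_π]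
      · by_cases h : c.inc σ.1 τ = 0
        · rw [c.comp_eq_zero P h, zero_comp]
        · have := c.dim_of_inc h
          have := σ.2
          omega
    have e2 : c.cellι P σ ≫ (c.cellularHomotopyHom g i (i - 1) ≫
        (c.cellular.obj P).d (i - 1) i) ≫ c.cellπ P σ' = ∑ τ, g σ.1 τ ≫ c.comp P τ σ'.1 := by
      rw [← c.sum_cell (fun τ => g σ.1 τ ≫ c.comp P τ σ'.1) (i - 1) fun τ hτ => ?_]
      · simp only [cellι_comp_π, cellι_d_π, cellι_homotopyHom_π]
      · rw [hg _ _ fun h => hτ (by have := σ.2; omega), zero_comp]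
    rw [Preadditive.add_comp, Preadditive.comp_add]
    refine Eq.trans ?_ (congrArg₂ (· + ·) e1 e2).symm
    rw [Category.id_comp]
    by_cases h : σ = σ'
    · subst h
      rw [h1, cellι_π_self]
    · rw [h0 _ _ fun h' => h (Subtype.ext h'), cellι_π_ne P h]

section Map

variable {C' : Type*} [Category* C'] [Preadditive C'] [HasFiniteBiproducts C'] (F : C ⥤ C')
  [F.Additive]

theorem map_comp (P : Iᵒᵖ ⥤ C) (σ τ : I) : F.map (c.comp P σ τ) = c.comp (P ⋙ F) σ τ := by
  unfold comp
  split_ifs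
  · exact F.map_zsmul
  · exact F.map_zero _ _

/-- Cellular complexes commute with additive functors, in each degree. -/
def cellularMapXIso (P : Iᵒᵖ ⥤ C) (i : ℤ) :
    F.obj ((c.cellular.obj P).X i) ≅ (c.cellular.obj (P ⋙ F)).X i :=
  F.mapBiproduct (fun σ : c.Cell i => P.obj (.op σ.1))

theorem cellularMapXIso_hom_π (P : Iᵒᵖ ⥤ C) {i : ℤ} (σ : c.Cell i) :
    (c.cellularMapXIso F P i).hom ≫ c.cellπ (P ⋙ F) σ = F.map (c.cellπ P σ) :=
  biproduct.lift_π _ _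

/-- Cellular complexes commute with additive functors. -/
def cellularMapIso : c.cellular ⋙ F.mapHomologicalComplex (.up ℤ) ≅
    (Functor.whiskeringRight _ _ _).obj F ⋙ c.cellular :=
  NatIso.ofComponents (fun P => HomologicalComplex.Hom.isoOfComponents
    (fun i => c.cellularMapXIso F P i) (fun i j _ => by
      refine cellπ_hom_ext (P := P ⋙ F) fun τ => ?_
      change ((c.cellularMapXIso F P i).hom ≫ (c.cellular.obj (P ⋙ F)).d i j) ≫ _ =
        (F.map ((c.cellular.obj P).d i j) ≫ (c.cellularMapXIso F P j).hom) ≫ _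
      rw [Category.assoc, Category.assoc, cellularMapXIso_hom_π, ← F.map_comp, cellular_d_π,
        cellular_d_π, Preadditive.comp_sum, F.map_sum]
      refine Finset.sum_congr rfl fun σ _ => ?_
      rw [← Category.assoc, cellularMapXIso_hom_π, F.map_comp, c.map_comp]))
    (fun {P Q} f => by
      ext i : 1
      refine cellπ_hom_ext (P := Q ⋙ F) fun τ => ?_
      change (F.map ((c.cellular.map f).f i) ≫ (c.cellularMapXIso F Q i).hom) ≫ _ =
        ((c.cellularMapXIso F P i).hom ≫ (c.cellular.map (Functor.whiskerRight f F)).f i) ≫ _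
      rw [Category.assoc, Category.assoc, cellularMapXIso_hom_π, ← F.map_comp, cellular_map_π,
        cellular_map_π, ← Category.assoc, cellularMapXIso_hom_π, F.map_comp]
      rfl)

end Map

end CellData

/-! ### Contraction of cellular complexes in the direction of a ray -/

namespace SmoothFan

variable {N : Type} [AddCommGroup N] {Δ : SmoothFan N}

/-- The cone `ρ` is spanned by its facet `σ` and by `v`. -/
def Adj (v : N) (σ ρ : Δ.Cone) : Prop := v ∉ σ.1 ∧ ρ.1 = insert v σ.1

theorem Adj.le {v : N} {σ ρ : Δ.Cone} (h : Adj v σ ρ) : σ ≤ ρ :=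
  show σ.1 ⊆ ρ.1 from h.2 ▸ Finset.subset_insert _ _

theorem Adj.mem {v : N} {σ ρ : Δ.Cone} (h : Adj v σ ρ) : v ∈ ρ.1 :=
  h.2 ▸ Finset.mem_insert_self _ _

theorem Adj.dim {v : N} {σ ρ : Δ.Cone} (h : Adj v σ ρ) : Δ.dim ρ = Δ.dim σ + 1 := by
  rw [SmoothFan.dim, h.2, Finset.card_insert_of_notMem h.1]; rfl

theorem Adj.inc (ε : Δ.Orientation) {v : N} {σ ρ : Δ.Cone} (h : Adj v σ ρ) :
    (Δ.cellData ε).inc ρ σ = ε ρ * ε σ * sign ρ.1 σ.1 := if_pos ⟨h.le, h.dim⟩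

theorem exists_adj (ε : Δ.Orientation) {σ ρ : Δ.Cone} (h : (Δ.cellData ε).inc ρ σ ≠ 0) :
    ∃ v, Adj v σ ρ := by
  have h1 : σ.1 ⊆ ρ.1 := (Δ.cellData ε).le_of_inc h
  have h2 : ρ.1.card = σ.1.card + 1 := (Δ.cellData ε).dim_of_inc h
  have h3 := Finset.card_sdiff_add_card_eq_card h1
  obtain ⟨v, hv⟩ := Finset.card_eq_one.1 (show (ρ.1 \ σ.1).card = 1 by omega)
  have h4 : v ∈ ρ.1 \ σ.1 := by rw [hv]; simp
  refine ⟨v, (Finset.mem_sdiff.1 h4).2, ?_⟩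
  rw [← Finset.sdiff_union_of_subset h1, hv]
  rfl

theorem sign_sq {S : Finset N} {a : N} (ha : a ∉ S) :
    sign (insert a S) S * sign (insert a S) S = 1 := by
  rw [sign_insert ha, ← pow_add, ← two_mul, pow_mul]
  norm_num

theorem units_sq (u : ℤˣ) : (u : ℤ) * u = 1 := by
  rw [← Units.val_mul, Int.units_mul_self, Units.val_one]

theorem Adj.inc_sq (ε : Δ.Orientation) {v : N} {σ ρ : Δ.Cone} (h : Adj v σ ρ) :
    (Δ.cellData ε).inc ρ σ * (Δ.cellData ε).inc ρ σ = 1 := by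
  have h1 := sign_sq h.1
  rw [← h.2] at h1
  rw [h.inc]
  linear_combination ε σ * ε σ * (sign ρ.1 σ.1 * sign ρ.1 σ.1) * units_sq (ε ρ) +
    (sign ρ.1 σ.1 * sign ρ.1 σ.1) * units_sq (ε σ) + h1

/-- The square of the differential vanishes on the square of faces between `ξ` and `ρ`: `[ρ:σ][σ:ξ]
+ [ρ:τ][τ:ξ] = 0`. Multiplying by `[ρ:τ][σ:ξ]`, where every incidence number is a sign, gives the
claim. -/
theorem inc_square (ε : Δ.Orientation) {v w : N} {ξ σ τ ρ : Δ.Cone} (hvw : v ≠ w)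
    (h₁ : Adj v ξ σ) (h₂ : Adj w σ ρ) (h₃ : Adj w ξ τ) (h₄ : Adj v τ ρ) :
    (Δ.cellData ε).inc σ ξ * (Δ.cellData ε).inc τ ξ +
      (Δ.cellData ε).inc ρ σ * (Δ.cellData ε).inc ρ τ = 0 := by
  have h5 := sign_mul_sign (N := N) h₃.1 h₁.1 hvw.symm
  rw [← h₁.2, ← h₃.2, ← h₂.2, ← h₄.2] at h5
  have hs : sign ρ.1 τ.1 * sign ρ.1 τ.1 = 1 := by
    have := sign_sq h₄.1
    rwa [← h₄.2] at this
  have ht : sign σ.1 ξ.1 * sign σ.1 ξ.1 = 1 := by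
    have := sign_sq h₁.1
    rwa [← h₁.2] at this
  rw [h₁.inc, h₂.inc, h₃.inc, h₄.inc]
  linear_combination (ε σ * ε τ * sign σ.1 ξ.1 * sign τ.1 ξ.1) * units_sq (ε ξ) +
    (ε σ * ε τ * sign ρ.1 σ.1 * sign ρ.1 τ.1) * units_sq (ε ρ) +
    (ε σ * ε τ * sign ρ.1 τ.1 * sign σ.1 ξ.1) * h5 -
    ε σ * ε τ * sign ρ.1 τ.1 * sign ρ.1 σ.1 * ht - ε σ * ε τ * sign σ.1 ξ.1 * sign τ.1 ξ.1 * hs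

section

variable {C : Type*} [Category* C] [Preadditive C] [HasFiniteBiproducts C]
  (ε : Δ.Orientation) {P : Δ.Coneᵒᵖ ⥤ C} {v : N}
  (hi : ∀ (σ ρ : Δ.Cone) (h : Adj v σ ρ), IsIso (P.map (homOfLE h.le).op))

/-- The contraction of a diagram that does not change in the direction `v`. -/
def contractionMap (σ ρ : Δ.Cone) : P.obj (.op σ) ⟶ P.obj (.op ρ) :=
  if h : Adj v σ ρ then
    have := hi σ ρ h
    (Δ.cellData ε).inc ρ σ • inv (P.map (homOfLE h.le).op) else 0

theorem contractionMap_of_not {σ ρ : Δ.Cone} (h : ¬ Adj v σ ρ) :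
    contractionMap ε hi σ ρ = 0 := dif_neg h

theorem comp_of_adj {w : N} {σ ρ : Δ.Cone} (h : Adj w σ ρ) :
    (Δ.cellData ε).comp P ρ σ = (Δ.cellData ε).inc ρ σ • P.map (homOfLE h.le).op :=
  dif_pos h.le

theorem comp_contractionMap {σ τ ξ : Δ.Cone} {w : N} (h : Adj w ξ σ) (h' : Adj v ξ τ) :
    (Δ.cellData ε).comp P σ ξ ≫ contractionMap ε hi ξ τ =
      have := hi ξ τ h'
      ((Δ.cellData ε).inc σ ξ * (Δ.cellData ε).inc τ ξ) •
        (P.map (homOfLE h.le).op ≫ inv (P.map (homOfLE h'.le).op)) := by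
  rw [comp_of_adj ε h, contractionMap, dif_pos h', Preadditive.zsmul_comp, Preadditive.comp_zsmul,
    smul_smul]

theorem contractionMap_comp {σ τ ρ : Δ.Cone} {w : N} (h : Adj v σ ρ) (h' : Adj w τ ρ) :
    contractionMap ε hi σ ρ ≫ (Δ.cellData ε).comp P ρ τ =
      have := hi σ ρ h
      ((Δ.cellData ε).inc ρ σ * (Δ.cellData ε).inc ρ τ) •
        (inv (P.map (homOfLE h.le).op) ≫ P.map (homOfLE h'.le).op) := by
  rw [comp_of_adj ε h', contractionMap, dif_pos h, Preadditive.zsmul_comp, Preadditive.comp_zsmul,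
    smul_smul]

theorem comp_contractionMap_eq_zero {σ τ ξ : Δ.Cone}
    (h : ¬ ((∃ w, Adj w ξ σ) ∧ Adj v ξ τ)) :
    (Δ.cellData ε).comp P σ ξ ≫ contractionMap ε hi ξ τ = 0 := by
  by_cases h' : Adj v ξ τ
  · rw [(Δ.cellData ε).comp_eq_zero P, zero_comp]
    by_contra h''
    exact h ⟨exists_adj ε h'', h'⟩
  · rw [contractionMap_of_not ε hi h', comp_zero]

theorem contractionMap_comp_eq_zero {σ τ ρ : Δ.Cone}
    (h : ¬ ((∃ w, Adj w τ ρ) ∧ Adj v σ ρ)) :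
    contractionMap ε hi σ ρ ≫ (Δ.cellData ε).comp P ρ τ = 0 := by
  by_cases h' : Adj v σ ρ
  · rw [(Δ.cellData ε).comp_eq_zero P, comp_zero]
    by_contra h''
    exact h ⟨exists_adj ε h'', h'⟩
  · rw [contractionMap_of_not ε hi h', zero_comp]

theorem Adj.unique_left {v : N} {σ σ' ρ : Δ.Cone} (h : Adj v σ ρ) (h' : Adj v σ' ρ) : σ = σ' := by
  refine Subtype.ext ?_
  have := h.2.symm.trans h'.2
  rw [← Finset.erase_insert h.1, this, Finset.erase_insert h'.1]

theorem Adj.unique_right {v : N} {σ ρ ρ' : Δ.Cone} (h : Adj v σ ρ) (h' : Adj v σ ρ') : ρ = ρ' :=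
  Subtype.ext (h.2.trans h'.2.symm)

theorem Adj.eq_of_mem {v w : N} {σ ρ : Δ.Cone} (h : Adj w σ ρ) (h' : v ∈ ρ.1) (h'' : v ∉ σ.1) :
    v = w := by
  rw [h.2, Finset.mem_insert] at h'
  exact h'.resolve_right h''

theorem exists_adj_of_mem {v : N} {ρ : Δ.Cone} (h : v ∈ ρ.1) : ∃ σ : Δ.Cone, Adj v σ ρ :=
  ⟨⟨ρ.1.erase v, Δ.faces _ ρ.2 _ (Finset.erase_subset _ _)⟩, Finset.notMem_erase _ _,
    (Finset.insert_erase h).symm⟩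

/-- The cellular complex of a diagram that does not change in the direction `v` is
contractible. -/
theorem nonempty_contraction
    (hi : ∀ (σ ρ : Δ.Cone) (h : Adj v σ ρ), IsIso (P.map (homOfLE h.le).op))
    (hz : ∀ σ : Δ.Cone, v ∉ σ.1 → (¬ ∃ ρ : Δ.Cone, Adj v σ ρ) →
    IsZero (P.obj (.op σ))) :
    Nonempty (Homotopy (𝟙 ((Δ.cellData ε).cellular.obj P)) 0) := by
  refine ⟨(Δ.cellData ε).cellularContraction (contractionMap ε hi)
    (fun σ τ h => contractionMap_of_not ε hi fun h' => h h'.dim) (fun σ => ?_)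
    fun σ σ' hne => ?_⟩
  -- Diagonal entries. If `v ∈ σ`, the only route removes `v` and puts it back. Otherwise it adds
  -- `v` and removes it, or `P σ` is zero. The incidence number occurs squared.
  · by_cases hv : v ∈ σ.1
    · obtain ⟨ξ, hξ⟩ := exists_adj_of_mem hv
      rw [Finset.sum_eq_single ξ, Finset.sum_eq_zero, comp_contractionMap ε hi hξ hξ, hξ.inc_sq,
        one_smul, IsIso.hom_inv_id, add_zero]
      · exact fun τ _ => contractionMap_comp_eq_zero ε hi fun h => h.2.1 hv
      · exact fun τ _ hτ => comp_contractionMap_eq_zero ε hi fun h => hτ (h.2.unique_left hξ)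
      · simp
    · by_cases hρ : ∃ ρ : Δ.Cone, Adj v σ ρ
      · obtain ⟨ρ, hρ⟩ := hρ
        rw [Finset.sum_eq_zero, Finset.sum_eq_single ρ, contractionMap_comp ε hi hρ hρ, hρ.inc_sq,
          one_smul, IsIso.inv_hom_id, zero_add]
        · exact fun τ _ hτ => contractionMap_comp_eq_zero ε hi fun h => hτ (h.2.unique_right hρ)
        · simp
        · exact fun τ _ => comp_contractionMap_eq_zero ε hi fun h => hv h.2.mem
      · exact (hz σ hv hρ).eq_of_src _ _
  · by_cases hv : v ∈ σ.1
    · rw [Finset.sum_eq_zero, Finset.sum_eq_zero, add_zero]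
      · exact fun τ _ => contractionMap_comp_eq_zero ε hi fun h => h.2.1 hv
      · refine fun τ _ => comp_contractionMap_eq_zero ε hi fun h => ?_
        obtain ⟨⟨w, h1⟩, h2⟩ := h
        obtain rfl := h1.eq_of_mem hv h2.1
        exact hne (h1.unique_right h2)
    by_cases hρ : ∃ ρ : Δ.Cone, Adj v σ ρ
    swap
    · exact (hz σ hv hρ).eq_of_src _ _
    obtain ⟨ρ, hρ⟩ := hρ
    -- Off the diagonal the only surviving case exchanges a ray `w` of `σ` for `v`. There are two
    -- routes, through the common facet `ξ` and through the join `ρ`, and they cancel by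
    -- `inc_square`.
    by_cases hσ' : ∃ w, Adj w σ' ρ
    · obtain ⟨w, hw⟩ := hσ'
      have hwv : w ≠ v := by
        rintro rfl
        exact hne (hρ.unique_left hw)
      have hv' : v ∈ σ'.1 := by
        by_contra h
        exact hwv (hw.eq_of_mem hρ.mem h).symm
      obtain ⟨ξ, hξ⟩ := exists_adj_of_mem hv'
      have hwσ : Adj w ξ σ := by
        refine ⟨fun h => hw.1 (hξ.le h), ?_⟩
        have h1 : insert v σ.1 = insert v (insert w ξ.1) := by
          rw [← hρ.2, hw.2, hξ.2, Finset.insert_comm]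
        rw [← Finset.erase_insert hv, h1, Finset.erase_insert]
        rw [Finset.mem_insert]
        exact fun h => h.elim (fun h => hwv h.symm) hξ.1
      rw [Finset.sum_eq_single ξ, Finset.sum_eq_single ρ, comp_contractionMap ε hi hwσ hξ,
        contractionMap_comp ε hi hρ hw]
      · have h1 := hi _ _ hξ
        have h2 := hi _ _ hρ
        have h3 : P.map (homOfLE hwσ.le).op ≫ inv (P.map (homOfLE hξ.le).op) =
            inv (P.map (homOfLE hρ.le).op) ≫ P.map (homOfLE hw.le).op := by
          rw [IsIso.comp_inv_eq, Category.assoc, IsIso.eq_inv_comp, ← P.map_comp, ← P.map_comp]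
          rfl
        change _ • (P.map (homOfLE hwσ.le).op ≫ inv (P.map (homOfLE hξ.le).op)) + _ • _ = 0
        rw [h3, ← add_smul, inc_square ε hwv hwσ hρ hξ hw, zero_smul]
      · exact fun τ _ hτ => contractionMap_comp_eq_zero ε hi fun h => hτ (h.2.unique_right hρ)
      · simp
      · exact fun τ _ hτ => comp_contractionMap_eq_zero ε hi fun h => hτ (h.2.unique_left hξ)
      · simp
    · rw [Finset.sum_eq_zero, Finset.sum_eq_zero, add_zero]
      · refine fun τ _ => contractionMap_comp_eq_zero ε hi fun h => ?_
        obtain ⟨⟨w, h1⟩, h2⟩ := h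
        exact hσ' ⟨w, by rwa [h2.unique_right hρ] at h1⟩
      · refine fun τ _ => comp_contractionMap_eq_zero ε hi fun h => ?_
        obtain ⟨⟨w, h1⟩, h2⟩ := h
        refine hσ' ⟨w, ?_, ?_⟩
        · rw [h2.2, Finset.mem_insert]
          rintro (rfl | h)
          · exact hv (by rw [h1.2]; simp)
          · exact h1.1 h
        · rw [hρ.2, h1.2, h2.2, Finset.insert_comm]

end

end SmoothFan

/-! ### Bounds and closure properties of the terms of cellular complexes -/

namespace CellData

variable {I : Type} [PartialOrder I] [Fintype I] {c : CellData I}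
variable {C : Type*} [Category* C] [Preadditive C] [HasFiniteBiproducts C]

theorem cellular_isZero {P : Iᵒᵖ ⥤ C} {i : ℤ} (h : ∀ σ : c.Cell i, IsZero (P.obj (.op σ.1))) :
    IsZero ((c.cellular.obj P).X i) :=
  (IsZero.iff_id_eq_zero _).2 (cellπ_hom_ext fun σ => (h σ).eq_of_tgt _ _)

theorem cellular_isZero_of_pos (P : Iᵒᵖ ⥤ C) {i : ℤ} (h : 0 < i) :
    IsZero ((c.cellular.obj P).X i) := cellular_isZero fun σ => by have := σ.2; lia

theorem cellular_isZero_of_lt (P : Iᵒᵖ ⥤ C) {i : ℤ}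
    (h : i < -(Finset.univ.sup c.dim : ℕ)) : IsZero ((c.cellular.obj P).X i) :=
  cellular_isZero fun σ => by
    have := σ.2
    have := Finset.le_sup (f := c.dim) (Finset.mem_univ σ.1)
    lia

theorem cellular_prop {Q : ObjectProperty C} [Q.IsClosedUnderIsomorphisms]
    [Q.IsClosedUnderFiniteProducts] {P : Iᵒᵖ ⥤ C} (h : ∀ σ, Q (P.obj σ)) (i : ℤ) :
    Q ((c.cellular.obj P).X i) :=
  Q.prop_of_iso (biproduct.isoProduct fun σ : c.Cell i => P.obj (.op σ.1)).symm
    (Q.prop_product fun _ => h _)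

theorem cellular_injective {P : Iᵒᵖ ⥤ C} (h : ∀ σ, Injective (P.obj σ)) (i : ℤ) :
    Injective ((c.cellular.obj P).X i) :=
  inferInstanceAs (Injective (⨁ fun σ : c.Cell i => P.obj (.op σ.1)))

end CellData

/-! ### Dual point sheaves and their morphisms to the kernels -/

namespace MonoidSheaf

variable {I : Type} [PartialOrder I] {D : MonoidSheaf I}

theorem kernelMap_add {F F' : D.Sheaf} (α β : F ⟶ F') {σ τ : I} (h : τ ≤ σ) :
    D.kernelMap (α + β) h = D.kernelMap α h + D.kernelMap β h := ker_hom_ext fun b q w => by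
  change ((D.kernelMap (α + β) h).app q).hom (D.kerElt F σ b q w) =
    ((D.kernelMap α h).app q).hom (D.kerElt F σ b q w) +
      ((D.kernelMap β h).app q).hom (D.kerElt F σ b q w)
  rw [kernelMap_kerElt, kernelMap_kerElt, kernelMap_kerElt, ← map_add]
  rfl

instance : D.kernelDiagram.Additive where
  map_add {F F' α β} := by
    ext σ : 2
    exact kernelMap_add _ _ _

instance [Fintype I] (c : CellData I) : (D.koszul c).Additive :=
  inferInstanceAs (D.kernelDiagram ⋙ c.cellular).Additive

section Point

variable {x x' : D.ShIdx} {τ : I}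

/-- Restriction of weights is transitive, so the weight condition at `q` sees only the restriction
of `x.deg` to `q.cone`. The cone `τ` enters through `q.cone ≤ τ` alone, which makes the coefficients
of the cellular complex constant. -/
theorem le_resCosh_iff (h : τ ≤ x.cone) {q : D.CoshIdx} :
    q ≤ resCosh x h ↔ q.cone ≤ τ ∧ q ≤ resCosh x le_rfl := by
  constructor
  · rintro ⟨h₁, h₂⟩
    refine ⟨h₁, h₁.trans h, ?_⟩
    change D.res (h₁.trans h) (D.res (le_refl _) x.deg) - q.deg ∈ _
    change D.res h₁ (D.res h x.deg) - q.deg ∈ _ at h₂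
    rwa [D.res_refl, ← D.res_res h h₁]
  · rintro ⟨h₁, h₂, h₃⟩
    refine ⟨h₁, ?_⟩
    have h₂ : q.cone ≤ x.cone := h₂
    change D.res h₂ (D.res (le_refl _) x.deg) - q.deg ∈ _ at h₃
    change D.res h₁ (D.res h x.deg) - q.deg ∈ _
    rwa [D.res_refl, ← D.res_res h h₁] at h₃

/-- The support of the dual of a point sheaf. -/
def pointSet (x : D.ShIdx) : Set D.CoshIdx := {q | q.cone = x.cone ∧ q ≤ resCosh x le_rfl}

theorem mem_pointSet_of_le {q q' : D.CoshIdx} (hq : q ∈ pointSet x) (h : q ≤ q')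
    (hq' : q' ≤ resCosh x le_rfl) : q' ∈ pointSet x :=
  ⟨le_antisymm ((le_resCosh_iff _).1 hq').1 (hq.1 ▸ h.1), hq'⟩

instance (x : D.ShIdx) : (pointSet x).OrdConnected where
  out' _ ha _ hb _ hc := mem_pointSet_of_le ha hc.1 (hc.2.trans hb.2)

/-- The first term of the resolution. -/
def pointKer (x : D.ShIdx) : ind (pointSet x) ⟶ D.kernelTensor (free x) x.cone :=
  fromInd (pointSet x) _ (fun q => kerGen x le_rfl q) fun q q' f hq => by
    rw [kerGen_map]
    split_ifs with h
    · rfl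
    · exact kerGen_eq_zero _ fun h' => h (mem_pointSet_of_le hq (leOfHom f) h')

theorem pointKer_indVal {q : D.CoshIdx} (hq : q ∈ pointSet x) :
    ((pointKer x).app q).hom (indVal (pointSet x) q 1) = kerGen x le_rfl q :=
  (fromInd_indVal hq 1).trans (one_smul _ _)

theorem pointKer_injective (q : D.CoshIdx) : Function.Injective ((pointKer x).app q).hom :=
  ind_hom_injective (fun q hq => by
    rw [pointKer_indVal hq]
    exact kerGen_ne_zero _ hq.2) q

instance : Mono (pointKer x) := mono_of_injective pointKer_injective

/-- The dual of the point sheaf is the part of `𝒜_{[σ]}^∨` (shifted) that lives over `σ = x.cone`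
itself. -/
theorem pointKer_bijective {q : D.CoshIdx} (hq : q.cone = x.cone) :
    Function.Bijective ((pointKer x).app q).hom := by
  refine ⟨pointKer_injective q, fun a => ?_⟩
  obtain ⟨c, rfl⟩ := exists_smul_kerGen le_rfl a
  by_cases h : q ≤ resCosh x le_rfl
  · exact ⟨c • indVal (pointSet x) q 1, by rw [map_smul, pointKer_indVal ⟨hq, h⟩]⟩
  · exact ⟨0, by rw [map_zero, kerGen_eq_zero _ h, smul_zero]⟩

/-- The nonzero components of the target are lines spanned by `kerGen`, all carried isomorphically
to the greatest index `resCosh x' h`. A morphism is therefore one scalar, read off there, and it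
vanishes if this index is outside the support of the source. -/
theorem exists_point_hom (h : τ ≤ x'.cone)
    (f : ind (pointSet x) ⟶ D.kernelTensor (free x') τ) :
    ∃ c : ℂ, (resCosh x' h ∉ pointSet x → c = 0) ∧
      ∀ q ∈ pointSet x, (f.app q).hom (indVal (pointSet x) q 1) = c • kerGen x' h q := by
  obtain ⟨c, hc⟩ := exists_smul_kerGen h ((f.app (resCosh x' h)).hom (indVal (pointSet x) _ 1))
  have hc0 : resCosh x' h ∉ pointSet x → c = 0 := fun h' => by
    rw [ind_eq_of_notMem h' (indVal _ _ 1) 0, map_zero] at hc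
    exact (smul_eq_zero.1 hc.symm).resolve_right (kerGen_ne_zero h le_rfl)
  refine ⟨c, hc0, fun q hq => ?_⟩
  by_cases h' : q ≤ resCosh x' h
  · obtain ⟨d, hd⟩ := exists_smul_kerGen h ((f.app q).hom (indVal (pointSet x) q 1))
    have h1 := nat_apply f (homOfLE h') (indVal (pointSet x) q 1)
    rw [ind_map _ hq, hc, hd, map_smul, kerGen_map] at h1
    rw [hd, smul_left_injective ℂ (kerGen_ne_zero h le_rfl) h1]
  · obtain ⟨d, hd⟩ := exists_smul_kerGen h ((f.app q).hom (indVal (pointSet x) q 1))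
    rw [hd, kerGen_eq_zero h h', smul_zero, smul_zero]

/-- The greatest index of the target has cone `τ`, whereas the source is supported over `x.cone`. -/
theorem point_hom_eq_zero (h : τ ≠ x.cone) (f : ind (pointSet x) ⟶ D.kernelTensor (free x') τ) :
    f = 0 := by
  by_cases h' : τ ≤ x'.cone
  · obtain ⟨c, hc, hf⟩ := exists_point_hom h' f
    refine ind_hom_ext fun q hq => ?_
    rw [hf q hq, hc fun hm => h hm.1, zero_smul]
    rfl
  · exact (kernelTensor_free_isZero h').eq_of_tgt _ _

theorem resCosh_mem_pointSet (h : x.cone ≤ x'.cone) : resCosh x' h ∈ pointSet x ↔ x' ≤ x := by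
  have key : resCosh x' h ≤ resCosh x le_rfl ↔ x' ≤ x := by
    constructor
    · rintro ⟨h₁, h₂⟩
      refine ⟨h, ?_⟩
      change D.res (le_refl _) (D.res (le_refl _) x.deg) - D.res h x'.deg ∈ D.mon x.cone at h₂
      rwa [D.res_refl, D.res_refl] at h₂
    · rintro ⟨h₁, h₂⟩
      have h₃ : D.res (le_refl _) (D.res (le_refl _) x.deg) - D.res h x'.deg ∈ D.mon x.cone := by
        rwa [D.res_refl, D.res_refl]
      exact ⟨le_rfl, h₃⟩
  exact ⟨fun h' => key.1 h'.2, fun h' => ⟨rfl, key.2 h'⟩⟩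

/-- Full faithfulness on free sheaves comes down to this. Both morphism spaces are `ℂ` when `x' ≤ x`
and zero otherwise, and the map preserves the coefficient. -/
theorem point_hom_bijective (x x' : D.ShIdx) : Function.Bijective fun α : free x ⟶ free x' =>
    pointKer x ≫ D.kernelMap α (le_refl x.cone) := by
  by_cases hx : x' ≤ x
  · have h := hx.1
    have key : ∀ (α : free x ⟶ free x') (q : D.CoshIdx), q ∈ pointSet x →
        ((pointKer x ≫ D.kernelMap α (le_refl x.cone)).app q).hom (indVal (pointSet x) q 1) =
          coef α • kerGen x' h q := fun α q hq => by
      refine Eq.trans ?_ (kernelMap_kerGen hx α (le_refl _) (le_refl _) h q)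
      exact congrArg _ (pointKer_indVal hq)
    have hm := (resCosh_mem_pointSet h).2 hx
    refine ⟨fun α β e => (coef_bijective hx).1 ?_, fun f => ?_⟩
    · have h1 := key α _ hm
      rw [show pointKer x ≫ D.kernelMap α (le_refl x.cone) = _ from e, key β _ hm] at h1
      exact (smul_left_injective ℂ (kerGen_ne_zero h le_rfl) h1).symm
    · obtain ⟨c, -, hc⟩ := exists_point_hom h f
      obtain ⟨α, rfl⟩ := (coef_bijective hx).2 c
      exact ⟨α, ind_hom_ext fun q hq => (key α q hq).trans (hc q hq).symm⟩
  · refine ⟨fun α β _ => (free_hom_eq_zero hx α).trans (free_hom_eq_zero hx β).symm, fun f => ?_⟩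
    refine ⟨0, Eq.trans ?_ (Eq.symm (?_ : f = 0))⟩
    · change pointKer x ≫ D.kernelMap 0 (le_refl x.cone) = 0
      rw [kernelMap_zero, comp_zero]
    · by_cases h : x.cone ≤ x'.cone
      · obtain ⟨c, hc, hf⟩ := exists_point_hom h f
        refine ind_hom_ext fun q hq => ?_
        rw [hf q hq, hc fun hm => hx ((resCosh_mem_pointSet h).1 hm), zero_smul]
        rfl
      · exact (kernelTensor_free_isZero h).eq_of_tgt _ _

theorem kernelTensor_free_obj_isZero {q : D.CoshIdx}
    (h : ¬ (q.cone ≤ τ ∧ τ ≤ x.cone ∧ q ≤ resCosh x le_rfl)) :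
    IsZero ((D.kernelTensor (free x) τ).obj q) := by
  by_cases h' : τ ≤ x.cone
  · have : Subsingleton ((D.kernelTensor (free x) τ).obj q) := ⟨fun a b => by
      obtain ⟨c, rfl⟩ := exists_smul_kerGen h' a
      obtain ⟨d, rfl⟩ := exists_smul_kerGen h' b
      rw [kerGen_eq_zero h' fun h'' => h ⟨((le_resCosh_iff h').1 h'').1, h',
        ((le_resCosh_iff h').1 h'').2⟩, smul_zero, smul_zero]⟩
    exact ModuleCat.isZero_of_subsingleton _
  · exact (kernelTensor_free_isZero h').obj q

theorem coef_id (x : D.ShIdx) : coef (𝟙 (free x)) = 1 :=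
  indFun_indVal (show x ∈ Set.Ici x from le_refl x) 1

/-- The projection sends generator to generator, so it is bijective at `q` unless `q.cone` is a face
of `σ` but not of `τ`. -/
theorem isIso_kernelMap_app {σ : I} (h : τ ≤ σ) (hσ : σ ≤ x.cone) {q : D.CoshIdx}
    (hq : q.cone ≤ σ → q.cone ≤ τ) : IsIso ((D.kernelMap (𝟙 (free x)) h).app q) := by
  have key : ((D.kernelMap (𝟙 (free x)) h).app q).hom (kerGen x hσ q) =
      kerGen x (h.trans hσ) q := by
    rw [kernelMap_kerGen (le_refl x) _ hσ h (h.trans hσ), coef_id, one_smul]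
  refine (ConcreteCategory.isIso_iff_bijective _).2 ⟨?_, fun a => ?_⟩
  · refine (injective_iff_map_eq_zero ((D.kernelMap (𝟙 (free x)) h).app q).hom).2 fun a ha => ?_
    obtain ⟨c, rfl⟩ := exists_smul_kerGen hσ a
    by_cases h' : q ≤ resCosh x hσ
    · rw [map_smul, key] at ha
      have h1 : q ≤ resCosh x (h.trans hσ) := by
        rw [le_resCosh_iff] at h' ⊢
        exact ⟨hq h'.1, h'.2⟩
      rw [(smul_eq_zero.1 ha).resolve_right (kerGen_ne_zero _ h1), zero_smul]
    · rw [kerGen_eq_zero _ h', smul_zero]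
  · obtain ⟨c, rfl⟩ := exists_smul_kerGen (h.trans hσ) a
    exact ⟨c • kerGen x hσ q, (map_smul ((D.kernelMap (𝟙 (free x)) h).app q).hom c _).trans
      (congrArg _ key)⟩

end Point

end MonoidSheaf

theorem isIso_of_isZero {C : Type*} [Category* C] {X Y : C} (hX : IsZero X) (hY : IsZero Y)
    (f : X ⟶ Y) : IsIso f := ⟨hY.to_ X, hX.eq_of_src _ _, hY.eq_of_src _ _⟩

theorem exactAt_of_homotopy {C : Type*} [Category* C] [Abelian C] {L : CochainComplex C ℤ}
    (h : Homotopy (𝟙 L) 0) (i : ℤ) : L.ExactAt i := by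
  rw [HomologicalComplex.exactAt_iff_isZero_homology, IsZero.iff_id_eq_zero,
    ← HomologicalComplex.homologyMap_id, h.homologyMap_eq, HomologicalComplex.homologyMap_zero]

theorem exactAt_of_isZero {C : Type*} [Category* C] [Abelian C] {L : CochainComplex C ℤ} {i : ℤ}
    (h : IsZero (L.X i)) : L.ExactAt i := by
  rw [HomologicalComplex.exactAt_iff]
  exact ShortComplex.exact_of_isZero_X₂ _ h

namespace CellData

theorem comp_cellι_bijective {I : Type} [PartialOrder I] [Fintype I] {c : CellData I}
    {C : Type*} [Category* C] [Preadditive C] [HasFiniteBiproducts C] {P : Iᵒᵖ ⥤ C} {i : ℤ}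
    (σ : c.Cell i) {X : C} (h : ∀ τ : c.Cell i, τ ≠ σ → ∀ f : X ⟶ P.obj (.op τ.1), f = 0) :
    Function.Bijective fun f : X ⟶ P.obj (.op σ.1) => f ≫ c.cellι P σ := by
  refine ⟨fun f g e => ?_, fun f => ⟨f ≫ c.cellπ P σ, cellπ_hom_ext fun τ => ?_⟩⟩
  · have e := congrArg (fun a => a ≫ c.cellπ P σ) e
    simpa only [Category.assoc, cellι_π_self, Category.comp_id] using e
  · by_cases hτ : τ = σ
    · subst hτ
      simp only [Category.assoc, cellι_π_self, Category.comp_id]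
    · exact (h τ hτ _).trans (h τ hτ _).symm

variable {I : Type} [PartialOrder I] [Fintype I] {c : CellData I} {J : Type} [Preorder J]
  {P : Iᵒᵖ ⥤ J ⥤ ModuleCat.{0} ℂ} {q : J} {i : ℤ}

instance : HasFiniteBiproducts (J ⥤ ModuleCat.{0} ℂ) := Abelian.hasFiniteBiproducts

theorem sum_cell_app : ∑ σ : c.Cell i, (c.cellπ P σ).app q ≫ (c.cellι P σ).app q = 𝟙 _ := by
  have := congrArg (fun f => f.app q) (sum_cellπ_ι (c := c) P i)
  simpa only [NatTrans.app_sum, NatTrans.comp_app, NatTrans.id_app] using this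

theorem cellular_obj_isZero (h : ∀ σ : c.Cell i, IsZero ((P.obj (.op σ.1)).obj q)) :
    IsZero (((c.cellular.obj P).X i).obj q) := by
  rw [IsZero.iff_id_eq_zero, ← sum_cell_app]
  exact Finset.sum_eq_zero fun σ _ => by rw [(h σ).eq_of_tgt ((c.cellπ P σ).app q) 0, zero_comp]

theorem isIso_cellι_app (σ : c.Cell i)
    (h : ∀ τ : c.Cell i, τ ≠ σ → IsZero ((P.obj (.op τ.1)).obj q)) :
    IsIso ((c.cellι P σ).app q) := by
  refine ⟨(c.cellπ P σ).app q, ?_, ?_⟩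
  · exact congrArg (fun f => f.app q) (cellι_π_self P σ)
  · rw [← sum_cell_app, Finset.sum_eq_single σ]
    · exact fun τ _ hτ => by rw [(h τ hτ).eq_of_tgt ((c.cellπ P τ).app q) 0, zero_comp]
    · simp

end CellData

/-! ### The cellular complex of a free sheaf resolves a dual point sheaf -/

namespace SmoothFan

open MonoidSheaf CellData

variable {N : Type} [AddCommGroup N] [Module.Finite ℤ N] {Δ : SmoothFan N} (ε : Δ.Orientation)

/-- The cellular complexes of objects of `ℬ-mod`. -/
abbrev koszulB : Δ.BMod ⥤ CochainComplex Δ.B.Cosheaf ℤ :=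
  Δ.B.fg.ι ⋙ Δ.B.koszul (Δ.cellData ε)

theorem koszulB_tcf (F : Δ.BMod) (i : ℤ) : Δ.B.tcf (((koszulB ε).obj F).X i) :=
  cellular_prop (c := Δ.cellData ε) (P := Δ.B.kernelDiagram.obj F.obj)
    (fun σ => kernelTensor_tcf free_fg F.2 σ.unop) i

/-- The cellular complexes of objects of `ℬ-mod`, as complexes of objects of `co-ℬ-tcf`. -/
abbrev koszulBTcf : Δ.BMod ⥤ CochainComplex Δ.CoBTcf ℤ :=
  liftComplex Δ.B.tcf (koszulB ε) (koszulB_tcf ε)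

/-- The dual of a point sheaf, as an object of `co-ℬ-tcf`. -/
def pointCosh (x : Δ.B.ShIdx) : Δ.CoBTcf :=
  ⟨ind (pointSet x), Δ.B.tcf.prop_of_mono (pointKer x) (kernelTensor_tcf free_fg (free_fg x) _)⟩

/-- The cone of an index, as a cell. -/
def idxCell (x : Δ.B.ShIdx) : (Δ.cellData ε).Cell (-(Δ.dim x.cone : ℤ)) := ⟨x.cone, rfl⟩

/-- Only the summand at `x.cone` can receive a nonzero morphism, and it sits in degree `-dim
x.cone`. -/
theorem pointCosh_koszul_eq_zero (x x' : Δ.B.ShIdx) (i : ℤ) (hi : i ≠ -(Δ.dim x.cone : ℤ))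
    (f : pointCosh x ⟶ ((koszulBTcf ε).obj (shFree x')).X i) : f = 0 :=
  ObjectProperty.hom_ext _ <| cellπ_hom_ext (c := Δ.cellData ε)
    (P := Δ.B.kernelDiagram.obj (free x')) fun τ =>
    (point_hom_eq_zero (fun h => hi (by rw [← τ.2, ← h]; rfl)) _).trans
      (point_hom_eq_zero (fun h => hi (by rw [← τ.2, ← h]; rfl)) _).symm

/-- The inclusion of the dual of a point sheaf in the cellular complex of a free sheaf. -/
def pointToKoszul (x : Δ.B.ShIdx) :
    pointCosh x ⟶ ((koszulBTcf ε).obj (shFree x)).X (-(Δ.dim x.cone : ℤ)) :=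
  ObjectProperty.homMk (pointKer x ≫ (Δ.cellData ε).cellι (Δ.B.kernelDiagram.obj (free x))
    (idxCell ε x))

/-- The cellular complex of a free sheaf as a resolution of the dual of a point sheaf. -/
def pointResolution (x : Δ.B.ShIdx) :
    (CochainComplex.singleFunctor Δ.CoBTcf (-(Δ.dim x.cone : ℤ))).obj (pointCosh x) ⟶
      (koszulBTcf ε).obj (shFree x) :=
  fromSingle _ (pointCosh_koszul_eq_zero ε x x) (pointToKoszul ε x)

theorem pointResolution_f (x : Δ.B.ShIdx) :
    (pointResolution ε x).f (-(Δ.dim x.cone : ℤ)) =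
      (singleXSelf (-(Δ.dim x.cone : ℤ)) (pointCosh x)).hom ≫ pointToKoszul ε x := by
  rw [← Iso.inv_comp_eq]
  exact fromSingle_f _ (pointCosh_koszul_eq_zero ε x x) (pointToKoszul ε x)

/-- Combines `point_hom_bijective` with the fact that morphisms from the dual point to the whole
term factor through the summand at `x.cone`. -/
theorem pointToKoszul_bijective (x x' : Δ.B.ShIdx) :
    Function.Bijective fun α : shFree x ⟶ shFree x' =>
      (singleXSelf (-(Δ.dim x.cone : ℤ)) (pointCosh x)).inv ≫
        (pointResolution ε x).f (-(Δ.dim x.cone : ℤ)) ≫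
          ((koszulBTcf ε).map α).f (-(Δ.dim x.cone : ℤ)) := by
  let P' := Δ.B.kernelDiagram.obj (free x')
  let e₁ : (shFree x ⟶ shFree x') → (free x ⟶ free x') := fun α => α.hom
  let e₂ : (free x ⟶ free x') → (ind (pointSet x) ⟶ Δ.B.kernelTensor (free x') x.cone) :=
    fun α => pointKer x ≫ Δ.B.kernelMap α (le_refl x.cone)
  let e₃ : (ind (pointSet x) ⟶ Δ.B.kernelTensor (free x') x.cone) →
      (pointCosh x ⟶ ((koszulBTcf ε).obj (shFree x')).X (-(Δ.dim x.cone : ℤ))) :=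
    fun f => ObjectProperty.homMk (f ≫ (Δ.cellData ε).cellι P' (idxCell ε x))
  have h₁ : Function.Bijective e₁ :=
    ⟨fun _ _ h => ObjectProperty.hom_ext _ h, fun f => ⟨ObjectProperty.homMk f, rfl⟩⟩
  have h₃ : Function.Bijective e₃ := by
    have h₄ : Function.Bijective
        (ObjectProperty.homMk : _ → (pointCosh x ⟶ ((koszulBTcf ε).obj (shFree x')).X (-(Δ.dim x.cone : ℤ)))) :=
      ⟨fun _ _ h => congrArg (fun a => Δ.B.tcf.ι.map a) h, fun f => ⟨f.hom, rfl⟩⟩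
    exact h₄.comp (comp_cellι_bijective (c := Δ.cellData ε) (P := P') (X := ind (pointSet x))
      (idxCell ε x) fun τ hτ f => point_hom_eq_zero (fun h' => hτ (Subtype.ext h')) f)
  have key : e₃ ∘ e₂ ∘ e₁ = fun α : shFree x ⟶ shFree x' =>
      (singleXSelf (-(Δ.dim x.cone : ℤ)) (pointCosh x)).inv ≫
        (pointResolution ε x).f (-(Δ.dim x.cone : ℤ)) ≫
          ((koszulBTcf ε).map α).f (-(Δ.dim x.cone : ℤ)) := by
    funext α
    rw [pointResolution_f, Category.assoc, Iso.inv_hom_id_assoc]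
    refine ObjectProperty.hom_ext _ ?_
    have h := cellι_map (c := Δ.cellData ε) (Δ.B.kernelDiagram.map α.hom) (idxCell ε x)
    exact (Category.assoc _ _ _).trans ((congrArg (fun a => pointKer x ≫ a) h.symm).trans
      (Category.assoc _ _ _).symm)
  rw [← key]
  exact h₃.comp ((point_hom_bijective x x').comp h₁)

theorem kernelDiagram_free_isZero {x : Δ.B.ShIdx} {q : Δ.B.CoshIdx} (hq : q.cone = x.cone)
    {τ : Δ.Cone} (hτ : τ ≠ x.cone) :
    IsZero (((Δ.B.kernelDiagram.obj (free x)).obj (.op τ)).obj q) :=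
  kernelTensor_free_obj_isZero fun h => hτ (le_antisymm h.2.1 (hq ▸ h.1))

/-- At `q` only the cones between `q.cone` and `x.cone` contribute. A ray `v` of `x.cone` outside
`q.cone` can be added to or removed from these cones without changing the component, so the complex
contracts in the direction `v`. -/
theorem exists_contraction {x : Δ.B.ShIdx} {q : Δ.B.CoshIdx} (hq : q.cone ≠ x.cone) :
    Nonempty (Homotopy (𝟙 ((Δ.cellData ε).cellular.obj (Δ.B.kernelDiagram.obj (free x) ⋙
      (evaluation _ _).obj q))) 0) := by
  let P := Δ.B.kernelDiagram.obj (free x) ⋙ (evaluation _ _).obj q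
  have hP : ∀ τ : Δ.Cone, ¬ (q.cone ≤ τ ∧ τ ≤ x.cone) → IsZero (P.obj (.op τ)) := fun τ h =>
    kernelTensor_free_obj_isZero fun h' => h ⟨h'.1, h'.2.1⟩
  by_cases hle : q.cone ≤ x.cone
  · obtain ⟨v, hv, hv'⟩ : ∃ v ∈ x.cone.1, v ∉ q.cone.1 := by
      by_contra! h
      exact hq (le_antisymm hle h)
    refine nonempty_contraction ε (P := P) (v := v) (fun σ ρ h => ?_) fun σ hσ h => hP σ fun h' => ?_
    · by_cases hρ : ρ ≤ x.cone
      · exact isIso_kernelMap_app h.le hρ fun h1 w hw =>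
          (Finset.mem_insert.1 (h.2 ▸ h1 hw)).resolve_left fun e : w = v => hv' (e ▸ hw)
      · refine isIso_of_isZero (hP _ fun h' => hρ h'.2) (hP _ fun h' => hρ ?_) _
        change ρ.1 ⊆ x.cone.1
        rw [h.2]
        exact Finset.insert_subset hv h'.2
    · have h1 : insert v σ.1 ⊆ x.cone.1 := Finset.insert_subset hv h'.2
      exact h ⟨⟨insert v σ.1, Δ.faces _ x.cone.2 _ h1⟩, hσ, rfl⟩
  · have hz : ∀ τ : Δ.Cone, IsZero (P.obj (.op τ)) := fun τ => hP τ fun h => hle (h.1.trans h.2)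
    -- The diagram is zero at `q`, so any vector does as the direction.
    exact nonempty_contraction ε (P := P) (v := 0) (fun σ ρ h => isIso_of_isZero (hz _) (hz _) _)
      fun σ _ _ => hz σ

/-- Tested at each index `q`. Over `x.cone` only the summand of `x.cone` is nonzero and the map is
an isomorphism of complexes. Elsewhere the source is zero and the target contractible. -/
instance (x : Δ.B.ShIdx) : QuasiIso (pointResolution ε x) := by
  rw [← HomologicalComplex.quasiIso_map_iff_of_preservesHomology _ Δ.B.tcf.ι]
  rw [HomologicalComplex.quasiIso_iff_evaluation]
  intro q
  set u := (((evaluation Δ.B.CoshIdx (ModuleCat.{0} ℂ)).obj q).mapHomologicalComplex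
    (.up ℤ)).map ((Δ.B.tcf.ι.mapHomologicalComplex (.up ℤ)).map (pointResolution ε x))
  have hs : ∀ i, i ≠ -(Δ.dim x.cone : ℤ) → IsZero ((((CochainComplex.singleFunctor Δ.CoBTcf
      (-(Δ.dim x.cone : ℤ))).obj (pointCosh x)).X i).obj.obj q) := fun i hi =>
    (evaluation Δ.B.CoshIdx (ModuleCat.{0} ℂ)).obj q |>.map_isZero <| Δ.B.tcf.ι.map_isZero <|
      HomologicalComplex.isZero_single_obj_X (.up ℤ) _ _ _ hi
  by_cases hq : q.cone = x.cone
  · have hu : ∀ i, IsIso (u.f i) := fun i => by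
      by_cases hi : i = -(Δ.dim x.cone : ℤ)
      · subst hi
        have h1 : u.f (-(Δ.dim x.cone : ℤ)) =
            ((singleXSelf (-(Δ.dim x.cone : ℤ)) (pointCosh x)).hom.hom.app q) ≫
            ((pointKer x).app q ≫ ((Δ.cellData ε).cellι (Δ.B.kernelDiagram.obj (free x))
              (idxCell ε x)).app q) :=
          congrArg (fun a => a.hom.app q) (pointResolution_f ε x)
        have h2 : IsIso ((pointKer x).app q) :=
          (ConcreteCategory.isIso_iff_bijective _).2 (pointKer_bijective hq)
        have h3 := isIso_cellι_app (q := q) (P := Δ.B.kernelDiagram.obj (free x)) (idxCell ε x)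
          fun τ hτ => kernelDiagram_free_isZero hq fun h => hτ (Subtype.ext h)
        have h4 : IsIso ((singleXSelf (-(Δ.dim x.cone : ℤ)) (pointCosh x)).hom.hom.app q) :=
          inferInstanceAs (IsIso (((evaluation _ _).obj q).map
            (Δ.B.tcf.ι.map (singleXSelf (-(Δ.dim x.cone : ℤ)) (pointCosh x)).hom)))
        rw [h1]
        exact IsIso.comp_isIso' h4 (IsIso.comp_isIso' h2 h3)
      · refine isIso_of_isZero (hs i hi) ?_ _
        exact cellular_obj_isZero (c := Δ.cellData ε) (P := Δ.B.kernelDiagram.obj (free x))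
          fun σ => kernelDiagram_free_isZero hq fun h => hi (by rw [← σ.2, h]; rfl)
    have := HomologicalComplex.Hom.isIso_of_components u
    infer_instance
  · rw [quasiIso_iff]
    intro i
    rw [quasiIsoAt_iff_exactAt]
    · obtain ⟨h⟩ := exists_contraction ε hq
      refine HomologicalComplex.ExactAt.of_iso (exactAt_of_homotopy h i) ?_
      exact (((evaluation Δ.B.CoshIdx (ModuleCat.{0} ℂ)).obj q).mapHomologicalComplex
        (.up ℤ)).mapIso ((liftComplexIso Δ.B.tcf (koszulB ε) (koszulB_tcf ε)).app (shFree x)) ≪≫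
          ((Δ.cellData ε).cellularMapIso ((evaluation Δ.B.CoshIdx (ModuleCat.{0} ℂ)).obj q)).app
            (Δ.B.kernelDiagram.obj (free x)) |>.symm
    · refine exactAt_of_isZero ?_
      by_cases hi : i = -(Δ.dim x.cone : ℤ)
      · subst hi
        have : Subsingleton ((ind (pointSet x)).obj q) :=
          ⟨ind_eq_of_notMem fun h : q ∈ pointSet x => hq h.1⟩
        exact IsZero.of_iso (ModuleCat.isZero_of_subsingleton ((ind (pointSet x)).obj q))
          (((evaluation _ _).obj q).mapIso
            (Δ.B.tcf.ι.mapIso (singleXSelf (-(Δ.dim x.cone : ℤ)) (pointCosh x))))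
      · exact hs i hi

end SmoothFan

/-- Indicator functors of equal sets. -/
def indCongr {J : Type} [Preorder J] {Z Z' : Set J} [Z.OrdConnected] [Z'.OrdConnected]
    (h : Z = Z') : ind Z ≅ ind Z' := eqToIso (by subst h; rfl)

/-! ### The equivalence for `ℬ` -/

namespace SmoothFan

open MonoidSheaf CellData

variable {N : Type} [AddCommGroup N] [Module.Finite ℤ N] {Δ : SmoothFan N}

/-- The index with the opposite weight. -/
def negIdx (x : Δ.B.ShIdx) : Δ.B.ShIdx := ⟨x.cone, -x.deg⟩

theorem negSet_point (x : Δ.B.ShIdx) : negSet (shSet x x.cone.1 ∅) = pointSet (negIdx x) := by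
  ext q
  change (x ≤ (⟨q.cone, -q.deg⟩ : Δ.B.ShIdx) ∧ x.cone.1 ⊆ q.cone.1 ∧ _ ∧ _) ↔
    q.cone = x.cone ∧ q ≤ resCosh (negIdx x) le_rfl
  rw [sh_le_iff, cosh_le_iff]
  have key : q.cone ≤ x.cone → ((∀ v ∈ q.cone.1, coord x.deg v ≤ coord (-q.deg) v) ↔
      ∀ v ∈ q.cone.1, coord q.deg v ≤ coord (resCosh (negIdx x) le_rfl).deg v) := fun h =>
    forall₂_congr fun v hv => by
      have h1 : coord (resCosh (negIdx x) le_rfl).deg v = -coord x.deg v :=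
        (coord_res (le_refl x.cone) (-x.deg) (h hv)).trans (coord_neg x.deg (h hv))
      rw [h1, coord_neg _ hv]
      lia
  constructor
  · rintro ⟨⟨h1, h2⟩, h3, -⟩
    exact ⟨le_antisymm h1 h3, h1, (key h1).1 h2⟩
  · rintro ⟨h1, h2, h3⟩
    exact ⟨⟨h1.le, (key h1.le).2 h3⟩, h1.ge, by simp, by simp⟩

def pointCoshIso (x : Δ.B.ShIdx) : pointCosh (negIdx x) ≅ Δ.dualB (shInd x x.cone.1 ∅) :=
  Δ.B.tcf.isoMk ((indCongr (negSet_point x)).symm ≪≫ Δ.B.dualIndIso (shSet x x.cone.1 ∅))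

instance shFree_projective (x : Δ.B.ShIdx) : Projective (shFree x) :=
  Δ.B.fg.ι.projective_of_map_projective (free_projective x)

variable (ε : Δ.Orientation)

instance koszulBTcf_isStrictlyGE (F : Δ.BMod) : ((koszulBTcf ε).obj F).IsStrictlyGE
    (-(Finset.univ.sup (Δ.cellData ε).dim : ℕ)) :=
  (CochainComplex.isStrictlyGE_iff _ _).2 fun _ hn => (IsZero.iff_id_eq_zero _).2 <| ObjectProperty.hom_ext _ <|
    (cellular_isZero_of_lt (c := Δ.cellData ε) (Δ.B.kernelDiagram.obj F.obj) hn).eq_of_src _ _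

/-- The terms are finite sums of cofree cosheaves, hence injective, and the complex is bounded below
by minus the largest dimension of a cone. -/
instance koszulBTcf_isKInjective (x : Δ.B.ShIdx) :
    ((koszulBTcf ε).obj (shFree x)).IsKInjective := by
  have : ∀ n, Injective (((koszulBTcf ε).obj (shFree x)).X n) := fun n =>
    Δ.B.tcf.ι.injective_of_map_injective (cellular_injective (c := Δ.cellData ε)
      (P := Δ.B.kernelDiagram.obj (free x)) (fun σ => kernelTensor_free_injective x σ.unop) n)
  exact CochainComplex.isKInjective_of_injective _ (-(Finset.univ.sup (Δ.cellData ε).dim : ℕ))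

theorem koszulB_totalization_tcf (K : CochainComplex Δ.BMod ℤ) (n : ℤ) :
    Δ.B.tcf (((totalization (koszulB ε)).obj K).X n) :=
  totalization_prop Δ.B.tcf (koszulB_tcf ε) (-(Finset.univ.sup (Δ.cellData ε).dim : ℕ)) 0
    (fun F _ hn => cellular_isZero_of_lt (c := Δ.cellData ε) (Δ.B.kernelDiagram.obj F.obj) hn)
    (fun F _ hn => cellular_isZero_of_pos (c := Δ.cellData ε) (Δ.B.kernelDiagram.obj F.obj) hn) K n

universe w w'

variable [HasDerivedCategory.{w} Δ.BMod] [HasDerivedCategory.{w'} Δ.CoBTcf]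

theorem exists_derived_koszulB :
    ∃ (K : Db Δ.BMod ⥤ Db Δ.CoBTcf) (_ : K.CommShift ℤ), K.IsTriangulated ∧
      Nonempty (Db.ofProj Δ.BMod ⋙ K ⋙ Db.ι Δ.CoBTcf ≅ (boundedProj Δ.BMod).ι ⋙
        totalizationQ (koszulB ε) Δ.B.tcf (koszulB_totalization_tcf ε) ⋙ DerivedCategory.Q) :=
  exists_derived (koszulB ε) Δ.B.tcf (koszulB_totalization_tcf ε) generates_shFree
    (fun _ ⟨_, ⟨x, ⟨e⟩⟩, ⟨j⟩⟩ => ⟨shFree x, inferInstance, ⟨j ≪≫ (Db.single _).mapIso e⟩⟩)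
    (-(Finset.univ.sup (Δ.cellData ε).dim : ℕ)) 0
    (fun F _ hn => cellular_isZero_of_lt (c := Δ.cellData ε) (Δ.B.kernelDiagram.obj F.obj) hn)
    (fun F _ hn => cellular_isZero_of_pos (c := Δ.cellData ε) (Δ.B.kernelDiagram.obj F.obj) hn)

variable {ε} {K : Db Δ.BMod ⥤ Db Δ.CoBTcf} [K.CommShift ℤ] [K.IsTriangulated]
  (i : Db.ofProj Δ.BMod ⋙ K ⋙ Db.ι Δ.CoBTcf ≅ (boundedProj Δ.BMod).ι ⋙
    totalizationQ (koszulB ε) Δ.B.tcf (koszulB_totalization_tcf ε) ⋙ DerivedCategory.Q)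

/-- The value of the Koszul functor on a free sheaf. -/
def koszulFreeIso (x : Δ.B.ShIdx) : K.obj ((Db.single _).obj (shFree x)) ≅
    ((Db.single _).obj (pointCosh x))⟦(Δ.dim x.cone : ℤ)⟧ :=
  derivedSingleIso (koszulB_tcf ε) i (by lia) (pointResolution ε x)

theorem homBij_shFree (i : Db.ofProj Δ.BMod ⋙ K ⋙ Db.ι Δ.CoBTcf ≅
      (boundedProj Δ.BMod).ι ⋙ totalizationQ (koszulB ε) Δ.B.tcf (koszulB_totalization_tcf ε) ⋙
        DerivedCategory.Q)
    (x x' : Δ.B.ShIdx) (n : ℤ) :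
    HomBij K ((Db.single _).obj (shFree x)) (((Db.single _).obj (shFree x'))⟦n⟧) :=
  homBij_of_resolution (koszulB_tcf ε) i (pointResolution ε x)
    (pointCosh_koszul_eq_zero ε x x') (pointToKoszul_bijective ε x x') n

/-- Fully faithful because it is so between shifts of free sheaves. Essentially surjective because,
up to shift, the free sheaves go to the duals of point sheaves, which generate the target. -/
theorem isEquivalence_koszulB (i : Db.ofProj Δ.BMod ⋙ K ⋙ Db.ι Δ.CoBTcf ≅
      (boundedProj Δ.BMod).ι ⋙ totalizationQ (koszulB ε) Δ.B.tcf (koszulB_totalization_tcf ε) ⋙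
        DerivedCategory.Q) :
    K.IsEquivalence := by
  refine isEquivalence_of_generates (F := K) (generates_shFree (Δ := Δ)) (fun X Y hX hY n => ?_)
    (generates_dualPoint (Δ := Δ)) fun E hE => ?_
  · obtain ⟨P, ⟨x, ⟨e⟩⟩, ⟨j⟩⟩ := hX
    obtain ⟨P', ⟨x', ⟨e'⟩⟩, ⟨j'⟩⟩ := hY
    exact (homBij_shFree i x x' n).of_iso (j ≪≫ (Db.single _).mapIso e).symm
      ((shiftFunctor _ n).mapIso (j' ≪≫ (Db.single _).mapIso e').symm)
  · obtain ⟨F, ⟨x, ⟨e⟩⟩, ⟨j⟩⟩ := hE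
    refine K.essImage.prop_of_iso (j ≪≫ (Db.single _).mapIso (e ≪≫ (pointCoshIso x).symm)).symm ?_
    let d : ℤ := Δ.dim (negIdx x).cone
    -- Duality negates weights, hence `negIdx`. The shift by `-d` cancels the shift by the dimension
    -- in the value on a free sheaf.
    refine ⟨((Db.single _).obj (shFree (negIdx x)))⟦-d⟧, ⟨(K.commShiftIso (-d)).app _ ≪≫
      (shiftFunctor _ (-d)).mapIso (koszulFreeIso i (negIdx x)) ≪≫
        (shiftFunctorCompIsoId _ d (-d) (by lia)).app _⟩⟩

end SmoothFan

/-! ### Extensions by zero of the sheaf of algebras as indicator sheaves -/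

namespace MonoidSheaf

variable {I : Type} [PartialOrder I] (D : MonoidSheaf I)

/-- The indices of the nonzero components of the extension by zero of the sheaf of algebras. -/
def extSet (Z : Set I) : Set D.ShIdx := {y | y.cone ∈ Z ∧ y.deg ∈ D.mon y.cone}

theorem mem_mon_of_le {x y : D.ShIdx} (h : x ≤ y) (hx : x.deg ∈ D.mon x.cone) :
    y.deg ∈ D.mon y.cone := by
  obtain ⟨h', hm⟩ := h
  simpa using add_mem hm (D.res_mem h' _ hx)

instance (Z : Set I) [Z.OrdConnected] : (D.extSet Z).OrdConnected where
  out' _ hx _ hy _ hz := ⟨Set.OrdConnected.out (s := Z) ‹_› hy.1 hx.1 ⟨hz.2.1, hz.1.1⟩,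
    D.mem_mon_of_le hz.1 hx.2⟩

theorem extendByZero_map_apply {F : D.Sheaf} {Z : Set I} [Z.OrdConnected] {x y : D.ShIdx}
    (f : x ⟶ y) (hx : x.cone ∈ Z) (φ : PLift (x.cone ∈ Z) → F.obj x) :
    ((D.extendByZero F Z).map f).hom φ =
      fun _ : PLift (y.cone ∈ Z) => (F.map f).hom (φ ⟨hx⟩) := funext fun h => by
  change (if h : x.cone ∈ Z then (F.map f).hom ∘ₗ LinearMap.proj ⟨h⟩ else 0) φ = _
  rw [dif_pos hx]
  rfl

/-- The basis element of a component of the sheaf of algebras. -/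
def structureOne (x : D.ShIdx) : D.structureSheaf.obj x :=
  if h : x.deg ∈ D.mon x.cone then
    (Finsupp.single ⟨h⟩ 1 : PLift (x.deg ∈ D.mon x.cone) →₀ ℂ) else 0

theorem structureOne_eq {x : D.ShIdx} (h : x.deg ∈ D.mon x.cone) :
    D.structureOne x = (Finsupp.single ⟨h⟩ 1 : PLift (x.deg ∈ D.mon x.cone) →₀ ℂ) := dif_pos h

theorem structureOne_map {x y : D.ShIdx} (f : x ⟶ y) (hx : x.deg ∈ D.mon x.cone) :
    (D.structureSheaf.map f).hom (D.structureOne x) = D.structureOne y := by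
  refine (congrArg _ (D.structureOne_eq hx)).trans (Eq.trans ?_
    (D.structureOne_eq (D.mem_mon_of_le (leOfHom f) hx)).symm)
  exact Finsupp.mapDomain_single

theorem structureOne_ne_zero {x : D.ShIdx} (hx : x.deg ∈ D.mon x.cone) :
    D.structureOne x ≠ 0 := fun h =>
  Finsupp.single_ne_zero.2 one_ne_zero ((D.structureOne_eq hx).symm.trans h)

theorem exists_smul_structureOne (x : D.ShIdx) (φ : D.structureSheaf.obj x) :
    ∃ c : ℂ, φ = c • D.structureOne x := by
  let φ' : PLift (x.deg ∈ D.mon x.cone) →₀ ℂ := φ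
  by_cases h : x.deg ∈ D.mon x.cone
  · refine ⟨φ' ⟨h⟩, Eq.trans ?_ (congrArg (φ' ⟨h⟩ • ·) (D.structureOne_eq h)).symm⟩
    refine Finsupp.ext (f := φ') fun i => ?_
    obtain ⟨i⟩ := i
    change _ = (φ' ⟨h⟩ • (Finsupp.single ⟨h⟩ 1 : PLift (x.deg ∈ D.mon x.cone) →₀ ℂ)) _
    simp
  · exact ⟨0, Finsupp.ext (f := φ') fun i => absurd i.down h⟩

/-- The basis element of a component of the extension by zero of the sheaf of algebras. -/
def extOne (Z : Set I) [Z.OrdConnected] (x : D.ShIdx) :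
    (D.extendByZero D.structureSheaf Z).obj x :=
  (fun _ => D.structureOne x : PLift (x.cone ∈ Z) → D.structureSheaf.obj x)

/-- The extension by zero of the sheaf of algebras is an indicator sheaf. -/
def indExt (Z : Set I) [Z.OrdConnected] :
    ind (D.extSet Z) ⟶ D.extendByZero D.structureSheaf Z :=
  fromInd (D.extSet Z) _ (D.extOne Z) fun x y f hx => by
    have h1 : ((D.extendByZero D.structureSheaf Z).map f).hom (D.extOne Z x) = D.extOne Z y :=
      (D.extendByZero_map_apply f hx.1 _).trans
        (funext fun _ => D.structureOne_map f hx.2)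
    rw [h1]
    split_ifs with h
    · rfl
    · exact funext fun h' => absurd ⟨h'.down, D.mem_mon_of_le (leOfHom f) hx.2⟩ h

/-- Each component of the sheaf of algebras is spanned by at most one monomial, and monomials
restrict to monomials. -/
theorem isIso_indExt (Z : Set I) [Z.OrdConnected] : IsIso (D.indExt Z) :=
  isIso_of_bijective _ fun x => by
    refine ⟨ind_hom_injective (fun x hx h => ?_) x, fun φ => ?_⟩
    · have h1 : D.extOne Z x = 0 :=
        ((one_smul ℂ (D.extOne Z x)).symm.trans (fromInd_indVal hx 1).symm).trans h
      exact D.structureOne_ne_zero hx.2 (congrFun h1 ⟨hx.1⟩)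
    · let φ' : PLift (x.cone ∈ Z) → D.structureSheaf.obj x := φ
      by_cases hx : x ∈ D.extSet Z
      · obtain ⟨c, hc⟩ := D.exists_smul_structureOne x (φ' ⟨hx.1⟩)
        refine ⟨indVal _ x c, (fromInd_indVal (F := D.extendByZero D.structureSheaf Z) hx c).trans
          (funext fun _ => hc.symm)⟩
      · refine ⟨0, (map_zero _).trans (funext fun h => ?_)⟩
        change 0 = φ' h
        exact (Finsupp.ext (f := φ' h) (g := 0) fun i => absurd ⟨h.down, i.down⟩ hx).symm

def extIso (Z : Set I) [Z.OrdConnected] : ind (D.extSet Z) ≅ D.extendByZero D.structureSheaf Z :=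
  have := D.isIso_indExt Z
  asIso (D.indExt Z)

end MonoidSheaf

/-! ### The sheaves `ℬ_{[σ]}` and `ℬ_{{σ}}` and their duals among the indicator sheaves -/

namespace SmoothFan

open MonoidSheaf

variable {N : Type} [AddCommGroup N] [Module.Finite ℤ N] {Δ : SmoothFan N}

theorem zero_le_iff {σ : Δ.Cone} {y : Δ.B.ShIdx} :
    (⟨σ, 0⟩ : Δ.B.ShIdx) ≤ y ↔ y.cone ≤ σ ∧ y.deg ∈ Δ.B.mon y.cone := by
  rw [ShIdx.le_def]
  simp

theorem extSet_Iic (σ : Δ.Cone) : Δ.B.extSet (Set.Iic σ) = Set.Ici ⟨σ, 0⟩ :=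
  Set.ext fun _ => zero_le_iff.symm

theorem extSet_singleton (σ : Δ.Cone) : Δ.B.extSet {σ} = shSet ⟨σ, 0⟩ σ.1 ∅ := by
  ext y
  change y.cone = σ ∧ _ ↔ (⟨σ, 0⟩ : Δ.B.ShIdx) ≤ y ∧ σ ≤ y.cone ∧ _ ∧ _
  rw [zero_le_iff]
  constructor
  · rintro ⟨h, h'⟩
    exact ⟨⟨h.le, h'⟩, h.ge, by simp, by simp⟩
  · rintro ⟨⟨h, h'⟩, h'', -⟩
    exact ⟨le_antisymm h h'', h'⟩

def openBIso (σ : Δ.Cone) : shFree ⟨σ, 0⟩ ≅ Δ.openB σ :=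
  Δ.B.fg.isoMk ((indCongr (extSet_Iic σ)).symm ≪≫ Δ.B.extIso (Set.Iic σ))

def pointBIso (σ : Δ.Cone) : shInd ⟨σ, 0⟩ σ.1 ∅ ≅ Δ.pointB σ :=
  Δ.B.fg.isoMk ((indCongr (extSet_singleton σ)).symm ≪≫ Δ.B.extIso {σ})

theorem negIdx_zero (σ : Δ.Cone) : negIdx (⟨σ, 0⟩ : Δ.B.ShIdx) = ⟨σ, 0⟩ :=
  congrArg (ShIdx.mk σ) neg_zero

/-- The cosheaf of the dual of the structure sheaf of a point. -/
def pointCoshZeroIso (σ : Δ.Cone) : pointCosh (⟨σ, 0⟩ : Δ.B.ShIdx) ≅ Δ.dualB (Δ.pointB σ) :=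
  eqToIso (congrArg pointCosh (negIdx_zero σ).symm) ≪≫ pointCoshIso ⟨σ, 0⟩ ≪≫
    dualBIso (pointBIso σ)

/-- The cosheaf `ℬ_{[σ]}^∨ ⊗ ℬ_σ`, with shifted weights. -/
def hullCosh (x : Δ.B.ShIdx) : Δ.CoBTcf :=
  ⟨Δ.B.kernelTensor (free x) x.cone, kernelTensor_tcf free_fg (free_fg x) x.cone⟩

instance hullCosh_injective (x : Δ.B.ShIdx) : Injective (hullCosh x) :=
  Δ.B.tcf.ι.injective_of_map_injective (kernelTensor_free_injective x x.cone)

/-- The inclusion of the cosheaf of a point in its injective hull. -/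
def pointHull (x : Δ.B.ShIdx) : pointCosh x ⟶ hullCosh x := ObjectProperty.homMk (pointKer x)

instance (x : Δ.B.ShIdx) : Mono (pointHull x) :=
  Δ.B.tcf.ι.mono_of_mono_map (inferInstanceAs (Mono (pointKer x)))

theorem negSet_Ici_zero (σ : Δ.Cone) : negSet (Set.Ici (⟨σ, 0⟩ : Δ.B.ShIdx)) =
    Set.Iic (resCosh (⟨σ, 0⟩ : Δ.B.ShIdx) le_rfl) := by
  ext q
  change (⟨σ, 0⟩ : Δ.B.ShIdx) ≤ ⟨q.cone, -q.deg⟩ ↔ q ≤ _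
  rw [zero_le_iff, CoshIdx.le_def]
  have key : ∀ h : q.cone ≤ σ, Δ.B.res h (Δ.B.res (le_refl σ) 0) - q.deg = -q.deg := fun h => by
    rw [map_zero, map_zero, zero_sub]
  exact ⟨fun h => ⟨h.1, (key h.1).symm ▸ h.2⟩, fun ⟨h, h'⟩ => ⟨h, key h ▸ h'⟩⟩

/-- The injective hull of the cosheaf of a point, as a dual. -/
def hullCoshZeroIso (σ : Δ.Cone) : hullCosh (⟨σ, 0⟩ : Δ.B.ShIdx) ≅ Δ.dualB (Δ.openB σ) :=
  Δ.B.tcf.isoMk (@asIso _ _ _ _ _ (isIso_kerDesc (x := (⟨σ, 0⟩ : Δ.B.ShIdx)) (le_refl σ)) ≪≫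
    indCongr (negSet_Ici_zero σ).symm ≪≫ Δ.B.dualIndIso (Set.Ici ⟨σ, 0⟩)) ≪≫ dualBIso (openBIso σ)

end SmoothFan

/-! ### Recognizing objects of the heart, and morphisms to injective objects -/

section DerivedHearts

open DerivedCategory.TStructure

universe w v u

variable {C : Type u} [Category.{v} C] [Abelian C]

/-- A map to the cycles of degree `n` is a chain map from `P` in degree `n`, and on homology it
induces the composite with the projection from cycles. -/
theorem eq_zero_of_homologyMap_fromSingle {P : C} {L : CochainComplex C ℤ} {n : ℤ}
    (a : P ⟶ L.cycles n) :
    ∃ φ : (CochainComplex.singleFunctor C n).obj P ⟶ L,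
      HomologicalComplex.homologyMap φ n = 0 → a ≫ L.homologyπ n = 0 := by
  let φ : (HomologicalComplex.single C (.up ℤ) n).obj P ⟶ L :=
    HomologicalComplex.mkHomFromSingle (a ≫ L.iCycles n) fun k _ => by simp
  refine ⟨φ, fun h => ?_⟩
  have h1 : (HomologicalComplex.singleObjCyclesSelfIso (.up ℤ) n P).inv ≫
      HomologicalComplex.cyclesMap φ n = a := by
    rw [← cancel_mono (L.iCycles n), Category.assoc, HomologicalComplex.cyclesMap_i,
      HomologicalComplex.singleObjCyclesSelfIso_inv_iCycles_assoc,
      HomologicalComplex.mkHomFromSingle_f, Iso.inv_hom_id_assoc]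
  have h2 : HomologicalComplex.homologyMap φ n = 0 := h
  rw [← h1, Category.assoc, ← HomologicalComplex.homologyπ_naturality, h2, comp_zero, comp_zero]

variable [HasDerivedCategory.{w} C]

/-- A shift of an object, as the image of a complex. -/
def Db.singleShiftIso (X : C) (n : ℤ) : (((Db.single C).obj X)⟦n⟧).obj ≅
    DerivedCategory.Q.obj ((CochainComplex.singleFunctor C (-n)).obj X) :=
  ((Db.ι C).commShiftIso n).app ((Db.single C).obj X) ≪≫
    ((DerivedCategory.singleFunctors C).shiftIso n (-n) 0 (by lia)).app X ≪≫
    (DerivedCategory.singleFunctorIsoCompQ C (-n)).app X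

instance : (Db.single C).Full where
  map_surjective {X Y} f := by
    obtain ⟨g, hg⟩ := (DerivedCategory.singleFunctor C 0).map_surjective (X := X) (Y := Y) f.hom
    exact ⟨g, ObjectProperty.hom_ext _ hg⟩

instance : (Db.single C).Faithful where
  map_injective h := (DerivedCategory.singleFunctor C 0).map_injective
    (congrArg (fun a => a.hom) h)

/-- An object of the bounded derived category with no nonzero morphisms from the nonzero shifts of
enough projective objects is in the heart. -/
theorem Db.exists_single {S : ObjectProperty C} (hS : ∀ P, S P → Projective P)
    (hS' : ∀ X : C, (∀ P, S P → ∀ f : P ⟶ X, f = 0) → IsZero X) (X : Db C)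
    (h : ∀ P, S P → ∀ n : ℤ, n ≠ 0 → ∀ f : ((Db.single C).obj P)⟦n⟧ ⟶ X, f = 0) :
    ∃ F : C, Nonempty (X ≅ (Db.single C).obj F) := by
  let L := DerivedCategory.Q.objPreimage X.obj
  let e : DerivedCategory.Q.obj L ≅ X.obj := DerivedCategory.Q.objObjPreimageIso X.obj
  have h0 : ∀ n : ℤ, n ≠ 0 → IsZero ((DerivedCategory.homologyFunctor C n).obj X.obj) := by
    intro n hn
    refine IsZero.of_iso ?_ ((DerivedCategory.homologyFunctor C n).mapIso e.symm ≪≫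
      (DerivedCategory.homologyFunctorFactors C n).app L)
    change IsZero (L.homology n)
    refine hS' _ fun P hP g => ?_
    have := hS P hP
    -- As `P` is projective, `g` lifts to the cycles and comes from a chain map out of `P` in degree
    -- `n`. By hypothesis this chain map is zero in the derived category, so it induces zero on
    -- homology and `g = 0`.
    obtain ⟨φ, hφ⟩ := eq_zero_of_homologyMap_fromSingle
      (Projective.factorThru g (L.homologyπ n))
    rw [Projective.factorThru_comp] at hφ
    refine hφ ?_
    let e' : (((Db.single C).obj P)⟦-n⟧).obj ≅
        DerivedCategory.Q.obj ((CochainComplex.singleFunctor C n).obj P) :=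
      singleShiftIso P (-n) ≪≫ DerivedCategory.Q.mapIso (eqToIso (by rw [neg_neg]))
    have h1 : e'.hom ≫ DerivedCategory.Q.map φ ≫ e.hom = 0 :=
      congrArg (fun a => a.hom) (h P hP (-n) (by lia)
        (ObjectProperty.homMk (e'.hom ≫ DerivedCategory.Q.map φ ≫ e.hom)))
    have h2 : DerivedCategory.Q.map φ = 0 := by
      rw [← cancel_epi e'.hom, ← cancel_mono e.hom, Category.assoc, h1, comp_zero, zero_comp]
    have h3 := DerivedCategory.homologyFunctorFactors_hom_naturality φ n
    rw [h2, Functor.map_zero, zero_comp] at h3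
    exact (cancel_epi ((DerivedCategory.homologyFunctorFactors C n).hom.app
      ((CochainComplex.singleFunctor C n).obj P))).1 (h3.symm.trans comp_zero.symm)
  have : X.obj.IsGE 0 := (DerivedCategory.isGE_iff _ _).2 fun i hi => h0 i (by lia)
  have : X.obj.IsLE 0 := (DerivedCategory.isLE_iff _ _).2 fun i hi => h0 i (by lia)
  obtain ⟨F, ⟨i⟩⟩ := DerivedCategory.exists_iso_singleFunctor_obj_of_isGE_of_isLE X.obj 0
  exact ⟨F, ⟨(t (C := C)).bounded.isoMk i⟩⟩

/-- An injective object in a single degree is a K-injective complex, so the morphism is a chain map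
between complexes in the degrees `-a` and `-b`. -/
theorem injective_single_eq_zero {Z J : C} [Injective J] {a b : ℤ}
    (h : a = b → ∀ g : Z ⟶ J, g = 0)
    (f : ((Db.single C).obj Z)⟦a⟧ ⟶ ((Db.single C).obj J)⟦b⟧) : f = 0 := by
  let L := (CochainComplex.singleFunctor C (-b)).obj J
  have hL : ∀ i, Injective (L.X i) := fun i => by
    by_cases hi : i = -b
    · subst hi
      exact Injective.of_iso (singleXSelf (-b) J).symm inferInstance
    · exact (HomologicalComplex.isZero_single_obj_X (.up ℤ) (-b) J i hi).injective
  have : L.IsKInjective := CochainComplex.isKInjective_of_injective L (-b)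
  have h1 : (Db.singleShiftIso Z a).inv ≫ f.hom ≫ (Db.singleShiftIso J b).hom = 0 := by
    refine single_Q_eq_zero (fun g => ?_) _
    by_cases hab : a = b
    · subst hab
      rw [← cancel_mono (singleXSelf (-a) J).hom, zero_comp]
      exact h rfl _
    · exact (HomologicalComplex.isZero_single_obj_X (.up ℤ) (-b) J (-a) (by lia)).eq_of_tgt _ _
  refine ObjectProperty.hom_ext _ ?_
  change f.hom = 0
  rw [← cancel_epi (Db.singleShiftIso Z a).inv, ← cancel_mono (Db.singleShiftIso J b).hom,
    Category.assoc, h1, comp_zero, zero_comp]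

end DerivedHearts

/-! ### Transfer of morphisms along fully faithful functors -/

section Transfer

variable {C E T : Type*} [Category* C] [Category* E] [Category* T] (F : C ⥤ T) [F.Full]
  [F.Faithful] (G : E ⥤ T) [G.Full] [G.Faithful]

/-- The bijection between morphisms that is induced by fully faithful functors. -/
def homTransfer {X Y : C} {Z W : E} (e : F.obj X ≅ G.obj Z) (e' : F.obj Y ≅ G.obj W) :
    (X ⟶ Y) ≃ (Z ⟶ W) :=
  ((Functor.FullyFaithful.ofFullyFaithful F).homEquiv.trans (e.homCongr e')).trans
    (Functor.FullyFaithful.ofFullyFaithful G).homEquiv.symm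

theorem map_homTransfer {X Y : C} {Z W : E} (e : F.obj X ≅ G.obj Z) (e' : F.obj Y ≅ G.obj W)
    (f : X ⟶ Y) : G.map (homTransfer F G e e' f) = e.inv ≫ F.map f ≫ e'.hom :=
  (Functor.FullyFaithful.ofFullyFaithful G).homEquiv.apply_symm_apply _

theorem homTransfer_comp {X Y X' : C} {Z W Z' : E} (e : F.obj X ≅ G.obj Z)
    (e' : F.obj Y ≅ G.obj W) (e'' : F.obj X' ≅ G.obj Z') (f : X ⟶ Y) (g : Y ⟶ X') :
    homTransfer F G e e'' (f ≫ g) = homTransfer F G e e' f ≫ homTransfer F G e' e'' g :=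
  G.map_injective (by simp [map_homTransfer])

theorem comp_bijective_of_transfer {X Y X' : C} {Z W Z' : E} (e : F.obj X ≅ G.obj Z)
    (e' : F.obj Y ≅ G.obj W) (e'' : F.obj X' ≅ G.obj Z') (g : Y ⟶ X')
    (h : Function.Bijective fun f : Z ⟶ W => f ≫ homTransfer F G e' e'' g) :
    Function.Bijective fun f : X ⟶ Y => f ≫ g := by
  have key : (fun f : X ⟶ Y => f ≫ g) = (homTransfer F G e e'').symm ∘
      (fun f : Z ⟶ W => f ≫ homTransfer F G e' e'' g) ∘ homTransfer F G e e' := by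
    funext f
    simp [← homTransfer_comp]
  rw [key]
  exact (Equiv.bijective _).comp (h.comp (Equiv.bijective _))

end Transfer

/-! ### Values of the Koszul functor on point sheaves and on free sheaves -/

namespace SmoothFan

open MonoidSheaf CellData

variable {N : Type} [AddCommGroup N] [Module.Finite ℤ N] {Δ : SmoothFan N}

/-- The dual point of `y` is supported over the cone of `x`, where the inclusion into the hull is
bijective. A morphism to the hull therefore dies in the cokernel and factors. -/
theorem shFree_comp_pointHull_bijective {x y : Δ.B.ShIdx} (h : y.cone = x.cone) :
    Function.Bijective fun f : pointCosh y ⟶ pointCosh x => f ≫ pointHull x := by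
  refine ⟨fun f g e => (cancel_mono (pointHull x)).1 e, fun a => ?_⟩
  have h0 : a.hom ≫ cokernel.π (pointKer x) = 0 := ind_hom_ext fun q hq => by
    obtain ⟨w, hw⟩ := (pointKer_bijective (x := x) (hq.1.trans h)).2
      ((a.hom.app q).hom (indVal (pointSet y) q 1))
    change ((cokernel.π (pointKer x)).app q).hom ((a.hom.app q).hom _) = 0
    refine (congrArg _ hw.symm).trans ?_
    exact congrArg (fun t => (t.app q).hom w) (cokernel.condition (pointKer x))
  exact ⟨ObjectProperty.homMk (Abelian.monoLift (pointKer x) a.hom h0),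
    ObjectProperty.hom_ext _ (Abelian.monoLift_comp (pointKer x) a.hom h0)⟩

theorem pointCosh_hullCosh_eq_zero {x y : Δ.B.ShIdx} (h : y.cone ≠ x.cone)
    (f : pointCosh y ⟶ hullCosh x) : f = 0 :=
  ObjectProperty.hom_ext _ (point_hom_eq_zero h.symm f.hom)

/-- By Yoneda the morphisms from free sheaves are the elements of the components. -/
theorem isZero_of_shFree (X : Δ.BMod) (h : ∀ P, IsShFree Δ P → ∀ f : P ⟶ X, f = 0) : IsZero X := by
  refine IsZero.of_full_of_faithful_of_isZero Δ.B.fg.ι X ((Functor.isZero_iff _).2 fun y => ?_)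
  have : ∀ a : X.obj.obj y, a = 0 := fun a => by
    have h1 : fromFree a = 0 := congrArg (fun t => t.hom) (h (shFree y) ⟨y, ⟨Iso.refl _⟩⟩
      (ObjectProperty.homMk (fromFree a)))
    rw [← fromFree_self a, h1]
    rfl
  have : Subsingleton (X.obj.obj y) := ⟨fun a b => (this a).trans (this b).symm⟩
  exact ModuleCat.isZero_of_subsingleton (X.obj.obj y)

/-- A sheaf is isomorphic to a point sheaf if the morphisms to it from free sheaves are those of a
quotient of a free sheaf that is supported at a point. -/
theorem nonempty_shInd_iso {x : Δ.B.ShIdx} {F : Δ.BMod} (f : shFree x ⟶ F)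
    (h0 : ∀ y : Δ.B.ShIdx, y.cone ≠ x.cone → ∀ g : shFree y ⟶ F, g = 0)
    (h1 : ∀ y : Δ.B.ShIdx, y.cone = x.cone → Function.Bijective fun g : shFree y ⟶ shFree x => g ≫ f) :
    Nonempty (shInd x x.cone.1 ∅ ≅ F) := by
  have hz : ∀ y : Δ.B.ShIdx, y.cone ≠ x.cone → ∀ a : F.obj.obj y, a = 0 := fun y hy a => by
    have h2 : fromFree a = 0 := congrArg (fun t => t.hom) (h0 y hy
      (ObjectProperty.homMk (fromFree a)))
    rw [← fromFree_self a, h2]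
    rfl
  -- Read through Yoneda, the hypotheses say that `F` vanishes away from the cone of `x` and that
  -- `f` is bijective over it, which describes the point sheaf as a quotient of `free x`.
  have hb : ∀ y : Δ.B.ShIdx, y.cone = x.cone → Function.Bijective (f.hom.app y).hom := by
    refine fun y hy => ⟨(injective_iff_map_eq_zero _).2 fun a ha => ?_, fun b => ?_⟩
    · have h2 : (ObjectProperty.homMk (fromFree a) : shFree y ⟶ shFree x) = 0 := by
        refine (h1 y hy).1 (ObjectProperty.hom_ext _ ?_)
        change fromFree a ≫ f.hom = 0 ≫ f.hom
        rw [fromFree_comp, ha, zero_comp]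
        exact free_hom_ext ((fromFree_self _).trans rfl)
      have h3 : fromFree a = 0 := congrArg (fun t => t.hom) h2
      rw [← fromFree_self a, h3]
      rfl
    · obtain ⟨g, hg⟩ := (h1 y hy).2 (ObjectProperty.homMk (fromFree b))
      have h2 : g.hom ≫ f.hom = fromFree b := congrArg (fun t => t.hom) hg
      refine ⟨(g.hom.app y).hom (indVal (Set.Ici y) y 1), ?_⟩
      exact (congrArg (fun t => (t.app y).hom (indVal (Set.Ici y) y 1)) h2).trans
        (fromFree_self b)
  have hs : ∀ y, y ∈ shSet x x.cone.1 ∅ ↔ x ≤ y ∧ y.cone = x.cone := fun y =>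
    ⟨fun h => ⟨h.1, le_antisymm h.1.1 h.2.1⟩, fun h => ⟨h.1, h.2.ge, by simp, by simp⟩⟩
  let f' : free x ⟶ F.obj := f.hom
  let p : ind (shSet x x.cone.1 ∅) ⟶ F.obj := fromInd _ _
    (fun y => (f'.app y).hom (indVal (Set.Ici x) y 1)) fun y z g hy => by
      have hx : x ≤ y := hy.1
      rw [← nat_apply]
      refine (congrArg _ (ind_map g (show y ∈ Set.Ici x from hx) 1)).trans ?_
      split_ifs with hz'
      · rfl
      · exact hz z (fun e => hz' ((hs z).2 ⟨hx.trans (leOfHom g), e⟩)) _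
  have hp : ∀ y (hy : y ∈ shSet x x.cone.1 ∅) c, (p.app y).hom (indVal _ y c) =
      (f'.app y).hom (indVal (Set.Ici x) y c) := fun y hy c => by
    refine (fromInd_indVal hy c).trans ?_
    rw [← map_smul, smul_indVal, mul_one]
  have : IsIso p := isIso_of_bijective _ fun y => by
    by_cases hy : y ∈ shSet x x.cone.1 ∅
    · have hx : y ∈ Set.Ici x := hy.1
      refine ⟨ind_hom_injective (fun y hy h => ?_) y, fun b => ?_⟩
      · rw [hp y hy] at h
        have h2 := (injective_iff_map_eq_zero _).1 (hb y ((hs y).1 hy).2).1 _ h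
        exact one_ne_zero (congrArg (indCoe (Set.Ici x) (show y ∈ Set.Ici x from hy.1)) h2)
      · obtain ⟨a, rfl⟩ := (hb y ((hs y).1 hy).2).2 b
        exact ⟨indVal _ y (indCoe (Set.Ici x) hx a), hp y hy _⟩
    · refine ⟨fun _ _ _ => ind_eq_of_notMem hy _ _, fun b => ⟨0, (map_zero _).trans ?_⟩⟩
      by_cases hc : y.cone = x.cone
      · obtain ⟨a, rfl⟩ := (hb y hc).2 b
        have : a = 0 := ind_eq_of_notMem (Z := Set.Ici x) (fun hx => hy ((hs y).2 ⟨hx, hc⟩)) _ _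
        rw [this, map_zero]
      · exact (hz y hc b).symm
  exact ⟨Δ.B.fg.isoMk (@asIso _ _ _ _ p this)⟩

universe w w'

variable [HasDerivedCategory.{w} Δ.BMod] [HasDerivedCategory.{w'} Δ.CoBTcf]
  {ε : Δ.Orientation} {K : Db Δ.BMod ⥤ Db Δ.CoBTcf} [K.CommShift ℤ] [K.IsTriangulated]

/-- The value of the Koszul functor on a point sheaf. -/
theorem nonempty_koszul_shInd (i : Db.ofProj Δ.BMod ⋙ K ⋙ Db.ι Δ.CoBTcf ≅
      (boundedProj Δ.BMod).ι ⋙ totalizationQ (koszulB ε) Δ.B.tcf (koszulB_totalization_tcf ε) ⋙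
        DerivedCategory.Q) (x : Δ.B.ShIdx) :
    Nonempty (K.obj ((Db.single _).obj (shInd x x.cone.1 ∅)) ≅
      ((Db.single _).obj (hullCosh x))⟦(Δ.dim x.cone : ℤ)⟧) := by
  have := isEquivalence_koszulB i
  let d : ℤ := Δ.dim x.cone
  let Y := ((Db.single _).obj (hullCosh x))⟦d⟧
  let X := K.objPreimage Y
  -- After `K`, the source is a dual point with shift `dim y.cone + n` and the target an injective
  -- cosheaf with shift `d`. A nonzero morphism requires equal shifts and equal cones, that is, `n =
  -- 0` and `y.cone = x.cone`.
  have key : ∀ (y : Δ.B.ShIdx) (n : ℤ), (y.cone = x.cone → n ≠ 0) →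
      ∀ f : ((Db.single _).obj (shFree y))⟦n⟧ ⟶ X, f = 0 := fun y n hn f => by
    let e : K.obj (((Db.single _).obj (shFree y))⟦n⟧) ≅
        ((Db.single _).obj (pointCosh y))⟦(Δ.dim y.cone : ℤ) + n⟧ :=
      (K.commShiftIso n).app _ ≪≫ (shiftFunctor _ n).mapIso (koszulFreeIso i y) ≪≫
        ((shiftFunctorAdd (Db Δ.CoBTcf) (Δ.dim y.cone : ℤ) n).app _).symm
    have h1 : e.inv ≫ K.map f ≫ (K.objObjPreimageIso Y).hom = 0 := by
      refine injective_single_eq_zero (fun hd g => ?_) _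
      refine pointCosh_hullCosh_eq_zero (fun hc => ?_) g
      refine hn hc ?_
      simp only [hc, d] at hd
      lia
    have h2 : K.map f = 0 := by
      rw [← cancel_epi e.inv, ← cancel_mono (K.objObjPreimageIso Y).hom, Category.assoc, h1,
        comp_zero, zero_comp]
    exact K.map_injective (h2.trans (K.map_zero _ _).symm)
  obtain ⟨F, ⟨eF⟩⟩ := Db.exists_single (S := IsShFree Δ)
    (fun P ⟨x, ⟨e⟩⟩ => Projective.of_iso e.symm inferInstance) isZero_of_shFree X
    fun P ⟨y, ⟨e⟩⟩ n hn f => by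
      rw [← cancel_epi (((Db.single _).mapIso e.symm).hom⟦n⟧'), comp_zero]
      exact key y n (fun _ => hn) _
  let S₁ := Db.single Δ.BMod ⋙ K
  let S₂ := Db.single Δ.CoBTcf ⋙ shiftFunctor (Db Δ.CoBTcf) d
  let eF' : S₁.obj F ≅ S₂.obj (hullCosh x) := K.mapIso eF.symm ≪≫ K.objObjPreimageIso Y
  let eP : ∀ y : Δ.B.ShIdx, y.cone = x.cone → (S₁.obj (shFree y) ≅ S₂.obj (pointCosh y)) :=
    fun y hy => koszulFreeIso i y ≪≫ eqToIso (by rw [hy]; rfl)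
  -- The morphism that corresponds under `K` to the inclusion of the dual point in its hull. It will
  -- present `F` as the point quotient of the free sheaf.
  let f : shFree x ⟶ F := (homTransfer S₁ S₂ (eP x rfl) eF').symm (pointHull x)
  have hf : homTransfer S₁ S₂ (eP x rfl) eF' f = pointHull x := Equiv.apply_symm_apply _ _
  obtain ⟨e⟩ := nonempty_shInd_iso f (fun y hy g => by
    have h1 := key y 0 (fun h => absurd h hy)
      ((shiftFunctorZero (Db Δ.BMod) ℤ).hom.app _ ≫ (Db.single _).map g ≫ eF.inv)
    refine (Db.single _).map_injective ?_
    rw [Functor.map_zero, ← cancel_epi ((shiftFunctorZero (Db Δ.BMod) ℤ).hom.app _),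
      ← cancel_mono eF.inv, Category.assoc, h1, comp_zero, zero_comp]) fun y hy =>
    comp_bijective_of_transfer S₁ S₂ (eP y hy) (eP x rfl) eF' f (by
      rw [hf]
      exact shFree_comp_pointHull_bijective hy)
  exact ⟨S₁.mapIso e ≪≫ eF'⟩

theorem koszulB_values (i : Db.ofProj Δ.BMod ⋙ K ⋙ Db.ι Δ.CoBTcf ≅
      (boundedProj Δ.BMod).ι ⋙ totalizationQ (koszulB ε) Δ.B.tcf (koszulB_totalization_tcf ε) ⋙
        DerivedCategory.Q) (σ : Δ.Cone) :
    Nonempty (K.obj ((Db.single _).obj (Δ.pointB σ)) ≅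
        ((Db.single _).obj (Δ.dualB (Δ.openB σ)))⟦(Δ.dim σ : ℤ)⟧) ∧
      Nonempty (K.obj ((Db.single _).obj (Δ.openB σ)) ≅
        ((Db.single _).obj (Δ.dualB (Δ.pointB σ)))⟦(Δ.dim σ : ℤ)⟧) := by
  obtain ⟨e⟩ := nonempty_koszul_shInd i ⟨σ, 0⟩
  exact ⟨⟨K.mapIso ((Db.single _).mapIso (pointBIso σ).symm) ≪≫ e ≪≫
      (shiftFunctor _ (Δ.dim σ : ℤ)).mapIso ((Db.single _).mapIso (hullCoshZeroIso σ))⟩,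
    ⟨K.mapIso ((Db.single _).mapIso (openBIso σ).symm) ≪≫ koszulFreeIso i ⟨σ, 0⟩ ≪≫
      (shiftFunctor _ (Δ.dim σ : ℤ)).mapIso ((Db.single _).mapIso (pointCoshZeroIso σ))⟩⟩

end SmoothFan

/-! ### Total complexes and equivalences -/

section MapTotal

universe v v' u u'

variable {E : Type u} [Category.{v} E] [Abelian E] [HasCoproducts.{0} E]
  {E' : Type u'} [Category.{v'} E'] [Abelian E'] [HasCoproducts.{0} E'] (F : E ⥤ E') [F.Additive]

/-- The functor on bicomplexes induced by an additive functor. -/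
abbrev mapBicomplex : HomologicalComplex₂ E (.up ℤ) (.up ℤ) ⥤
    HomologicalComplex₂ E' (.up ℤ) (.up ℤ) :=
  (F.mapHomologicalComplex (.up ℤ)).mapHomologicalComplex (.up ℤ)

variable (K : HomologicalComplex₂ E (.up ℤ) (.up ℤ))

/-- The comparison of the terms of the total complexes. -/
def totalComparison (n : ℤ) :
    (((mapBicomplex F).obj K).total (.up ℤ)).X n ⟶ F.obj ((K.total (.up ℤ)).X n) :=
  HomologicalComplex₂.totalDesc _ fun p q h => F.map (K.ιTotal (.up ℤ) p q n h)

theorem ι_totalComparison (p q n : ℤ) (h : p + q = n) :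
    ((mapBicomplex F).obj K).ιTotal (.up ℤ) p q n h ≫ totalComparison F K n =
      F.map (K.ιTotal (.up ℤ) p q n h) :=
  HomologicalComplex₂.ι_totalDesc _ _ _ _ _

theorem ι_totalComparison_assoc (p q n : ℤ) (h : p + q = n) {Z : E'}
    (g : F.obj ((K.total (.up ℤ)).X n) ⟶ Z) :
    ((mapBicomplex F).obj K).ιTotal (.up ℤ) p q n h ≫ totalComparison F K n ≫ g =
      F.map (K.ιTotal (.up ℤ) p q n h) ≫ g := by
  rw [← Category.assoc, ι_totalComparison]
  rfl

theorem ι_total_d (p q n n' : ℤ) (h : p + q = n) (h' : n + 1 = n') :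
    K.ιTotal (.up ℤ) p q n h ≫ (K.total (.up ℤ)).d n n' =
      (K.d p (p + 1)).f q ≫ K.ιTotal (.up ℤ) (p + 1) q n' (show p + 1 + q = n' by lia) +
        p.negOnePow • (K.X p).d q (q + 1) ≫
          K.ιTotal (.up ℤ) p (q + 1) n' (show p + (q + 1) = n' by lia) := by
  subst h'
  refine (Preadditive.comp_add (C := E) _ _ _ (K.ιTotal (.up ℤ) p q n h) _ _).trans ?_
  refine congrArg₂ (fun a b => a + b) ?_ ?_
  · refine (K.ι_D₁ (.up ℤ) _ _ p q h).trans ?_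
    refine (K.d₁_eq (.up ℤ) (show (ComplexShape.up ℤ).Rel p (p + 1) from rfl) q (n + 1)
      (show p + 1 + q = n + 1 by lia)).trans ?_
    exact one_smul _ _
  · refine (K.ι_D₂ (.up ℤ) _ _ p q h).trans ?_
    exact K.d₂_eq (.up ℤ) p (show (ComplexShape.up ℤ).Rel q (q + 1) from rfl) (n + 1)
      (show p + (q + 1) = n + 1 by lia)

theorem totalComparison_d (n n' : ℤ) (h' : n + 1 = n') :
    totalComparison F K n ≫ F.map ((K.total (.up ℤ)).d n n') =
      (((mapBicomplex F).obj K).total (.up ℤ)).d n n' ≫ totalComparison F K n' :=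
  HomologicalComplex₂.total.hom_ext _ fun p q h => by
    have h : p + q = n := h
    have e₁ : ((mapBicomplex F).obj K).ιTotal (.up ℤ) p q n h ≫ totalComparison F K n ≫
        F.map ((K.total (.up ℤ)).d n n') = _ :=
      (ι_totalComparison_assoc F K p q n h _).trans
        ((F.map_comp _ _).symm.trans (congrArg F.map (ι_total_d K p q n n' h h')))
    have e₂ : ((mapBicomplex F).obj K).ιTotal (.up ℤ) p q n h ≫
        (((mapBicomplex F).obj K).total (.up ℤ)).d n n' ≫ totalComparison F K n' = _ :=
      (Category.assoc _ _ _).symm.trans ((congrArg (fun a => a ≫ totalComparison F K n')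
        (ι_total_d ((mapBicomplex F).obj K) p q n n' h h')).trans
          ((Preadditive.add_comp _ _ _ _ _ _).trans (congrArg₂ (fun a b => a + b)
            ((Category.assoc _ _ _).trans (congrArg _ (ι_totalComparison F K _ _ _ _)))
            ((Linear.units_smul_comp _ _ _).trans (congrArg (fun a => p.negOnePow • a)
              ((Category.assoc _ _ _).trans (congrArg _ (ι_totalComparison F K _ _ _ _))))))))
    refine e₁.trans (Eq.trans ?_ e₂.symm)
    rw [F.map_add, F.map_comp, Functor.map_units_smul, F.map_comp]
    rfl

variable [F.IsEquivalence]

/-- The terms of a total complex are coproducts, and an equivalence preserves all coproducts. -/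
theorem isIso_totalComparison (n : ℤ) : IsIso (totalComparison F K n) :=
  inferInstanceAs (IsIso (sigmaComparison F (K.toGradedObject.mapObjFun
    (ComplexShape.π (.up ℤ) (.up ℤ) (.up ℤ)) n)))

/-- Total complexes commute with equivalences. -/
def totalMapIso : HomologicalComplex₂.totalFunctor E (.up ℤ) (.up ℤ) (.up ℤ) ⋙
      F.mapHomologicalComplex (.up ℤ) ≅
    mapBicomplex F ⋙ HomologicalComplex₂.totalFunctor E' (.up ℤ) (.up ℤ) (.up ℤ) :=
  Iso.symm <| NatIso.ofComponents (fun K => HomologicalComplex.Hom.isoOfComponents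
    (fun n => @asIso _ _ _ _ _ (isIso_totalComparison F K n)) fun n n' h => totalComparison_d F K n n' h) fun {K L} f => by
      ext n : 1
      refine HomologicalComplex₂.total.hom_ext _ fun p q h => ?_
      change _ ≫ (HomologicalComplex₂.total.map _ _).f n ≫ totalComparison F L n =
        _ ≫ totalComparison F K n ≫ F.map ((HomologicalComplex₂.total.map f _).f n)
      rw [HomologicalComplex₂.ιTotal_map_assoc, ι_totalComparison F L p q n h,
        ι_totalComparison_assoc F K p q n h]
      exact (F.map_comp _ _).symm.trans ((congrArg F.map
        (HomologicalComplex₂.ιTotal_map (i₁ := p) (i₂ := q) (i₁₂ := n) (h := h) (φ := f) ..).symm).trans (F.map_comp _ _))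

end MapTotal

/-! ### The tensor products with the kernels and extension of scalars -/

namespace MonoidSheaf

variable {I : Type} [PartialOrder I]

section KerLift

variable {D : MonoidSheaf I} {F : D.Sheaf} {τ : I} {X : D.Cosheaf}

/-- The universal property of the tensor product in terms of decomposable elements. -/
theorem exists_kerLift (l : ∀ (b : D.wt τ) (q : D.CoshIdx), F.obj ⟨τ, b⟩ →ₗ[ℂ] X.obj q)
    (h₀ : ∀ b q w, ¬ q ≤ ⟨τ, b⟩ → l b q w = 0)
    (h₁ : ∀ b q q' (f : q ⟶ q') w, (X.map f).hom (l b q w) = l b q' w)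
    (h₂ : ∀ a b (f : (⟨τ, a⟩ : D.ShIdx) ⟶ ⟨τ, b⟩) q w, l a q w = l b q ((F.map f).hom w)) :
    ∃ g : D.kernelTensor F τ ⟶ X, ∀ b q w, (g.app q).hom (D.kerElt F τ b q w) = l b q w := by
  let p (b : D.wt τ) : (D.cofree.obj (.op ⟨τ, b⟩)).obj (F.obj ⟨τ, b⟩) ⟶ X :=
    { app := fun q => ModuleCat.ofHom (if h : q ≤ ⟨τ, b⟩ then l b q ∘ₗ
        LinearMap.proj (R := ℂ) (φ := fun _ : q ⟶ ⟨τ, b⟩ => F.obj ⟨τ, b⟩) (homOfLE h) else 0)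
      naturality := fun q q' f => ModuleCat.hom_ext <| LinearMap.ext fun φ => by
        obtain ⟨w, rfl⟩ := D.exists_cofreeConst φ
        change (if h : q' ≤ ⟨τ, b⟩ then l b q' ∘ₗ
            LinearMap.proj (R := ℂ) (φ := fun _ : q' ⟶ ⟨τ, b⟩ => F.obj ⟨τ, b⟩) (homOfLE h) else 0)
            (fun _ => w) =
          (X.map f).hom ((if h : q ≤ ⟨τ, b⟩ then l b q ∘ₗ
            LinearMap.proj (R := ℂ) (φ := fun _ : q ⟶ ⟨τ, b⟩ => F.obj ⟨τ, b⟩) (homOfLE h) else 0)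
            (fun _ => w))
        by_cases h : q ≤ ⟨τ, b⟩
        · rw [dif_pos h]
          refine Eq.trans ?_ (h₁ b q q' f w).symm
          by_cases h' : q' ≤ ⟨τ, b⟩
          · rw [dif_pos h']
            rfl
          · rw [dif_neg h', h₀ b q' w h']
            rfl
        · rw [dif_neg h, dif_neg fun h' => h ((leOfHom f).trans h')]
          exact (map_zero _).symm }
  have hp : ∀ b q w, ((p b).app q).hom (D.cofreeConst ⟨τ, b⟩ (F.obj ⟨τ, b⟩) q w) = l b q w :=
    fun b q w => by
      change (if h : q ≤ ⟨τ, b⟩ then l b q ∘ₗ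
        LinearMap.proj (R := ℂ) (φ := fun _ : q ⟶ ⟨τ, b⟩ => F.obj ⟨τ, b⟩) (homOfLE h) else 0)
          (fun _ => w) = _
      by_cases h : q ≤ ⟨τ, b⟩
      · rw [dif_pos h]
        rfl
      · rw [dif_neg h, h₀ b q w h]
        rfl
  have hp' : ∀ (a b : D.wt τ) (f : (⟨τ, a⟩ : D.CoshIdx) ⟶ ⟨τ, b⟩)
      (f' : (⟨τ, a⟩ : D.ShIdx) ⟶ ⟨τ, b⟩),
      D.cofreeMap f (𝟙 _) ≫ p a = D.cofreeMap (𝟙 _) (F.map f') ≫ p b := fun a b f f' => by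
    ext q φ
    obtain ⟨w, rfl⟩ := D.exists_cofreeConst φ
    exact (hp a q w).trans ((h₂ a b f' q w).trans (hp b q _).symm)
  exact ⟨D.kernelDesc p hp', fun b q w => (congrArg (fun k => (k.app q).hom
    (D.cofreeConst ⟨τ, b⟩ (F.obj ⟨τ, b⟩) q w)) (D.kernelIncl_desc p hp' b)).trans (hp b q w)⟩

end KerLift

namespace Quot

variable {A B : MonoidSheaf I} (δ : Quot A B) (F : B.Sheaf) (τ : I)

theorem exists_kerRestrict : ∃ g : A.kernelTensor (δ.restrictSh.obj F) τ ⟶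
    δ.restrictCosh.obj (B.kernelTensor F τ), ∀ b q w,
      (g.app q).hom (A.kerElt (δ.restrictSh.obj F) τ b q w) =
        B.kerElt F τ (δ.hom τ b) (δ.toCosh.obj q) w :=
  exists_kerLift (F := δ.restrictSh.obj F) (X := δ.restrictCosh.obj (B.kernelTensor F τ))
    (fun b q => B.kerElt F τ (δ.hom τ b) (δ.toCosh.obj q))
    (fun b q w h => kerElt_eq_zero (fun h' => h ((δ.cosh_le_iff q ⟨τ, b⟩).1 h')) w)
    (fun _ _ _ f w => kerElt_map (δ.toCosh.map f) w)
    fun a b f q w => kerElt_mul (F := F) (a := δ.hom τ a) (b := δ.hom τ b)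
      (δ.toSh.map (X := ⟨τ, a⟩) (Y := ⟨τ, b⟩) f) (δ.toCosh.obj q) w

/-- The tensor products with the kernels commute with restriction of scalars. -/
def kerRestrict : A.kernelTensor (δ.restrictSh.obj F) τ ⟶
    δ.restrictCosh.obj (B.kernelTensor F τ) := (δ.exists_kerRestrict F τ).choose

theorem kerRestrict_kerElt (b : A.wt τ) (q : A.CoshIdx) (w : (δ.restrictSh.obj F).obj ⟨τ, b⟩) :
    ((δ.kerRestrict F τ).app q).hom (A.kerElt (δ.restrictSh.obj F) τ b q w) =
      B.kerElt F τ (δ.hom τ b) (δ.toCosh.obj q) w :=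
  (δ.exists_kerRestrict F τ).choose_spec b q w

/-- A weight that lifts a weight of the quotient. -/
def liftWt (b : B.wt τ) : A.wt τ := (δ.surj τ b).choose

theorem hom_liftWt (b : B.wt τ) : δ.hom τ (δ.liftWt τ b) = b := (δ.surj τ b).choose_spec

theorem toSh_liftWt (b : B.wt τ) : (⟨τ, b⟩ : B.ShIdx) = δ.toSh.obj ⟨τ, δ.liftWt τ b⟩ :=
  congrArg (ShIdx.mk τ) (δ.hom_liftWt τ b).symm

theorem toCosh_liftWt (b : B.wt τ) : δ.toCosh.obj ⟨τ, δ.liftWt τ b⟩ = (⟨τ, b⟩ : B.CoshIdx) :=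
  congrArg (CoshIdx.mk τ) (δ.hom_liftWt τ b)

/-- The candidate inverse, built from chosen lifts of the weights. Two lifts of one weight are
isomorphic indices, so the tensor relation makes the result compatible whatever the choice. -/
theorem exists_kerExtend : ∃ g : B.kernelTensor F τ ⟶
    δ.toCosh.inv ⋙ A.kernelTensor (δ.restrictSh.obj F) τ, ∀ b q w,
      (g.app q).hom (B.kerElt F τ b q w) =
        A.kerElt (δ.restrictSh.obj F) τ (δ.liftWt τ b) (δ.toCosh.inv.obj q)
          ((F.map (eqToHom (δ.toSh_liftWt τ b))).hom w) := by
  refine exists_kerLift (X := δ.toCosh.inv ⋙ A.kernelTensor (δ.restrictSh.obj F) τ)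
    (fun b q => A.kerElt (δ.restrictSh.obj F) τ (δ.liftWt τ b) (δ.toCosh.inv.obj q) ∘ₗ
      (F.map (eqToHom (δ.toSh_liftWt τ b))).hom)
    (fun b q w h => kerElt_eq_zero (fun h' => h ?_) _)
    (fun b q q' f w => kerElt_map (δ.toCosh.inv.map f) _)
    fun a b f q w => ?_
  · have h1 := leOfHom (δ.toCosh.map (homOfLE h'))
    rw [toCosh_liftWt] at h1
    exact (leOfHom (δ.toCosh.asEquivalence.counitInv.app q)).trans h1
  · have f' : (⟨τ, δ.liftWt τ a⟩ : A.ShIdx) ⟶ ⟨τ, δ.liftWt τ b⟩ := homOfLE <| by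
      rw [← δ.sh_le_iff]
      exact (δ.toSh_liftWt τ a).symm.le.trans ((leOfHom f).trans (δ.toSh_liftWt τ b).le)
    refine (kerElt_mul f' _ _).trans ?_
    refine congrArg (A.kerElt (δ.restrictSh.obj F) τ (δ.liftWt τ b) (δ.toCosh.inv.obj q)) ?_
    exact map_map_eq F _ _ _ _ w

theorem isIso_kerRestrict : IsIso (δ.kerRestrict F τ) := by
  obtain ⟨g, hg⟩ := δ.exists_kerExtend F τ
  let T := A.kernelTensor (δ.restrictSh.obj F) τ
  let r : δ.restrictCosh.obj (B.kernelTensor F τ) ⟶ T := δ.restrictCosh.map g ≫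
    (Functor.associator _ _ _).inv ≫ Functor.whiskerRight δ.toCosh.asEquivalence.unitInv T ≫
      (Functor.leftUnitor _).hom
  have hr : ∀ (b : A.wt τ) (q : A.CoshIdx) (w : (δ.restrictSh.obj F).obj ⟨τ, b⟩),
      (r.app q).hom (B.kerElt F τ (δ.hom τ b) (δ.toCosh.obj q) w) =
        A.kerElt (δ.restrictSh.obj F) τ b q w := fun b q w => by
    have h1 : (r.app q).hom (B.kerElt F τ (δ.hom τ b) (δ.toCosh.obj q) w) =
        (T.map (δ.toCosh.asEquivalence.unitInv.app q)).hom
          ((g.app (δ.toCosh.obj q)).hom (B.kerElt F τ (δ.hom τ b) (δ.toCosh.obj q) w)) := rfl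
    refine h1.trans ((congrArg (T.map (δ.toCosh.asEquivalence.unitInv.app q)).hom
      (hg (δ.hom τ b) (δ.toCosh.obj q) w)).trans ?_)
    refine (kerElt_map _ _).trans ?_
    have f : (⟨τ, δ.liftWt τ (δ.hom τ b)⟩ : A.ShIdx) ⟶ ⟨τ, b⟩ := homOfLE <| by
      rw [← δ.sh_le_iff]
      exact (δ.toSh_liftWt τ (δ.hom τ b)).symm.le
    refine (kerElt_mul f _ _).trans (congrArg (A.kerElt (δ.restrictSh.obj F) τ b q) ?_)
    exact (map_map_apply F _ (δ.toSh.map f) (𝟙 _) w).trans (map_self_apply F _ w)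
  refine ⟨r, ker_hom_ext fun b q w => ?_, ?_⟩
  · exact (congrArg (r.app q).hom (δ.kerRestrict_kerElt F τ b q w)).trans (hr b q w)
  -- Restriction of scalars is full, so this composite comes from an endomorphism over `B`. There
  -- decomposable elements are available for testing, and all their weights lift to `A`.
  · obtain ⟨k, hk⟩ := δ.restrictCosh.map_surjective (r ≫ δ.kerRestrict F τ)
    have hk' : k = 𝟙 _ := ker_hom_ext fun b q w => by
      obtain ⟨b, rfl⟩ := δ.surj τ b
      obtain ⟨κ, c⟩ := q
      obtain ⟨c, rfl⟩ := δ.surj κ c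
      refine (congrArg (fun t => (t.app ⟨κ, c⟩).hom
        (B.kerElt F τ (δ.hom τ b) (δ.toCosh.obj ⟨κ, c⟩) w)) hk).trans ?_
      exact (congrArg ((δ.kerRestrict F τ).app ⟨κ, c⟩).hom (hr b ⟨κ, c⟩ w)).trans
        (δ.kerRestrict_kerElt F τ b ⟨κ, c⟩ w)
    rw [← hk, hk', CategoryTheory.Functor.map_id]

theorem kerRestrict_naturality {F F' : B.Sheaf} (α : F ⟶ F') {τ τ' : I} (h : τ' ≤ τ) :
    A.kernelMap (δ.restrictSh.map α) h ≫ δ.kerRestrict F' τ' =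
      δ.kerRestrict F τ ≫ δ.restrictCosh.map (B.kernelMap α h) :=
  ker_hom_ext fun b q w => by
    refine (congrArg ((δ.kerRestrict F' τ').app q).hom
      (kernelMap_kerElt (δ.restrictSh.map α) h b q w)).trans ?_
    refine (δ.kerRestrict_kerElt F' τ' (A.res h b) q _).trans ?_
    refine Eq.trans ?_ ((congrArg ((B.kernelMap α h).app (δ.toCosh.obj q)).hom
      (δ.kerRestrict_kerElt F τ b q w)).trans
        (kernelMap_kerElt α h (δ.hom τ b) (δ.toCosh.obj q) w)).symm
    have f : (⟨τ', δ.hom τ' (A.res h b)⟩ : B.ShIdx) ⟶ ⟨τ', B.res h (δ.hom τ b)⟩ :=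
      eqToHom (congrArg (ShIdx.mk τ') (δ.res_hom h b).symm)
    refine (kerElt_mul f _ _).trans (congrArg (B.kerElt F' τ' _ _) ?_)
    refine (nat_apply α f _).symm.trans (congrArg (α.app _).hom ?_)
    exact map_map_apply F _ _ _ w

/-- The kernel diagrams commute with restriction of scalars. -/
def kernelDiagramIso : δ.restrictSh ⋙ A.kernelDiagram ≅
    B.kernelDiagram ⋙ (Functor.whiskeringRight _ _ _).obj δ.restrictCosh :=
  NatIso.ofComponents (fun F => NatIso.ofComponents
    (fun σ => @asIso _ _ _ _ _ (δ.isIso_kerRestrict F σ.unop)) fun {σ τ} f => by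
      have := δ.kerRestrict_naturality (𝟙 F) (leOfHom f.unop)
      rw [CategoryTheory.Functor.map_id] at this
      exact this) fun {F F'} α => by
        ext σ : 2
        exact δ.kerRestrict_naturality α (le_refl σ.unop)

variable [Fintype I] (c : CellData I)

instance : δ.restrictCosh.Additive := Functor.additive_of_preserves_binary_products _

instance : δ.restrictSh.Additive := Functor.additive_of_preserves_binary_products _

def koszulIso : δ.restrictSh ⋙ A.koszul c ≅
    B.koszul c ⋙ δ.restrictCosh.mapHomologicalComplex (.up ℤ) :=
  Functor.isoWhiskerRight δ.kernelDiagramIso c.cellular ≪≫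
    Functor.isoWhiskerLeft B.kernelDiagram (c.cellularMapIso δ.restrictCosh).symm

def koszulTotalIso : δ.restrictSh.mapHomologicalComplex (.up ℤ) ⋙ A.koszulTotal c ≅
    B.koszulTotal c ⋙ δ.restrictCosh.mapHomologicalComplex (.up ℤ) :=
  Functor.isoWhiskerRight (Functor.mapHomologicalComplexCompIso (δ.koszulIso c) (.up ℤ) ≪≫
      (Functor.mapHomologicalComplexCompIso (Iso.refl (B.koszul c ⋙
        δ.restrictCosh.mapHomologicalComplex (.up ℤ))) (.up ℤ)).symm)
      (HomologicalComplex₂.totalFunctor A.Cosheaf (.up ℤ) (.up ℤ) (.up ℤ)) ≪≫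
    Functor.isoWhiskerLeft ((B.koszul c).mapHomologicalComplex (.up ℤ))
      (totalMapIso δ.restrictCosh).symm

end Quot

end MonoidSheaf

/-! ### Equivalences of abelian categories and bounded derived categories -/

section DerivedEquivalence

open DerivedCategory.TStructure

universe w w' v v' u u'

variable {C : Type u} [Category.{v} C] [Abelian C] [HasDerivedCategory.{w} C]
  {E : Type u'} [Category.{v'} E] [Abelian E] [HasDerivedCategory.{w'} E]

section

variable (F : C ⥤ E) [F.Additive] (G : E ⥤ C) [G.Additive]

/-- Functors which compose to the identity, on complexes. -/
def mapComplexCompIso (α : F ⋙ G ≅ 𝟭 C) :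
    F.mapHomologicalComplex (.up ℤ) ⋙ G.mapHomologicalComplex (.up ℤ) ≅
      𝟭 (CochainComplex C ℤ) :=
  Functor.mapHomologicalComplexCompIso α (.up ℤ) ≪≫ Functor.mapHomologicalComplexIdIso C (.up ℤ)

variable [PreservesFiniteLimits F] [PreservesFiniteColimits F]
  [PreservesFiniteLimits G] [PreservesFiniteColimits G]

/-- Functors which compose to the identity, on derived categories. -/
def mapDerivedCategoryCompIso (α : F ⋙ G ≅ 𝟭 C) :
    F.mapDerivedCategory ⋙ G.mapDerivedCategory ≅ 𝟭 (DerivedCategory C) :=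
  let i : DerivedCategory.Q ⋙ (F.mapDerivedCategory ⋙ G.mapDerivedCategory) ≅
      F.mapHomologicalComplex (.up ℤ) ⋙ G.mapHomologicalComplex (.up ℤ) ⋙ DerivedCategory.Q :=
    Functor.isoWhiskerRight F.mapDerivedCategoryFactors G.mapDerivedCategory ≪≫
      Functor.isoWhiskerLeft (F.mapHomologicalComplex (.up ℤ)) G.mapDerivedCategoryFactors
  letI : Localization.Lifting DerivedCategory.Q (HomologicalComplex.quasiIso C (.up ℤ))
      (F.mapHomologicalComplex (.up ℤ) ⋙ G.mapHomologicalComplex (.up ℤ) ⋙ DerivedCategory.Q)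
      (F.mapDerivedCategory ⋙ G.mapDerivedCategory) := ⟨i⟩
  Localization.liftNatIso DerivedCategory.Q (HomologicalComplex.quasiIso C (.up ℤ))
    (F.mapHomologicalComplex (.up ℤ) ⋙ G.mapHomologicalComplex (.up ℤ) ⋙ DerivedCategory.Q)
    DerivedCategory.Q _ _ (Functor.isoWhiskerRight (mapComplexCompIso F G α) DerivedCategory.Q)

/-- Functors which compose to the identity, on bounded derived categories. -/
def mapDbCompIso (α : F ⋙ G ≅ 𝟭 C) : mapDb F ⋙ mapDb G ≅ 𝟭 (Db C) :=
  ((t (C := C)).bounded.fullyFaithfulι.whiskeringRight _).preimageIso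
    (Functor.isoWhiskerLeft (Db.ι C) (mapDerivedCategoryCompIso F G α))

end

variable (F : C ⥤ E) [F.Additive] [F.IsEquivalence]

instance : F.inv.Additive :=
  have : F.asEquivalence.functor.Additive := inferInstanceAs F.Additive
  F.asEquivalence.inverse_additive

instance mapDerivedCategory_isEquivalence : F.mapDerivedCategory.IsEquivalence :=
  (CategoryTheory.Equivalence.mk F.mapDerivedCategory F.inv.mapDerivedCategory
    (mapDerivedCategoryCompIso F F.inv F.asEquivalence.unitIso.symm).symm
    (mapDerivedCategoryCompIso F.inv F F.asEquivalence.counitIso)).isEquivalence_functor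

instance mapDb_isEquivalence : (mapDb F).IsEquivalence :=
  (CategoryTheory.Equivalence.mk (mapDb F) (mapDb F.inv)
    (mapDbCompIso F F.inv F.asEquivalence.unitIso.symm).symm
    (mapDbCompIso F.inv F F.asEquivalence.counitIso)).isEquivalence_functor

/-- The objects of the abelian categories, in the bounded derived categories. -/
def mapDbSingleIso (X : C) : (mapDb F).obj ((Db.single C).obj X) ≅ (Db.single E).obj (F.obj X) :=
  (t (C := E)).bounded.isoMk ((F.mapDerivedCategorySingleFunctor 0).app X)

theorem boundedProj_map (P : (boundedProj C).FullSubcategory) :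
    boundedProj E ((F.mapHomologicalComplex (.up ℤ)).obj P.obj) := by
  obtain ⟨⟨a, _⟩, ⟨b, _⟩, h⟩ := P.property
  refine ⟨⟨a, inferInstance⟩, ⟨b, inferInstance⟩, fun i => ?_⟩
  have := h i
  exact (F.asEquivalence.map_projective_iff _).2 this

/-- An equivalence, on bounded complexes of projective objects. -/
def mapBoundedProj : (boundedProj C).FullSubcategory ⥤ (boundedProj E).FullSubcategory :=
  (boundedProj E).lift ((boundedProj C).ι ⋙ F.mapHomologicalComplex (.up ℤ)) (boundedProj_map F)

def ofProjMapIso : Db.ofProj C ⋙ mapDb F ≅ mapBoundedProj F ⋙ Db.ofProj E :=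
  ((t (C := E)).bounded.fullyFaithfulι.whiskeringRight _).preimageIso
    (Functor.isoWhiskerLeft (boundedProj C).ι F.mapDerivedCategoryFactors)

end DerivedEquivalence

/-! ### Transport of an equivalence along equivalences of abelian categories -/

section Transport

open DerivedCategory.TStructure

universe y₁ y₂ y₃ y₄ v₁ v₂ v₃ v₄ u₁ u₂ u₃ u₄

variable {C₁ : Type u₁} [Category.{v₁} C₁] [Abelian C₁] [HasDerivedCategory.{y₁} C₁]
  {E₁ : Type u₂} [Category.{v₂} E₁] [Abelian E₁] [HasDerivedCategory.{y₂} E₁]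
  {C₂ : Type u₃} [Category.{v₃} C₂] [Abelian C₂] [HasDerivedCategory.{y₃} C₂]
  {E₂ : Type u₄} [Category.{v₄} E₂] [Abelian E₂] [HasDerivedCategory.{y₄} E₂]
  (S : C₁ ⥤ C₂) [S.Additive] [S.IsEquivalence] (R : E₁ ⥤ E₂) [R.Additive] [R.IsEquivalence]

/-- Transport of a triangulated equivalence along equivalences of abelian categories. -/
theorem exists_transport (K₂ : Db C₂ ⥤ Db E₂) [K₂.CommShift ℤ] [K₂.IsTriangulated]
    [K₂.IsEquivalence] :
    ∃ (K₁ : Db C₁ ⥤ Db E₁) (_ : K₁.CommShift ℤ), K₁.IsTriangulated ∧ K₁.IsEquivalence ∧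
      ∃ e : K₁ ⋙ mapDb R ≅ mapDb S ⋙ K₂, NatTrans.CommShift e.hom ℤ := by
  have := mapDb_isTriangulated S
  have := mapDb_isTriangulated R
  refine ⟨(mapDb S ⋙ K₂) ⋙ (mapDb R).asEquivalence.inverse, inferInstance, inferInstance,
    inferInstance, Functor.associator _ _ _ ≪≫ Functor.isoWhiskerLeft (mapDb S ⋙ K₂)
      (mapDb R).asEquivalence.counitIso ≪≫ Functor.rightUnitor _, ?_⟩
  have h : NatTrans.CommShift (mapDb R).asEquivalence.counitIso.hom ℤ := inferInstance
  let i : (mapDb R).asEquivalence.inverse ⋙ mapDb R ⟶ 𝟭 _ := (mapDb R).asEquivalence.counitIso.hom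
  have : NatTrans.CommShift i ℤ := h
  exact inferInstanceAs (NatTrans.CommShift ((Functor.associator (mapDb S ⋙ K₂)
    (mapDb R).asEquivalence.inverse (mapDb R)).hom ≫
      Functor.whiskerLeft (mapDb S ⋙ K₂) i ≫ (Functor.rightUnitor (mapDb S ⋙ K₂)).hom) ℤ)

variable {S R} {K₁ : Db C₁ ⥤ Db E₁} {K₂ : Db C₂ ⥤ Db E₂}
  (e : K₁ ⋙ mapDb R ≅ mapDb S ⋙ K₂)

/-- Transport of the description by complexes of projective objects. -/
def transportFactors
    (T₂ : (boundedProj C₂).FullSubcategory ⥤ CochainComplex E₂ ℤ)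
    (i : Db.ofProj C₂ ⋙ K₂ ⋙ Db.ι E₂ ≅ T₂ ⋙ DerivedCategory.Q) :
    Db.ofProj C₁ ⋙ K₁ ⋙ Db.ι E₁ ≅
      (mapBoundedProj S ⋙ T₂ ⋙ R.inv.mapHomologicalComplex (.up ℤ)) ⋙ DerivedCategory.Q :=
  ((Functor.FullyFaithful.ofFullyFaithful R.mapDerivedCategory).whiskeringRight _).preimageIso
    (show Db.ofProj C₁ ⋙ (K₁ ⋙ mapDb R) ⋙ Db.ι E₂ ≅ mapBoundedProj S ⋙ T₂ ⋙
        R.inv.mapHomologicalComplex (.up ℤ) ⋙ DerivedCategory.Q ⋙ R.mapDerivedCategory from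
      Functor.isoWhiskerLeft (Db.ofProj C₁) (Functor.isoWhiskerRight e (Db.ι E₂)) ≪≫
        Functor.isoWhiskerRight (ofProjMapIso S) (K₂ ⋙ Db.ι E₂) ≪≫
        Functor.isoWhiskerLeft (mapBoundedProj S) (i ≪≫ Functor.isoWhiskerLeft T₂
          (Functor.isoWhiskerRight
            (mapComplexCompIso R.inv R R.asEquivalence.counitIso).symm DerivedCategory.Q ≪≫
            Functor.isoWhiskerLeft (R.inv.mapHomologicalComplex (.up ℤ))
              R.mapDerivedCategoryFactors.symm)))

/-- Transport of the values on objects of the abelian categories. -/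
theorem transport_single (e : K₁ ⋙ mapDb R ≅ mapDb S ⋙ K₂) {X₁ : C₁} {Y₁ : E₁} {X₂ : C₂} {Y₂ : E₂} (f : S.obj X₁ ≅ X₂)
    (g : R.obj Y₁ ≅ Y₂) {n : ℤ}
    (h : Nonempty (K₂.obj ((Db.single C₂).obj X₂) ≅ ((Db.single E₂).obj Y₂)⟦n⟧)) :
    Nonempty (K₁.obj ((Db.single C₁).obj X₁) ≅ ((Db.single E₁).obj Y₁)⟦n⟧) := by
  obtain ⟨h⟩ := h
  exact ⟨(mapDb R).preimageIso <| e.app _ ≪≫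
    K₂.mapIso (mapDbSingleIso S X₁ ≪≫ (Db.single C₂).mapIso f) ≪≫ h ≪≫
    (shiftFunctor (Db E₂) n).mapIso ((mapDbSingleIso R Y₁ ≪≫ (Db.single E₂).mapIso g).symm) ≪≫
    (((mapDb R).commShiftIso n).app ((Db.single E₁).obj Y₁)).symm⟩

end Transport

/-! ### Extension of scalars for the standard sheaves, their duals and the Koszul description -/

namespace MonoidSheaf

namespace Quot

variable {I : Type} [PartialOrder I] {A B : MonoidSheaf I} (δ : Quot A B)

theorem extSet_preimage (Z : Set I) : A.extSet Z = δ.toSh.obj ⁻¹' B.extSet Z :=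
  Set.ext fun x => and_congr Iff.rfl (δ.mem_iff x.cone x.deg).symm

/-- The extensions by zero of the sheaves of algebras are compatible with restriction of
scalars. -/
def extRestrictIso (Z : Set I) [Z.OrdConnected] :
    A.extendByZero A.structureSheaf Z ≅ δ.restrictSh.obj (B.extendByZero B.structureSheaf Z) :=
  have : (δ.toSh.obj ⁻¹' B.extSet Z).OrdConnected := δ.extSet_preimage Z ▸ inferInstance
  (A.extIso Z).symm ≪≫ indCongr (δ.extSet_preimage Z) ≪≫
    (Iso.refl _ : ind (δ.toSh.obj ⁻¹' B.extSet Z) ≅ δ.restrictSh.obj (ind (B.extSet Z))) ≪≫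
    δ.restrictSh.mapIso (B.extIso Z)

def extendOfRestrictIso {F : A.Sheaf} {E : B.Sheaf} (e : F ≅ δ.restrictSh.obj E) :
    δ.extendSh.obj F ≅ E :=
  δ.extendSh.mapIso e ≪≫ asIso (δ.adjSh.counit.app E)

variable [A.IsFinGen] [B.IsFinGen]

def starShOpenIso (σ : I) : δ.starSh.obj (A.openStar σ) ≅ B.openStar σ :=
  B.fg.isoMk (δ.extendOfRestrictIso (δ.extRestrictIso (Set.Iic σ)))

def starShPointIso (σ : I) : δ.starSh.obj (A.point σ) ≅ B.point σ :=
  B.fg.isoMk (δ.extendOfRestrictIso (δ.extRestrictIso {σ}))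

def starCoshDualIso [B.HasLength] (F : A.fg.FullSubcategory) :
    δ.starCosh.obj ⟨A.dual F.obj, δ.dual_tcf F.property⟩ ≅
      ⟨B.dual (δ.starSh.obj F).obj, B.dual_tcf (δ.starSh.obj F).property⟩ :=
  let e : δ.extendCosh.obj (A.dual F.obj) ≅ B.dual (δ.extendSh.obj F.obj) :=
    δ.extendCosh.mapIso ((A.dualIso (δ.unitIsoSh F.obj)).symm ≪≫
      δ.dualRestrictIso (δ.extendSh.obj F.obj)) ≪≫ asIso (δ.adjCosh.counit.app _)
  B.tcf.isoMk e

/-- Restriction of scalars for torsion co-finite cosheaves. -/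
def starCoshInvIso : δ.starCosh.inv ⋙ δ.tcf.ι ≅ B.tcf.ι ⋙ δ.restrictCosh :=
  Functor.isoWhiskerLeft (δ.starCosh.inv ⋙ δ.tcf.ι)
      (asIso δ.adjCosh.unit : 𝟭 _ ≅ δ.extendCosh ⋙ δ.restrictCosh) ≪≫
    Functor.isoWhiskerRight δ.starCosh.asEquivalence.counitIso (B.tcf.ι ⋙ δ.restrictCosh)

/-- Restriction of scalars for finitely generated sheaves. -/
def starShRestrictIso : δ.starSh ⋙ B.fg.ι ⋙ δ.restrictSh ≅ A.fg.ι :=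
  Functor.isoWhiskerLeft A.fg.ι
    (asIso δ.adjSh.unit : 𝟭 _ ≅ δ.extendSh ⋙ δ.restrictSh).symm

universe y₁ y₂ y₃ y₄

variable [Fintype I] {c : CellData I}
  [HasDerivedCategory.{y₁} A.fg.FullSubcategory] [HasDerivedCategory.{y₂} δ.tcf.FullSubcategory]
  [HasDerivedCategory.{y₃} B.fg.FullSubcategory] [HasDerivedCategory.{y₄} B.tcf.FullSubcategory]

/-- The complex for `A` is obtained by extending scalars to `B`, taking the total complex there, and
restricting back. It is the total complex over `A` because `koszulTotal` commutes with restriction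
and restriction undoes extension. -/
theorem isKoszul_of_iso {KA : Db A.fg.FullSubcategory ⥤ Db δ.tcf.FullSubcategory}
    {KB : Db B.fg.FullSubcategory ⥤ Db B.tcf.FullSubcategory}
    (e : KA ⋙ mapDb δ.starCosh ≅ mapDb δ.starSh ⋙ KB) (h : B.IsKoszul c B.tcf KB) :
    A.IsKoszul c δ.tcf KA := by
  obtain ⟨T, ⟨i⟩, ⟨j⟩⟩ := h
  refine ⟨_, ⟨?_⟩, ⟨transportFactors e T j⟩⟩
  let bA := (boundedProj A.fg.FullSubcategory).ι
  let bB := (boundedProj B.fg.FullSubcategory).ι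
  let S := mapBoundedProj δ.starSh
  let i₁ : δ.starCosh.inv.mapHomologicalComplex (.up ℤ) ⋙ δ.tcf.ι.mapHomologicalComplex (.up ℤ) ≅
      B.tcf.ι.mapHomologicalComplex (.up ℤ) ⋙ δ.restrictCosh.mapHomologicalComplex (.up ℤ) :=
    Functor.mapHomologicalComplexCompIso δ.starCoshInvIso _ ≪≫
      (Functor.mapHomologicalComplexCompIso (Iso.refl (B.tcf.ι ⋙ δ.restrictCosh)) _).symm
  let i₂ : δ.starSh.mapHomologicalComplex (.up ℤ) ⋙ B.fg.ι.mapHomologicalComplex (.up ℤ) ⋙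
      δ.restrictSh.mapHomologicalComplex (.up ℤ) ≅ A.fg.ι.mapHomologicalComplex (.up ℤ) :=
    Functor.isoWhiskerLeft (δ.starSh.mapHomologicalComplex (.up ℤ))
        (Functor.mapHomologicalComplexCompIso (Iso.refl (B.fg.ι ⋙ δ.restrictSh)) (.up ℤ)) ≪≫
      Functor.mapHomologicalComplexCompIso δ.starShRestrictIso (.up ℤ)
  exact Functor.isoWhiskerLeft (S ⋙ T) i₁ ≪≫
    Functor.isoWhiskerLeft S (Functor.isoWhiskerRight i
      (δ.restrictCosh.mapHomologicalComplex (.up ℤ))) ≪≫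
    Functor.isoWhiskerLeft (S ⋙ bB ⋙ B.fg.ι.mapHomologicalComplex (.up ℤ))
      (δ.koszulTotalIso c).symm ≪≫
    Functor.isoWhiskerLeft bA (Functor.isoWhiskerRight i₂ (A.koszulTotal c))

end Quot

end MonoidSheaf

/-! ### The cellular description of the functor for `ℬ` -/

namespace SmoothFan

open MonoidSheaf

universe y₁ y₂ y₃ y₄

variable {N : Type} [AddCommGroup N] [Module.Finite ℤ N] {Δ : SmoothFan N}

theorem isKoszul_koszulB {ε : Δ.Orientation}
    [HasDerivedCategory.{y₁} Δ.BMod] [HasDerivedCategory.{y₂} Δ.CoBTcf]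
    {K : Db Δ.BMod ⥤ Db Δ.CoBTcf}
    (i : Db.ofProj Δ.BMod ⋙ K ⋙ Db.ι Δ.CoBTcf ≅ (boundedProj Δ.BMod).ι ⋙
      totalizationQ (koszulB ε) Δ.B.tcf (koszulB_totalization_tcf ε) ⋙ DerivedCategory.Q) :
    Δ.B.IsKoszul (Δ.cellData ε) Δ.B.tcf K := by
  refine ⟨(boundedProj Δ.BMod).ι ⋙
    totalizationQ (koszulB ε) Δ.B.tcf (koszulB_totalization_tcf ε), ⟨?_⟩, ⟨i⟩⟩
  exact Functor.isoWhiskerLeft (boundedProj Δ.BMod).ι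
    (liftComplexIso Δ.B.tcf (totalization (koszulB ε)) (koszulB_totalization_tcf ε) ≪≫
      totalizationIso (koszulB ε) ≪≫
      Functor.isoWhiskerRight (Functor.mapHomologicalComplexCompIso
          (Iso.refl (koszulB ε)) (.up ℤ)).symm
        (HomologicalComplex₂.totalFunctor Δ.B.Cosheaf (.up ℤ) (.up ℤ) (.up ℤ)))

end SmoothFan

end ToricKoszul

end

theorem theorem3p5 {N : Type} [AddCommGroup N] [Module.Free ℤ N] [Module.Finite ℤ N]
    (Δ : SmoothFan N) (ε : Δ.Orientation)
    [HasDerivedCategory.{w₁} Δ.AMod] [HasDerivedCategory.{w₂} Δ.CoATcf]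
    [HasDerivedCategory.{w₃} Δ.BMod] [HasDerivedCategory.{w₄} Δ.CoBTcf] :
    ∃ (KA : Db Δ.AMod ⥤ Db Δ.CoATcf) (_ : KA.CommShift ℤ)
      (KB : Db Δ.BMod ⥤ Db Δ.CoBTcf) (_ : KB.CommShift ℤ),
      (KA.IsTriangulated ∧ KA.IsEquivalence ∧ Δ.A.IsKoszul (Δ.cellData ε) Δ.δ.tcf KA ∧
        ∀ σ : Δ.Cone,
          Nonempty (KA.obj ((Db.single _).obj (Δ.pointA σ)) ≅
            ((Db.single _).obj (Δ.dualA (Δ.openA σ)))⟦(Δ.dim σ : ℤ)⟧) ∧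
          Nonempty (KA.obj ((Db.single _).obj (Δ.openA σ)) ≅
            ((Db.single _).obj (Δ.dualA (Δ.pointA σ)))⟦(Δ.dim σ : ℤ)⟧)) ∧
      (KB.IsTriangulated ∧ KB.IsEquivalence ∧ Δ.B.IsKoszul (Δ.cellData ε) Δ.B.tcf KB ∧
        ∀ σ : Δ.Cone,
          Nonempty (KB.obj ((Db.single _).obj (Δ.pointB σ)) ≅
            ((Db.single _).obj (Δ.dualB (Δ.openB σ)))⟦(Δ.dim σ : ℤ)⟧) ∧
          Nonempty (KB.obj ((Db.single _).obj (Δ.openB σ)) ≅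
            ((Db.single _).obj (Δ.dualB (Δ.pointB σ)))⟦(Δ.dim σ : ℤ)⟧)) ∧
      ∃ e : KA ⋙ mapDb Δ.δ.starCosh ≅ mapDb Δ.δ.starSh ⋙ KB, NatTrans.CommShift e.hom ℤ := by
  obtain ⟨KB, hKB, tB, ⟨i⟩⟩ := SmoothFan.exists_derived_koszulB ε
  have eqB : KB.IsEquivalence := SmoothFan.isEquivalence_koszulB i
  have kB := SmoothFan.isKoszul_koszulB i
  -- `KA` is defined by the commutative square, so the compatibility with `δ^*` and the shifts holds
  -- from the start, and every property of `KA` is read off from `KB`.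
  obtain ⟨KA, hKA, tA, eqA, e, he⟩ := exists_transport Δ.δ.starSh Δ.δ.starCosh KB
  refine ⟨KA, hKA, KB, hKB, ⟨tA, eqA, Δ.δ.isKoszul_of_iso e kB, fun σ => ⟨?_, ?_⟩⟩,
    ⟨tB, eqB, kB, SmoothFan.koszulB_values i⟩, e, he⟩
  · exact transport_single e (Δ.δ.starShPointIso σ) (Δ.δ.starCoshDualIso (Δ.openA σ) ≪≫
      SmoothFan.dualBIso (Δ.δ.starShOpenIso σ)) (SmoothFan.koszulB_values i σ).1
  · exact transport_single e (Δ.δ.starShOpenIso σ) (Δ.δ.starCoshDualIso (Δ.pointA σ) ≪≫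
      SmoothFan.dualBIso (Δ.δ.starShPointIso σ)) (SmoothFan.koszulB_values i σ).2
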